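/- All algebras are associative over $\mathbb{C}$, not necessarily unital; $R^+=R\oplus\mathbb{C}$ is the unitalization. **Notation.** $X(R): R\rightleftarrows\Omega^1R_\natural$ is the $\mathbb{Z}_2$-graded $X$-complex of an algebra $R$, where $\Omega^1R_\natural=\Omega^1R/[R,\Omega^1R]$, with boundary $\partial=\natural\mathbf{d}\oplus\overline b$, $\overline b(\natural x\mathbf{d}y)=[x,y]$. For an ideal $I\subset R$ it is filtered by $F_I^{2k}X(R): I^{k+1}+[I^k,R]\rightleftarrows\natural I^k_{(+)}\mathbf{d}R$ and $F_I^{2k+1}X(R): I^{k+1}\rightleftarrows\natural(I^{k+1}_{(+)}\mathbf{d}R+I^k_{(+)}\mathbf{d}I)$, where $I^k_{(+)}=I^k$ for $k>0$ and $I^0_{(+)}=R^+$. For the non-unital tensor algebra $TA$ and $JA=\ker(TA\to A)$, a cochain on $X(\widehat TA)$ is a linear functional on $X(TA)$ vanishing on $F^k_{JA}X(TA)$ for $k\gg0$, and $HP^i(A)=H^i(X(\widehat TA))$, $i\in\mathbb{Z}_2$. Let $(E):0\to B\to E\to A\to0$ be an extension, with a lifting: a commutative $3\times3$ diagram of extensions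 with rows $0\to J\to N\to Q\to0$, $0\to R\to M\to P\to0$, $0\to B\to E\to A\to 0$ and columns $J\to R\to B$, $N\to M\to E$, $Q\to P\to A$. Assume that $(E)$ is invertible: there is a homomorphism $\rho:A\to M_2(E)$ whose off-diagonal entries take values in $B$ and whose upper left entry is a linear splitting of $E\to A$. A cochain on $X(\widehat M)$ is a linear functional on $X(M)$ vanishing on $F_N^kX(M)$ for $k\gg0$; a cocycle over $F_R^mX(\widehat M)$ is a linear functional $\tau$ on $F_R^mX(M)$ with $\tau\partial=0$, vanishing on $F_R^mX(M)\cap F_N^kX(M)$ for $k\gg0$. **Bivariant Chern character.** Let $M^s_+=\begin{pmatrix}M&R\\R&M\end{pmatrix}$, choose a linear lifting $\ell:A\to M^s_+$ of $\rho$, and let $\rho_*:TA\to M^s_+$ be the homomorphism extending $\ell$. Let $C_1=\mathbb{C}\oplus\varepsilon\mathbb{C}$, $\varepsilon^2=1$, be the Clifford algebra, $F=\varepsilon\otimes\mathrm{diag}(1,-1)$, and $\mathrm{tr}_s(\varepsilon\otimes m)=-\sqrt{2i}\,\mathrm{tr}(m)$. For $n$ odd put $$\chi^n_0(x_0\mathbf{d}x_1\cdots\mathbf{d}x_n)=-\tfrac{\Gamma(1+\frac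 n2)}{(n+1)!}\sum_{\lambda}\mathrm{sgn}(\lambda)\,\mathrm{tr}_s(x_{\lambda(0)}[F,x_{\lambda(1)}]\cdots[F,x_{\lambda(n)}])\in R^n,$$ the sum being over the cyclic permutations of $\{0,\dots,n\}$, and $$\chi^n_1(x_0\mathbf{d}x_1\cdots\mathbf{d}x_{n+1})=-\tfrac{\Gamma(1+\frac n2)}{(n+1)!}\sum_{i=1}^{n+1}\mathrm{tr}_s\natural(x_0[F,x_1]\cdots\mathbf{d}x_i\cdots[F,x_{n+1}])\in\Omega^1M_\natural ,$$ where $\varepsilon$ and $\mathbf{d}$ anticommute and $\varepsilon$ is moved to the left. Let $\gamma:X(TA)\to\prod_k\Omega^kTA$ be the generalized Goodwillie equivalence $\gamma(x)=(1-\phi)^{-1}(x)$, $\gamma(\natural x\mathbf{d}y)=(1-\phi)^{-1}(x\mathbf{d}y+b(x\phi(y)))$, where $\phi:TA\to\Omega^2TA$ is the linear map with $\phi(a)=0$ for $a\in A$ and $\phi(xy)=\phi(x)y+x\phi(y)+\mathbf{d}x\mathbf{d}y$, extended to forms by $\phi(x_0\mathbf{d}x_1\cdots\mathbf{d}x_k)=\sum_{i=0}^k(-1)^{ki}\phi(x_i)\mathbf{d}x_{i+1}\cdots\mathbf{d}x_k\mathbf{d}x_0\cdots\mathbf{d}x_{i-1}$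 with $\phi(1)=0$. Set $\mathrm{ch}^n(\rho)=\chi^n\circ\rho_*\circ\gamma$. **Statement.** Let $n\ge1$ be odd and let $\tau$ be a cocycle of degree $i\in\mathbb{Z}_2$ over $F_R^{2n-1}X(\widehat M)$. Then $\mathrm{ch}^n(\rho)$ maps $X(TA)$ to $F_R^{2n-1}X(M)$, $\tau\,\mathrm{ch}^n(\rho)$ is a cocycle of degree $i+1$ on $X(\widehat TA)$, and $$[\tau\,\mathrm{ch}^n(\rho)]=\sqrt{2\pi i}\;E^*([\tau])\quad\text{in } HP^{i+1}(A).$$ (In the factors $\sqrt{2\pi i}$ and $\sqrt{2i}$ the letter $i$ denotes the imaginary unit, and the square roots are the principal ones.) Here $E^*([\tau])$ is the class of the cocycle $\tau_R\,\partial\circ\sigma_*$, for an arbitrary renormalization $\tau_R$ of $\tau$ (a cochain of degree $i$ on $X(\widehat M)$ extending $\tau$) and an arbitrary linear splitting $\sigma:A\to M$ of $M\to A$, with $\sigma_*:TA\to M$ the homomorphism extending $\sigma$. Moreover, whenever $\tau$ represents a class $\beta\in HP^i(B)$, this class is the image of $\beta$ under the connecting morphism $HP^i(B)\to HP^{i+1}(A)$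 of $(E)$. Here $\tau$ represents $\beta$ if, for some homomorphism $TE\to M$ extending a linear section $s$ of $M\to E$ with $s(B)\subset R$, the pullback of $\tau$ to $F^{2n-1}_{T(B:E)}X(\widehat TE)$, where $T(B:E)=\ker(TE\to TA)$, is cohomologous to the restriction of a cocycle over $F^1_{T(B:E)}X(\widehat TE)$ whose restriction to $X(\widehat TB)$ is in the class $\beta$. -/

import Mathlib

open scoped TensorProduct

noncomputable section

namespace PeriodicCyclic

/-! All algebras are associative, complex and not necessarily unital. -/

/-- The unitalization `R⁺ = R ⊕ ℂ`. -/
abbrev U (R : Type*) [NonUnitalRing R] [Module ℂ R] := Unitization ℂ R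

/-- An extension `0 → B → E → A → 0` of algebras. -/
structure IsExtension {B E A : Type*}
    [NonUnitalRing B] [Module ℂ B] [NonUnitalRing E] [Module ℂ E] [NonUnitalRing A] [Module ℂ A]
    (i : B →ₙₐ[ℂ] E) (p : E →ₙₐ[ℂ] A) : Prop where
  inj : Function.Injective i
  surj : Function.Surjective p
  exact : ∀ x : E, p x = 0 ↔ ∃ b : B, i b = x

/-! ### Noncommutative differential forms -/

section Forms

set_option linter.unusedSectionVars false

variable {R : Type*} [NonUnitalRing R] [Module ℂ R] [IsScalarTower ℂ R R] [SMulCommClass ℂ R R]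
variable {S : Type*} [NonUnitalRing S] [Module ℂ S] [IsScalarTower ℂ S S] [SMulCommClass ℂ S S]
variable {V : Type*} [AddCommGroup V] [Module ℂ V]

variable (R) in
/-- Noncommutative `n`-forms `Ωⁿ R = R⁺ ⊗ R^{⊗ n}`; the element `x₀ ⊗ (x₁ ⊗ ⋯ ⊗ xₙ)` is the form
`x₀ dx₁ ⋯ dxₙ`. -/
abbrev Om (n : ℕ) := U R ⊗[ℂ] (PiTensorProduct ℂ (fun _ : Fin n => R))

/-- The form `x₀ dx₁ ⋯ dxₙ` for `xᵢ ∈ R⁺`, where `d1 = 0`. -/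
def form (n : ℕ) : MultilinearMap ℂ (fun _ : Fin (n + 1) => U R) (Om R n) :=
  LinearMap.uncurryLeft
    { toFun := fun x => (TensorProduct.mk ℂ (U R) _ x).compMultilinearMap
        ((PiTensorProduct.tprod ℂ).compLinearMap
          (fun _ : Fin n => Unitization.sndHom (S := ℂ) (R := ℂ) (A := R)))
      map_add' := fun x y => by ext v; simp
      map_smul' := fun c x => by ext v; simp [TensorProduct.smul_tmul'] }

/-- The linear map on `Ωⁿ R` sending `x₀ dx₁ ⋯ dxₙ` to `f (x₀, x₁, …, xₙ)`, for `x₀ ∈ R⁺` and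
`x₁, …, xₙ ∈ R`. -/
def liftForm {n : ℕ} (f : MultilinearMap ℂ (fun _ : Fin (n + 1) => U R) V) : Om R n →ₗ[ℂ] V :=
  TensorProduct.lift
    ((PiTensorProduct.lift (R := ℂ) (s := fun _ : Fin n => R) (E := V)).toLinearMap ∘ₗ
      MultilinearMap.compLinearMapₗ
        (fun _ : Fin n => Unitization.inrHom (S := ℂ) (R := ℂ) (A := R)) ∘ₗ f.curryLeft)

@[simp]
theorem liftForm_tmul {n : ℕ} (f : MultilinearMap ℂ (fun _ : Fin (n + 1) => U R) V)
    (x : U R) (v : Fin n → R) :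
    liftForm f (x ⊗ₜ[ℂ] PiTensorProduct.tprod ℂ v) =
      f (Fin.cons x (fun j => (v j : U R))) := by
  simp [liftForm]

theorem form_apply (n : ℕ) (x : Fin (n + 1) → U R) :
    form n x = x 0 ⊗ₜ[ℂ] PiTensorProduct.tprod ℂ (fun j : Fin n => (x j.succ).snd) := rfl

/-- The map `(ω, x) ↦ ω dx`. -/
def mulD (n : ℕ) : Om R n →ₗ[ℂ] U R →ₗ[ℂ] Om R (n + 1) :=
  liftForm (V := U R →ₗ[ℂ] Om R (n + 1)) (MultilinearMap.curryRight (form (R := R) (n + 1)))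

/-- The inclusion of `R⁺` as the space of zero-forms. -/
def zeroForm : U R →ₗ[ℂ] Om R 0 :=
  (TensorProduct.mk ℂ (U R) (PiTensorProduct ℂ (fun _ : Fin 0 => R))).flip
    (PiTensorProduct.tprod ℂ Fin.elim0)

/-- The one-form `x dy`. -/
def dOne : U R →ₗ[ℂ] U R →ₗ[ℂ] Om R 1 := mulD 0 ∘ₗ zeroForm

/-- The two-form `x dy dz`. -/
def dTwo : U R →ₗ[ℂ] U R →ₗ[ℂ] U R →ₗ[ℂ] Om R 2 := LinearMap.compr₂ dOne (mulD 1)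

theorem mulD_form (n : ℕ) (x : Fin (n + 1) → U R) (y : U R) :
    mulD n (form n x) y = form (n + 1) (Fin.snoc x y) := by
  have hs : ∀ (a : U R) (q : Fin n → U R) (j : Fin (n + 1)),
      (Fin.snoc (Fin.cons a q : Fin (n + 1) → U R) y : Fin (n + 2) → U R) j.succ
        = (Fin.snoc q y : Fin (n + 1) → U R) j := by
    intro a q j
    have := Fin.cons_snoc_eq_snoc_cons (β := U R) a q y
    exact (congrFun this j.succ).symm
  rw [form_apply, mulD, liftForm_tmul, MultilinearMap.curryRight_apply, form_apply, form_apply]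
  rw [← Fin.cons_self_tail x]
  refine congrArg₂ (fun a b => a ⊗ₜ[ℂ] PiTensorProduct.tprod ℂ b) ?_ ?_
  · rfl
  · funext j
    rw [hs, hs]
    refine Fin.lastCases ?_ (fun k => ?_) j
    · rw [Fin.snoc_last, Fin.snoc_last]
    · rw [Fin.snoc_castSucc, Fin.snoc_castSucc, Unitization.snd_inr]
      rfl

/-- Left multiplication of forms by `R⁺`. -/
def lmul (n : ℕ) : U R →ₗ[ℂ] Om R n →ₗ[ℂ] Om R n :=
  LinearMap.rTensorHom (PiTensorProduct ℂ (fun _ : Fin n => R)) ∘ₗ LinearMap.mul ℂ (U R)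

/-- The Hochschild operator on two-forms:
`b (x₀ dx₁ dx₂) = x₀ x₁ dx₂ - x₀ d(x₁ x₂) + x₂ x₀ dx₁`. -/
def bTwo : Om R 2 →ₗ[ℂ] Om R 1 :=
  liftForm
    (MultilinearMap.mk' (fun x => dOne (x 0 * x 1) (x 2) - dOne (x 0) (x 1 * x 2) + dOne (x 2 * x 0) (x 1))
      (fun m i x y => by fin_cases i <;> simp [add_mul, mul_add] <;> abel)
      (fun m i c x => by fin_cases i <;> simp [smul_add, smul_sub]))

/-- The Hochschild operator `b (x₀ dx₁) = x₀ x₁ - x₁ x₀` on one-forms, with values in `R`. -/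
def bOne : Om R 1 →ₗ[ℂ] R :=
  Unitization.sndHom (S := ℂ) (R := ℂ) (A := R) ∘ₗ liftForm
    (MultilinearMap.mk' (fun x => x 0 * x 1 - x 1 * x 0)
      (fun m i x y => by fin_cases i <;> simp [add_mul, mul_add] <;> abel)
      (fun m i c x => by fin_cases i <;> simp [smul_sub]))

/-- The map on `n`-forms induced by a homomorphism. -/
def mapForm (f : R →ₙₐ[ℂ] S) (n : ℕ) : Om R n →ₗ[ℂ] Om S n :=
  TensorProduct.map (Unitization.lift ((Unitization.inrNonUnitalAlgHom ℂ S).comp f)).toLinearMap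
    (PiTensorProduct.map (fun _ : Fin n => (f : R →ₗ[ℂ] S)))

theorem dOne_apply (x y : U R) : dOne x y = form 1 ![x, y] := by
  have : dOne x y = mulD 0 (form 0 ![x]) y := by
    simp only [dOne, LinearMap.comp_apply, form_apply]
    congr 2
    simp only [zeroForm, LinearMap.flip_apply, TensorProduct.mk_apply]
    congr 2
    exact Subsingleton.elim _ _
  rw [this, mulD_form]
  congr 1
  funext i
  fin_cases i <;> rfl

theorem dTwo_apply (x y z : U R) : dTwo x y z = form 2 ![x, y, z] := by
  have : dTwo x y z = mulD 1 (dOne x y) z := rfl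
  rw [this, dOne_apply, mulD_form]
  congr 1
  funext i
  fin_cases i <;> rfl

theorem form_two_ext {W : Type*} [AddCommGroup W] [Module ℂ W] {f g : Om R 2 →ₗ[ℂ] W}
    (h : ∀ (x : U R) (y z : R), f (dTwo x y z) = g (dTwo x y z)) : f = g := by
  refine TensorProduct.ext' fun x w => ?_
  induction w using PiTensorProduct.induction_on with
  | smul_tprod c v =>
    have := h x (v 0) (v 1)
    rw [dTwo_apply, form_apply] at this
    have hv : (fun j : Fin 2 => (Matrix.vecCons x ![(v 0 : U R), (v 1 : U R)] j.succ).snd) = v := by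
      funext j
      fin_cases j <;> rfl
    rw [hv] at this
    simpa [TensorProduct.tmul_smul] using congrArg (c • ·) this
  | add a b ha hb => rw [TensorProduct.tmul_add, map_add, map_add, ha, hb]

theorem bTwo_dTwo (x : U R) (y z : R) :
    bTwo (dTwo x y z) = 
      dOne (x * (y : U R)) z - dOne x ((y * z : R) : U R) + dOne ((z : U R) * x) y := by
  rw [dTwo_apply, form_apply, bTwo, liftForm_tmul]
  simp
  rfl

theorem lmul_dTwo (u x y z : U R) : lmul 2 u (dTwo x y z) = dTwo (u * x) y z := by
  rw [dTwo_apply, dTwo_apply, form_apply, form_apply]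
  rfl

theorem lmul_one (n : ℕ) (ω : Om R n) : lmul n (1 : U R) ω = ω := by
  induction ω using TensorProduct.induction_on with
  | zero => simp
  | tmul x y => simp [lmul]
  | add a b ha hb => rw [map_add, ha, hb]

theorem lmul_mul (n : ℕ) (u v : U R) (ω : Om R n) : lmul n (u * v) ω = lmul n u (lmul n v ω) := by
  induction ω using TensorProduct.induction_on with
  | zero => simp
  | tmul x y => simp [lmul, mul_assoc]
  | add a b ha hb => rw [map_add, map_add, map_add, ha, hb]

/-- Right multiplication of two-forms by `R⁺`:
`(x₀ dx₁ dx₂) z = x₀ dx₁ d(x₂ z) - x₀ d(x₁ x₂) dz + x₀ x₁ dx₂ dz`. -/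
def rmulTwo (z : U R) : Om R 2 →ₗ[ℂ] Om R 2 :=
  liftForm
    (MultilinearMap.mk' (fun x => dTwo (x 0) (x 1) (x 2 * z) - dTwo (x 0) (x 1 * x 2) z
        + dTwo (x 0 * x 1) (x 2) z)
      (fun m i x y => by fin_cases i <;> simp [add_mul, mul_add] <;> abel)
      (fun m i c x => by fin_cases i <;> simp [smul_add, smul_sub]))

theorem dTwo_one_mid (x z : U R) : dTwo x 1 z = 0 := by
  rw [dTwo_apply, form_apply]
  have : (fun j : Fin 2 => (Matrix.vecCons x ![1, z] j.succ).snd) = ![0, z.snd] := by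
    funext j
    fin_cases j <;> rfl
  rw [this, MultilinearMap.map_coord_zero _ 0 rfl, TensorProduct.tmul_zero]

theorem dTwo_one_right (x y : U R) : dTwo x y 1 = 0 := by
  rw [dTwo_apply, form_apply]
  have : (fun j : Fin 2 => (Matrix.vecCons x ![y, 1] j.succ).snd) = ![y.snd, 0] := by
    funext j
    fin_cases j <;> rfl
  rw [this, MultilinearMap.map_coord_zero _ 1 rfl, TensorProduct.tmul_zero]

theorem dTwo_eq (x y z : U R) : dTwo x y z = dTwo x (y.snd : U R) (z.snd : U R) := by
  simp only [dTwo_apply, form_apply]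
  refine congrArg₂ (fun a b => a ⊗ₜ[ℂ] PiTensorProduct.tprod ℂ b) rfl ?_
  funext j
  fin_cases j <;> rfl

theorem rmulTwo_dTwo (u x y z : U R) : rmulTwo u (dTwo x y z) =
    dTwo x y (z * u) - dTwo x (y * z) u + dTwo (x * y) z u := by
  have key : ∀ y z : R, rmulTwo u (dTwo x y z) =
      dTwo x y (z * u) - dTwo x ((y : U R) * z) u + dTwo (x * (y : U R)) z u := by
    intro y z
    rw [dTwo_apply x, form_apply, rmulTwo, liftForm_tmul]
    simp
    rfl
  have hy : y = algebraMap ℂ (U R) y.fst + (y.snd : U R) := (Unitization.inl_fst_add_inr_snd_eq y).symm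
  have hz : z = algebraMap ℂ (U R) z.fst + (z.snd : U R) := (Unitization.inl_fst_add_inr_snd_eq z).symm
  rw [dTwo_eq x y z, key]
  generalize y.snd = y' at *
  generalize z.snd = z' at *
  generalize y.fst = c at *
  generalize z.fst = e at *
  subst hy hz
  simp only [Algebra.algebraMap_eq_smul_one, map_add, map_smul, LinearMap.add_apply,
    LinearMap.smul_apply, add_mul, mul_add, smul_mul_assoc, mul_smul_comm, one_mul, mul_one,
    dTwo_one_mid, smul_zero, zero_add]
  abel

theorem rmulTwo_rmulTwo (s t : U R) (ω : Om R 2) :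
    rmulTwo s (rmulTwo t ω) = rmulTwo (t * s) ω := by
  have : (rmulTwo s) ∘ₗ (rmulTwo t) = rmulTwo (t * s) := by
    refine form_two_ext fun x y z => ?_
    simp only [LinearMap.comp_apply, rmulTwo_dTwo, map_add, map_sub, mul_assoc]
    abel
  exact LinearMap.congr_fun this ω

theorem lmul_rmulTwo (s t : U R) (ω : Om R 2) :
    lmul 2 s (rmulTwo t ω) = rmulTwo t (lmul 2 s ω) := by
  have : (lmul 2 s) ∘ₗ (rmulTwo t) = (rmulTwo t) ∘ₗ lmul 2 s := by
    refine form_two_ext fun x y z => ?_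
    simp only [LinearMap.comp_apply, rmulTwo_dTwo, lmul_dTwo, map_add, map_sub, mul_assoc]
  exact LinearMap.congr_fun this ω

theorem bTwo_rmulTwo (s : R) (ω : Om R 2) : bTwo (rmulTwo (s : U R) ω) = bTwo (lmul 2 s ω) := by
  have : bTwo ∘ₗ (rmulTwo (s : U R)) = bTwo ∘ₗ lmul 2 (s : U R) := by
    refine form_two_ext fun x y z => ?_
    simp only [LinearMap.comp_apply, rmulTwo_dTwo, lmul_dTwo, map_add, map_sub,
      ← Unitization.inr_mul, bTwo_dTwo]
    simp only [Unitization.inr_mul, mul_assoc]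
    abel
  exact LinearMap.congr_fun this ω

end Forms

/-! ### The non-unital tensor algebra -/

section Tensor

set_option linter.unusedSectionVars false

variable (A : Type*) [NonUnitalRing A] [Module ℂ A]

/-- The augmentation ideal of the unital tensor algebra of the vector space `A`. -/
def augmentation : NonUnitalSubalgebra ℂ (TensorAlgebra ℂ A) where
  carrier := {x | TensorAlgebra.algebraMapInv (R := ℂ) (M := A) x = 0}
  zero_mem' := by simp
  add_mem' := by
    intro a b ha hb
    simp only [Set.mem_ofPred_eq] at *
    simp [ha, hb]
  mul_mem' := by
    intro a b ha hb
    simp only [Set.mem_ofPred_eq] at *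
    simp [ha]
  smul_mem' := by
    intro c a ha
    simp only [Set.mem_ofPred_eq] at *
    simp [ha]

/-- The non-unital tensor algebra `TA = A ⊕ A ⊗ A ⊕ ⋯`: the augmentation ideal of the unital tensor
algebra of the vector space `A`. -/
def T : Type _ := augmentation A

instance : NonUnitalRing (T A) := inferInstanceAs (NonUnitalRing (augmentation A))
instance : Module ℂ (T A) := inferInstanceAs (Module ℂ (augmentation A))
instance : IsScalarTower ℂ (T A) (T A) :=
  inferInstanceAs (IsScalarTower ℂ (augmentation A) (augmentation A))
instance : SMulCommClass ℂ (T A) (T A) :=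
  inferInstanceAs (SMulCommClass ℂ (augmentation A) (augmentation A))

/-- The inclusion of `TA` in the unital tensor algebra. -/
def T.incl : T A →ₙₐ[ℂ] TensorAlgebra ℂ A := NonUnitalSubalgebraClass.subtype (augmentation A)

theorem T.incl_injective : Function.Injective (T.incl A) := Subtype.val_injective

theorem T.algebraMapInv_incl (x : T A) : TensorAlgebra.algebraMapInv (T.incl A x) = (0 : ℂ) := x.2

/-- The inclusion of `A` in `TA`. -/
def T.ι : A →ₗ[ℂ] T A :=
  (TensorAlgebra.ι ℂ).codRestrict (augmentation A).toSubmodule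
    (fun a => by simp [augmentation, TensorAlgebra.algebraMapInv])

theorem T.incl_ι (a : A) : T.incl A (T.ι A a) = TensorAlgebra.ι ℂ a := rfl

variable {A}
variable {M : Type*} [NonUnitalRing M] [Module ℂ M] [IsScalarTower ℂ M M] [SMulCommClass ℂ M M]

/-- The unital extension of a linear map `f : A → M`. -/
def T.liftU (f : A →ₗ[ℂ] M) : TensorAlgebra ℂ A →ₐ[ℂ] U M :=
  TensorAlgebra.lift ℂ (Unitization.inrHom (S := ℂ) (R := ℂ) (A := M) ∘ₗ f)

theorem T.liftU_fst (f : A →ₗ[ℂ] M) (x : T A) : (T.liftU f (T.incl A x)).fst = 0 := by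
  have : (Unitization.fstHom ℂ M).comp (T.liftU f) = TensorAlgebra.algebraMapInv := by
    ext a
    simp [T.liftU, TensorAlgebra.algebraMapInv]
  have h := DFunLike.congr_fun this (T.incl A x)
  rw [T.algebraMapInv_incl] at h
  exact h

/-- The homomorphism `f_* : TA → M`, `f_* (a₁ ⊗ ⋯ ⊗ aₖ) = f a₁ ⋯ f aₖ`, extending a linear map
`f : A → M`. -/
def T.lift (f : A →ₗ[ℂ] M) : T A →ₙₐ[ℂ] M where
  toFun x := (T.liftU f (T.incl A x)).snd
  map_smul' c x := by simp
  map_zero' := by simp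
  map_add' x y := by simp
  map_mul' x y := by simp [T.liftU_fst]

/-- The ideal `JA`, the kernel of the multiplication homomorphism `TA → A`. -/
def JT (A : Type*) [NonUnitalRing A] [Module ℂ A] [IsScalarTower ℂ A A] [SMulCommClass ℂ A A] :
    Submodule ℂ (T A) :=
  LinearMap.ker (T.lift (LinearMap.id : A →ₗ[ℂ] A) : T A →ₗ[ℂ] A)

/-- The homomorphism `TA → TA'` induced by a homomorphism `A → A'`. -/
def T.map {A' : Type*} [NonUnitalRing A'] [Module ℂ A'] (f : A →ₙₐ[ℂ] A') : T A →ₙₐ[ℂ] T A' :=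
  T.lift (T.ι A' ∘ₗ (f : A →ₗ[ℂ] A'))

/-- The operators `L_a (x, ω) = (a x, a ω + da dx)`, for `a ∈ A`. -/
def phiStep : A →ₗ[ℂ] Module.End ℂ (U (T A) × Om (T A) 2) :=
  LinearMap.mk₂ ℂ (fun a v => ((T.ι A a : U (T A)) * v.1,
      lmul 2 (T.ι A a : U (T A)) v.2 + dTwo 1 (T.ι A a : U (T A)) v.1))
    (fun a b v => by ext <;> simp [add_mul]; abel)
    (fun c a v => by ext <;> simp)
    (fun a v w => by ext <;> simp [mul_add]; abel)
    (fun c a v => by ext <;> simp)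

variable (A) in
/-- The action of the tensor algebra generated by the operators `L_a`. -/
def phiHom : TensorAlgebra ℂ A →ₐ[ℂ] Module.End ℂ (U (T A) × Om (T A) 2) :=
  TensorAlgebra.lift ℂ phiStep

theorem phiHom_ι (a : A) : phiHom A (TensorAlgebra.ι ℂ a) = phiStep a :=
  TensorAlgebra.lift_ι_apply _ _

/-- The linear map `φ : TA → Ω² TA` determined by `φ a = 0` for `a ∈ A` and
`φ (x y) = (φ x) y + x (φ y) + dx dy`. Explicitly
`φ (a₁ ⊗ ⋯ ⊗ aₖ) = ∑_{1 ≤ j < k} (a₁ ⋯ a_{j-1}) da_j d(a_{j+1} ⋯ aₖ)`. -/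
def phi : T A →ₗ[ℂ] Om (T A) 2 :=
  LinearMap.snd ℂ _ _ ∘ₗ LinearMap.applyₗ ((1 : U (T A)), (0 : Om (T A) 2)) ∘ₗ
    (phiHom A).toLinearMap ∘ₗ (T.incl A : T A →ₗ[ℂ] TensorAlgebra ℂ A)

theorem T.liftU_ι_coe (x : T A) : T.liftU (T.ι A) (T.incl A x) = (x : U (T A)) := by
  let e : U (T A) →ₐ[ℂ] TensorAlgebra ℂ A := Unitization.lift (T.incl A)
  have he : ∀ u : U (T A), e u = algebraMap ℂ _ u.fst + T.incl A u.snd := fun u => by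
    simp [e]
  have h1 : e.comp (T.liftU (T.ι A)) = AlgHom.id ℂ _ := by
    ext a
    simp [e, T.liftU, T.incl_ι]
  have h2 : e (T.liftU (T.ι A) (T.incl A x)) = T.incl A x := DFunLike.congr_fun h1 _
  rw [he, T.liftU_fst, map_zero, zero_add] at h2
  refine Unitization.ext ?_ ?_
  · rw [T.liftU_fst, Unitization.fst_inr]
  · rw [Unitization.snd_inr]
    exact T.incl_injective A h2

theorem phiStep_lift (y : TensorAlgebra ℂ A) : ∀ (s : U (T A)) (ω : Om (T A) 2),
    phiHom A y (s, ω) = (T.liftU (T.ι A) y * s,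
      lmul 2 (T.liftU (T.ι A) y) ω + rmulTwo s (phiHom A y (1, 0)).2
        + dTwo 1 (T.liftU (T.ι A) y) s) := by
  induction y using TensorAlgebra.induction with
  | algebraMap c =>
    intro s ω
    have : ∀ v, phiHom A (algebraMap ℂ _ c) v = c • v := fun v => by
      rw [AlgHom.commutes]
      rfl
    rw [this, this, AlgHom.commutes, Algebra.algebraMap_eq_smul_one]
    ext <;> simp [lmul_one, dTwo_one_mid]
  | ι a =>
    intro s ω
    simp [phiHom_ι, phiStep, T.liftU, dTwo_one_right]
  | mul x y hx hy =>
    intro s ω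
    rw [map_mul, map_mul, Module.End.mul_apply, Module.End.mul_apply, hy s ω, hx, hy 1 0, hx (_ * 1)]
    simp only [Prod.mk.injEq, mul_assoc, true_and, map_add, map_zero, mul_one, zero_add,
      dTwo_one_right, add_zero, rmulTwo_rmulTwo, rmulTwo_dTwo, lmul_mul, lmul_rmulTwo, lmul_dTwo,
      one_mul]
    abel
  | add x y hx hy =>
    intro s ω
    rw [map_add, LinearMap.add_apply, hx, hy, map_add, LinearMap.add_apply]
    simp only [Prod.mk_add_mk, Prod.mk.injEq, add_mul, map_add, LinearMap.add_apply, Prod.snd_add,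
      true_and]
    abel

theorem phi_ι (a : A) : phi (T.ι A a) = 0 := by
  have : phi (T.ι A a) = (phiHom A (TensorAlgebra.ι ℂ a) (1, 0)).2 := rfl
  rw [this]
  simp [phiHom_ι, phiStep, dTwo_one_right]

theorem phi_mul (x y : T A) :
    phi (x * y) = rmulTwo (y : U (T A)) (phi x) + lmul 2 (x : U (T A)) (phi y)
      + dTwo 1 (x : U (T A)) (y : U (T A)) := by
  have h : ∀ z : T A, phi z = (phiHom A (T.incl A z) (1, 0)).2 := fun _ => rfl
  have h1 : phiHom A (T.incl A y) (1, 0) = ((y : U (T A)), phi y) := by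
    refine Prod.ext ?_ rfl
    rw [phiStep_lift, T.liftU_ι_coe]
    simp
  rw [h (x * y), map_mul, map_mul, Module.End.mul_apply, h1,
    phiStep_lift, T.liftU_ι_coe, h x]
  abel

end Tensor

/-! ### The `X`-complex, its filtrations, and periodic cyclic cohomology -/

section XComplex

set_option linter.unusedSectionVars false

variable (R : Type*) [NonUnitalRing R] [Module ℂ R] [IsScalarTower ℂ R R] [SMulCommClass ℂ R R]

/-- The commutator subspace `[R, Ω¹R]`, spanned by the elements
`a (x dy) - (x dy) a = a x dy - x d(y a) + x y da`. -/
def commutators : Submodule ℂ (Om R 1) :=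
  Submodule.span ℂ {ω | ∃ (a : R) (x : U R) (y : R),
    ω = dOne ((a : U R) * x) (y : U R) - dOne x ((y * a : R) : U R)
      + dOne (x * (y : U R)) (a : U R)}

/-- `Ω¹R_♮ = Ω¹R / [R, Ω¹R]`. -/
abbrev OmNat := Om R 1 ⧸ commutators R

/-- The `X`-complex `R ⇄ Ω¹R_♮`: the first component is the even part and the second one is the odd
part. -/
abbrev X := R × OmNat R

variable {R}

/-- The class `♮ x dy`. -/
def natD : U R →ₗ[ℂ] U R →ₗ[ℂ] OmNat R := LinearMap.compr₂ dOne (commutators R).mkQ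

theorem bOne_dOne (x : U R) (y : R) : bOne (dOne x y) = (x * y - y * x : U R).snd := by
  rw [dOne_apply, form_apply, bOne, LinearMap.comp_apply, liftForm_tmul]
  simp

/-- The map `♮ x dy ↦ [x, y]`. -/
def bBar : OmNat R →ₗ[ℂ] R :=
  (commutators R).liftQ bOne (by
    refine Submodule.span_le.2 ?_
    rintro _ ⟨a, x, y, rfl⟩
    rw [SetLike.mem_coe, LinearMap.mem_ker, map_add, map_sub, bOne_dOne, bOne_dOne, bOne_dOne,
      Unitization.inr_mul]
    have : (a : U R) * x * y - y * (a * x) - (x * (y * a) - y * a * x) + (x * y * a - a * (x * y))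
        = 0 := by
      simp only [mul_assoc]
      abel
    have h2 := congrArg (Unitization.sndHom (S := ℂ) (R := ℂ) (A := R)) this
    exact h2)

/-- The boundary `∂ = ♮d ⊕ b̄` of the `X`-complex. -/
def bdry : X R →ₗ[ℂ] X R :=
  LinearMap.prod (bBar ∘ₗ LinearMap.snd ℂ R (OmNat R))
    (natD 1 ∘ₗ Unitization.inrHom (S := ℂ) (R := ℂ) (A := R) ∘ₗ LinearMap.fst ℂ R (OmNat R))

variable {S : Type*} [NonUnitalRing S] [Module ℂ S] [IsScalarTower ℂ S S] [SMulCommClass ℂ S S]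

theorem mapForm_dOne (f : R →ₙₐ[ℂ] S) (x y : U R) : mapForm f 1 (dOne x y) =
    dOne (Unitization.lift ((Unitization.inrNonUnitalAlgHom ℂ S).comp f) x) ((f y.snd : S) : U S) := by
  rw [dOne_apply, dOne_apply, form_apply, form_apply, mapForm, TensorProduct.map_tmul,
    PiTensorProduct.map_tprod]
  refine congrArg₂ (fun a b => a ⊗ₜ[ℂ] PiTensorProduct.tprod ℂ b) rfl ?_
  funext j
  fin_cases j
  rfl

/-- The chain map `X(R) → X(S)` induced by a homomorphism `R → S`. -/
def X.map (f : R →ₙₐ[ℂ] S) : X R →ₗ[ℂ] X S :=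
  LinearMap.prodMap (f : R →ₗ[ℂ] S)
    ((commutators R).mapQ (commutators S) (mapForm f 1) (by
      refine Submodule.span_le.2 ?_
      rintro _ ⟨a, x, y, rfl⟩
      refine Submodule.subset_span ⟨f a,
        Unitization.lift ((Unitization.inrNonUnitalAlgHom ℂ S).comp f) x, f y, ?_⟩
      simp only [map_add, map_sub, mapForm_dOne, map_mul, Unitization.snd_inr]
      simp))

/-- The powers of an ideal: `powI I 0` is the whole algebra, and `powI I n` is `Iⁿ`, the span of the
products of `n` elements of `I`, for `n ≥ 1`. -/
def powI (I : Submodule ℂ R) : ℕ → Submodule ℂ R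
  | 0 => ⊤
  | 1 => I
  | n + 2 => Submodule.span ℂ {z | ∃ x ∈ powI I (n + 1), ∃ y ∈ I, z = x * y}

/-- `I_(+)ⁿ`, equal to the unitalization `R⁺` for `n = 0` and to `Iⁿ` for `n ≥ 1`. -/
def powPlus (I : Submodule ℂ R) (n : ℕ) : Submodule ℂ (U R) :=
  if n = 0 then ⊤ else (powI I n).map (Unitization.inrHom (S := ℂ) (R := ℂ) (A := R))

/-- The subspace `♮(K dL)` of `Ω¹R_♮`. -/
def natSpan (K : Submodule ℂ (U R)) (L : Submodule ℂ R) : Submodule ℂ (OmNat R) :=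
  Submodule.span ℂ {w | ∃ x ∈ K, ∃ y ∈ L, w = natD x (y : U R)}

/-- The subcomplex `F_I^k X(R)` of the filtration attached to an ideal `I` of `R`, for `k ≥ 0`:
`F_I^{2n} X(R)` is `I^{n+1} + [I^n, R] ⇄ ♮(I_(+)^n dR)` and
`F_I^{2n+1} X(R)` is `I^{n+1} ⇄ ♮(I_(+)^{n+1} dR + I_(+)^n dI)`. -/
def filt (I : Submodule ℂ R) (k : ℕ) : Submodule ℂ (X R) :=
  if Even k then
    Submodule.prod
      (powI I (k / 2 + 1) ⊔ Submodule.span ℂ {z | ∃ x ∈ powI I (k / 2), ∃ y : R, z = x * y - y * x})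
      (natSpan (powPlus I (k / 2)) ⊤)
  else
    Submodule.prod (powI I (k / 2 + 1))
      (natSpan (powPlus I (k / 2 + 1)) ⊤ ⊔ natSpan (powPlus I (k / 2)) I)

/-- The linear functionals of degree `i ∈ ℤ/2` on `X(R)`. -/
def homogeneous (R : Type*) [NonUnitalRing R] [Module ℂ R] [IsScalarTower ℂ R R]
    [SMulCommClass ℂ R R] (i : ZMod 2) : Submodule ℂ (X R →ₗ[ℂ] ℂ) where
  carrier := {f | (i = 0 → ∀ w : OmNat R, f (0, w) = 0) ∧ (i = 1 → ∀ x : R, f (x, 0) = 0)}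
  zero_mem' := by simp
  add_mem' := fun hf hg => ⟨fun h w => by simp [hf.1 h w, hg.1 h w],
    fun h w => by simp [hf.2 h w, hg.2 h w]⟩
  smul_mem' := fun c f hf => ⟨fun h w => by simp [hf.1 h w], fun h w => by simp [hf.2 h w]⟩

/-- The cochains of degree `i` on the pro-complex `lim X(R) / F_I^k X(R)`: the linear functionals of
degree `i` on `X(R)` which vanish on `F_I^k X(R)` for all large `k`. -/
def cochains (I : Submodule ℂ R) (i : ZMod 2) : Submodule ℂ (X R →ₗ[ℂ] ℂ) where
  carrier := {f | f ∈ homogeneous R i ∧ ∃ m, ∀ k ≥ m, ∀ x ∈ filt I k, f x = 0}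
  zero_mem' := ⟨zero_mem _, 0, by simp⟩
  add_mem' := by
    rintro f g ⟨hf, m, hm⟩ ⟨hg, m', hm'⟩
    refine ⟨add_mem hf hg, max m m', fun k hk x hx => ?_⟩
    rw [LinearMap.add_apply, hm k (le_trans (le_max_left _ _) hk) x hx,
      hm' k (le_trans (le_max_right _ _) hk) x hx, add_zero]
  smul_mem' := by
    rintro c f ⟨hf, m, hm⟩
    refine ⟨Submodule.smul_mem _ c hf, m, fun k hk x hx => ?_⟩
    rw [LinearMap.smul_apply, hm k hk x hx, smul_zero]

/-- The coboundary `f ↦ f ∘ ∂` of functionals on `X(R)`. -/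
def cobdry : (X R →ₗ[ℂ] ℂ) →ₗ[ℂ] (X R →ₗ[ℂ] ℂ) := LinearMap.lcomp ℂ ℂ bdry

/-- The cocycles of degree `i` on the pro-complex `lim X(R) / F_I^k X(R)`. -/
def cocycles (I : Submodule ℂ R) (i : ZMod 2) : Submodule ℂ (X R →ₗ[ℂ] ℂ) :=
  cochains I i ⊓ LinearMap.ker cobdry

/-- The coboundaries of the cochains of degree `i + 1`. -/
def coboundaries (I : Submodule ℂ R) (i : ZMod 2) : Submodule ℂ (X R →ₗ[ℂ] ℂ) :=
  (cochains I (i + 1)).map cobdry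

/-- The periodic cyclic cohomology `HP^i(A) = H^i(X(T̂A))`, where `T̂A` is the `JA`-adic completion
of the tensor algebra `TA`. -/
abbrev HP (A : Type*) [NonUnitalRing A] [Module ℂ A] [IsScalarTower ℂ A A] [SMulCommClass ℂ A A]
    (i : ZMod 2) :=
  cocycles (JT A) i ⧸ (coboundaries (JT A) i).comap (cocycles (JT A) i).subtype

/-- The class in `HP^i(A)` of a cocycle. -/
def HP.mk {A : Type*} [NonUnitalRing A] [Module ℂ A] [IsScalarTower ℂ A A] [SMulCommClass ℂ A A]
    {i : ZMod 2} (f : X (T A) →ₗ[ℂ] ℂ) (hf : f ∈ cocycles (JT A) i) : HP A i :=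
  Submodule.Quotient.mk ⟨f, hf⟩

end XComplex

/-! ### The Goodwillie equivalence `γ : X(TA) → Ω̂ TA` -/

section Goodwillie

set_option linter.unusedSectionVars false

variable {R : Type*} [NonUnitalRing R] [Module ℂ R] [IsScalarTower ℂ R R] [SMulCommClass ℂ R R]

/-- The map `(ω, (y₁, …, yₙ)) ↦ ω dy₁ ⋯ dyₙ`, for a two-form `ω`. -/
def appendD : (n : ℕ) → Om R 2 →ₗ[ℂ] MultilinearMap ℂ (fun _ : Fin n => U R) (Om R (n + 2))
  | 0 => (MultilinearMap.constLinearEquivOfIsEmpty (R := ℂ) (S := ℂ)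
      (M₁ := fun _ : Fin 0 => U R) (M₂ := Om R 2)).toLinearMap
  | n + 1 =>
      (multilinearCurryRightEquiv ℂ (fun _ : Fin (n + 1) => U R) (Om R (n + 3))).symm.toLinearMap ∘ₗ
        (mulD (n + 2)).compMultilinearMapₗ ℂ ∘ₗ appendD n

variable {A : Type*} [NonUnitalRing A] [Module ℂ A]

/-- The extension `φ (x₀ dx₁ ⋯ dxₙ) = ∑ᵢ (-1)^{ni} φ(xᵢ) dx_{i+1} ⋯ dxₙ dx₀ ⋯ dx_{i-1}` of `φ` to
`n`-forms over `TA`, where `φ(1) = 0`. -/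
def phiForm (n : ℕ) : Om (T A) n →ₗ[ℂ] Om (T A) (n + 2) :=
  liftForm (∑ k : Fin (n + 1), (-1 : ℂ) ^ (n * k.val) •
    (LinearMap.uncurryLeft
      (appendD n ∘ₗ phi ∘ₗ Unitization.sndHom (S := ℂ) (R := ℂ) (A := T A))).domDomCongr
        (Equiv.addRight k))

/-- The map `x dy ↦ x dy + b (x φ(y))` on one-forms over `TA`. -/
def gammaForm : Om (T A) 1 →ₗ[ℂ] Om (T A) 1 :=
  LinearMap.id + bTwo ∘ₗ liftForm (MultilinearMap.mk'
    (fun x => lmul 2 (x 0) (phi (x 1).snd))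
    (fun m i x y => by fin_cases i <;> simp)
    (fun m i c x => by fin_cases i <;> simp))

theorem gammaForm_dOne (x : U (T A)) (y : T A) :
    gammaForm (dOne x y) = dOne x y + bTwo (lmul 2 x (phi y)) := by
  rw [gammaForm, LinearMap.add_apply, LinearMap.id_apply, LinearMap.comp_apply]
  congr 2
  rw [dOne_apply, form_apply, liftForm_tmul]
  simp

variable (A) in
/-- The map `♮ x dy ↦ x dy + b (x φ(y))`. -/
def gammaOne : OmNat (T A) →ₗ[ℂ] Om (T A) 1 :=
  (commutators (T A)).liftQ gammaForm (by
    refine Submodule.span_le.2 ?_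
    rintro _ ⟨a, x, y, rfl⟩
    rw [SetLike.mem_coe, LinearMap.mem_ker, map_add, map_sub, gammaForm_dOne, gammaForm_dOne,
      gammaForm_dOne, phi_mul]
    simp only [map_add, lmul_rmulTwo, bTwo_rmulTwo, ← lmul_mul, lmul_dTwo, bTwo_dTwo, mul_one]
    abel)

variable (A) in
/-- The degree `k` component of the generalized Goodwillie equivalence `γ : X(TA) → Ω̂ TA`,
`γ(x) = (1 - φ)⁻¹ (x)` and `γ(♮ x dy) = (1 - φ)⁻¹ (x dy + b (x φ(y)))`. -/
def gamma : (k : ℕ) → X (T A) →ₗ[ℂ] Om (T A) k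
  | 0 => zeroForm ∘ₗ Unitization.inrHom (S := ℂ) (R := ℂ) (A := T A) ∘ₗ
      LinearMap.fst ℂ (T A) (OmNat (T A))
  | 1 => gammaOne A ∘ₗ LinearMap.snd ℂ (T A) (OmNat (T A))
  | k + 2 => phiForm k ∘ₗ gamma k

end Goodwillie

/-! ### Liftings of extensions, and the bivariant Chern character -/

section Chern

set_option linter.unusedSectionVars false

/-- A lifting `0 → R → M → P → 0` of an extension `0 → B → E → A → 0`: a commutative diagram
```
0 → J → N → Q → 0
    ↓   ↓   ↓
0 → R → M → P → 0
    ↓   ↓   ↓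
0 → B → E → A → 0
```
whose rows and columns are extensions. -/
structure Lifting {B E A : Type*}
    [NonUnitalRing B] [Module ℂ B] [NonUnitalRing E] [Module ℂ E] [NonUnitalRing A] [Module ℂ A]
    (i : B →ₙₐ[ℂ] E) (p : E →ₙₐ[ℂ] A) (J N Q R M P : Type*)
    [NonUnitalRing J] [Module ℂ J] [NonUnitalRing N] [Module ℂ N] [NonUnitalRing Q] [Module ℂ Q]
    [NonUnitalRing R] [Module ℂ R] [NonUnitalRing M] [Module ℂ M] [NonUnitalRing P] [Module ℂ P]
    where
  jn : J →ₙₐ[ℂ] N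
  nq : N →ₙₐ[ℂ] Q
  rm : R →ₙₐ[ℂ] M
  mp : M →ₙₐ[ℂ] P
  jr : J →ₙₐ[ℂ] R
  rb : R →ₙₐ[ℂ] B
  nm : N →ₙₐ[ℂ] M
  me : M →ₙₐ[ℂ] E
  qp : Q →ₙₐ[ℂ] P
  pa : P →ₙₐ[ℂ] A
  row_top : IsExtension jn nq
  row_mid : IsExtension rm mp
  row_bot : IsExtension i p
  col_left : IsExtension jr rb
  col_mid : IsExtension nm me
  col_right : IsExtension qp pa
  sq_jnrm : ∀ x, nm (jn x) = rm (jr x)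
  sq_nqmp : ∀ x, qp (nq x) = mp (nm x)
  sq_rmbe : ∀ x, me (rm x) = i (rb x)
  sq_mpea : ∀ x, pa (mp x) = p (me x)

/-- The image of a homomorphism as a subspace. -/
def image {R M : Type*} [NonUnitalRing R] [Module ℂ R] [NonUnitalRing M] [Module ℂ M]
    (f : R →ₙₐ[ℂ] M) : Submodule ℂ M := LinearMap.range (f : R →ₗ[ℂ] M)

variable {R M P : Type*} [NonUnitalRing R] [Module ℂ R]
  [NonUnitalRing M] [Module ℂ M] [IsScalarTower ℂ M M] [SMulCommClass ℂ M M]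
  [NonUnitalRing P] [Module ℂ P]

/-- The algebra `M^s_+` of `2 × 2` matrices over `M` with off-diagonal entries in `R`, for an
extension `0 → R → M → P → 0`. -/
def offDiag {r : R →ₙₐ[ℂ] M} {q : M →ₙₐ[ℂ] P} (h : IsExtension r q) :
    NonUnitalSubalgebra ℂ (Matrix (Fin 2) (Fin 2) M) where
  carrier := {m | m 0 1 ∈ image r ∧ m 1 0 ∈ image r}
  zero_mem' := ⟨zero_mem _, zero_mem _⟩
  add_mem' := fun ha hb => ⟨add_mem ha.1 hb.1, add_mem ha.2 hb.2⟩
  smul_mem' := fun c _ ha => ⟨Submodule.smul_mem _ c ha.1, Submodule.smul_mem _ c ha.2⟩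
  mul_mem' := by
    have key : ∀ x : M, x ∈ image r ↔ q x = 0 := fun x => (h.exact x).symm
    rintro a b ⟨ha, ha'⟩ ⟨hb, hb'⟩
    rw [key] at ha ha' hb hb'
    constructor
    · rw [key, Matrix.mul_apply, Fin.sum_univ_two, map_add, map_mul, map_mul, ha, hb]
      simp
    · rw [key, Matrix.mul_apply, Fin.sum_univ_two, map_add, map_mul, map_mul, ha', hb']
      simp

variable (M) in
/-- The unital algebra `M₂(M⁺)`, in which the products of elements of `M₂(M)⁺` are computed. -/
abbrev Mat := Matrix (Fin 2) (Fin 2) (U M)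

variable (M) in
/-- The inclusion of `M₂(M)` in `M₂(M⁺)`. -/
def matIncl : Matrix (Fin 2) (Fin 2) M →ₙₐ[ℂ] Mat M where
  toFun m := m.map (fun x => (x : U M))
  map_smul' c m := by ext <;> simp
  map_zero' := by ext <;> simp
  map_add' a b := by ext <;> simp
  map_mul' a b := by ext <;> simp [Matrix.mul_apply]

variable {r : R →ₙₐ[ℂ] M} {q : M →ₙₐ[ℂ] P} (h : IsExtension r q)

/-- The unital homomorphism `(M^s_+)⁺ → M₂(M⁺)`. -/
def jMat : U (offDiag h) →ₐ[ℂ] Mat M :=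
  Unitization.lift ((matIncl M).comp (NonUnitalSubalgebraClass.subtype (offDiag h)))

variable (M) in
/-- The diagonal matrix with entries `1, -1`. -/
def sgn : Mat M := Matrix.diagonal ![1, -1]

/-- The commutator with `F`. Here `F = ε ⊗ diag(1, -1)`, where `ε` is the odd generator of the
Clifford algebra `C₁ = ℂ ⊕ εℂ`, so that `[F, x] = ε ⊗ [diag(1, -1), x]`; the odd factor `ε` is left
implicit. -/
def commF : Mat M →ₗ[ℂ] Mat M :=
  LinearMap.mulLeft ℂ (sgn M) - LinearMap.mulRight ℂ (sgn M)

/-- The value of the odd supertrace on `ε`: `tr_s (ε ⊗ m) = -√(2i) tr m`. -/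
def superFactor : ℂ := -((2 * Complex.I) ^ (1 / 2 : ℂ))

/-- The constant `-Γ(1 + n/2) / (n+1)!`. -/
def chiConst (n : ℕ) : ℂ := -(Complex.Gamma (1 + n / 2) / (n + 1).factorial)

/-- The trace of `2 × 2` matrices over `M⁺`, followed by the projection onto `M`. -/
def trM : Mat M →ₗ[ℂ] M :=
  Unitization.sndHom (S := ℂ) (R := ℂ) (A := M) ∘ₗ Matrix.traceLinearMap (Fin 2) ℂ (U M)

/-- The bilinear map `(Y, Z) ↦ tr ♮ (Y dZ) = ∑_{a,b} ♮ Y_{ab} dZ_{ba}`. -/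
def trNat : Mat M →ₗ[ℂ] Mat M →ₗ[ℂ] OmNat M :=
  ∑ a : Fin 2, ∑ b : Fin 2,
    natD.compl₁₂ (Matrix.entryLinearMap ℂ (U M) a b) (Matrix.entryLinearMap ℂ (U M) b a)

/-- The even component
`χ₀ⁿ (x₀ dx₁ ⋯ dxₙ) = -Γ(1 + n/2)/(n+1)! ∑_λ sgn(λ) tr_s (x_{λ(0)} [F, x_{λ(1)}] ⋯ [F, x_{λ(n)}])`,
the sum being over the cyclic permutations `λ` of `{0, …, n}`. Since `n` is odd,
`[F, y₁] ⋯ [F, yₙ]` has the Clifford part `εⁿ = ε`. -/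
def chiZero (n : ℕ) : Om (offDiag h) n →ₗ[ℂ] M :=
  (chiConst n * superFactor) • trM ∘ₗ liftForm (∑ k : Fin (n + 1),
    (Equiv.Perm.sign (Equiv.addRight k : Equiv.Perm (Fin (n + 1))) : ℤ) •
      ((MultilinearMap.mkPiAlgebraFin ℂ (n + 1) (Mat M)).compLinearMap
        (fun s : Fin (n + 1) => if s = 0 then (jMat h).toLinearMap
          else commF ∘ₗ (jMat h).toLinearMap)).domDomCongr (Equiv.addRight k))

/-- The odd component `χ₁ⁿ (x₀ dx₁ ⋯ dx_{n+1}) =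
-Γ(1 + n/2)/(n+1)! ∑_{1 ≤ i ≤ n+1} tr_s ♮ (x₀ [F, x₁] ⋯ dxᵢ ⋯ [F, x_{n+1}])`.
Modulo commutators, `x₀ [F, x₁] ⋯ dxᵢ ⋯ [F, x_{n+1}]` is computed by moving the factors on the
right of `dxᵢ` to the left end. Both `ε` and `d` are odd, so that moving the `n + 1 - i` factors `ε`
standing on the right of `d` to its left yields the sign `(-1)^{n+1-i}`. -/
def chiOne (n : ℕ) : Om (offDiag h) (n + 1) →ₗ[ℂ] OmNat M :=
  (chiConst n * superFactor) • liftForm (∑ i : Fin (n + 1),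
    (-1 : ℂ) ^ (n - i.val) •
      ((MultilinearMap.uncurryRight (M := fun _ : Fin (n + 2) => Mat M)
        (trNat.compMultilinearMap (MultilinearMap.mkPiAlgebraFin ℂ (n + 1) (Mat M)))).domDomCongr
          (Equiv.addRight (i.succ + 1))).compLinearMap
        (fun s : Fin (n + 2) => if s = 0 ∨ s = i.succ then (jMat h).toLinearMap
          else commF ∘ₗ (jMat h).toLinearMap))

variable {A : Type*} [NonUnitalRing A] [Module ℂ A]

/-- The bivariant Chern character
`ch^n(ρ) : X(TA) → Ω̂ TA → Ω̂ M^s_+ → X(M)`, `ch^n(ρ) = χⁿ ∘ ρ_* ∘ γ`, for `n` odd, where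
`ρ_* : TA → M^s_+` extends a linear map `l : A → M^s_+`. -/
def chern (n : ℕ) (l : A →ₗ[ℂ] offDiag h) : X (T A) →ₗ[ℂ] X M :=
  LinearMap.prod (chiZero h n ∘ₗ mapForm (T.lift l) n ∘ₗ gamma A n)
    (chiOne h n ∘ₗ mapForm (T.lift l) (n + 1) ∘ₗ gamma A (n + 1))

end Chern

/-! ### Renormalization and the connecting morphism -/

section Connecting

variable {M : Type*} [NonUnitalRing M] [Module ℂ M] [IsScalarTower ℂ M M] [SMulCommClass ℂ M M]

/-- `τ` is a cocycle of degree `d` over the pro-complex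
`F_I^k X(M̂) = lim_l F_I^k X(M) / (F_I^k X(M) ∩ F_K^l X(M))`, where `M̂` is the `K`-adic completion. -/
structure IsCocycleOver (I K : Submodule ℂ M) (k : ℕ) (d : ZMod 2) (τ : filt I k →ₗ[ℂ] ℂ) :
    Prop where
  even : d = 0 → ∀ x : filt I k, x.1.1 = 0 → τ x = 0
  odd : d = 1 → ∀ x : filt I k, x.1.2 = 0 → τ x = 0
  adic : ∃ m, ∀ l ≥ m, ∀ x : filt I k, x.1 ∈ filt K l → τ x = 0
  closed : ∀ x y : filt I k, y.1 = bdry x.1 → τ y = 0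

/-- A renormalization of `τ`: a cochain on `X(M̂)`, of the same degree, which extends `τ`. -/
structure IsRenormalization (I K : Submodule ℂ M) (k : ℕ) (d : ZMod 2) (τ : filt I k →ₗ[ℂ] ℂ)
    (τR : X M →ₗ[ℂ] ℂ) : Prop where
  cochain : τR ∈ cochains K d
  extends_cocycle : ∀ x : filt I k, τR x.1 = τ x

variable {B E A : Type*}
  [NonUnitalRing B] [Module ℂ B] [IsScalarTower ℂ B B] [SMulCommClass ℂ B B]
  [NonUnitalRing E] [Module ℂ E] [IsScalarTower ℂ E E] [SMulCommClass ℂ E E]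
  [NonUnitalRing A] [Module ℂ A] [IsScalarTower ℂ A A] [SMulCommClass ℂ A A]
  (i : B →ₙₐ[ℂ] E) (p : E →ₙₐ[ℂ] A)

/-- The ideal `T(B:E)`, the kernel of `TE → TA`. -/
def TRel : Submodule ℂ (T E) := LinearMap.ker (T.map p : T E →ₗ[ℂ] T A)

/-- `θ` is a cochain of degree `d` on `X(T̂E)` whose restriction to `F¹_{T(B:E)} X(T̂E)` is a
cocycle. -/
def IsUniversalCocycle (d : ZMod 2) (θ : X (T E) →ₗ[ℂ] ℂ) : Prop :=
  θ ∈ cochains (JT E) d ∧ ∀ x ∈ filt (TRel p) 1, θ (bdry x) = 0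

/-- The graph of the connecting morphism `E^* : HP^d(B) → HP^{d+1}(A)` of an extension. By excision
`X(T̂B) → F¹_{T(B:E)} X(T̂E)` is a homotopy equivalence, so that a class `β` is the restriction of a
cocycle over `F¹_{T(B:E)} X(T̂E)`; the image of `β` is its image under the boundary map of the exact
sequence `0 → F¹_{T(B:E)} X(T̂E) → X(T̂E) → X(T̂A) → 0`: the cocycle is extended to a cochain `θ` on
`X(T̂E)`, and `θ ∘ ∂` descends to a cocycle `φ` over `X(T̂A)`. -/
def IsConnecting (d : ZMod 2) (β : HP B d) (α : HP A (d + 1)) : Prop :=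
  ∃ (θ : X (T E) →ₗ[ℂ] ℂ) (hθ : θ ∘ₗ X.map (T.map i) ∈ cocycles (JT B) d)
    (φ : X (T A) →ₗ[ℂ] ℂ) (hφ : φ ∈ cocycles (JT A) (d + 1)),
    IsUniversalCocycle p d θ ∧ HP.mk _ hθ = β ∧
    φ ∘ₗ X.map (T.map p) = θ ∘ₗ bdry ∧ HP.mk φ hφ = α

variable {J N Q R M P : Type*}
  [NonUnitalRing J] [Module ℂ J] [NonUnitalRing N] [Module ℂ N] [NonUnitalRing Q] [Module ℂ Q]
  [NonUnitalRing R] [Module ℂ R] [NonUnitalRing P] [Module ℂ P]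
  [NonUnitalRing M] [Module ℂ M] [IsScalarTower ℂ M M] [SMulCommClass ℂ M M]

variable {i p} in
/-- The cocycle `τ` over `F_R^k X(M̂)` represents the class `β ∈ HP^d(B)`: for some classifying
homomorphism `TE → M`, induced by a linear section `s` of `M → E` with `s(B) ⊂ R`, the pullback of
`τ` is cohomologous, over `F_{T(B:E)}^k X(T̂E)`, to the restriction of a cocycle over
`F¹_{T(B:E)} X(T̂E)` which restricts to `β` on `X(T̂B)`. -/
def Represents (D : Lifting i p J N Q R M P) (k : ℕ) (d : ZMod 2)
    (τ : filt (image D.rm) k →ₗ[ℂ] ℂ) (β : HP B d) : Prop :=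
  ∃ s : E →ₗ[ℂ] M, (∀ e, D.me (s e) = e) ∧ (∀ b, s (i b) ∈ image D.rm) ∧
    ∃ (θ : X (T E) →ₗ[ℂ] ℂ) (hθ : θ ∘ₗ X.map (T.map i) ∈ cocycles (JT B) d),
      IsUniversalCocycle p d θ ∧ HP.mk _ hθ = β ∧
      ∃ ψ ∈ cochains (JT E) (d + 1), ∀ x ∈ filt (TRel p) k,
        ∃ hx : X.map (T.lift s) x ∈ filt (image D.rm) k,
          τ ⟨X.map (T.lift s) x, hx⟩ = θ x + ψ (bdry x)

variable {i p} in
/-- An extension is invertible through a homomorphism `ρ : A → M₂(E)` if the off-diagonal entries of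
`ρ` lie in `B` and the upper left corner of `ρ` is a linear splitting of `E → A`. -/
structure IsInvertibleVia (i : B →ₙₐ[ℂ] E) (p : E →ₙₐ[ℂ] A)
    (ρ : A →ₙₐ[ℂ] Matrix (Fin 2) (Fin 2) E) : Prop where
  upper_right : ∀ a, ρ a 0 1 ∈ image i
  lower_left : ∀ a, ρ a 1 0 ∈ image i
  upper_left : ∀ a, p (ρ a 0 0) = a

end Connecting

end PeriodicCyclic

end

open PeriodicCyclic

/-! The character is a coboundary as soon as the filtration by the powers of R is forgotten, and the
renormalization measures exactly this. Put F = diag(1, -1), let L : A → M₂(M) be the linear lifting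
of ρ and ∇a = [F, L a]. For a word w let Pₘ(w) be the sum of the products obtained from w by
replacing m of its letters a by ∇a and the others by L a. For n = 2j+1, `chern_eq` gives ch^n(ρ) =
∂H - H∂ for an explicit even map H = `homot`. On a word, H is a constant C times the sum of tr(F
P_{2i}(w)) 4^{-i} for i ≤ j, plus C tr P₀(w). There is a matching odd component, with a correction
`kOne`.

Since F anticommutes with every ∇a, one has F Pₖ = Pₖ F + Pₖ₊₁ for k even and F Pₖ = -Pₖ F for k
odd. With the weights 4^{-i} the boundaries of consecutive terms telescope (`XTrace.hitSum_even`,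
`XTrace.hitSum_odd`) and only words with 2j+1 commutators remain. On the other side, forms over TA
are read as words in the generators of the tensor algebra of TA. There φ becomes a cyclic operator,
which under a trace can be replaced by a derivation whose j-th power cuts a word into a tower of
2j+1 factors, j! times. This yields the closed formulas `chern_fst` and `chern_snd`, which match the
telescoped boundary. The summand tr P₀ is a chain map and does not affect ∂H - H∂; it is there
because tr(Fx) + tr(x) only sees the upper left corner of x.

Hence τ ch = τ_R ch = (τ_R ∂)H - (τ_R H)∂, and the last term is a coboundary. The cocycle τ_R ∂
vanishes on F_R^{2n-1}, because τ is closed, and on high powers of N, because τ_R is a cochain. So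
it is a cocycle for the ideal N + R = ker(M → A) (`renormalization_bdry_mem_cocycles`), and it may
be evaluated on a deformation of L modulo this ideal. One deforms along m ↦ s(m̄), s being a linear
section of M → P, which kills the off-diagonal entries. The deformation takes place over TM, where
linear maps extend to homomorphisms and the Cartan homotopy (`cartan_homotopy`) applies. Its error
term is the Cartan homotopy applied to a Chern character. It stays in the filtration step where τ_R
∂ vanishes (`cartan_filt`, `chern_mem`). For a diagonal L all commutators vanish, and H is 2C times
the map induced by the splitting σ₀ = s(L̄₀₀) (`homot_diagonal`). The duplication formula for Γ
gives 2C = √(2πi) (`chernConst_eq`). The passage from σ₀ to σ is again a Cartan homotopy. This is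
assembled in `exists_chern_eq`.

For the connecting morphism (`exists_connecting`), let θ be the universal cochain on X(TE) and s a
section of M → E. The cochain τ_R ∘ X(s_*) - θ - ψ∂ vanishes on a step of the T(B:E)-filtration and
on high powers of JE, hence is a cochain for ker(TE → A). Therefore τ_R ∂ X(s_*) and θ∂ differ by a
coboundary for that ideal, and pulling back along a splitting of TE → A compares the two classes. -/

open scoped TensorProduct
noncomputable section
namespace PeriodicCyclic

/-! ### Sums over the letters of a word -/

section Words

variable {V W W' : Type*} [AddCommGroup V] [Module ℂ V] [AddCommGroup W] [Module ℂ W]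
  [AddCommGroup W'] [Module ℂ W']

/-- The sum of `f z b w` over the decompositions `l = z b w` of a list, `b` being a letter. -/
def lsum {V W : Type*} [AddCommMonoid W] : (List V → V → List V → W) → List V → W
  | _, [] => 0
  | f, a :: l => f [] a l + lsum (fun z b w => f (a :: z) b w) l

section lsum

variable {V W W' : Type*} [AddCommGroup W] [AddCommGroup W']

@[simp] theorem lsum_nil (f : List V → V → List V → W) : lsum f [] = 0 := rfl

theorem lsum_cons (f : List V → V → List V → W) (a : V) (l : List V) :
    lsum f (a :: l) = f [] a l + lsum (fun z b w => f (a :: z) b w) l := rfl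

theorem lsum_congr {f g : List V → V → List V → W} {l : List V}
    (h : ∀ z b w, l = z ++ b :: w → f z b w = g z b w) : lsum f l = lsum g l := by
  induction l generalizing f g with
  | nil => rfl
  | cons a l ih =>
    rw [lsum_cons, lsum_cons, h [] a l rfl, ih]
    intro z b w hl
    exact h _ _ _ (by rw [hl]; rfl)

theorem lsum_add (f g : List V → V → List V → W) (l : List V) :
    lsum (fun z b w => f z b w + g z b w) l = lsum f l + lsum g l := by
  induction l generalizing f g with
  | nil => simp
  | cons a l ih => rw [lsum_cons, lsum_cons, lsum_cons, ih]; abel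

theorem lsum_zero (l : List V) : lsum (fun _ _ _ => (0 : W)) l = 0 := by
  induction l with
  | nil => rfl
  | cons a l ih => rw [lsum_cons, ih, add_zero]

theorem lsum_map (φ : W →+ W') (f : List V → V → List V → W) (l : List V) :
    φ (lsum f l) = lsum (fun z b w => φ (f z b w)) l := by
  induction l generalizing f with
  | nil => simp
  | cons a l ih => rw [lsum_cons, lsum_cons, map_add, ih]

theorem lsum_neg (f : List V → V → List V → W) (l : List V) :
    lsum (fun z b w => -f z b w) l = -lsum f l :=
  (lsum_map (-AddMonoidHom.id W) f l).symm

theorem lsum_sub (f g : List V → V → List V → W) (l : List V) :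
    lsum (fun z b w => f z b w - g z b w) l = lsum f l - lsum g l := by
  simp only [sub_eq_add_neg, lsum_add, lsum_neg]

theorem lsum_smul {K : Type*} [Semiring K] [Module K W] (c : K) (f : List V → V → List V → W)
    (l : List V) : lsum (fun z b w => c • f z b w) l = c • lsum f l :=
  (lsum_map (DistribSMul.toAddMonoidHom W c) f l).symm

theorem lsum_finset_sum {I : Type*} (s : Finset I) (f : I → List V → V → List V → W)
    (l : List V) : lsum (fun z b w => ∑ k ∈ s, f k z b w) l = ∑ k ∈ s, lsum (f k) l := by
  classical
  induction s using Finset.induction_on with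
  | empty => simp [lsum_zero]
  | insert k s hk ih => simp only [Finset.sum_insert hk, lsum_add, ih]

theorem lsum_append (f : List V → V → List V → W) (l l' : List V) :
    lsum f (l ++ l') = lsum (fun z b w => f z b (w ++ l')) l + lsum (fun z b w => f (l ++ z) b w) l' := by
  induction l generalizing f with
  | nil => simp
  | cons a l ih =>
    rw [List.cons_append, lsum_cons, lsum_cons, ih, add_assoc]
    rfl

/-- Both sides run over the decompositions z b w' c w'' with two marked letters. It is used whenever
two letters of a word are singled out in succession. -/
theorem lsum_assoc (f : List V → V → List V → V → List V → W) (l : List V) :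
    lsum (fun z b w => lsum (fun w' c w'' => f z b w' c w'') w) l =
      lsum (fun z' c w'' => lsum (fun z b w' => f z b w' c w'') z') l := by
  induction l generalizing f with
  | nil => rfl
  | cons a l ih =>
    rw [lsum_cons, lsum_cons, ih]
    simp only [lsum_cons, lsum_nil, zero_add, lsum_add]

theorem lsum_mem {K : Type*} [Semiring K] [Module K W] (p : Submodule K W)
    {f : List V → V → List V → W} {l : List V} (h : ∀ z b w, f z b w ∈ p) : lsum f l ∈ p := by
  induction l generalizing f with
  | nil => exact p.zero_mem
  | cons a l ih => exact p.add_mem (h _ _ _) (ih fun z b w => h _ _ _)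

theorem lsum_eq_sum (f : List V → V → List V → W) (l : List V) :
    lsum f l = ∑ k : Fin l.length, f (l.take k) l[k] (l.drop (k + 1)) := by
  induction l generalizing f with
  | nil => simp
  | cons a l ih =>
    rw [lsum_cons, ih]
    simp only [List.length_cons]
    rw [Fin.sum_univ_succ]
    simp

theorem mul_lsum {𝔄 : Type*} [Ring 𝔄] (c : 𝔄) (f : List V → V → List V → 𝔄) (l : List V) :
    c * lsum f l = lsum (fun z b w => c * f z b w) l :=
  lsum_map (AddMonoidHom.mulLeft c) f l

theorem lsum_mul {𝔄 : Type*} [Ring 𝔄] (c : 𝔄) (f : List V → V → List V → 𝔄) (l : List V) :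
    lsum f l * c = lsum (fun z b w => f z b w * c) l :=
  lsum_map (AddMonoidHom.mulRight c) f l

theorem map_lsum {K : Type*} [Ring K] [Module K W] [Module K W'] (φ : W →ₗ[K] W')
    (f : List V → V → List V → W) (l : List V) :
    φ (lsum f l) = lsum (fun z b w => φ (f z b w)) l :=
  lsum_map φ.toAddMonoidHom f l

theorem map_lsum₂ {K X : Type*} [CommRing K] [AddCommGroup X] [Module K X] [Module K W]
    [Module K W'] (φ : W →ₗ[K] X →ₗ[K] W') (f : List V → V → List V → W) (l : List V) (x : X) :
    φ (lsum f l) x = lsum (fun z b w => φ (f z b w) x) l :=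
  map_lsum (φ.flip x) f l

end lsum

/-- The word `a₁ ⊗ ⋯ ⊗ aₖ` in the unital tensor algebra. -/
def word (l : List V) : TensorAlgebra ℂ V := (l.map (TensorAlgebra.ι ℂ)).prod

@[simp] theorem word_nil : word ([] : List V) = 1 := rfl

@[simp] theorem word_cons (a : V) (l : List V) : word (a :: l) = TensorAlgebra.ι ℂ a * word l := by
  simp [word]

@[simp] theorem word_append (l l' : List V) : word (l ++ l') = word l * word l' := by
  simp [word]

theorem span_word : Submodule.span ℂ (Set.range (word : List V → TensorAlgebra ℂ V)) = ⊤ := by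
  refine Submodule.eq_top_iff'.2 fun x => ?_
  have hmul : ∀ x y : TensorAlgebra ℂ V, x ∈ Submodule.span ℂ (Set.range (word : List V → _)) →
      y ∈ Submodule.span ℂ (Set.range (word : List V → _)) →
      x * y ∈ Submodule.span ℂ (Set.range (word : List V → _)) := by
    intro x y hx hy
    have := Submodule.mul_mem_mul hx hy
    rw [Submodule.span_mul_span] at this
    refine Submodule.span_mono ?_ this
    rintro _ ⟨_, ⟨l, rfl⟩, _, ⟨l', rfl⟩, rfl⟩
    exact ⟨l ++ l', by simp⟩
  induction x using TensorAlgebra.induction with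
  | algebraMap c =>
    rw [Algebra.algebraMap_eq_smul_one]
    exact Submodule.smul_mem _ _ (Submodule.subset_span ⟨[], rfl⟩)
  | ι a => exact Submodule.subset_span ⟨[a], by simp⟩
  | mul x y hx hy => exact hmul x y hx hy
  | add x y hx hy => exact add_mem hx hy

theorem word_hom_ext {f g : TensorAlgebra ℂ V →ₗ[ℂ] W} (h : ∀ l, f (word l) = g (word l)) :
    f = g :=
  LinearMap.ext_on_range span_word h

theorem word_induction {C : TensorAlgebra ℂ V → Prop} (hw : ∀ l, C (word l))
    (hadd : ∀ x y, C x → C y → C (x + y)) (hsmul : ∀ (c : ℂ) x, C x → C (c • x)) (x) : C x := by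
  have hx : x ∈ Submodule.span ℂ (Set.range (word : List V → TensorAlgebra ℂ V)) := by
    rw [span_word]; trivial
  induction hx using Submodule.span_induction with
  | mem x h => obtain ⟨l, rfl⟩ := h; exact hw l
  | zero => simpa using hsmul 0 _ (hw [])
  | add x y _ _ hx hy => exact hadd x y hx hy
  | smul c x _ hx => exact hsmul c x hx

/-- A trilinear map given by a function which is linear in each variable. -/
def trilin {X Y Z : Type*} [AddCommGroup X] [Module ℂ X] [AddCommGroup Y] [Module ℂ Y]
    [AddCommGroup Z] [Module ℂ Z] (f : X → Y → Z → W)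
    (h₁ : ∀ x x' y z, f (x + x') y z = f x y z + f x' y z)
    (h₂ : ∀ (c : ℂ) x y z, f (c • x) y z = c • f x y z)
    (h₃ : ∀ x y y' z, f x (y + y') z = f x y z + f x y' z)
    (h₄ : ∀ (c : ℂ) x y z, f x (c • y) z = c • f x y z)
    (h₅ : ∀ x y z z', f x y (z + z') = f x y z + f x y z')
    (h₆ : ∀ (c : ℂ) x y z, f x y (c • z) = c • f x y z) : X →ₗ[ℂ] Y →ₗ[ℂ] Z →ₗ[ℂ] W where
  toFun x := LinearMap.mk₂ ℂ (f x) (h₃ x) (fun c y z => h₄ c x y z) (h₅ x) (fun c y z => h₆ c x y z)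
  map_add' x x' := by ext; exact h₁ _ _ _ _
  map_smul' c x := by ext; exact h₂ _ _ _ _

@[simp] theorem trilin_apply {X Y Z : Type*} [AddCommGroup X] [Module ℂ X] [AddCommGroup Y]
    [Module ℂ Y] [AddCommGroup Z] [Module ℂ Z] (f : X → Y → Z → W) (h₁ h₂ h₃ h₄ h₅ h₆)
    (x : X) (y : Y) (z : Z) : trilin f h₁ h₂ h₃ h₄ h₅ h₆ x y z = f x y z := rfl

variable (V) in
/-- The target `TV⁺ ⊗ V ⊗ TV⁺` of the universal derivation of the tensor algebra. -/
abbrev Splitting := TensorAlgebra ℂ V ⊗[ℂ] (V ⊗[ℂ] TensorAlgebra ℂ V)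

/-- The operators `(x, ω) ↦ (a x, a ω + 1 ⊗ a ⊗ x)`. -/
def splitStep : V →ₗ[ℂ] Module.End ℂ (TensorAlgebra ℂ V × Splitting V) :=
  LinearMap.mk₂ ℂ (fun a v => (TensorAlgebra.ι ℂ a * v.1,
      LinearMap.rTensor _ (LinearMap.mulLeft ℂ (TensorAlgebra.ι ℂ a)) v.2 + 1 ⊗ₜ (a ⊗ₜ v.1)))
    (fun a b v => by
      ext
      · simp [add_mul]
      · have : LinearMap.mulLeft ℂ (TensorAlgebra.ι ℂ a + TensorAlgebra.ι ℂ b) =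
          LinearMap.mulLeft ℂ (TensorAlgebra.ι ℂ a) + LinearMap.mulLeft ℂ (TensorAlgebra.ι ℂ b) := by
          ext; simp [add_mul]
        simp only [map_add, this, LinearMap.rTensor_add, LinearMap.add_apply, Prod.snd_add,
          TensorProduct.add_tmul, TensorProduct.tmul_add]
        abel)
    (fun c a v => by
      ext
      · simp
      · have : LinearMap.mulLeft ℂ (c • TensorAlgebra.ι ℂ a) =
          c • LinearMap.mulLeft ℂ (TensorAlgebra.ι ℂ a) := by
          ext; simp
        simp only [map_smul, this, LinearMap.rTensor_smul, LinearMap.smul_apply, Prod.smul_snd,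
          ← TensorProduct.smul_tmul', TensorProduct.tmul_smul, smul_add])
    (fun a v w => by
      ext
      · simp [mul_add]
      · simp only [map_add, Prod.snd_add, Prod.fst_add, TensorProduct.tmul_add]
        abel)
    (fun c a v => by
      ext
      · simp
      · simp)

/-- The universal derivation of the tensor algebra, `∑ z ⊗ b ⊗ w` over the decompositions
of a word into a word `z`, a letter `b` and a word `w`. -/
def split : TensorAlgebra ℂ V →ₗ[ℂ] Splitting V :=
  LinearMap.snd ℂ _ _ ∘ₗ LinearMap.applyₗ ((1 : TensorAlgebra ℂ V), (0 : Splitting V)) ∘ₗ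
    (TensorAlgebra.lift ℂ (splitStep (V := V))).toLinearMap

/-- The linear map sending a word to the sum of `E z b w` over its decompositions `z b w`. -/
def splitSum (E : TensorAlgebra ℂ V →ₗ[ℂ] V →ₗ[ℂ] TensorAlgebra ℂ V →ₗ[ℂ] W) :
    TensorAlgebra ℂ V →ₗ[ℂ] W :=
  TensorProduct.lift (TensorProduct.uncurry (.id ℂ) V (TensorAlgebra ℂ V) W ∘ₗ E) ∘ₗ split

theorem splitSum_word (E : TensorAlgebra ℂ V →ₗ[ℂ] V →ₗ[ℂ] TensorAlgebra ℂ V →ₗ[ℂ] W)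
    (l : List V) : splitSum E (word l) = lsum (fun z b w => E (word z) b (word w)) l := by
  have key : ∀ l : List V, (TensorAlgebra.lift ℂ (splitStep (V := V)) (word l)
      ((1 : TensorAlgebra ℂ V), (0 : Splitting V))) =
      (word l, lsum (fun z b w => word z ⊗ₜ (b ⊗ₜ word w)) l) := by
    intro l
    induction l with
    | nil => simp
    | cons a l ih =>
      rw [word_cons, map_mul, Module.End.mul_apply, ih, TensorAlgebra.lift_ι_apply, lsum_cons]
      ext
      · rfl
      · change LinearMap.rTensor _ (LinearMap.mulLeft ℂ (TensorAlgebra.ι ℂ a)) _ + _ = _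
        rw [add_comm]
        congr 1
        rw [← LinearMap.toAddMonoidHom_coe, lsum_map]
        refine lsum_congr fun z b w _ => ?_
        simp
  have : split (word l) = lsum (fun z b w => word z ⊗ₜ (b ⊗ₜ word w)) l :=
    congrArg Prod.snd (key l)
  rw [splitSum, LinearMap.comp_apply, this, ← LinearMap.toAddMonoidHom_coe, lsum_map]
  refine lsum_congr fun z b w _ => ?_
  simp

end Words

/-! ### The `X`-complex -/

section XBasic

set_option linter.unusedSectionVars false

variable {R : Type*} [NonUnitalRing R] [Module ℂ R] [IsScalarTower ℂ R R] [SMulCommClass ℂ R R]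
variable {S : Type*} [NonUnitalRing S] [Module ℂ S] [IsScalarTower ℂ S S] [SMulCommClass ℂ S S]
variable {S' : Type*} [NonUnitalRing S'] [Module ℂ S'] [IsScalarTower ℂ S' S']
  [SMulCommClass ℂ S' S']
variable {V : Type*} [AddCommGroup V] [Module ℂ V]

theorem natD_apply (x y : U R) : natD x y = (commutators R).mkQ (dOne x y) := rfl

theorem natD_snd (x y : U R) : natD x y = natD x (y.snd : U R) := by
  rw [natD_apply, natD_apply, dOne_apply, dOne_apply, form_apply, form_apply]
  refine congrArg _ (congrArg₂ (fun a b => a ⊗ₜ[ℂ] PiTensorProduct.tprod ℂ b) rfl ?_)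
  funext j
  fin_cases j
  rfl

theorem natD_one_right (x : U R) : natD x 1 = 0 := by
  rw [natD_snd]; simp

theorem U_cases (x : U R) : x = x.fst • (1 : U R) + (x.snd : U R) := by
  rw [← Algebra.algebraMap_eq_smul_one]
  exact (Unitization.inl_fst_add_inr_snd_eq x).symm

theorem natD_mul_coe (x : U R) (y z : R) :
    natD x ((y : U R) * z) = natD (x * (y : U R)) (z : U R) + natD ((z : U R) * x) (y : U R) := by
  have : dOne ((z : U R) * x) (y : U R) - dOne x ((y * z : R) : U R)
      + dOne (x * (y : U R)) (z : U R) ∈ commutators R := Submodule.subset_span ⟨z, x, y, rfl⟩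
  rw [← Submodule.ker_mkQ (commutators R), LinearMap.mem_ker, map_add, map_sub,
    ← natD_apply, ← natD_apply, ← natD_apply] at this
  rw [← Unitization.inr_mul, eq_comm, ← sub_eq_zero, ← this]
  abel

/-- For elements of R this is the relation [R, Ω¹R] = 0; scalars contribute nothing because ♮x d1 =
0. This cyclic Leibniz rule is what the field `tr₁_mul` of `XTrace` abstracts. -/
theorem natD_mul (x y z : U R) : natD x (y * z) = natD (x * y) z + natD (z * x) y := by
  rw [U_cases y, U_cases z]
  simp only [add_mul, mul_add, smul_mul_assoc, mul_smul_comm, one_mul, mul_one, map_add, map_smul,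
    LinearMap.add_apply, LinearMap.smul_apply, natD_mul_coe, natD_one_right]
  module

theorem bBar_natD (x y : U R) : bBar (natD x y) = (x * y - y * x).snd := by
  rw [natD_snd]
  have : bBar (natD x (y.snd : U R)) = bOne (dOne x (y.snd : U R)) := rfl
  rw [this, bOne_dOne]
  conv_rhs => rw [U_cases y]
  simp only [add_mul, mul_add, smul_mul_assoc, mul_smul_comm, one_mul, mul_one]
  congr 1
  abel_nf

theorem omNat_ext {f g : OmNat R →ₗ[ℂ] V} (h : ∀ (x : U R) (y : R), f (natD x y) = g (natD x y)) :
    f = g := by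
  refine Submodule.linearMap_qext _ (TensorProduct.ext' fun x w => ?_)
  induction w using PiTensorProduct.induction_on with
  | smul_tprod c v =>
    have := h x (v 0)
    rw [natD_apply, dOne_apply, form_apply] at this
    have hv : (fun j : Fin 1 => (Matrix.vecCons x ![(v 0 : U R)] j.succ).snd) = v := by
      funext j
      fin_cases j
      rfl
    rw [hv] at this
    simpa [TensorProduct.tmul_smul] using congrArg (c • ·) this
  | add a b ha hb => rw [TensorProduct.tmul_add, map_add, map_add, ha, hb]

theorem bdry_apply (x : R) (w : OmNat R) : bdry (x, w) = (bBar w, natD 1 (x : U R)) := rfl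

theorem bdry_bdry (x : X R) : bdry (bdry x) = 0 := by
  obtain ⟨x, w⟩ := x
  rw [bdry_apply, bdry_apply, bBar_natD]
  have : natD 1 ∘ₗ Unitization.inrHom (S := ℂ) (R := ℂ) (A := R) ∘ₗ bBar = 0 := by
    refine omNat_ext fun x y => ?_
    change natD 1 ((bBar (natD x y) : R) : U R) = 0
    rw [bBar_natD, ← natD_snd, map_sub, natD_mul, natD_mul, one_mul, one_mul, mul_one, mul_one,
      add_comm, sub_self]
  have h2 := LinearMap.congr_fun this w
  ext
  · simp
  · exact h2

/-- The unital extension of a homomorphism. -/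
def uMap (f : R →ₙₐ[ℂ] S) : U R →ₐ[ℂ] U S :=
  Unitization.lift ((Unitization.inrNonUnitalAlgHom ℂ S).comp f)

@[simp] theorem uMap_coe (f : R →ₙₐ[ℂ] S) (x : R) : uMap f (x : U R) = (f x : U S) := by
  simp [uMap]

theorem uMap_snd (f : R →ₙₐ[ℂ] S) (x : U R) : (uMap f x).snd = f x.snd := by
  conv_lhs => rw [U_cases x]
  simp

theorem map_natD (f : R →ₙₐ[ℂ] S) (x y : U R) :
    (X.map f (0, natD x y)).2 = natD (uMap f x) (uMap f y) := by
  rw [natD_snd _ (uMap f y), uMap_snd]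
  change (commutators S).mkQ (mapForm f 1 (dOne x y)) = _
  rw [mapForm_dOne]
  rfl

/-- The odd component of the chain map induced by a homomorphism. -/
def omMap (f : R →ₙₐ[ℂ] S) : OmNat R →ₗ[ℂ] OmNat S :=
  LinearMap.snd ℂ _ _ ∘ₗ X.map f ∘ₗ LinearMap.inr ℂ _ _

theorem X_map_apply (f : R →ₙₐ[ℂ] S) (x : R) (w : OmNat R) :
    X.map f (x, w) = (f x, omMap f w) := rfl

@[simp] theorem omMap_natD (f : R →ₙₐ[ℂ] S) (x y : U R) :
    omMap f (natD x y) = natD (uMap f x) (uMap f y) := map_natD f x y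

theorem bBar_omMap (f : R →ₙₐ[ℂ] S) (w : OmNat R) : bBar (omMap f w) = f (bBar w) := by
  have : bBar ∘ₗ omMap f = (f : R →ₗ[ℂ] S) ∘ₗ bBar := by
    refine omNat_ext fun x y => ?_
    change bBar (omMap f (natD x y)) = f (bBar (natD x y))
    rw [omMap_natD, bBar_natD, bBar_natD, ← uMap_snd]
    simp
  exact LinearMap.congr_fun this w

theorem map_bdry (f : R →ₙₐ[ℂ] S) (x : X R) : bdry (X.map f x) = X.map f (bdry x) := by
  obtain ⟨x, w⟩ := x
  rw [X_map_apply, bdry_apply, bdry_apply, X_map_apply, bBar_omMap, omMap_natD]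
  simp

theorem uMap_comp (g : S →ₙₐ[ℂ] S') (f : R →ₙₐ[ℂ] S) (x : U R) :
    uMap (g.comp f) x = uMap g (uMap f x) := by
  conv_lhs => rw [U_cases x]
  conv_rhs => rw [U_cases x]
  simp

theorem map_comp (g : S →ₙₐ[ℂ] S') (f : R →ₙₐ[ℂ] S) (x : X R) :
    X.map (g.comp f) x = X.map g (X.map f x) := by
  obtain ⟨x, w⟩ := x
  rw [X_map_apply, X_map_apply, X_map_apply]
  have : omMap (g.comp f) = omMap g ∘ₗ omMap f := by
    refine omNat_ext fun x y => ?_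
    simp [uMap_comp]
  rw [this]
  rfl

theorem map_id (x : X R) : X.map (NonUnitalAlgHom.id ℂ R) x = x := by
  obtain ⟨x, w⟩ := x
  rw [X_map_apply]
  have h1 : ∀ x : U R, uMap (NonUnitalAlgHom.id ℂ R) x = x := fun x => by
    conv_lhs => rw [U_cases x]
    conv_rhs => rw [U_cases x]
    simp
  have : omMap (NonUnitalAlgHom.id ℂ R) = LinearMap.id := by
    refine omNat_ext fun x y => ?_
    simp [h1]
  rw [this]
  rfl

end XBasic

/-! ### The `X`-complex of the tensor algebra -/

section XTensor

set_option linter.unusedSectionVars false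

variable {A : Type*} [NonUnitalRing A] [Module ℂ A]
variable {M : Type*} [NonUnitalRing M] [Module ℂ M] [IsScalarTower ℂ M M] [SMulCommClass ℂ M M]
variable {V : Type*} [AddCommGroup V] [Module ℂ V]

variable (A) in
/-- The isomorphism from the unitalization of `TA` to the unital tensor algebra. -/
def toW : U (T A) →ₐ[ℂ] TensorAlgebra ℂ A := Unitization.lift (T.incl A)

variable (A) in
/-- The isomorphism from the unital tensor algebra to the unitalization of `TA`. -/
def ofW : TensorAlgebra ℂ A →ₐ[ℂ] U (T A) := T.liftU (T.ι A)

@[simp] theorem toW_coe (x : T A) : toW A (x : U (T A)) = T.incl A x := by simp [toW]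

@[simp] theorem ofW_incl (x : T A) : ofW A (T.incl A x) = (x : U (T A)) := T.liftU_ι_coe x

@[simp] theorem ofW_ι (a : A) : ofW A (TensorAlgebra.ι ℂ a) = (T.ι A a : U (T A)) := by
  simp [ofW, T.liftU]

@[simp] theorem ofW_toW (x : U (T A)) : ofW A (toW A x) = x := by
  conv_lhs => rw [U_cases x]
  conv_rhs => rw [U_cases x]
  simp

@[simp] theorem toW_ofW (x : TensorAlgebra ℂ A) : toW A (ofW A x) = x := by
  have : (toW A).comp (ofW A) = AlgHom.id ℂ _ := by
    ext a
    simp [T.incl_ι]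
  exact DFunLike.congr_fun this x

/-- The product in `TA` of a list of letters. -/
def tword (l : List A) : T A := (ofW A (word l)).snd

@[simp] theorem tword_nil : tword ([] : List A) = 0 := by simp [tword]

theorem fst_ofW_word_cons (a : A) (l : List A) : (ofW A (word (a :: l))).fst = 0 := by
  simp

@[simp] theorem coe_tword_cons (a : A) (l : List A) :
    ((tword (a :: l) : T A) : U (T A)) = ofW A (word (a :: l)) := by
  conv_rhs => rw [U_cases (ofW A (word (a :: l))), fst_ofW_word_cons]
  simp [tword]

@[simp] theorem incl_tword_cons (a : A) (l : List A) :
    T.incl A (tword (a :: l)) = word (a :: l) := by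
  rw [← toW_coe, coe_tword_cons, toW_ofW]

theorem tword_singleton (a : A) : tword [a] = T.ι A a := by
  simp [tword]

theorem T_hom_ext {f g : T A →ₗ[ℂ] V} (h : ∀ a l, f (tword (a :: l)) = g (tword (a :: l))) :
    f = g := by
  have : f ∘ₗ Unitization.sndHom (S := ℂ) (R := ℂ) (A := T A) ∘ₗ (ofW A).toLinearMap =
      g ∘ₗ Unitization.sndHom (S := ℂ) (R := ℂ) (A := T A) ∘ₗ (ofW A).toLinearMap := by
    refine word_hom_ext fun l => ?_
    cases l with
    | nil => simp
    | cons a l => exact h a l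
  ext x
  have := LinearMap.congr_fun this (T.incl A x)
  simpa using this

/-- The bilinear map `(x, y) ↦ ∑ E (w x z) b`, the sum being over the decompositions `z b w`
of the word `y`. -/
def rotSum (E : TensorAlgebra ℂ A →ₗ[ℂ] A →ₗ[ℂ] V) :
    TensorAlgebra ℂ A →ₗ[ℂ] TensorAlgebra ℂ A →ₗ[ℂ] V :=
  LinearMap.mk₂ ℂ (fun x y => splitSum (trilin (fun z b w => E (w * x * z) b)
      (by intros; simp [mul_add]) (by intros; simp) (by intros; simp)
      (by intros; simp) (by intros; simp [add_mul]) (by intros; simp)) y)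
    (fun x x' y => by
      induction y using word_induction with
      | hw l => simp only [splitSum_word, ← lsum_add]; simp [mul_add, add_mul]
      | hadd x y hx hy => simp only [map_add, hx, hy]; abel
      | hsmul c x hx => simp only [map_smul, hx, smul_add])
    (fun c x y => by
      induction y using word_induction with
      | hw l => simp only [splitSum_word, ← lsum_smul]; simp
      | hadd x y hx hy => simp only [map_add, hx, hy, smul_add]
      | hsmul c x hx => simp only [map_smul, hx, smul_comm c])
    (fun x y y' => by simp)
    (fun c x y => by simp)

theorem rotSum_word (E : TensorAlgebra ℂ A →ₗ[ℂ] A →ₗ[ℂ] V) (x : TensorAlgebra ℂ A)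
    (l : List A) :
    rotSum E x (word l) = lsum (fun z b w => E (word w * x * word z) b) l := by
  rw [rotSum, LinearMap.mk₂_apply, splitSum_word]
  rfl

theorem rotSum_one (E : TensorAlgebra ℂ A →ₗ[ℂ] A →ₗ[ℂ] V) (x : TensorAlgebra ℂ A) :
    rotSum E x 1 = 0 := by
  rw [← word_nil, rotSum_word, lsum_nil]

theorem rotSum_ι (E : TensorAlgebra ℂ A →ₗ[ℂ] A →ₗ[ℂ] V) (x : TensorAlgebra ℂ A) (a : A) :
    rotSum E x (TensorAlgebra.ι ℂ a) = E x a := by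
  have := rotSum_word E x [a]
  simpa [lsum_cons] using this

/-- A marked letter of a concatenation lies in one of the two factors. This being the cyclic Leibniz
rule, `rotSum` descends to the commutator quotient. -/
theorem rotSum_mul (E : TensorAlgebra ℂ A →ₗ[ℂ] A →ₗ[ℂ] V) (x y z : TensorAlgebra ℂ A) :
    rotSum E x (y * z) = rotSum E (x * y) z + rotSum E (z * x) y := by
  induction y using word_induction with
  | hw l =>
    induction z using word_induction with
    | hw l' =>
      rw [← word_append, rotSum_word, rotSum_word, rotSum_word, lsum_append, add_comm]
      simp [mul_assoc]
    | hadd x y hx hy => simp only [map_add, hx, hy, mul_add, add_mul, LinearMap.add_apply]; abel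
    | hsmul c x hx => simp [hx]
  | hadd x y hx hy => simp only [map_add, hx, hy, mul_add, add_mul, LinearMap.add_apply]; abel
  | hsmul c x hx => simp [hx]

/-- The linear map on `Ω¹(TA)_♮` sending `♮ x da` to `E x a`, for a letter `a`. -/
def omLift (E : TensorAlgebra ℂ A →ₗ[ℂ] A →ₗ[ℂ] V) : OmNat (T A) →ₗ[ℂ] V :=
  (commutators (T A)).liftQ
    (liftForm (MultilinearMap.mk' (fun x => rotSum E (toW A (x 0)) (toW A (x 1)))
      (fun m i x y => by fin_cases i <;> simp)
      (fun m i c x => by fin_cases i <;> simp))) (by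
    refine Submodule.span_le.2 ?_
    rintro _ ⟨a, x, y, rfl⟩
    rw [SetLike.mem_coe, LinearMap.mem_ker, map_add, map_sub]
    simp only [dOne_apply, form_apply, liftForm_tmul]
    simp [rotSum_mul])

theorem omLift_natD (E : TensorAlgebra ℂ A →ₗ[ℂ] A →ₗ[ℂ] V) (x y : U (T A)) :
    omLift E (natD x y) = rotSum E (toW A x) (toW A y) := by
  have : omLift E (natD x y) = rotSum E (toW A x) (toW A (y.snd : U (T A))) := by
    change (liftForm _) (dOne x y) = _
    rw [dOne_apply, form_apply, liftForm_tmul]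
    simp
  rw [this]
  conv_rhs => rw [U_cases y]
  simp [rotSum_one]

@[simp] theorem omLift_letter (E : TensorAlgebra ℂ A →ₗ[ℂ] A →ₗ[ℂ] V) (x : U (T A)) (a : A) :
    omLift E (natD x (T.ι A a : U (T A))) = E (toW A x) a := by
  rw [omLift_natD, toW_coe, T.incl_ι, rotSum_ι]

theorem omLift_d_word (E : TensorAlgebra ℂ A →ₗ[ℂ] A →ₗ[ℂ] V) (l : List A) :
    omLift E (natD 1 (ofW A (word l))) = lsum (fun z b w => E (word w * word z) b) l := by
  rw [omLift_natD, toW_ofW, rotSum_word]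
  simp

/-- The bilinear map `(x, a) ↦ ♮ x da`. -/
def natW : TensorAlgebra ℂ A →ₗ[ℂ] A →ₗ[ℂ] OmNat (T A) :=
  natD.compl₁₂ (ofW A).toLinearMap (Unitization.inrHom (S := ℂ) (R := ℂ) (A := T A) ∘ₗ T.ι A)

theorem natW_apply (x : TensorAlgebra ℂ A) (a : A) :
    natW x a = natD (ofW A x) (T.ι A a : U (T A)) := rfl

/-- Iterating the Leibniz rule moves d onto single letters. Together with `omLift` this identifies
Ω¹(TA)_♮ with TA⁺ ⊗ A, so that maps out of it are given by their values on ♮x da. -/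
theorem natD_eq_rotSum (x y : U (T A)) : natD x y = rotSum natW (toW A x) (toW A y) := by
  suffices h : ∀ (l : List A) (x : TensorAlgebra ℂ A),
      natD (ofW A x) (ofW A (word l)) = rotSum natW x (word l) by
    obtain ⟨x, rfl⟩ : ∃ x', ofW A x' = x := ⟨_, ofW_toW x⟩
    obtain ⟨y, rfl⟩ : ∃ x', ofW A x' = y := ⟨_, ofW_toW y⟩
    rw [toW_ofW, toW_ofW]
    induction y using word_induction with
    | hw l => exact h l x
    | hadd x y hx hy => simp only [map_add, hx, hy]
    | hsmul c x hx => simp [hx]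
  intro l
  induction l with
  | nil => intro x; simp [natD_one_right, rotSum_one]
  | cons a l ih =>
    intro x
    rw [word_cons, map_mul, natD_mul, rotSum_mul, ← map_mul, ih, ← map_mul, rotSum_ι, natW_apply,
      ofW_ι]

theorem omNat_T_ext {f g : OmNat (T A) →ₗ[ℂ] V}
    (h : ∀ l a, f (natD (ofW A (word l)) (T.ι A a : U (T A))) =
      g (natD (ofW A (word l)) (T.ι A a : U (T A)))) : f = g := by
  have h1 : ∀ x a, f (natW x a) = g (natW x a) := by
    intro x a
    induction x using word_induction with
    | hw l => exact h l a
    | hadd x y hx hy => simp only [map_add, hx, hy, LinearMap.add_apply]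
    | hsmul c x hx => simp [hx]
  refine omNat_ext fun x y => ?_
  rw [natD_eq_rotSum]
  generalize toW A (y : U (T A)) = y
  induction y using word_induction with
  | hw l =>
    rw [rotSum_word, ← LinearMap.toAddMonoidHom_coe f, ← LinearMap.toAddMonoidHom_coe g, lsum_map,
      lsum_map]
    exact lsum_congr fun z b w _ => h1 _ _
  | hadd x y hx hy => simp only [map_add, hx, hy]
  | hsmul c x hx => simp [hx]

theorem X_T_ext {f g : X (T A) →ₗ[ℂ] V} (h₀ : ∀ a l, f (tword (a :: l), 0) = g (tword (a :: l), 0))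
    (h₁ : ∀ l a, f (0, natD (ofW A (word l)) (T.ι A a : U (T A))) =
      g (0, natD (ofW A (word l)) (T.ι A a : U (T A)))) : f = g := by
  refine LinearMap.prod_ext ?_ ?_
  · exact T_hom_ext h₀
  · exact omNat_T_ext h₁

end XTensor

/-! ### Ideals and filtrations -/

section Ideals

set_option linter.unusedSectionVars false

variable {R : Type*} [NonUnitalRing R] [Module ℂ R] [IsScalarTower ℂ R R] [SMulCommClass ℂ R R]
variable {S : Type*} [NonUnitalRing S] [Module ℂ S] [IsScalarTower ℂ S S] [SMulCommClass ℂ S S]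
variable {V : Type*} [AddCommGroup V] [Module ℂ V]

/-- Two-sided ideals of an algebra. -/
structure IsTwoSided (I : Submodule ℂ R) : Prop where
  left : ∀ x y, y ∈ I → x * y ∈ I
  right : ∀ x y, x ∈ I → x * y ∈ I

theorem isTwoSided_ker (f : R →ₙₐ[ℂ] S) : IsTwoSided (LinearMap.ker (f : R →ₗ[ℂ] S)) where
  left x y hy := by
    have : f y = 0 := hy
    change f (x * y) = 0
    rw [map_mul, this, mul_zero]
  right x y hx := by
    have : f x = 0 := hx
    change f (x * y) = 0
    rw [map_mul, this, zero_mul]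

variable {I : Submodule ℂ R} {J : Submodule ℂ S}

theorem powI_zero : powI I 0 = ⊤ := rfl

theorem powI_one : powI I 1 = I := rfl

theorem powI_succ_succ (n : ℕ) :
    powI I (n + 2) = Submodule.span ℂ {z | ∃ x ∈ powI I (n + 1), ∃ y ∈ I, z = x * y} := rfl

theorem powI_le {n : ℕ} {Z : Submodule ℂ R} (h : ∀ x ∈ powI I (n + 1), ∀ y ∈ I, x * y ∈ Z) :
    powI I (n + 2) ≤ Z := by
  rw [powI_succ_succ, Submodule.span_le]
  rintro _ ⟨x, hx, y, hy, rfl⟩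
  exact h x hx y hy

theorem powI_left (hI : IsTwoSided I) (n : ℕ) (x y : R) (hy : y ∈ powI I n) :
    x * y ∈ powI I n := by
  induction n using Nat.strong_induction_on generalizing x y with
  | _ n ih =>
  match n, ih with
  | 0, _ => trivial
  | 1, _ => exact hI.left x y hy
  | n + 2, ih =>
    rw [powI_succ_succ] at hy ⊢
    induction hy using Submodule.span_induction with
    | mem y hy =>
      obtain ⟨u, hu, v, hv, rfl⟩ := hy
      exact Submodule.subset_span ⟨x * u, ih (n + 1) (by omega) _ _ hu, v, hv, (mul_assoc _ _ _).symm⟩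
    | zero => simp
    | add y z _ _ hy hz => rw [mul_add]; exact add_mem hy hz
    | smul c y _ hy => rw [mul_smul_comm]; exact Submodule.smul_mem _ c hy

theorem powI_right (hI : IsTwoSided I) (n : ℕ) (x y : R) (hx : x ∈ powI I n) :
    x * y ∈ powI I n := by
  match n with
  | 0 => trivial
  | 1 => exact hI.right x y hx
  | n + 2 =>
    rw [powI_succ_succ] at hx ⊢
    induction hx using Submodule.span_induction with
    | mem x hx =>
      obtain ⟨u, hu, v, hv, rfl⟩ := hx
      exact Submodule.subset_span ⟨u, hu, v * y, hI.right _ _ hv, mul_assoc _ _ _⟩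
    | zero => simp
    | add x z _ _ hx hz => rw [add_mul]; exact add_mem hx hz
    | smul c x _ hx => rw [smul_mul_assoc]; exact Submodule.smul_mem _ c hx

theorem powI_mul (hI : IsTwoSided I) (m n : ℕ) {x y : R} (hx : x ∈ powI I m) (hy : y ∈ powI I n) :
    x * y ∈ powI I (m + n) := by
  have key : ∀ m {x y : R}, x ∈ powI I m → y ∈ I → x * y ∈ powI I (m + 1) := by
    intro m x y hx hy
    cases m with
    | zero => exact hI.left x y hy
    | succ m => exact Submodule.subset_span ⟨x, hx, y, hy, rfl⟩
  induction n using Nat.strong_induction_on generalizing x y with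
  | _ n ih =>
  match n, ih with
  | 0, _ => exact powI_right hI m x y hx
  | 1, _ => exact key m hx hy
  | n + 2, ih =>
    rw [powI_succ_succ] at hy
    induction hy using Submodule.span_induction with
    | mem y hy =>
      obtain ⟨u, hu, v, hv, rfl⟩ := hy
      rw [← mul_assoc]
      exact key _ (ih (n + 1) (by omega) hx hu) hv
    | zero => simp
    | add y z _ _ hy hz => rw [mul_add]; exact add_mem hy hz
    | smul c y _ hy => rw [mul_smul_comm]; exact Submodule.smul_mem _ c hy

theorem powI_succ_le (hI : IsTwoSided I) (n : ℕ) : powI I (n + 1) ≤ powI I n := by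
  match n with
  | 0 => exact le_top
  | n + 1 =>
    rw [powI_succ_succ, Submodule.span_le]
    rintro _ ⟨x, hx, y, _, rfl⟩
    exact powI_right hI _ x y hx

theorem powI_anti (hI : IsTwoSided I) : Antitone (powI I) := antitone_nat_of_succ_le (powI_succ_le hI)

theorem powPlus_zero : powPlus I 0 = ⊤ := rfl

theorem mem_powPlus {n : ℕ} {x : R} : (x : U R) ∈ powPlus I n ↔ x ∈ powI I n := by
  cases n with
  | zero => simp [powPlus_zero, powI_zero]
  | succ n =>
    rw [powPlus, if_neg (Nat.succ_ne_zero n)]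
    constructor
    · rintro ⟨y, hy, h⟩
      have : y = x := Unitization.inr_injective h
      exact this ▸ hy
    · exact fun h => ⟨x, h, rfl⟩

theorem powPlus_snd {n : ℕ} {x : U R} (hx : x ∈ powPlus I n) : x.snd ∈ powI I n := by
  cases n with
  | zero => trivial
  | succ n =>
    rw [powPlus, if_neg (Nat.succ_ne_zero n)] at hx
    obtain ⟨y, hy, rfl⟩ := hx
    exact hy

/-- A decreasing multiplicative filtration of a unital algebra. -/
structure Filtered (𝔄 : Type*) [Ring 𝔄] [Algebra ℂ 𝔄] where
  /-- The subspaces of the filtration. -/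
  seq : ℕ → Submodule ℂ 𝔄
  zero : seq 0 = ⊤
  anti : Antitone seq
  mul : ∀ m n {x y : 𝔄}, x ∈ seq m → y ∈ seq n → x * y ∈ seq (m + n)

/-- The filtration of the unitalization by the powers of an ideal. -/
def powFiltered (hI : IsTwoSided I) : Filtered (U R) where
  seq := powPlus I
  zero := rfl
  anti := by
    refine antitone_nat_of_succ_le fun n => ?_
    cases n with
    | zero => exact le_top
    | succ n =>
      rw [powPlus, powPlus, if_neg (Nat.succ_ne_zero _), if_neg (Nat.succ_ne_zero _)]
      exact Submodule.map_mono (powI_succ_le hI _)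
  mul m n x y hx hy := by
    match m, n with
    | 0, 0 => trivial
    | 0, n + 1 =>
      rw [powPlus, if_neg (Nat.succ_ne_zero n)] at hy
      obtain ⟨y, hy, rfl⟩ := hy
      change x * (y : U R) ∈ _
      rw [U_cases x, add_mul, smul_mul_assoc, one_mul, ← Unitization.inr_mul, zero_add]
      exact add_mem (Submodule.smul_mem _ _ (mem_powPlus.2 hy)) (mem_powPlus.2 (powI_left hI _ _ _ hy))
    | m + 1, 0 =>
      rw [powPlus, if_neg (Nat.succ_ne_zero m)] at hx
      obtain ⟨x, hx, rfl⟩ := hx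
      change (x : U R) * y ∈ _
      rw [U_cases y, mul_add, mul_smul_comm, mul_one, ← Unitization.inr_mul, add_zero]
      exact add_mem (Submodule.smul_mem _ _ (mem_powPlus.2 hx)) (mem_powPlus.2 (powI_right hI _ _ _ hx))
    | m + 1, n + 1 =>
      rw [powPlus, if_neg (Nat.succ_ne_zero n)] at hy
      rw [powPlus, if_neg (Nat.succ_ne_zero m)] at hx
      obtain ⟨x, hx, rfl⟩ := hx
      obtain ⟨y, hy, rfl⟩ := hy
      change (x : U R) * (y : U R) ∈ _
      rw [← Unitization.inr_mul]
      exact mem_powPlus.2 (powI_mul hI _ _ hx hy)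

theorem mem_natSpan {K : Submodule ℂ (U R)} {L : Submodule ℂ R} {x : U R} {y : R} (hx : x ∈ K)
    (hy : y ∈ L) : natD x (y : U R) ∈ natSpan K L := Submodule.subset_span ⟨x, hx, y, hy, rfl⟩

theorem mem_natSpan_top {K : Submodule ℂ (U R)} {x : U R} (hx : x ∈ K) (y : U R) :
    natD x y ∈ natSpan K ⊤ := by
  rw [natD_snd]
  exact mem_natSpan hx trivial

theorem natSpan_le {K : Submodule ℂ (U R)} {L : Submodule ℂ R} {Z : Submodule ℂ (OmNat R)}
    (h : ∀ x ∈ K, ∀ y ∈ L, natD x (y : U R) ∈ Z) : natSpan K L ≤ Z := by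
  rw [natSpan, Submodule.span_le]
  rintro _ ⟨x, hx, y, hy, rfl⟩
  exact h x hx y hy

theorem natSpan_mono {K K' : Submodule ℂ (U R)} {L L' : Submodule ℂ R} (hK : K ≤ K') (hL : L ≤ L') :
    natSpan K L ≤ natSpan K' L' := natSpan_le fun _ hx _ hy => mem_natSpan (hK hx) (hL hy)

/-- The odd part of `F_I^{2k+1} X(R)`. -/
def oddPart (I : Submodule ℂ R) (k : ℕ) : Submodule ℂ (OmNat R) :=
  natSpan (powPlus I (k + 1)) ⊤ ⊔ natSpan (powPlus I k) I

theorem filt_odd (I : Submodule ℂ R) (k : ℕ) :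
    filt I (2 * k + 1) = (powI I (k + 1)).prod (oddPart I k) := by
  have h1 : ¬ Even (2 * k + 1) := by simp
  have h2 : (2 * k + 1) / 2 = k := by omega
  rw [filt, if_neg h1, h2]
  rfl

theorem filt_even (I : Submodule ℂ R) (k : ℕ) :
    filt I (2 * k) = (powI I (k + 1) ⊔
      Submodule.span ℂ {z | ∃ x ∈ powI I k, ∃ y : R, z = x * y - y * x}).prod
      (natSpan (powPlus I k) ⊤) := by
  have h1 : Even (2 * k) := by simp
  have h2 : (2 * k) / 2 = k := by omega
  rw [filt, if_pos h1, h2]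

/-- The filtration `I^k ⇄ ♮ I_(+)^k dR` of the `X`-complex. -/
def coarse (I : Submodule ℂ R) (k : ℕ) : Submodule ℂ (X R) :=
  (powI I k).prod (natSpan (powPlus I k) ⊤)

theorem coarse_anti (hI : IsTwoSided I) : Antitone (coarse I) := fun _ _ h =>
  Submodule.prod_mono (powI_anti hI h) (natSpan_mono ((powFiltered hI).anti h) le_rfl)

theorem coarse_le_filt_odd (I : Submodule ℂ R) (k : ℕ) : coarse I (k + 1) ≤ filt I (2 * k + 1) := by
  rw [filt_odd]
  exact Submodule.prod_mono le_rfl le_sup_left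

theorem oddPart_le (hI : IsTwoSided I) (k : ℕ) : oddPart I k ≤ natSpan (powPlus I k) ⊤ :=
  sup_le (natSpan_mono ((powFiltered hI).anti (Nat.le_succ k)) le_rfl) (natSpan_mono le_rfl le_top)

theorem filt_odd_le_coarse (hI : IsTwoSided I) (k : ℕ) : filt I (2 * k + 1) ≤ coarse I k := by
  rw [filt_odd]
  exact Submodule.prod_mono (powI_succ_le hI k) (oddPart_le hI k)

theorem coarse_le_filt_even (hI : IsTwoSided I) (k : ℕ) : coarse I (k + 1) ≤ filt I (2 * k) := by
  rw [filt_even]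
  exact Submodule.prod_mono le_sup_left
    (natSpan_mono ((powFiltered hI).anti (Nat.le_succ k)) le_rfl)

theorem filt_even_le_coarse (hI : IsTwoSided I) (k : ℕ) : filt I (2 * k) ≤ coarse I k := by
  rw [filt_even]
  refine Submodule.prod_mono (sup_le (powI_succ_le hI k) ?_) le_rfl
  rw [Submodule.span_le]
  rintro _ ⟨x, hx, y, rfl⟩
  exact sub_mem (powI_right hI _ _ _ hx) (powI_left hI _ _ _ hx)

theorem coarse_le_filt (hI : IsTwoSided I) (k : ℕ) : coarse I (k / 2 + 1) ≤ filt I k := by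
  obtain ⟨m, rfl | rfl⟩ := k.even_or_odd'
  · rw [Nat.mul_div_cancel_left _ two_pos]
    exact coarse_le_filt_even hI m
  · rw [show (2 * m + 1) / 2 = m by omega]
    exact coarse_le_filt_odd I m

theorem filt_le_coarse (hI : IsTwoSided I) (k : ℕ) : filt I k ≤ coarse I (k / 2) := by
  obtain ⟨m, rfl | rfl⟩ := k.even_or_odd'
  · rw [Nat.mul_div_cancel_left _ two_pos]
    exact filt_even_le_coarse hI m
  · rw [show (2 * m + 1) / 2 = m by omega]
    exact filt_odd_le_coarse hI m

/-- The two filtrations are interleaved, up to halving the index, so continuity can be tested on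
`coarse`, which has no parity cases. -/
theorem mem_cochains (hI : IsTwoSided I) {d : ZMod 2} {f : X R →ₗ[ℂ] ℂ} :
    f ∈ cochains I d ↔ f ∈ homogeneous R d ∧ ∃ m, ∀ x ∈ coarse I m, f x = 0 := by
  constructor
  · rintro ⟨h, m, hm⟩
    exact ⟨h, m / 2 + 1, fun x hx => hm m le_rfl x (coarse_le_filt hI m hx)⟩
  · rintro ⟨h, m, hm⟩
    refine ⟨h, 2 * m, fun k hk x hx => hm x ?_⟩
    exact coarse_anti hI (by omega : m ≤ k / 2) (filt_le_coarse hI k hx)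

/-- The Leibniz rule distributes d over the b factors of y. In each resulting term one factor in I
stays behind d and the other a + b - 1 move in front of it. -/
theorem natD_mem_oddPart (hI : IsTwoSided I) {a b k : ℕ} (hab : a + b = k + 1) {x : U R} {y : R}
    (hx : x ∈ powPlus I a) (hy : y ∈ powI I b) : natD x (y : U R) ∈ oddPart I k := by
  induction b using Nat.strong_induction_on generalizing a x y with
  | _ b ih =>
  match b, ih, hab, hy with
  | 0, _, hab, _ =>
    obtain rfl : a = k + 1 := hab
    exact Submodule.mem_sup_left (mem_natSpan_top hx _)
  | 1, _, hab, hy =>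
    obtain rfl : a = k := by omega
    exact Submodule.mem_sup_right (mem_natSpan hx hy)
  | b + 2, ih, hab, hy =>
    have : powI I (b + 2) ≤ (oddPart I k).comap
        (natD x ∘ₗ Unitization.inrHom (S := ℂ) (R := ℂ) (A := R)) := by
      refine powI_le fun u hu v hv => ?_
      change natD x ((u * v : R) : U R) ∈ oddPart I k
      rw [Unitization.inr_mul, natD_mul]
      refine add_mem ?_ ?_
      · exact ih 1 (by omega) (a := a + (b + 1)) (by omega)
          ((powFiltered hI).mul _ _ hx (mem_powPlus.2 hu)) hv
      · exact ih (b + 1) (by omega) (a := 1 + a) (by omega)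
          ((powFiltered hI).mul 1 _ (mem_powPlus.2 hv) hx) hu
    exact this hy

theorem bdry_coarse (hI : IsTwoSided I) (m : ℕ) {x : X R} (hx : x ∈ coarse I (m + 1)) :
    bdry x ∈ coarse I m := by
  obtain ⟨x, w⟩ := x
  obtain ⟨h1, h2⟩ := hx
  rw [bdry_apply]
  refine ⟨?_, ?_⟩
  · have : natSpan (powPlus I (m + 1)) ⊤ ≤ (powI I m).comap (bBar (R := R)) := by
      refine natSpan_le fun x hx y _ => ?_
      rw [Submodule.mem_comap]
      rw [bBar_natD]
      refine powPlus_snd (sub_mem ?_ ?_)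
      · exact (powFiltered hI).anti (Nat.le_succ m) ((powFiltered hI).mul (m + 1) 0 hx trivial)
      · exact (powFiltered hI).anti (by omega : m ≤ 0 + (m + 1))
          ((powFiltered hI).mul 0 (m + 1) trivial hx)
    exact this h2
  · exact oddPart_le hI m (natD_mem_oddPart hI (zero_add _) trivial h1)

/-- Closure under b̄ uses [I^k, I] ⊂ I^{k+1}, closure under d the summand ♮I^k dI of the odd part:
the odd steps of the filtration are subcomplexes with no loss of index, unlike `coarse`. -/
theorem bdry_filt_odd (hI : IsTwoSided I) (k : ℕ) {x : X R} (hx : x ∈ filt I (2 * k + 1)) :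
    bdry x ∈ filt I (2 * k + 1) := by
  rw [filt_odd] at hx ⊢
  obtain ⟨x, w⟩ := x
  obtain ⟨h1, h2⟩ := hx
  rw [bdry_apply]
  refine ⟨?_, natD_mem_oddPart hI (zero_add _) trivial h1⟩
  have : oddPart I k ≤ (powI I (k + 1)).comap (bBar (R := R)) := by
    refine sup_le (natSpan_le fun x hx y _ => ?_) (natSpan_le fun x hx y hy => ?_)
    all_goals
      rw [Submodule.mem_comap]
      rw [bBar_natD]
      refine powPlus_snd (sub_mem ?_ ?_)
    · exact (powFiltered hI).mul (k + 1) 0 hx trivial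
    · exact zero_add (k + 1) ▸ (powFiltered hI).mul 0 (k + 1) trivial hx
    · exact (powFiltered hI).mul k 1 hx (mem_powPlus.2 hy)
    · exact add_comm k 1 ▸ (powFiltered hI).mul 1 k (mem_powPlus.2 hy) hx
  exact this h2

theorem map_powI (f : R →ₙₐ[ℂ] S) (hf : ∀ x ∈ I, f x ∈ J) (n : ℕ) {x : R} (hx : x ∈ powI I n) :
    f x ∈ powI J n := by
  induction n using Nat.strong_induction_on generalizing x with
  | _ n ih =>
  match n, ih, hx with
  | 0, _, _ => trivial
  | 1, _, hx => exact hf x hx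
  | n + 2, ih, hx =>
    have : powI I (n + 2) ≤ (powI J (n + 2)).comap (f : R →ₗ[ℂ] S) := by
      refine powI_le fun u hu v hv => ?_
      change f (u * v) ∈ powI J (n + 2)
      rw [map_mul]
      exact Submodule.subset_span ⟨f u, ih _ (by omega) hu, f v, hf v hv, rfl⟩
    exact this hx

theorem uMap_powPlus (f : R →ₙₐ[ℂ] S) (hf : ∀ x ∈ I, f x ∈ J) (n : ℕ) {x : U R}
    (hx : x ∈ powPlus I n) : uMap f x ∈ powPlus J n := by
  cases n with
  | zero => trivial
  | succ n =>
    rw [powPlus, if_neg (Nat.succ_ne_zero n)] at hx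
    obtain ⟨y, hy, rfl⟩ := hx
    change uMap f (y : U R) ∈ _
    rw [uMap_coe]
    exact mem_powPlus.2 (map_powI f hf _ hy)

theorem map_coarse (f : R →ₙₐ[ℂ] S) (hf : ∀ x ∈ I, f x ∈ J) (k : ℕ) {x : X R}
    (hx : x ∈ coarse I k) : X.map f x ∈ coarse J k := by
  obtain ⟨x, w⟩ := x
  rw [X_map_apply]
  refine ⟨map_powI f hf k hx.1, ?_⟩
  have : natSpan (powPlus I k) ⊤ ≤ (natSpan (powPlus J k) ⊤).comap (omMap f) := by
    refine natSpan_le fun x hx y _ => ?_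
    rw [Submodule.mem_comap]
    rw [omMap_natD]
    exact mem_natSpan_top (uMap_powPlus f hf k hx) _
  exact this hx.2

theorem map_filt_odd (f : R →ₙₐ[ℂ] S) (hf : ∀ x ∈ I, f x ∈ J) (k : ℕ) {x : X R}
    (hx : x ∈ filt I (2 * k + 1)) : X.map f x ∈ filt J (2 * k + 1) := by
  obtain ⟨x, w⟩ := x
  rw [filt_odd] at hx ⊢
  rw [X_map_apply]
  refine ⟨map_powI f hf _ hx.1, ?_⟩
  have : oddPart I k ≤ (oddPart J k).comap (omMap f) := by
    refine sup_le (natSpan_le fun x hx y _ => ?_) (natSpan_le fun x hx y hy => ?_)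
    all_goals
      rw [Submodule.mem_comap]
      rw [omMap_natD]
    · exact Submodule.mem_sup_left (mem_natSpan_top (uMap_powPlus f hf _ hx) _)
    · rw [uMap_coe]
      exact Submodule.mem_sup_right (mem_natSpan (uMap_powPlus f hf _ hx) (hf y hy))
  exact this hx.2

/-- A multiplicative map on `TA` which sends an ideal into the first step of a filtration is
filtered. -/
theorem Filtered.hom_powPlus {𝔄 : Type*} [Ring 𝔄] [Algebra ℂ 𝔄] (𝔍 : Filtered 𝔄)
    (u : U R →ₐ[ℂ] 𝔄) (hu : ∀ x ∈ I, u (x : U R) ∈ 𝔍.seq 1) (n : ℕ) {x : U R}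
    (hx : x ∈ powPlus I n) : u x ∈ 𝔍.seq n := by
  have key : ∀ n, ∀ x ∈ powI I n, u (x : U R) ∈ 𝔍.seq n := by
    intro n
    induction n using Nat.strong_induction_on with
    | _ n ih =>
    intro x hx
    match n, ih, hx with
    | 0, _, _ => rw [𝔍.zero]; trivial
    | 1, _, hx => exact hu x hx
    | n + 2, ih, hx =>
      have : powI I (n + 2) ≤ (𝔍.seq (n + 2)).comap
          (u.toLinearMap ∘ₗ Unitization.inrHom (S := ℂ) (R := ℂ) (A := R)) := by
        refine powI_le fun y hy v hv => ?_
        change u ((y * v : R) : U R) ∈ 𝔍.seq (n + 2)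
        rw [Unitization.inr_mul, map_mul]
        exact 𝔍.mul (n + 1) 1 (ih _ (by omega) y hy) (hu v hv)
      exact this hx
  cases n with
  | zero => rw [𝔍.zero]; trivial
  | succ n =>
    rw [powPlus, if_neg (Nat.succ_ne_zero n)] at hx
    obtain ⟨y, hy, rfl⟩ := hx
    exact key _ y hy

end Ideals

/-! ### Traces with values in `X`-complexes, and the Cartan homotopy formula -/

/-- A trace on the `X`-complex of a unital algebra `𝔄`: maps `x ↦ tr x` and `♮ x dy ↦ tr₁ x y`
to a two-periodic complex `M ⇄ Z`. -/
structure XTrace (𝔄 M Z : Type*) [Ring 𝔄] [Algebra ℂ 𝔄] [AddCommGroup M] [Module ℂ M]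
    [AddCommGroup Z] [Module ℂ Z] where
  /-- The boundary from the odd to the even part. -/
  b : Z →ₗ[ℂ] M
  /-- The boundary from the even to the odd part. -/
  d : M →ₗ[ℂ] Z
  /-- The even component. -/
  tr : 𝔄 →ₗ[ℂ] M
  /-- The odd component. -/
  tr₁ : 𝔄 →ₗ[ℂ] 𝔄 →ₗ[ℂ] Z
  b_tr₁ : ∀ x y, b (tr₁ x y) = tr (x * y) - tr (y * x)
  tr₁_mul : ∀ x y z, tr₁ x (y * z) = tr₁ (x * y) z + tr₁ (z * x) y
  d_tr : ∀ x, d (tr x) = tr₁ 1 x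

section Cartan

variable {𝔄 M Z A : Type*} [Ring 𝔄] [Algebra ℂ 𝔄] [AddCommGroup M] [Module ℂ M]
    [AddCommGroup Z] [Module ℂ Z] [NonUnitalRing A] [Module ℂ A]

theorem XTrace.tr₁_one_right (t : XTrace 𝔄 M Z) (x : 𝔄) : t.tr₁ x 1 = 0 := by
  have := t.tr₁_mul x 1 1
  simpa using this

/-- The odd component `♮ x da ↦ tr (u(x) δ(a))` of the Cartan homotopy. -/
def XTrace.etaOne (t : XTrace 𝔄 M Z) (u : TensorAlgebra ℂ A →ₐ[ℂ] 𝔄) (δ : A →ₗ[ℂ] 𝔄) :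
    OmNat (T A) →ₗ[ℂ] M :=
  omLift ((LinearMap.mul ℂ 𝔄).compl₁₂ u.toLinearMap δ |>.compr₂ t.tr)

/-- The sum of `tr₁ (c u(z) δ(b)) (u(w))` over the decompositions `z b w` of a word. -/
def XTrace.etaSum (t : XTrace 𝔄 M Z) (u : TensorAlgebra ℂ A →ₐ[ℂ] 𝔄) (δ : A →ₗ[ℂ] 𝔄) (c : 𝔄) :
    TensorAlgebra ℂ A →ₗ[ℂ] Z :=
  splitSum (trilin (fun z b w => t.tr₁ (c * u z * δ b) (u w))
    (by intros; simp [mul_add, add_mul]) (by intros; simp) (by intros; simp [mul_add])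
    (by intros; simp) (by intros; simp) (by intros; simp))

/-- The even component of the Cartan homotopy. -/
def XTrace.etaZero (t : XTrace 𝔄 M Z) (u : TensorAlgebra ℂ A →ₐ[ℂ] 𝔄) (δ : A →ₗ[ℂ] 𝔄) :
    T A →ₗ[ℂ] Z :=
  t.etaSum u δ 1 ∘ₗ (T.incl A : T A →ₗ[ℂ] TensorAlgebra ℂ A)

variable (t : XTrace 𝔄 M Z) (u : TensorAlgebra ℂ A →ₐ[ℂ] 𝔄) (δ : A →ₗ[ℂ] 𝔄)

theorem XTrace.etaOne_natD (x : TensorAlgebra ℂ A) (a : A) :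
    t.etaOne u δ (natD (ofW A x) (T.ι A a : U (T A))) = t.tr (u x * δ a) := by
  simp [XTrace.etaOne]

theorem XTrace.etaSum_word (c : 𝔄) (l : List A) :
    t.etaSum u δ c (word l) = lsum (fun z b w => t.tr₁ (c * u (word z) * δ b) (u (word w))) l := by
  simp [XTrace.etaSum, splitSum_word]

theorem XTrace.etaOne_natD_word (x : TensorAlgebra ℂ A) (l : List A) :
    t.etaOne u δ (natD (ofW A x) (ofW A (word l))) =
      lsum (fun z b w => t.tr (u (word w) * u x * u (word z) * δ b)) l := by
  simp [XTrace.etaOne, omLift_natD, rotSum_word]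

/-- The derivation along a homomorphism, on words. -/
theorem derivation_word {D : 𝔄 →ₗ[ℂ] 𝔄} (hD : ∀ x y, D (x * y) = D x * y + x * D y)
    (l : List A) : D (u (word l)) = lsum (fun z b w => u (word z) * D (u (TensorAlgebra.ι ℂ b)) *
      u (word w)) l := by
  have h1 : D 1 = 0 := by simpa using hD 1 1
  induction l with
  | nil => simp [h1]
  | cons a l ih =>
    rw [word_cons, map_mul, hD, ih, lsum_cons, mul_lsum]
    simp [mul_assoc]

variable {D : 𝔄 →ₗ[ℂ] 𝔄}

/-- Expand D u(word) over its letters. For a marked letter b, the boundary of tr₁(u(z)δ(b), u(w)) is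
tr(u(z)δ(b)u(w)) minus its rotation tr(u(w)u(z)δ(b)), and these rotations make up the value of η on
d(word). -/
theorem XTrace.cartan_even (hD : ∀ x y, D (x * y) = D x * y + x * D y)
    (hδ : ∀ a, D (u (TensorAlgebra.ι ℂ a)) = δ a) (l : List A) :
    t.b (t.etaSum u δ 1 (word l)) + t.etaOne u δ (natD 1 (ofW A (word l))) =
      t.tr (D (u (word l))) := by
  have h := t.etaOne_natD_word u δ 1 l
  rw [map_one] at h
  rw [h, t.etaSum_word, derivation_word u hD, map_lsum, map_lsum, ← lsum_add]
  refine lsum_congr fun z b w _ => ?_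
  simp only [t.b_tr₁, hδ]
  simp [mul_assoc]

/-- Expanding tr₁(D u(l), u(a)) over the letters of l gives the terms of η for the words l a and a l
whose marked letter lies in l. When a itself is marked, d tr(u(l)δ(a)) = tr₁(u(l), δ(a)) + tr₁(δ(a),
u(l)), and the last summand cancels against the word a l. -/
theorem XTrace.cartan_odd (hD : ∀ x y, D (x * y) = D x * y + x * D y)
    (hδ : ∀ a, D (u (TensorAlgebra.ι ℂ a)) = δ a) (l : List A) (a : A) :
    t.d (t.tr (u (word l) * δ a)) + t.etaSum u δ 1 (word (l ++ [a]) - word (a :: l)) =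
      t.tr₁ (D (u (word l))) (u (TensorAlgebra.ι ℂ a)) + t.tr₁ (u (word l)) (δ a) := by
  have e : t.tr₁ (D (u (word l))) (u (TensorAlgebra.ι ℂ a)) = lsum (fun z b w =>
      t.tr₁ (u (word z) * δ b) (u (word (w ++ [a]))) -
        t.tr₁ (u (word (a :: z)) * δ b) (u (word w))) l := by
    rw [derivation_word u hD, map_lsum₂]
    refine lsum_congr fun z b w _ => ?_
    simp only [hδ, word_append, map_mul,
      t.tr₁_mul, word_cons, word_nil, mul_one]
    rw [← mul_assoc, add_sub_cancel_right]
  rw [e, lsum_sub, map_sub, t.etaSum_word, t.etaSum_word, lsum_append, lsum_cons, lsum_nil, lsum_cons,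
    t.d_tr, t.tr₁_mul]
  simp [t.tr₁_one_right]
  abel

variable {t u δ}

theorem XTrace.etaOne_mem {K : Submodule ℂ (T A)} (𝔍 : Filtered 𝔄)
    (hu : ∀ x ∈ K, u (T.incl A x) ∈ 𝔍.seq 1) (hδ : ∀ a, δ a ∈ 𝔍.seq 1) {Y : ℕ → Submodule ℂ M}
    (hY : ∀ k, ∀ x ∈ 𝔍.seq k, t.tr x ∈ Y k) (k : ℕ) {x : U (T A)} (hx : x ∈ powPlus K k)
    (y : U (T A)) : t.etaOne u δ (natD x y) ∈ Y (k + 1) := by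
  have hx' : u (toW A x) ∈ 𝔍.seq k := by
    refine 𝔍.hom_powPlus (u.comp (toW A)) (I := K) ?_ k hx
    intro x hx
    simpa using hu x hx
  obtain ⟨x, rfl⟩ : ∃ x', ofW A x' = x := ⟨_, ofW_toW x⟩
  obtain ⟨y, rfl⟩ : ∃ x', ofW A x' = y := ⟨_, ofW_toW y⟩
  rw [toW_ofW] at hx'
  induction y using word_induction with
  | hw l =>
    rw [t.etaOne_natD_word]
    refine lsum_mem _ fun z b w => hY _ _ ?_
    have := 𝔍.mul 0 k (x := u (word w)) (𝔍.zero ▸ trivial) hx'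
    have := 𝔍.mul _ 0 this (y := u (word z)) (𝔍.zero ▸ trivial)
    have := 𝔍.mul _ 1 this (hδ b)
    simpa using this
  | hadd y z hy hz => rw [map_add, map_add, map_add]; exact add_mem hy hz
  | hsmul c y hy => rw [map_smul, map_smul, map_smul]; exact Submodule.smul_mem _ c hy

/-- The marked letter lies in x or in y. If it lies in x, the factor u(y) is part of the d-slot, and
the Leibniz rule either leaves it alone there, which gives the first summand, or rotates it into the
coefficient. -/
theorem XTrace.etaSum_mul (hD : ∀ x y, D (x * y) = D x * y + x * D y)
    (hδ : ∀ a, D (u (TensorAlgebra.ι ℂ a)) = δ a) (c : 𝔄) (x y : TensorAlgebra ℂ A) :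
    t.etaSum u δ c (x * y) = t.tr₁ (c * D (u x)) (u y) + t.etaSum u δ (u y * c) x +
      t.etaSum u δ (c * u x) y := by
  have hc : ∀ c c' : 𝔄, t.etaSum u δ (c + c') = t.etaSum u δ c + t.etaSum u δ c' := by
    intro c c'
    refine word_hom_ext fun l => ?_
    simp only [LinearMap.add_apply, t.etaSum_word, ← lsum_add]
    simp [add_mul]
  have hs : ∀ (s : ℂ) (c : 𝔄), t.etaSum u δ (s • c) = s • t.etaSum u δ c := by
    intro s c
    refine word_hom_ext fun l => ?_
    simp only [LinearMap.smul_apply, t.etaSum_word, ← lsum_smul]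
    simp
  induction x using word_induction with
  | hw l =>
    induction y using word_induction with
    | hw l' =>
      rw [← word_append, t.etaSum_word, t.etaSum_word, t.etaSum_word, lsum_append,
        derivation_word u hD, mul_lsum, map_lsum₂, ← lsum_add]
      simp only [word_append, map_mul, mul_assoc]
      congr 1
      refine lsum_congr fun z b w _ => ?_
      simp only [hδ, t.tr₁_mul, mul_assoc]
    | hadd x y hx hy => simp only [map_add, hx, hy, mul_add, add_mul, LinearMap.add_apply, hc]; abel
    | hsmul c x hx => simp [hx, hs]
  | hadd x y hx hy => simp only [map_add, hx, hy, mul_add, add_mul, LinearMap.add_apply, hc]; abel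
  | hsmul c x hx => simp [hx, hs]

/-- Induction on the number of factors of x. The coefficient c is left free because
`XTrace.etaSum_mul` rotates factors to the left, where they are absorbed into c. -/
theorem XTrace.etaSum_mem {K : Submodule ℂ (T A)} (𝔍 : Filtered 𝔄)
    (hu : ∀ x ∈ K, u (T.incl A x) ∈ 𝔍.seq 1) (hδJ : ∀ a, δ a ∈ 𝔍.seq 1)
    (hD : ∀ x y, D (x * y) = D x * y + x * D y)
    (hδ : ∀ a, D (u (TensorAlgebra.ι ℂ a)) = δ a) (hDJ : ∀ k, ∀ x ∈ 𝔍.seq k, D x ∈ 𝔍.seq k)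
    {Y : ℕ → Submodule ℂ Z}
    (hY : ∀ k, ∀ x ∈ 𝔍.seq (k + 1), ∀ y, t.tr₁ x y ∈ Y k)
    (hY' : ∀ k, ∀ x ∈ 𝔍.seq k, ∀ y ∈ 𝔍.seq 1, t.tr₁ x y ∈ Y k)
    (k : ℕ) {x : T A} (hx : x ∈ powI K (k + 1)) (r : ℕ) {c : 𝔄} (hc : c ∈ 𝔍.seq r) :
    t.etaSum u δ c (T.incl A x) ∈ Y (r + k) := by
  have hu' : ∀ k, ∀ x ∈ powI K k, u (T.incl A x) ∈ 𝔍.seq k := by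
    intro k x hx
    have := 𝔍.hom_powPlus (u.comp (toW A)) (I := K) (by intro x hx; simpa using hu x hx) k
      (mem_powPlus.2 hx)
    simpa using this
  have base : ∀ r, ∀ c ∈ 𝔍.seq r, ∀ x, t.etaSum u δ c x ∈ Y r := by
    intro r c hc x
    induction x using word_induction with
    | hw l =>
      rw [t.etaSum_word]
      refine lsum_mem _ fun z b w => hY _ _ ?_ _
      have := 𝔍.mul _ 0 hc (y := u (word z)) (𝔍.zero ▸ trivial)
      exact 𝔍.mul _ 1 this (hδJ b)
    | hadd y z hy hz => rw [map_add]; exact add_mem hy hz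
    | hsmul c y hy => rw [map_smul]; exact Submodule.smul_mem _ c hy
  induction k generalizing r c x with
  | zero => exact base r c hc _
  | succ k ih =>
    have : powI K (k + 2) ≤ (Y (r + (k + 1))).comap
        (t.etaSum u δ c ∘ₗ (T.incl A : T A →ₗ[ℂ] TensorAlgebra ℂ A)) := by
      refine powI_le fun x hx y hy => ?_
      change t.etaSum u δ c (T.incl A (x * y)) ∈ Y (r + (k + 1))
      rw [map_mul, XTrace.etaSum_mul hD hδ]
      refine add_mem (add_mem ?_ ?_) ?_
      · exact hY' _ _ (𝔍.mul _ _ hc (hDJ _ _ (hu' _ x hx))) _ (hu y hy)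
      · have := ih hx (1 + r) (c := u (T.incl A y) * c) (𝔍.mul _ _ (hu y hy) hc)
        rwa [show 1 + r + k = r + (k + 1) by omega] at this
      · exact base _ _ (𝔍.mul _ _ hc (hu' _ x hx)) _
    exact this hx

end Cartan

/-! ### Integration over [0, 1] of polynomial families, as a trace -/

section PolynomialTrace

set_option linter.unusedSectionVars false

open Polynomial

variable {R : Type*} [NonUnitalRing R] [Module ℂ R] [IsScalarTower ℂ R R] [SMulCommClass ℂ R R]

variable (R) in
/-- Integration over `[0, 1]` of polynomials with coefficients in `R⁺`, projected to `R`. -/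
def intTr : (U R)[X] →ₗ[ℂ] R :=
  Polynomial.lsum fun m => ((m : ℂ) + 1)⁻¹ • Unitization.sndHom (S := ℂ) (R := ℂ) (A := R)

variable (R) in
/-- Integration over `[0, 1]` of polynomial one-forms. -/
def intTr₁ : (U R)[X] →ₗ[ℂ] (U R)[X] →ₗ[ℂ] OmNat R :=
  Polynomial.lsum fun m => LinearMap.flip (Polynomial.lsum fun l => LinearMap.flip
    (((m : ℂ) + l + 1)⁻¹ • natD))

theorem intTr_monomial (m : ℕ) (x : U R) : intTr R (monomial m x) = ((m : ℂ) + 1)⁻¹ • x.snd := by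
  simp [intTr]

theorem intTr₁_monomial (m l : ℕ) (x y : U R) :
    intTr₁ R (monomial m x) (monomial l y) = ((m : ℂ) + l + 1)⁻¹ • natD x y := by
  simp [intTr₁]

variable (R) in
/-- The trace of polynomials given by integration over `[0, 1]`. -/
def polyTrace : XTrace (U R)[X] R (OmNat R) where
  b := bBar
  d := natD 1 ∘ₗ Unitization.inrHom (S := ℂ) (R := ℂ) (A := R)
  tr := intTr R
  tr₁ := intTr₁ R
  b_tr₁ x y := by
    induction x using Polynomial.induction_on' with
    | add x z hx hz => simp only [map_add, add_mul, mul_add, LinearMap.add_apply, hx, hz]; abel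
    | monomial m x =>
      induction y using Polynomial.induction_on' with
      | add y z hy hz => simp only [map_add, add_mul, mul_add, hy, hz]; abel
      | monomial l y =>
        rw [intTr₁_monomial, monomial_mul_monomial, monomial_mul_monomial, intTr_monomial,
          intTr_monomial, map_smul, bBar_natD, add_comm l m]
        push_cast
        rw [← smul_sub]
        rfl
  tr₁_mul x y z := by
    induction x using Polynomial.induction_on' with
    | add x z hx hz => simp only [map_add, add_mul, mul_add, LinearMap.add_apply, hx, hz]; abel
    | monomial m x =>
      induction y using Polynomial.induction_on' with
      | add y z hy hz => simp only [map_add, add_mul, mul_add, LinearMap.add_apply, hy, hz]; abel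
      | monomial l y =>
        induction z using Polynomial.induction_on' with
        | add y z hy hz => simp only [map_add, add_mul, mul_add, LinearMap.add_apply, hy, hz]; abel
        | monomial k z =>
          simp only [monomial_mul_monomial, intTr₁_monomial, natD_mul, smul_add]
          push_cast
          congr 3 <;> ring
  d_tr x := by
    induction x using Polynomial.induction_on' with
    | add x z hx hz => simp only [map_add, hx, hz]
    | monomial m x =>
      rw [← monomial_zero_one, intTr₁_monomial, intTr_monomial, map_smul]
      change _ • natD 1 (x.snd : U R) = _
      rw [← natD_snd]
      simp

variable (R) in
/-- Evaluation of polynomials at a scalar. -/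
def evalAt (s : ℂ) : (U R)[X] →+* U R :=
  eval₂RingHom' (RingHom.id _) (algebraMap ℂ (U R) s) fun _ => (Algebra.commutes _ _).symm

theorem evalAt_monomial (s : ℂ) (m : ℕ) (x : U R) : evalAt R s (monomial m x) = s ^ m • x := by
  simp [evalAt, eval₂RingHom', Algebra.algebraMap_eq_smul_one, _root_.smul_pow]

theorem intTr_derivative (x : (U R)[X]) :
    intTr R (derivative x) = (evalAt R 1 x - evalAt R 0 x).snd := by
  induction x using Polynomial.induction_on' with
  | add x z hx hz =>
    rw [map_add, map_add, hx, hz, map_add, map_add, add_sub_add_comm]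
    rfl
  | monomial m x =>
    rw [derivative_monomial, intTr_monomial, evalAt_monomial, evalAt_monomial]
    cases m with
    | zero => simp
    | succ m =>
      have : ((m : ℂ) + 1) ≠ 0 := Nat.cast_add_one_ne_zero m
      have h : x * ((m + 1 : ℕ) : U R) = ((m : ℂ) + 1) • x := by
        rw [← Nat.cast_comm, ← nsmul_eq_mul, ← Nat.cast_smul_eq_nsmul ℂ]
        push_cast; rfl
      rw [h]
      simp [smul_smul, this]

theorem intTr₁_derivative (x y : (U R)[X]) :
    intTr₁ R (derivative x) y + intTr₁ R x (derivative y) =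
      natD (evalAt R 1 x) (evalAt R 1 y) - natD (evalAt R 0 x) (evalAt R 0 y) := by
  have hc : ∀ (m : ℕ) (x : U R), x * (m : U R) = (m : ℂ) • x := by
    intro m x
    rw [← Nat.cast_comm, ← nsmul_eq_mul, ← Nat.cast_smul_eq_nsmul ℂ]
  induction x using Polynomial.induction_on' with
  | add x z hx hz =>
    have := congrArg₂ (· + ·) hx hz
    simp only [map_add, LinearMap.add_apply] at this ⊢
    rw [add_add_add_comm, this]; abel
  | monomial m x =>
    induction y using Polynomial.induction_on' with
    | add y z hx hz =>
      have := congrArg₂ (· + ·) hx hz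
      simp only [map_add] at this ⊢
      rw [add_add_add_comm, this]; abel
    | monomial l y =>
      simp only [derivative_monomial, intTr₁_monomial, evalAt_monomial, hc, map_smul,
        LinearMap.smul_apply, smul_smul, one_pow, one_smul]
      generalize natD x y = N
      cases m with
      | zero =>
        cases l with
        | zero => simp
        | succ l =>
          have : ((l : ℂ) + 1) ≠ 0 := Nat.cast_add_one_ne_zero l
          simp [this]
      | succ m =>
        have h : ((m : ℂ) + l + 1) ≠ 0 := by exact_mod_cast Nat.succ_ne_zero (m + l)
        cases l with
        | zero =>
          have : ((m : ℂ) + 1) ≠ 0 := Nat.cast_add_one_ne_zero m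
          simp [this]
        | succ l =>
          have h : ((m : ℂ) + l + 2) ≠ 0 := by exact_mod_cast Nat.succ_ne_zero (m + l + 1)
          rw [← add_smul]
          have e : (((m + 1 - 1 : ℕ) : ℂ) + ((l + 1 : ℕ) : ℂ) + 1)⁻¹ * ((m + 1 : ℕ) : ℂ) +
              (((m + 1 : ℕ) : ℂ) + ((l + 1 - 1 : ℕ) : ℂ) + 1)⁻¹ * ((l + 1 : ℕ) : ℂ) = 1 := by
            rw [Nat.add_sub_cancel, Nat.add_sub_cancel]
            push_cast
            rw [show (m : ℂ) + (l + 1) + 1 = m + l + 2 by ring,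
              show (m : ℂ) + 1 + l + 1 = m + l + 2 by ring]
            field_simp
            ring
          rw [e]
          simp

end PolynomialTrace

/-! ### The Cartan homotopy between two homomorphisms on `TA` and its compatibility with filtrations
-/

section Homotopy

set_option linter.unusedSectionVars false

open Polynomial

variable {𝔄 : Type*} [Ring 𝔄] [Algebra ℂ 𝔄]
variable {R : Type*} [NonUnitalRing R] [Module ℂ R] [IsScalarTower ℂ R R] [SMulCommClass ℂ R R]
variable {A : Type*} [NonUnitalRing A] [Module ℂ A]

/-- The homomorphism to polynomials sending a letter `a` to `g₀(a) + g₁(a) X`. -/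
def linPoly (g₀ g₁ : A →ₗ[ℂ] 𝔄) : TensorAlgebra ℂ A →ₐ[ℂ] 𝔄[X] :=
  TensorAlgebra.lift ℂ ((monomial 0 : 𝔄 →ₗ[𝔄] 𝔄[X]).restrictScalars ℂ ∘ₗ g₀ +
    (monomial 1 : 𝔄 →ₗ[𝔄] 𝔄[X]).restrictScalars ℂ ∘ₗ g₁)

theorem linPoly_ι (g₀ g₁ : A →ₗ[ℂ] 𝔄) (a : A) :
    linPoly g₀ g₁ (TensorAlgebra.ι ℂ a) = monomial 0 (g₀ a) + monomial 1 (g₁ a) := by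
  simp [linPoly]

theorem uMap_lift_ofW (f : A →ₗ[ℂ] R) (x : TensorAlgebra ℂ A) :
    uMap (T.lift f) (ofW A x) = T.liftU f x := by
  have : ((uMap (T.lift f)).comp (ofW A)) = T.liftU f := by
    ext a
    · simp [T.lift, T.incl_ι, T.liftU]
    · simp [T.lift, T.incl_ι, T.liftU]
  exact DFunLike.congr_fun this x

@[simp] theorem lift_ι (f : A →ₗ[ℂ] R) (a : A) : T.lift f (T.ι A a) = f a := by
  simp [T.lift, T.incl_ι, T.liftU]

variable (f₀ f₁ : A →ₗ[ℂ] R)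

/-- The polynomial homotopy between the homomorphisms extending two linear maps. -/
def polyHom : TensorAlgebra ℂ A →ₐ[ℂ] (U R)[X] :=
  linPoly (Unitization.inrHom (S := ℂ) (R := ℂ) (A := R) ∘ₗ f₀)
    (Unitization.inrHom (S := ℂ) (R := ℂ) (A := R) ∘ₗ (f₁ - f₀))

theorem evalAt_polyHom (s : ℂ) (x : TensorAlgebra ℂ A) :
    evalAt R s (polyHom f₀ f₁ x) = T.liftU (f₀ + s • (f₁ - f₀)) x := by
  induction x using word_induction with
  | hw l =>
    induction l with
    | nil => simp
    | cons a l ih =>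
      rw [word_cons, map_mul, map_mul, map_mul, ih, polyHom, linPoly_ι, map_add, evalAt_monomial,
        evalAt_monomial]
      congr 1
      simp [T.liftU]
  | hadd x y hx hy => simp only [map_add, hx, hy]
  | hsmul c x hx =>
    -- `evalAt` is only a ring homomorphism by construction, so its linearity is checked on
    -- monomials.
    have : ∀ (c : ℂ) (y : (U R)[X]), evalAt R s (c • y) = c • evalAt R s y := by
      intro c y
      induction y using Polynomial.induction_on' with
      | add x y hx hy => simp only [smul_add, map_add, hx, hy]
      | monomial m x => rw [smul_monomial, evalAt_monomial, evalAt_monomial, smul_comm]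
    rw [map_smul (polyHom f₀ f₁), this, hx, map_smul]

/-- The letters of the derivative of the polynomial homotopy. -/
def polyDer : A →ₗ[ℂ] (U R)[X] :=
  (monomial 0 : U R →ₗ[U R] (U R)[X]).restrictScalars ℂ ∘ₗ
    Unitization.inrHom (S := ℂ) (R := ℂ) (A := R) ∘ₗ (f₁ - f₀)

/-- The Cartan homotopy between the chain maps induced by two homomorphisms on `TA`. -/
def cartan : X (T A) →ₗ[ℂ] X R :=
  LinearMap.prod
    ((polyTrace R).etaOne (polyHom f₀ f₁) (polyDer f₀ f₁) ∘ₗ LinearMap.snd ℂ (T A) (OmNat (T A)))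
    ((polyTrace R).etaZero (polyHom f₀ f₁) (polyDer f₀ f₁) ∘ₗ LinearMap.fst ℂ (T A) (OmNat (T A)))

theorem cartan_apply (x : T A) (w : OmNat (T A)) : cartan f₀ f₁ (x, w) =
    ((polyTrace R).etaOne (polyHom f₀ f₁) (polyDer f₀ f₁) w,
      (polyTrace R).etaSum (polyHom f₀ f₁) (polyDer f₀ f₁) 1 (T.incl A x)) := rfl

theorem derivative_polyHom_ι (a : A) :
    (derivative : (U R)[X] →ₗ[U R] (U R)[X]).restrictScalars ℂ
      (polyHom f₀ f₁ (TensorAlgebra.ι ℂ a)) = polyDer f₀ f₁ a := by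
  rw [polyHom, linPoly_ι]
  simp [polyDer]

theorem derivative_restrictScalars_mul (x y : (U R)[X]) :
    (derivative : (U R)[X] →ₗ[U R] (U R)[X]).restrictScalars ℂ (x * y) =
      (derivative : (U R)[X] →ₗ[U R] (U R)[X]).restrictScalars ℂ x * y +
      x * (derivative : (U R)[X] →ₗ[U R] (U R)[X]).restrictScalars ℂ y := derivative_mul

theorem X_map_word (f : A →ₗ[ℂ] R) (l : List A) :
    (X.map (T.lift f) (tword l, 0)) = ((T.liftU f (word l)).snd, 0) := by
  rw [X_map_apply, map_zero]
  cases l with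
  | nil => simp
  | cons a l =>
    rw [← uMap_lift_ofW, ← coe_tword_cons, uMap_coe, Unitization.snd_inr]

theorem X_map_letter (f : A →ₗ[ℂ] R) (l : List A) (a : A) :
    (X.map (T.lift f) (0, natD (ofW A (word l)) (T.ι A a : U (T A)))) =
      (0, natD (T.liftU f (word l)) (f a : U R)) := by
  rw [X_map_apply, map_zero, omMap_natD, uMap_lift_ofW, uMap_coe, lift_ι]

theorem incl_tword {l : List A} (h : l ≠ []) : T.incl A (tword l) = word l := by
  cases l with
  | nil => exact absurd rfl h
  | cons a l => exact incl_tword_cons a l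

theorem bBar_letter (l : List A) (a : A) :
    bBar (natD (ofW A (word l)) (T.ι A a : U (T A))) = tword (l ++ [a]) - tword (a :: l) := by
  rw [bBar_natD, tword, tword, word_append, word_cons a l, map_mul, map_mul, word_cons, word_nil,
    mul_one, ofW_ι]
  rfl

/-- The Cartan formula ∂η + η∂ = d/dX for the family of homomorphisms a ↦ f₀(a) + X (f₁(a) - f₀(a)),
integrated over [0, 1] by the fundamental theorem of calculus. -/
theorem cartan_homotopy (x : X (T A)) :
    X.map (T.lift f₁) x - X.map (T.lift f₀) x =
      bdry (cartan f₀ f₁ x) + cartan f₀ f₁ (bdry x) := by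
  have h0 : ∀ x, evalAt R 0 (polyHom f₀ f₁ x) = T.liftU f₀ x := by
    intro x; rw [evalAt_polyHom, zero_smul, add_zero]
  have h1 : ∀ x, evalAt R 1 (polyHom f₀ f₁ x) = T.liftU f₁ x := by
    intro x; rw [evalAt_polyHom, one_smul, add_sub_cancel]
  suffices h : X.map (T.lift f₁) - X.map (T.lift f₀) =
      bdry ∘ₗ cartan f₀ f₁ + cartan f₀ f₁ ∘ₗ bdry from LinearMap.congr_fun h x
  refine X_T_ext (fun a l => ?_) (fun l a => ?_)
  · simp only [LinearMap.sub_apply, LinearMap.add_apply, LinearMap.comp_apply]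
    rw [X_map_word, X_map_word, cartan_apply, bdry_apply, bdry_apply, map_zero, map_zero,
      cartan_apply, map_zero, coe_tword_cons, incl_tword_cons]
    have := (polyTrace R).cartan_even (polyHom f₀ f₁) (polyDer f₀ f₁)
      derivative_restrictScalars_mul (derivative_polyHom_ι f₀ f₁) (a :: l)
    ext
    · refine Eq.trans ?_ this.symm
      refine Eq.trans ?_ (intTr_derivative _).symm
      rw [h0, h1]
      rfl
    · simp
  · simp only [LinearMap.sub_apply, LinearMap.add_apply, LinearMap.comp_apply]
    rw [X_map_letter, X_map_letter, cartan_apply, bdry_apply, bdry_apply, map_zero, map_zero,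
      cartan_apply, bBar_letter, Unitization.inr_zero, map_zero, map_zero, map_zero]
    have := (polyTrace R).cartan_odd (polyHom f₀ f₁) (polyDer f₀ f₁)
      derivative_restrictScalars_mul (derivative_polyHom_ι f₀ f₁) l a
    ext
    · simp
    · refine Eq.trans ?_ (Eq.trans this.symm ?_)
      · rw [← derivative_polyHom_ι]
        refine Eq.trans ?_ (intTr₁_derivative _ _).symm
        rw [h0, h1, h0, h1]
        simp [T.liftU]
      · rw [XTrace.etaOne_natD]
        refine congrArg₂ (· + ·) rfl ?_
        rw [map_sub (T.incl A), incl_tword (by simp), incl_tword (by simp)]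

/-- The filtration of polynomials by conditions on the coefficients. -/
def polyFiltered (𝔍 : Filtered 𝔄) : Filtered 𝔄[X] where
  seq k := ⨅ m, (𝔍.seq k).comap ((lcoeff 𝔄 m).restrictScalars ℂ)
  zero := by simp [𝔍.zero]
  anti _ _ h := iInf_mono fun m => Submodule.comap_mono (𝔍.anti h)
  mul m n x y hx hy := by
    rw [Submodule.mem_iInf] at hx hy ⊢
    intro k
    change (x * y).coeff k ∈ 𝔍.seq (m + n)
    rw [coeff_mul]
    exact sum_mem fun p _ => 𝔍.mul _ _ (hx _) (hy _)

theorem mem_polyFiltered {𝔍 : Filtered 𝔄} {k : ℕ} {x : 𝔄[X]} :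
    x ∈ (polyFiltered 𝔍).seq k ↔ ∀ m, x.coeff m ∈ 𝔍.seq k := Submodule.mem_iInf _

theorem monomial_mem_polyFiltered {𝔍 : Filtered 𝔄} {k m : ℕ} {x : 𝔄} (hx : x ∈ 𝔍.seq k) :
    monomial m x ∈ (polyFiltered 𝔍).seq k := by
  rw [mem_polyFiltered]
  intro l
  rw [coeff_monomial]
  split_ifs
  · exact hx
  · exact zero_mem _

/-- Homomorphisms which agree on the letters modulo an ideal agree modulo the ideal. -/
theorem hom_sub_mem (u v : TensorAlgebra ℂ A →ₐ[ℂ] 𝔄) (𝔍 : Filtered 𝔄)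
    (h : ∀ a, u (TensorAlgebra.ι ℂ a) - v (TensorAlgebra.ι ℂ a) ∈ 𝔍.seq 1) (x : TensorAlgebra ℂ A) :
    u x - v x ∈ 𝔍.seq 1 := by
  have h0 : ∀ x, x ∈ 𝔍.seq 0 := fun x => 𝔍.zero ▸ trivial
  induction x using word_induction with
  | hw l =>
    induction l with
    | nil => simp
    | cons a l ih =>
      have : u (word (a :: l)) - v (word (a :: l)) =
          (u (TensorAlgebra.ι ℂ a) - v (TensorAlgebra.ι ℂ a)) * u (word l) +
            v (TensorAlgebra.ι ℂ a) * (u (word l) - v (word l)) := by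
        simp only [word_cons, map_mul]
        noncomm_ring
      rw [this]
      exact add_mem (𝔍.mul 1 0 (h a) (h0 _)) (𝔍.mul 0 1 (h0 _) ih)
  | hadd x y hx hy => rw [map_add, map_add, add_sub_add_comm]; exact add_mem hx hy
  | hsmul c x hx => rw [map_smul, map_smul, ← smul_sub]; exact Submodule.smul_mem _ c hx

/-- The family is constant modulo J, so it sends K into polynomials over J, and its derivative also
has coefficients in J. The factor in K that is lost to the derivative is thus replaced by one in J,
and the index is preserved exactly. -/
theorem cartan_filt {K : Submodule ℂ (T A)} {J : Submodule ℂ R} (hK' : IsTwoSided K)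
    (hJ : IsTwoSided J) (hf : ∀ a, f₁ a - f₀ a ∈ J) (hK : ∀ x ∈ K, T.lift f₀ x ∈ J) (k : ℕ) {x : X (T A)}
    (hx : x ∈ filt K (2 * k + 1)) : cartan f₀ f₁ x ∈ filt J (2 * k + 1) := by
  have hδ : ∀ a, polyDer f₀ f₁ a ∈ (polyFiltered (powFiltered hJ)).seq 1 := fun a =>
    monomial_mem_polyFiltered (mem_powPlus.2 (hf a))
  have hu : ∀ x ∈ K, polyHom f₀ f₁ (T.incl A x) ∈ (polyFiltered (powFiltered hJ)).seq 1 := by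
    intro x hx
    -- The constant family at f₀, to which `hom_sub_mem` compares the polynomial family.
    have hv : ∀ x, linPoly (Unitization.inrHom (S := ℂ) (R := ℂ) (A := R) ∘ₗ f₀) 0 x =
        monomial 0 (T.liftU f₀ x) := by
      intro x
      have : linPoly (Unitization.inrHom (S := ℂ) (R := ℂ) (A := R) ∘ₗ f₀) 0 =
          CAlgHom.comp (T.liftU f₀) := by
        refine TensorAlgebra.hom_ext (LinearMap.ext fun a => ?_)
        change linPoly _ 0 (TensorAlgebra.ι ℂ a) = C (T.liftU f₀ (TensorAlgebra.ι ℂ a))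
        rw [linPoly_ι]
        simp [T.liftU]
      rw [this]
      rfl
    have h1 := hom_sub_mem (polyHom f₀ f₁)
      (linPoly (Unitization.inrHom (S := ℂ) (R := ℂ) (A := R) ∘ₗ f₀) 0)
      (polyFiltered (powFiltered hJ)) (fun a => ?_) (T.incl A x)
    · have h2 : monomial 0 (T.liftU f₀ (T.incl A x)) ∈ (polyFiltered (powFiltered hJ)).seq 1 := by
        refine monomial_mem_polyFiltered ?_
        rw [← uMap_lift_ofW, ofW_incl, uMap_coe]
        exact mem_powPlus.2 (hK x hx)
      rw [← hv] at h2
      simpa using add_mem h1 h2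
    · rw [polyHom, linPoly_ι, linPoly_ι, LinearMap.zero_apply, map_zero, add_zero,
        add_sub_cancel_left]
      exact monomial_mem_polyFiltered (mem_powPlus.2 (hf a))
  have htr₁ : ∀ (Z : Submodule ℂ (OmNat R)) (x y : (U R)[X]),
      (∀ m l, natD (x.coeff m) (y.coeff l) ∈ Z) → intTr₁ R x y ∈ Z := by
    intro Z x y h
    rw [intTr₁, lsum_apply, Polynomial.sum, LinearMap.sum_apply]
    refine sum_mem fun m _ => ?_
    rw [LinearMap.flip_apply, lsum_apply, Polynomial.sum, LinearMap.sum_apply]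
    exact sum_mem fun l _ => Submodule.smul_mem _ _ (h m l)
  obtain ⟨x, w⟩ := x
  rw [filt_odd] at hx ⊢
  rw [cartan_apply]
  refine ⟨?_, ?_⟩
  · have h1 : ∀ x ∈ powPlus K k, ∀ y, (polyTrace R).etaOne (polyHom f₀ f₁) (polyDer f₀ f₁)
        (natD x y) ∈ powI J (k + 1) := by
      intro x hx y
      refine XTrace.etaOne_mem (t := polyTrace R) (Y := powI J) _ hu hδ (fun k x hx => ?_) k hx y
      change intTr R x ∈ powI J k
      rw [intTr, lsum_apply, Polynomial.sum]
      exact sum_mem fun m _ => Submodule.smul_mem _ _ (powPlus_snd (mem_polyFiltered.1 hx m))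
    have hle : natSpan (powPlus K k) ⊤ ≤ (powI J (k + 1)).comap
        ((polyTrace R).etaOne (polyHom f₀ f₁) (polyDer f₀ f₁)) :=
      natSpan_le fun x hx y _ => h1 x hx y
    exact hle (oddPart_le hK' k hx.2)
  · refine zero_add k ▸ XTrace.etaSum_mem (t := polyTrace R) (Y := oddPart J) _ hu hδ
      derivative_restrictScalars_mul (derivative_polyHom_ι f₀ f₁) (fun k x hx => ?_)
      (fun k x hx y => ?_) (fun k x hx y hy => ?_) k hx.1 0
      ((polyFiltered (powFiltered hJ)).zero ▸ trivial)
    · rw [mem_polyFiltered] at hx ⊢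
      intro m
      change (derivative x).coeff m ∈ _
      rw [coeff_derivative, ← Nat.cast_add_one, ← Nat.cast_comm, ← nsmul_eq_mul]
      exact nsmul_mem (hx _) _
    · exact htr₁ _ _ _ fun m l => Submodule.mem_sup_left (mem_natSpan_top (mem_polyFiltered.1 hx m) _)
    · refine htr₁ _ _ _ fun m l => ?_
      rw [natD_snd]
      exact natD_mem_oddPart hJ rfl (mem_polyFiltered.1 hx m) (powPlus_snd (mem_polyFiltered.1 hy l))

end Homotopy

/-! ### Words with commutators -/

section Hits

set_option linter.unusedSectionVars false

open Polynomial

variable {𝔄 M Z A : Type*} [Ring 𝔄] [Algebra ℂ 𝔄] [AddCommGroup M] [Module ℂ M]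
    [AddCommGroup Z] [Module ℂ Z] [NonUnitalRing A] [Module ℂ A]

/-- The commutator `∇ a = [F, L a]`. -/
def nab (F : 𝔄) (L : A →ₗ[ℂ] 𝔄) : A →ₗ[ℂ] 𝔄 :=
  (LinearMap.mulLeft ℂ F - LinearMap.mulRight ℂ F) ∘ₗ L

theorem nab_apply (F : 𝔄) (L : A →ₗ[ℂ] 𝔄) (a : A) : nab F L a = F * L a - L a * F := rfl

variable (F : 𝔄) (L : A →ₗ[ℂ] 𝔄)

/-- The homomorphism sending `a` to `L a + X ∇ a`. -/
def uX : TensorAlgebra ℂ A →ₐ[ℂ] 𝔄[X] := linPoly L (nab F L)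

/-- The homomorphism sending `a` to `L a - X ∇ a`. -/
def vX : TensorAlgebra ℂ A →ₐ[ℂ] 𝔄[X] := linPoly L (-nab F L)

/-- The sum of the words obtained by replacing `m` letters `a` of a word by `∇ a`. -/
def hit (m : ℕ) : TensorAlgebra ℂ A →ₗ[ℂ] 𝔄 :=
  (lcoeff 𝔄 m).restrictScalars ℂ ∘ₗ (uX F L).toLinearMap

theorem hit_apply (m : ℕ) (x : TensorAlgebra ℂ A) : hit F L m x = (uX F L x).coeff m := rfl

theorem uX_ι (a : A) : uX F L (TensorAlgebra.ι ℂ a) = C (L a) + Polynomial.X * C (nab F L a) := by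
  rw [uX, linPoly_ι, ← monomial_zero_left, X_mul_C, C_mul_X_eq_monomial]

theorem vX_ι (a : A) : vX F L (TensorAlgebra.ι ℂ a) = C (L a) - Polynomial.X * C (nab F L a) := by
  rw [vX, linPoly_ι, ← monomial_zero_left, X_mul_C, C_mul_X_eq_monomial, LinearMap.neg_apply,
    map_neg, sub_eq_add_neg]

variable {F L}

theorem F_nab (hF : F * F = 1) (a : A) : F * nab F L a = -(nab F L a * F) := by
  rw [nab_apply, mul_sub, sub_mul, ← mul_assoc, hF, mul_assoc (L a), hF]
  simp [mul_assoc]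

/-- The homomorphism `vX` is `uX` with X replaced by -X. -/
theorem vX_coeff (x : TensorAlgebra ℂ A) (m : ℕ) : (vX F L x).coeff m = (-1) ^ m * hit F L m x := by
  induction x using word_induction with
  | hw l =>
    rw [hit_apply]
    induction l generalizing m with
    | nil =>
      simp only [word_nil, map_one, coeff_one]
      split_ifs with h
      · simp [h]
      · simp
    | cons a l ih =>
      simp only [word_cons, map_mul, vX_ι, uX_ι, add_mul, sub_mul, coeff_add, coeff_sub, mul_assoc,
        coeff_C_mul, ih]
      cases m with
      | zero => simp
      | succ m =>
        simp only [coeff_X_mul, coeff_C_mul, ih, pow_succ]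
        rcases neg_one_pow_eq_or 𝔄 m with h | h <;> rw [h] <;> noncomm_ring
  | hadd x y hx hy => simp only [map_add, coeff_add, hx, hy, mul_add]
  | hsmul c x hx => simp [hx]

/-- On a letter, F u(a) - v(a) F = ∇a because F anticommutes with ∇a, while u(a) - v(a) = 2X ∇a.
Both x ↦ F u(x) - v(x) F and x ↦ u(x) - v(x) are twisted derivations, δ(xy) = δ(x) u(y) + v(x) δ(y),
so the identity spreads to words. Its coefficients are the commutation relations of F with the Pₖ.
-/
theorem two_X_F (hF : F * F = 1) (x : TensorAlgebra ℂ A) :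
    2 * Polynomial.X * (C F * uX F L x - vX F L x * C F) = uX F L x - vX F L x := by
  induction x using word_induction with
  | hw l =>
    induction l with
    | nil => simp
    | cons a l ih =>
      have h1 : 2 * Polynomial.X * (C F * uX F L (TensorAlgebra.ι ℂ a) - vX F L (TensorAlgebra.ι ℂ a) * C F) =
          uX F L (TensorAlgebra.ι ℂ a) - vX F L (TensorAlgebra.ι ℂ a) := by
        rw [uX_ι, vX_ι]
        have e : C F * (C (L a) + Polynomial.X * C (nab F L a)) - (C (L a) - Polynomial.X * C (nab F L a)) * C F =
            C (nab F L a) := by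
          have h2 : C F * C (nab F L a) = -(C (nab F L a) * C F) := by
            rw [← C_mul, F_nab hF, C_neg, C_mul]
          have h3 : C F * C (L a) = C (nab F L a) + C (L a) * C F := by
            rw [← C_mul, ← C_mul, ← C_add, nab_apply, sub_add_cancel]
          rw [mul_add, sub_mul, h3, ← mul_assoc, ← X_mul_C, mul_assoc, h2]
          noncomm_ring
        rw [e]
        noncomm_ring
      rw [word_cons, map_mul, map_mul]
      generalize uX F L (TensorAlgebra.ι ℂ a) = u at *
      generalize vX F L (TensorAlgebra.ι ℂ a) = v at *
      generalize uX F L (word l) = p at *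
      generalize vX F L (word l) = q at *
      have hX : ∀ y : 𝔄[X], y * (2 * Polynomial.X) = 2 * Polynomial.X * y := by
        intro y
        rw [two_mul, mul_add, add_mul, X_mul]
      calc 2 * Polynomial.X * (C F * (u * p) - v * q * C F) =
          2 * Polynomial.X * (C F * u - v * C F) * p + v * (2 * Polynomial.X * (C F * p - q * C F)) := by
            rw [← mul_assoc v, hX v]; noncomm_ring
        _ = _ := by rw [h1, ih]; noncomm_ring
  | hadd x y hx hy =>
    have := congrArg₂ (· + ·) hx hy
    simp only [map_add]
    rw [add_sub_add_comm, ← this]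
    simp only [mul_add, add_mul, mul_sub]
    abel
  | hsmul c x hx => 
    simp only [map_smul, ← smul_sub, ← hx]; simp [mul_sub, smul_sub]

/-- The coefficient of `X ^ k` of the extension of a trace to polynomials. -/
def XTrace.coeff (t : XTrace 𝔄 M Z) (k : ℕ) : XTrace 𝔄[X] M Z where
  b := t.b
  d := t.d
  tr := t.tr ∘ₗ (lcoeff 𝔄 k).restrictScalars ℂ
  tr₁ := ∑ p ∈ Finset.HasAntidiagonal.antidiagonal k, t.tr₁.compl₁₂ ((lcoeff 𝔄 p.1).restrictScalars ℂ)
    ((lcoeff 𝔄 p.2).restrictScalars ℂ)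
  b_tr₁ x y := by
    simp only [LinearMap.sum_apply, LinearMap.compl₁₂_apply, LinearMap.comp_apply,
      LinearMap.restrictScalars_apply, lcoeff_apply, map_sum, t.b_tr₁, Finset.sum_sub_distrib]
    rw [coeff_mul, coeff_mul, map_sum, map_sum]
    congr 1
    rw [← Finset.Nat.sum_antidiagonal_swap]
    rfl
  tr₁_mul x y z := by
    have key : ∀ m l (x y : 𝔄), (∑ p ∈ Finset.HasAntidiagonal.antidiagonal k,
        t.tr₁ ((monomial m x).coeff p.1) ((monomial l y).coeff p.2)) =
          if m + l = k then t.tr₁ x y else 0 := by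
      intro m l x y
      simp only [coeff_monomial]
      split_ifs with h
      · rw [Finset.sum_eq_single (m, l)]
        · simp
        · rintro ⟨i, j⟩ hij hne
          rw [Finset.HasAntidiagonal.mem_antidiagonal] at hij
          by_cases hi : m = i
          · have : l ≠ j := by
              rintro rfl
              exact hne (by rw [hi])
            simp [this]
          · simp [hi]
        · intro hn
          exact absurd (Finset.HasAntidiagonal.mem_antidiagonal.2 h) hn
      · refine Finset.sum_eq_zero fun p hp => ?_
        rw [Finset.HasAntidiagonal.mem_antidiagonal] at hp
        by_cases hi : m = p.1
        · have : l ≠ p.2 := by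
            rintro rfl
            exact h (by rw [hi, hp])
          simp [this]
        · simp [hi]
    simp only [LinearMap.sum_apply, LinearMap.compl₁₂_apply, LinearMap.restrictScalars_apply,
      lcoeff_apply]
    induction x using Polynomial.induction_on' with
    | add x z hx hz =>
      simp only [add_mul, mul_add, coeff_add, map_add, LinearMap.add_apply, Finset.sum_add_distrib,
        hx, hz]
      abel
    | monomial m x =>
      induction y using Polynomial.induction_on' with
      | add x z hx hz =>
        simp only [add_mul, mul_add, coeff_add, map_add, LinearMap.add_apply,
          Finset.sum_add_distrib, hx, hz]
        abel
      | monomial l y =>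
        induction z using Polynomial.induction_on' with
        | add x z hx hz =>
          simp only [add_mul, mul_add, coeff_add, map_add, LinearMap.add_apply,
            Finset.sum_add_distrib, hx, hz]
          abel
        | monomial r z =>
          simp only [monomial_mul_monomial, key]
          rw [show r + m + l = m + (l + r) by omega, ← add_assoc m l r, t.tr₁_mul]
          split_ifs <;> simp
  d_tr x := by
    simp only [LinearMap.sum_apply, LinearMap.compl₁₂_apply, LinearMap.comp_apply,
      LinearMap.restrictScalars_apply, lcoeff_apply, t.d_tr]
    rw [Finset.sum_eq_single (0, k)]
    · simp
    · rintro ⟨i, j⟩ hij hne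
      rw [Finset.HasAntidiagonal.mem_antidiagonal] at hij
      have : i ≠ 0 := by
        rintro rfl
        exact hne (by rw [← hij]; simp)
      simp [coeff_one, this]
    · intro hn
      exact absurd (Finset.HasAntidiagonal.mem_antidiagonal.2 (zero_add k)) hn

theorem XTrace.coeff_tr₁_C_add (t : XTrace 𝔄 M Z) (k : ℕ) (y : 𝔄[X]) (a b : 𝔄) :
    (t.coeff k).tr₁ y (C a + Polynomial.X * C b) =
      t.tr₁ (y.coeff k) a + t.tr₁ ((Polynomial.X * y).coeff k) b := by
  have hC : ∀ (k : ℕ) (y : 𝔄[X]) (a : 𝔄), (t.coeff k).tr₁ y (C a) = t.tr₁ (y.coeff k) a := by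
    intro k y a
    simp only [XTrace.coeff, LinearMap.sum_apply, LinearMap.compl₁₂_apply,
      LinearMap.restrictScalars_apply, lcoeff_apply]
    rw [Finset.sum_eq_single (k, 0)]
    · simp
    · rintro ⟨i, j⟩ hij hne
      rw [Finset.HasAntidiagonal.mem_antidiagonal] at hij
      have : j ≠ 0 := by
        rintro rfl
        exact hne (by rw [← hij]; simp)
      simp [coeff_C, this]
    · intro hn
      exact absurd (Finset.HasAntidiagonal.mem_antidiagonal.2 (add_zero k)) hn
  have hX : ∀ (k : ℕ) (y : 𝔄[X]), (t.coeff k).tr₁ y Polynomial.X = 0 := by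
    intro k y
    simp only [XTrace.coeff, LinearMap.sum_apply, LinearMap.compl₁₂_apply,
      LinearMap.restrictScalars_apply, lcoeff_apply]
    refine Finset.sum_eq_zero fun p _ => ?_
    rw [coeff_X]
    split_ifs
    · exact t.tr₁_one_right _
    · simp
  rw [map_add, hC, XTrace.tr₁_mul, hC, hX, add_zero, X_mul]

/-- The trace `tr₁` of a word, expanded over its letters. -/
theorem XTrace.tr₁_word (t : XTrace 𝔄 M Z) (u : TensorAlgebra ℂ A →ₐ[ℂ] 𝔄) (y : 𝔄) (l : List A) :
    t.tr₁ y (u (word l)) =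
      lsum (fun z b w => t.tr₁ (u (word w) * y * u (word z)) (u (TensorAlgebra.ι ℂ b))) l := by
  induction l generalizing y with
  | nil => simp [t.tr₁_one_right]
  | cons a l ih =>
    rw [word_cons, map_mul, t.tr₁_mul, ih, lsum_cons, add_comm]
    simp [mul_assoc]

/-- D stands for 2X, the letters p, q for the values of u on two words and p', q' for those of v.
Moving F past a factor exchanges u and v at the cost of a term without F, and two copies of F that
meet cancel. -/
theorem central_identity {𝔅 : Type*} [Ring 𝔅] {D F p p' q q' : 𝔅} (hD : ∀ y, y * D = D * y)
    (hF : F * F = 1) (hp : D * (F * p - p' * F) = p - p') 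
    (hq' : D * (F * q' - q * F) = q - q') :
    2 * D * (p * F * q) - D * (F * p * q) - D * (p * q * F) + D * D * (p * F * q * F - F * p * F * q) =
      p' * q - p * q' - D * D * (p' * q - p * q') := by
  have e1 : D * D * (F * p * F * q) = D * ((p - p') * F * q) + D * D * (p' * q) := by
    have : D * D * (F * p * F * q) = D * (D * (F * p - p' * F) * F * q) + D * D * (p' * (F * F) * q) := by
      noncomm_ring
    rw [this, hp, hF, mul_one]
  have e2 : D * D * (p * F * q * F) = D * D * (p * q') - D * (p * F * (q - q')) := by
    have : D * D * (p * F * q * F) = D * D * (p * (F * F) * q') - D * (D * (p * F * (F * q' - q * F))) := by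
      noncomm_ring
    rw [this, hF, mul_one, ← hq', ← mul_assoc (p * F) D, hD (p * F), mul_assoc D (p * F)]
  have e3 : D * (F * p * q) = (p - p') * q + D * (p' * F * q) := by
    rw [← hp]; noncomm_ring
  have e4 : D * (p * q * F) = D * (p * F * q') - p * (q - q') := by
    rw [← hq', ← mul_assoc p, hD]; noncomm_ring
  rw [mul_sub (D * D) (p * F * q * F), e1, e2, e3, e4]
  noncomm_ring

theorem two_X_comm (y : 𝔄[X]) : y * (2 * Polynomial.X) = 2 * Polynomial.X * y := by
  rw [two_mul, mul_add, add_mul, X_mul]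

theorem coeff_two_X (y : 𝔄[X]) (k : ℕ) :
    (2 * Polynomial.X * y).coeff (k + 1) = (2 : ℂ) • y.coeff k := by
  rw [mul_assoc, two_mul, coeff_add, coeff_X_mul, two_smul]

/-- The coefficient of X^{k+1} in `two_X_F`; for odd k the right side of that identity has no such
coefficient, which gives the next relation. -/
theorem hit_succ_of_even (hF : F * F = 1) {k : ℕ} (hk : Even k) (x : TensorAlgebra ℂ A) :
    F * hit F L k x = hit F L k x * F + hit F L (k + 1) x := by
  have h := congrArg (fun y : 𝔄[X] => y.coeff (k + 1)) (two_X_F (L := L) hF x)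
  simp only [coeff_two_X, coeff_sub, coeff_C_mul, coeff_mul_C, vX_coeff, hk.neg_one_pow,
    hk.add_one.neg_one_pow, one_mul, neg_one_mul, ← hit_apply, sub_neg_eq_add] at h
  rw [← two_smul ℂ] at h
  have := smul_right_injective 𝔄 (two_ne_zero : (2 : ℂ) ≠ 0) h
  rw [← this, add_sub_cancel]

theorem hit_comm_of_odd (hF : F * F = 1) {k : ℕ} (hk : Odd k) (x : TensorAlgebra ℂ A) :
    F * hit F L k x = -(hit F L k x * F) := by
  have h := congrArg (fun y : 𝔄[X] => y.coeff (k + 1)) (two_X_F (L := L) hF x)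
  simp only [coeff_two_X, coeff_sub, coeff_C_mul, coeff_mul_C, vX_coeff, hk.neg_one_pow,
    hk.add_one.neg_one_pow, one_mul, ← hit_apply, sub_neg_eq_add, neg_mul, sub_self] at h
  have := (smul_eq_zero.1 h).resolve_left two_ne_zero
  exact eq_neg_of_add_eq_zero_left this

theorem coeff_vX_mul (x y : TensorAlgebra ℂ A) (c : 𝔄) (k : ℕ) :
    (uX F L x * C c * vX F L y).coeff k = (-1) ^ k * (vX F L x * C c * uX F L y).coeff k := by
  rw [coeff_mul, coeff_mul (vX F L x * C c), Finset.mul_sum]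
  refine Finset.sum_congr rfl fun p hp => ?_
  rw [coeff_mul_C, coeff_mul_C]
  rw [Finset.HasAntidiagonal.mem_antidiagonal] at hp
  rw [vX_coeff, vX_coeff, hit_apply, hit_apply, ← hp, pow_add]
  rcases neg_one_pow_eq_or 𝔄 p.1 with h | h <;> rcases neg_one_pow_eq_or 𝔄 p.2 with h' | h' <;>
    rw [h, h'] <;> noncomm_ring

/-- A quarter of the coefficient of X^{k+1} in `central_identity`. The left side is what one marked
letter contributes to d(tr F Pₖ) minus the odd component. -/
theorem coeff_identity (hF : F * F = 1) {k : ℕ} (hk : Even k) (x y : TensorAlgebra ℂ A) :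
    (uX F L x * C F * uX F L y).coeff k +
      ((Polynomial.X * (uX F L x * C F * uX F L y)).coeff k * F -
        F * (Polynomial.X * (uX F L x * C F * uX F L y)).coeff k) -
      (2⁻¹ : ℂ) • (F * (uX F L x * uX F L y).coeff k + (uX F L x * uX F L y).coeff k * F) =
    (2⁻¹ : ℂ) • (vX F L x * uX F L y).coeff (k + 1) -
      (2 : ℂ) • (Polynomial.X * (vX F L x * uX F L y)).coeff k := by
  -- Replacing F by -F changes the sign of ∇, hence exchanges u and v.
  have hneg : ∀ y : TensorAlgebra ℂ A, 2 * Polynomial.X * (C F * vX F L y - uX F L y * C F) =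
      uX F L y - vX F L y := by
    intro y
    have h1 := two_X_F (F := -F) (L := L) (by rw [neg_mul_neg, hF]) y
    have e : nab (-F) L = -nab F L := by
      ext a
      simp only [nab_apply, LinearMap.neg_apply]
      noncomm_ring
    have e1 : uX (-F) L = vX F L := by rw [uX, vX, e]
    have e2 : vX (-F) L = uX F L := by rw [uX, vX, e, neg_neg]
    rw [e1, e2, C_neg] at h1
    rw [← neg_inj, neg_sub, ← h1]
    noncomm_ring
  have h := central_identity two_X_comm (by rw [← C_mul, hF, C_1]) (two_X_F (L := L) hF x) (hneg y)
  have hX : ∀ y : 𝔄[X], (2 * Polynomial.X * (2 * Polynomial.X) * y).coeff (k + 1) =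
      (4 : ℂ) • (Polynomial.X * y).coeff k := by
    intro y
    rw [mul_assoc, coeff_two_X, mul_assoc 2, two_mul, coeff_add, ← two_smul ℂ, smul_smul]
    norm_num
  have hX' : ∀ y : 𝔄[X], (2 * (2 * Polynomial.X) * y).coeff (k + 1) = (4 : ℂ) • y.coeff k := by
    intro y
    rw [two_mul (2 * Polynomial.X), add_mul, coeff_add, coeff_two_X]
    module
  have hv : ∀ m, (uX F L x * vX F L y).coeff m = (-1) ^ m * (vX F L x * uX F L y).coeff m := by
    intro m
    have := coeff_vX_mul (F := F) (L := L) x y 1 m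
    simpa using this
  have h := congrArg (fun y : 𝔄[X] => y.coeff (k + 1)) h
  simp only [coeff_sub, coeff_add, hX, hX', coeff_two_X] at h
  simp only [mul_sub Polynomial.X, coeff_sub] at h
  have e1 : ∀ y : 𝔄[X], (Polynomial.X * (y * C F)).coeff k = (Polynomial.X * y).coeff k * F := by
    intro y; rw [← mul_assoc, coeff_mul_C]
  have e2 : (C F * uX F L x * uX F L y).coeff k = F * (uX F L x * uX F L y).coeff k := by
    rw [mul_assoc, coeff_C_mul]
  have e3 : (Polynomial.X * (C F * uX F L x * C F * uX F L y)).coeff k =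
      F * (Polynomial.X * (uX F L x * C F * uX F L y)).coeff k := by
    rw [← coeff_C_mul, mul_assoc, mul_assoc, ← mul_assoc, X_mul_C, mul_assoc, mul_assoc]
  -- Multiplication by X selects the coefficient of index k - 1, which is odd, and nothing when k =
  -- 0.
  have e4 : (Polynomial.X * (uX F L x * vX F L y)).coeff k =
      -(Polynomial.X * (vX F L x * uX F L y)).coeff k := by
    cases k with
    | zero => simp
    | succ k =>
      rw [coeff_X_mul, coeff_X_mul, hv, (Nat.even_add_one.1 hk |> Nat.not_even_iff_odd.1).neg_one_pow,
        neg_one_mul]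
  rw [e1, e2, e3, e4, hv, hk.add_one.neg_one_pow, coeff_mul_C, neg_one_mul] at h
  linear_combination (norm := module) (4⁻¹ : ℂ) • h

/-- The sum of `tr₁ Y (L b)` over the decompositions `z b w` of a word, where `Y` is the sum of the
products `(-1) ^ r w' c z'` in which `r` letters of `w` and `m - r` letters of `z` have been
replaced by commutators. -/
def XTrace.gSum (t : XTrace 𝔄 M Z) (F : 𝔄) (L : A →ₗ[ℂ] 𝔄) (m : ℕ) (c : 𝔄) (l : List A) : Z :=
  lsum (fun z b w => t.tr₁ ((vX F L (word w) * C c * uX F L (word z)).coeff m) (L b)) l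

/-- The map `♮ x da ↦ tr₁ (½ (F Pₖ(x) + Pₖ(x) F)) a`. -/
def XTrace.hitOne (t : XTrace 𝔄 M Z) (F : 𝔄) (L : A →ₗ[ℂ] 𝔄) (k : ℕ) : OmNat (T A) →ₗ[ℂ] Z :=
  omLift (t.tr₁.compl₁₂ ((2⁻¹ : ℂ) • (LinearMap.mulLeft ℂ F + LinearMap.mulRight ℂ F) ∘ₗ hit F L k) L)

/-- The map `w ↦ tr (F Pₖ(w))`. -/
def XTrace.hitZero (t : XTrace 𝔄 M Z) (F : 𝔄) (L : A →ₗ[ℂ] 𝔄) (k : ℕ) : TensorAlgebra ℂ A →ₗ[ℂ] M :=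
  t.tr ∘ₗ LinearMap.mulLeft ℂ F ∘ₗ hit F L k

variable {t : XTrace 𝔄 M Z}

theorem XTrace.hitOne_natD (k : ℕ) (x : TensorAlgebra ℂ A) (a : A) :
    t.hitOne F L k (natD (ofW A x) (T.ι A a : U (T A))) =
      t.tr₁ ((2⁻¹ : ℂ) • (F * hit F L k x + hit F L k x * F)) (L a) := by
  simp [XTrace.hitOne]

theorem XTrace.hitOne_d_word (k : ℕ) (l : List A) :
    t.hitOne F L k (natD 1 (ofW A (word l))) = lsum (fun z b w =>
      t.tr₁ ((2⁻¹ : ℂ) • (F * hit F L k (word w * word z) + hit F L k (word w * word z) * F)) (L b)) l := by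
  rw [XTrace.hitOne, omLift_d_word]
  simp

theorem XTrace.hitZero_apply (k : ℕ) (x : TensorAlgebra ℂ A) :
    t.hitZero F L k x = t.tr (F * hit F L k x) := rfl

theorem XTrace.tr_comm (hT : ∀ y, t.tr₁ y F = 0) (y : 𝔄) : t.tr (y * F) = t.tr (F * y) := by
  have := t.b_tr₁ y F
  rw [hT, map_zero] at this
  exact (sub_eq_zero.1 this.symm)

theorem XTrace.tr₁_nab (hT : ∀ y, t.tr₁ y F = 0) (y : 𝔄) (a : A) :
    t.tr₁ y (nab F L a) = t.tr₁ (y * F - F * y) (L a) := by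
  rw [nab_apply, map_sub, t.tr₁_mul, t.tr₁_mul, hT, hT, map_sub, LinearMap.sub_apply]
  abel

/-- Since dF = 0, one has d tr(F u(l)) = tr₁(F, u(l)), and tr₁(y, ∇b) = tr₁(yF - Fy, b). Expanding
over the letters reduces the claim to `coeff_identity`. The shape ½ G_{k+1} - 2 G_{k-1} of the
result, with G = `XTrace.gSum`, is what dictates the weights 4^{-i}. -/
theorem XTrace.hit_even (hF : F * F = 1) (hT : ∀ y, t.tr₁ y F = 0) {k : ℕ} (hk : Even k)
    (l : List A) :
    t.d (t.hitZero F L k (word l)) - t.hitOne F L k (natD 1 (ofW A (word l))) =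
      (2⁻¹ : ℂ) • t.gSum F L (k + 1) 1 l - (2 : ℂ) • lsum (fun z b w =>
        t.tr₁ ((Polynomial.X * (vX F L (word w) * uX F L (word z))).coeff k) (L b)) l := by
  have hCF : ∀ y : 𝔄[X], (t.coeff k).tr₁ y (C F) = 0 := by
    intro y
    have := t.coeff_tr₁_C_add k y F 0
    simpa [hT] using this
  have h1 : t.d (t.hitZero F L k (word l)) = (t.coeff k).tr₁ (C F) (uX F L (word l)) := by
    have h2 := (t.coeff k).d_tr (C F * uX F L (word l))
    rw [(t.coeff k).tr₁_mul, hCF, one_mul, add_zero] at h2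
    rw [← h2, XTrace.hitZero_apply, hit_apply, ← coeff_C_mul]
    rfl
  rw [h1, XTrace.tr₁_word, XTrace.hitOne_d_word, XTrace.gSum, ← lsum_smul, ← lsum_smul, ← lsum_sub,
    ← lsum_sub]
  refine lsum_congr fun z b w _ => ?_
  rw [uX_ι, XTrace.coeff_tr₁_C_add, XTrace.tr₁_nab hT]
  have key := congrArg (fun y => t.tr₁ y (L b)) (coeff_identity (L := L) hF hk (word w) (word z))
  simp only [map_add, map_sub, map_smul, LinearMap.add_apply, LinearMap.sub_apply,
    LinearMap.smul_apply] at key ⊢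
  rw [hit_apply, map_mul (uX F L), C_1, mul_one]
  exact key

/-- Only cyclicity, tr(yF) = tr(Fy), and the commutation relations of F with the Pₖ are used. Up to
sign the result has the shape ½(·)_{k+1} - 2(·)_{k-1} again, so the same weights make it telescope.
-/
theorem XTrace.hit_odd (hF : F * F = 1) (hT : ∀ y, t.tr₁ y F = 0) {k : ℕ} (hk : Even k)
    (l : List A) (a : A) :
    t.b (t.hitOne F L k (natD (ofW A (word l)) (T.ι A a : U (T A)))) -
        t.hitZero F L k (word (l ++ [a]) - word (a :: l)) =
      -((2⁻¹ : ℂ) • t.tr (hit F L (k + 1) (word l) * L a + L a * hit F L (k + 1) (word l))) +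
        (2 : ℂ) • t.tr ((Polynomial.X * uX F L (word l)).coeff k * L a +
          L a * (Polynomial.X * uX F L (word l)).coeff k) := by
  have h1 : hit F L k (word (l ++ [a])) = hit F L k (word l) * L a +
      (Polynomial.X * uX F L (word l)).coeff k * nab F L a := by
    rw [hit_apply, word_append, map_mul, word_cons, word_nil, mul_one, uX_ι, mul_add, coeff_add,
      ← mul_assoc, ← X_mul, coeff_mul_C, coeff_mul_C]
    rfl
  have h2 : hit F L k (word (a :: l)) = L a * hit F L k (word l) +
      nab F L a * (Polynomial.X * uX F L (word l)).coeff k := by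
    rw [hit_apply, word_cons, map_mul, uX_ι, add_mul, coeff_add, X_mul_C, mul_assoc, coeff_C_mul,
      coeff_C_mul]
    rfl
  -- This coefficient is P_{k-1} of the word, with k - 1 odd, or zero if k = 0.
  have h3 : F * (Polynomial.X * uX F L (word l)).coeff k =
      -((Polynomial.X * uX F L (word l)).coeff k * F) := by
    cases k with
    | zero => simp
    | succ k =>
      rw [coeff_X_mul]
      exact hit_comm_of_odd hF (Nat.not_even_iff_odd.1 (Nat.even_add_one.1 hk)) _
  rw [XTrace.hitOne_natD, map_sub, XTrace.hitZero_apply, XTrace.hitZero_apply, h1, h2, t.b_tr₁]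
  have h4 := hit_succ_of_even (L := L) hF hk (word l)
  generalize hit F L k (word l) = p at *
  generalize hit F L (k + 1) (word l) = r at *
  generalize (Polynomial.X * uX F L (word l)).coeff k = q at *
  have hr : r = F * p - p * F := by rw [h4]; abel
  have c := t.tr_comm hT
  have e1 : F * (q * nab F L a) = F * (q * (F * L a)) - F * (q * (L a * F)) := by
    rw [nab_apply]; noncomm_ring
  have e2 : t.tr (F * (q * nab F L a)) = -((2 : ℂ) • t.tr (q * L a)) := by
    have i1 : F * (q * (F * L a)) = -(q * L a) := by
      rw [← mul_assoc, h3, neg_mul, mul_assoc, ← mul_assoc F, hF, one_mul]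
    have i2 : t.tr (F * (q * (L a * F))) = t.tr (q * L a) := by
      rw [← c, mul_assoc, mul_assoc, hF, mul_one]
    rw [e1, map_sub, i1, i2, map_neg]
    module
  have e3 : t.tr (F * (nab F L a * q)) = (2 : ℂ) • t.tr (L a * q) := by
    have i1 : F * (nab F L a * q) = L a * q + F * L a * (q * F) := by
      rw [← neg_neg (q * F), ← h3, nab_apply, sub_mul, mul_sub, mul_assoc F (L a), ← mul_assoc F F, hF]
      noncomm_ring
    have i2 : t.tr (F * L a * (q * F)) = t.tr (L a * q) := by
      rw [← mul_assoc, c, ← mul_assoc, ← mul_assoc, hF, one_mul]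
    rw [i1, map_add, i2]
    module
  have e4 : t.tr (p * (F * L a)) = t.tr (F * (p * L a)) - t.tr (r * L a) := by
    rw [← map_sub, hr]; congr 1; noncomm_ring
  have e5 : t.tr (L a * (p * F)) = t.tr (F * (L a * p)) := by
    rw [← mul_assoc, c]
  have e6 : t.tr (L a * (F * p)) = t.tr (F * (L a * p)) + t.tr (L a * r) := by
    rw [← e5, ← map_add, hr]; congr 1; noncomm_ring
  simp only [smul_mul_assoc, mul_smul_comm, map_smul, add_mul, mul_add, map_add, e2, e3, e4, e5, e6,
    mul_assoc, smul_add, smul_sub]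
  module

/-- The even component of the homotopy which raises the number of commutators. -/
def XTrace.hitZeroSum (t : XTrace 𝔄 M Z) (F : 𝔄) (L : A →ₗ[ℂ] 𝔄) (j : ℕ) :
    TensorAlgebra ℂ A →ₗ[ℂ] M :=
  ∑ i ∈ Finset.range (j + 1), (4⁻¹ : ℂ) ^ i • t.hitZero F L (2 * i)

/-- The odd component of the homotopy which raises the number of commutators. -/
def XTrace.hitOneSum (t : XTrace 𝔄 M Z) (F : 𝔄) (L : A →ₗ[ℂ] 𝔄) (j : ℕ) : OmNat (T A) →ₗ[ℂ] Z :=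
  ∑ i ∈ Finset.range (j + 1), (4⁻¹ : ℂ) ^ i • t.hitOne F L (2 * i)

theorem XTrace.hitZeroSum_succ (j : ℕ) : t.hitZeroSum F L (j + 1) = t.hitZeroSum F L j +
    (4⁻¹ : ℂ) ^ (j + 1) • t.hitZero F L (2 * (j + 1)) := Finset.sum_range_succ _ _

theorem XTrace.hitOneSum_succ (j : ℕ) : t.hitOneSum F L (j + 1) = t.hitOneSum F L j +
    (4⁻¹ : ℂ) ^ (j + 1) • t.hitOne F L (2 * (j + 1)) := Finset.sum_range_succ _ _

/-- The term ½·4^{-i} G_{2i+1} coming from index i cancels the term -2·4^{-(i+1)} G_{2i+1} coming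
from index i + 1, and only the top one survives. -/
theorem XTrace.hitSum_even (hF : F * F = 1) (hT : ∀ y, t.tr₁ y F = 0) (j : ℕ) (l : List A) :
    t.d (t.hitZeroSum F L j (word l)) - t.hitOneSum F L j (natD 1 (ofW A (word l))) =
      ((2⁻¹ : ℂ) * (4⁻¹ : ℂ) ^ j) • t.gSum F L (2 * j + 1) 1 l := by
  induction j with
  | zero =>
    have := XTrace.hit_even (L := L) hF hT (k := 0) (by simp) l
    simp only [XTrace.hitZeroSum, XTrace.hitOneSum]
    simp [this, lsum_zero]
  | succ j ih =>
    have := XTrace.hit_even (L := L) hF hT (k := 2 * (j + 1)) (by simp) l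
    rw [XTrace.hitZeroSum_succ, XTrace.hitOneSum_succ, LinearMap.add_apply, LinearMap.add_apply, map_add,
      add_sub_add_comm, ih, LinearMap.smul_apply, LinearMap.smul_apply, map_smul, ← smul_sub, this]
    have e : lsum (fun z b w => t.tr₁ ((Polynomial.X * (vX F L (word w) * uX F L (word z))).coeff
        (2 * (j + 1))) (L b)) l = t.gSum F L (2 * j + 1) 1 l := by
      rw [XTrace.gSum]
      refine lsum_congr fun z b w _ => ?_
      rw [show 2 * (j + 1) = 2 * j + 1 + 1 by ring, coeff_X_mul, C_1, mul_one]
    rw [e, pow_succ]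
    module

theorem XTrace.hitSum_odd (hF : F * F = 1) (hT : ∀ y, t.tr₁ y F = 0) (j : ℕ) (l : List A) (a : A) :
    t.b (t.hitOneSum F L j (natD (ofW A (word l)) (T.ι A a : U (T A)))) -
        t.hitZeroSum F L j (word (l ++ [a]) - word (a :: l)) =
      -((2⁻¹ : ℂ) * (4⁻¹ : ℂ) ^ j) • t.tr (hit F L (2 * j + 1) (word l) * L a +
        L a * hit F L (2 * j + 1) (word l)) := by
  induction j with
  | zero =>
    have := XTrace.hit_odd (L := L) hF hT (k := 0) (by simp) l a
    simp only [XTrace.hitZeroSum, XTrace.hitOneSum]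
    simp only [zero_add, Finset.range_one, Finset.sum_singleton, pow_zero, mul_zero, one_smul] at this ⊢
    rw [this]
    simp [add_comm]
  | succ j ih =>
    have := XTrace.hit_odd (L := L) hF hT (k := 2 * (j + 1)) (by simp) l a
    rw [XTrace.hitZeroSum_succ, XTrace.hitOneSum_succ, LinearMap.add_apply, LinearMap.add_apply, map_add,
      add_sub_add_comm, ih, LinearMap.smul_apply, LinearMap.smul_apply, map_smul, ← smul_sub, this,
      show 2 * (j + 1) = 2 * j + 1 + 1 by ring, coeff_X_mul, ← hit_apply, pow_succ]
    module

/-- The chain map defined by a trace and a homomorphism on `TA`, in odd degree. -/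
def XTrace.chainOne (t : XTrace 𝔄 M Z) (u : TensorAlgebra ℂ A →ₐ[ℂ] 𝔄) : OmNat (T A) →ₗ[ℂ] Z :=
  omLift (t.tr₁.compl₁₂ u.toLinearMap (u.toLinearMap ∘ₗ TensorAlgebra.ι ℂ))

theorem XTrace.chain_even (u : TensorAlgebra ℂ A →ₐ[ℂ] 𝔄) (l : List A) :
    t.chainOne u (natD 1 (ofW A (word l))) = t.d (t.tr (u (word l))) := by
  rw [t.d_tr, t.tr₁_word, XTrace.chainOne, omLift_d_word]
  simp

theorem XTrace.chain_odd (u : TensorAlgebra ℂ A →ₐ[ℂ] 𝔄) (l : List A) (a : A) :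
    t.b (t.chainOne u (natD (ofW A (word l)) (T.ι A a : U (T A)))) =
      t.tr (u (word (l ++ [a]) - word (a :: l))) := by
  rw [XTrace.chainOne, omLift_letter]
  simp [t.b_tr₁]

end Hits

/-! ### Recursions for words with commutators, and the correction term of the homotopy -/

section HitWords

set_option linter.unusedSectionVars false

open Polynomial

variable {𝔄 M Z A : Type*} [Ring 𝔄] [Algebra ℂ 𝔄] [AddCommGroup M] [Module ℂ M]
    [AddCommGroup Z] [Module ℂ Z] [NonUnitalRing A] [Module ℂ A]
variable {F : 𝔄} {L : A →ₗ[ℂ] 𝔄} {t : XTrace 𝔄 M Z}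

theorem neg_one_pow_mul (m : ℕ) (x : 𝔄) : (-1) ^ m * x = (-1 : ℂ) ^ m • x := by
  simp [Algebra.smul_def]

theorem hit_zero (x : TensorAlgebra ℂ A) : hit F L 0 x = TensorAlgebra.lift ℂ L x := by
  induction x using word_induction with
  | hw l =>
    induction l with
    | nil => simp [hit_apply]
    | cons a l ih =>
      rw [hit_apply, word_cons, map_mul, map_mul, uX_ι, add_mul, coeff_add, coeff_C_mul, mul_assoc,
        coeff_X_mul_zero, add_zero, ← hit_apply, ih, TensorAlgebra.lift_ι_apply]
  | hadd x y hx hy => simp only [map_add, hx, hy]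
  | hsmul c x hx => simp only [map_smul, hx]

@[simp] theorem hit_one_zero : hit F L 0 1 = 1 := by simp [hit_apply]

@[simp] theorem hit_one_succ (m : ℕ) : hit F L (m + 1) 1 = 0 := by simp [hit_apply, coeff_one]

theorem hit_zero_ι_mul (a : A) (x : TensorAlgebra ℂ A) :
    hit F L 0 (TensorAlgebra.ι ℂ a * x) = L a * hit F L 0 x := by
  simp [hit_zero]

theorem hit_zero_mul_ι (a : A) (x : TensorAlgebra ℂ A) :
    hit F L 0 (x * TensorAlgebra.ι ℂ a) = hit F L 0 x * L a := by
  simp [hit_zero]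

theorem hit_succ_ι_mul (m : ℕ) (a : A) (x : TensorAlgebra ℂ A) :
    hit F L (m + 1) (TensorAlgebra.ι ℂ a * x) = L a * hit F L (m + 1) x + nab F L a * hit F L m x := by
  rw [hit_apply, map_mul, uX_ι, add_mul, coeff_add, coeff_C_mul, mul_assoc, coeff_X_mul, coeff_C_mul]
  rfl

theorem hit_succ_mul_ι (m : ℕ) (a : A) (x : TensorAlgebra ℂ A) :
    hit F L (m + 1) (x * TensorAlgebra.ι ℂ a) = hit F L (m + 1) x * L a + hit F L m x * nab F L a := by
  rw [hit_apply, map_mul, uX_ι, mul_add, coeff_add, coeff_mul_C, X_mul_C, ← mul_assoc, coeff_mul_X,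
    coeff_mul_C]
  rfl

/-- The marked letter b is the one carrying commutator number m + 1, counted from the left. -/
theorem hit_split (m m' : ℕ) (l : List A) : hit F L (m + 1 + m') (word l) =
    lsum (fun z b w => hit F L m (word z) * nab F L b * hit F L m' (word w)) l := by
  induction l generalizing m with
  | nil => simp [show m + 1 + m' = m + m' + 1 by ring]
  | cons a l ih =>
    rw [lsum_cons, word_cons, show m + 1 + m' = m + m' + 1 by ring, hit_succ_ι_mul,
      show m + m' + 1 = m + 1 + m' by ring, ih]
    cases m with
    | zero =>
      simp only [word_cons, hit_zero_ι_mul, word_nil, hit_one_zero, one_mul, mul_lsum, mul_assoc,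
        zero_add]
      rw [add_comm]
    | succ m =>
      simp only [word_cons, hit_succ_ι_mul, word_nil, hit_one_succ, zero_mul, zero_add, add_mul,
        lsum_add, ih, mul_lsum, mul_assoc]

/-- The terms of `gSum`. -/
def XTrace.gTerm (t : XTrace 𝔄 M Z) (F : 𝔄) (L : A →ₗ[ℂ] 𝔄) (r s : ℕ) (c : 𝔄) (l : List A) : Z :=
  lsum (fun z b w => t.tr₁ (hit F L r (word w) * c * hit F L s (word z)) (L b)) l

theorem XTrace.gSum_eq (m : ℕ) (c : 𝔄) (l : List A) : t.gSum F L m c l =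
    ∑ p ∈ Finset.HasAntidiagonal.antidiagonal m, (-1 : ℂ) ^ p.1 • t.gTerm F L p.1 p.2 c l := by
  simp only [XTrace.gSum, XTrace.gTerm, ← lsum_smul]
  rw [← lsum_finset_sum]
  refine lsum_congr fun z b w _ => ?_
  rw [coeff_mul, map_sum, LinearMap.sum_apply]
  refine Finset.sum_congr rfl fun p _ => ?_
  rw [coeff_mul_C, vX_coeff, ← hit_apply, neg_one_pow_mul, smul_mul_assoc, smul_mul_assoc, map_smul,
    LinearMap.smul_apply]

theorem XTrace.gTerm_split_left (m r s : ℕ) (c : 𝔄) (l : List A) :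
    t.gTerm F L (r + 1 + m) s c l =
      lsum (fun z b w => t.gTerm F L r s (nab F L b * hit F L m (word w) * c) z) l := by
  simp only [XTrace.gTerm, hit_split, lsum_mul, map_lsum₂]
  rw [lsum_assoc]
  simp only [mul_assoc]

theorem XTrace.gTerm_split_right (k r s : ℕ) (c : 𝔄) (l : List A) :
    t.gTerm F L r (k + 1 + s) c l =
      lsum (fun z b w => t.gTerm F L r s (c * hit F L k (word z) * nab F L b) w) l := by
  simp only [XTrace.gTerm, hit_split, mul_lsum, map_lsum₂]
  rw [lsum_assoc]
  simp only [mul_assoc]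

theorem XTrace.gSum_zero (c : 𝔄) (l : List A) : t.gSum F L 0 c l = t.tr₁ c (hit F L 0 (word l)) := by
  rw [XTrace.gSum_eq, Finset.Nat.antidiagonal_zero, Finset.sum_singleton, pow_zero, one_smul, hit_zero,
    t.tr₁_word]
  simp [XTrace.gTerm, hit_zero]

/-- The first term collects the products without commutator in z; in the others the first commutator
of z is singled out. -/
theorem XTrace.gSum_succ (m : ℕ) (c : 𝔄) (l : List A) : t.gSum F L (m + 1) c l =
    lsum (fun z b w => (-1 : ℂ) ^ (m + 1) • t.tr₁ (hit F L (m + 1) (word w) * c * hit F L 0 (word z))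
      (L b) + t.gSum F L m (c * hit F L 0 (word z) * nab F L b) w) l := by
  rw [lsum_add, lsum_smul, XTrace.gSum_eq, Finset.Nat.sum_antidiagonal_succ']
  congr 1
  conv_rhs =>
    arg 1
    intro z b w
    rw [XTrace.gSum_eq]
  rw [lsum_finset_sum]
  refine Finset.sum_congr rfl fun p _ => ?_
  rw [lsum_smul, ← t.gTerm_split_right, zero_add, add_comm 1]

/-- The products are sorted by whether z carries none, one or more commutators. In the first case
the leading commutator of w is singled out, in the last the second commutator of z. Two commutators
are consumed at a time because a step of `tower` adds two factors. -/
theorem XTrace.gSum_succ_succ (m : ℕ) (c : 𝔄) (l : List A) : t.gSum F L (m + 2) c l =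
    lsum (fun z b w => (-1 : ℂ) ^ m • t.tr₁ (nab F L b * hit F L (m + 1) (word w) * c)
        (hit F L 0 (word z)) -
      (-1 : ℂ) ^ m • t.tr₁ (hit F L (m + 1) (word w) * c * hit F L 1 (word z)) (L b) +
      t.gSum F L m (c * hit F L 1 (word z) * nab F L b) w) l := by
  rw [lsum_add, lsum_sub, lsum_smul, lsum_smul, XTrace.gSum_eq, Finset.Nat.sum_antidiagonal_succ',
    Finset.Nat.sum_antidiagonal_succ', ← add_assoc]
  congr 1
  · have e : t.gTerm F L (m + 1 + 1) 0 c l = lsum (fun z b w =>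
        t.tr₁ (nab F L b * hit F L (m + 1) (word w) * c) (hit F L 0 (word z))) l := by
      rw [show m + 1 + 1 = 0 + 1 + (m + 1) by ring, t.gTerm_split_left]
      refine lsum_congr fun z b w _ => ?_
      rw [← XTrace.gSum_zero, XTrace.gSum_eq, Finset.Nat.antidiagonal_zero, Finset.sum_singleton, pow_zero,
        one_smul]
    rw [e, XTrace.gTerm, pow_succ, pow_succ]
    module
  · conv_rhs =>
      arg 1
      intro z b w
      rw [XTrace.gSum_eq]
    rw [lsum_finset_sum]
    refine Finset.sum_congr rfl fun p _ => ?_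
    rw [lsum_smul, ← t.gTerm_split_right, show 1 + 1 + p.2 = p.2 + 1 + 1 by ring]

/-- The functional `♮ x da ↦ ∑ tr₁ (P_{m-i}(w) ∇a P_i(z)) b`, the sum being over the decompositions
`z b w` of `x`. -/
def XTrace.tau (t : XTrace 𝔄 M Z) (F : 𝔄) (L : A →ₗ[ℂ] 𝔄) (m i : ℕ) : OmNat (T A) →ₗ[ℂ] Z :=
  omLift (LinearMap.mk₂ ℂ (fun x a => splitSum (trilin
      (fun z b w => t.tr₁ (hit F L (m - i) w * nab F L a * hit F L i z) (L b))
      (by intros; simp [mul_add]) (by intros; simp) (by intros; simp) (by intros; simp)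
      (by intros; simp [add_mul]) (by intros; simp)) x)
    (fun x x' y => by simp)
    (fun c x y => by simp)
    (fun x a a' => by
      induction x using word_induction with
      | hw l => simp only [splitSum_word, ← lsum_add]; simp [mul_add, add_mul]
      | hadd x y hx hy =>
        rw [(splitSum _).map_add, (splitSum _).map_add, (splitSum _).map_add, hx, hy,
          add_add_add_comm]
      | hsmul c x hx =>
        rw [(splitSum _).map_smul, (splitSum _).map_smul, (splitSum _).map_smul, hx, smul_add])
    (fun c x a => by
      induction x using word_induction with
      | hw l => simp only [splitSum_word, ← lsum_smul]; simp
      | hadd x y hx hy =>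
        rw [(splitSum _).map_add, (splitSum _).map_add, hx, hy, smul_add]
      | hsmul c' x hx =>
        rw [(splitSum _).map_smul, (splitSum _).map_smul, hx, smul_comm c]))

theorem XTrace.tau_natD (m i : ℕ) (l : List A) (a : A) :
    t.tau F L m i (natD (ofW A (word l)) (T.ι A a : U (T A))) =
      lsum (fun z b w =>
        t.tr₁ (hit F L (m - i) (word w) * nab F L a * hit F L i (word z)) (L b)) l := by
  rw [XTrace.tau, omLift_letter, toW_ofW, LinearMap.mk₂_apply, splitSum_word]
  rfl

theorem lsum_lsum_rotate {V W : Type*} [AddCommGroup W] (K : List V → V → List V → V → W)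
    (l : List V) :
    lsum (fun z a w => lsum (fun z₂ b z₁ => K z₁ a z₂ b) (w ++ z)) l =
      lsum (fun z b w => lsum (fun z₁ a z₂ => K z₁ a z₂ b) (w ++ z)) l := by
  simp only [lsum_append, lsum_add]
  rw [lsum_assoc, lsum_assoc, add_comm]

/-- The letters a and b are two marks on one cyclic word. Fixing b and summing over a recombines
P_{m+1} through `hit_split`, for every value of i. -/
theorem XTrace.tau_d_word {m i : ℕ} (hi : i ≤ m) (l : List A) :
    t.tau F L m i (natD 1 (ofW A (word l))) =
      lsum (fun z b w => t.tr₁ (hit F L (m + 1) (word (w ++ z))) (L b)) l := by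
  have h := lsum_lsum_rotate (fun z₁ a z₂ b =>
    t.tr₁ (hit F L (m - i) (word z₁) * nab F L a * hit F L i (word z₂)) (L b)) l
  have e : ∀ l : List A, hit F L (m + 1) (word l) = lsum (fun z₁ a z₂ =>
      hit F L (m - i) (word z₁) * nab F L a * hit F L i (word z₂)) l := by
    intro l
    rw [← hit_split, show m - i + 1 + i = m + 1 by omega]
  simp only [e, map_lsum₂]
  rw [← h, XTrace.tau, omLift_d_word]
  refine lsum_congr fun z b w _ => ?_
  rw [LinearMap.mk₂_apply, ← word_append, splitSum_word]
  rfl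

/-- The correction term of the homotopy. -/
def XTrace.kOne (t : XTrace 𝔄 M Z) (F : 𝔄) (L : A →ₗ[ℂ] 𝔄) (j : ℕ) : OmNat (T A) →ₗ[ℂ] Z :=
  ∑ i ∈ Finset.range (2 * j + 1), ((-1 : ℂ) ^ i * (j - i)) • t.tau F L (2 * j) i

/-- By `XTrace.tau_d_word` the summands only differ by their weights (-1)^i (j - i), which are odd
under i ↦ 2j - i and add up to zero. So `kOne` corrects one component of ∂H - H∂ without disturbing
the other. -/
theorem XTrace.kOne_d_word (j : ℕ) (l : List A) :
    t.kOne F L j (natD 1 (ofW A (word l))) = 0 := by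
  have h : ∑ i ∈ Finset.range (2 * j + 1), ((-1 : ℂ) ^ i * (j - i)) = 0 := by
    have h1 := Finset.sum_range_reflect (fun i : ℕ => ((-1 : ℂ) ^ i * (j - i))) (2 * j + 1)
    have h2 : ∑ i ∈ Finset.range (2 * j + 1), ((-1 : ℂ) ^ (2 * j + 1 - 1 - i) *
        (j - ((2 * j + 1 - 1 - i : ℕ) : ℂ))) =
        -∑ i ∈ Finset.range (2 * j + 1), ((-1 : ℂ) ^ i * (j - i)) := by
      rw [← Finset.sum_neg_distrib]
      refine Finset.sum_congr rfl fun i hi => ?_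
      have hi : i ≤ 2 * j := Nat.lt_succ_iff.1 (Finset.mem_range.1 hi)
      rw [Nat.add_sub_cancel, Nat.cast_sub hi]
      have : (-1 : ℂ) ^ (2 * j - i) = (-1) ^ i := by
        have e : (-1 : ℂ) ^ (2 * j - i) * (-1) ^ i = 1 := by
          rw [← pow_add, Nat.sub_add_cancel hi]
          simp
        rcases neg_one_pow_eq_or ℂ i with h | h <;> rw [h] at e ⊢
        · simpa using e
        · linear_combination -e
      rw [this]
      push_cast
      ring
    rw [h2] at h1
    linear_combination (-1 / 2 : ℂ) * h1
  simp only [XTrace.kOne, LinearMap.sum_apply, LinearMap.smul_apply]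
  rw [Finset.sum_congr rfl fun i hi => by
    rw [t.tau_d_word (Nat.lt_succ_iff.1 (Finset.mem_range.1 hi))], ← Finset.sum_smul, h, zero_smul]

end HitWords

/-! ### The boundary of the correction term -/

section Relations

set_option linter.unusedSectionVars false

variable {𝔄 M Z A : Type*} [Ring 𝔄] [Algebra ℂ 𝔄] [AddCommGroup M] [Module ℂ M]
    [AddCommGroup Z] [Module ℂ Z] [NonUnitalRing A] [Module ℂ A]
variable {F : 𝔄} {L : A →ₗ[ℂ] 𝔄} {t : XTrace 𝔄 M Z}

theorem XTrace.tr_mul_nab (hT : ∀ y, t.tr₁ y F = 0) (y : 𝔄) (a : A) :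
    t.tr (y * nab F L a) = t.tr ((y * F - F * y) * L a) := by
  rw [nab_apply, mul_sub, sub_mul, map_sub, map_sub, ← mul_assoc, ← mul_assoc, t.tr_comm hT,
    mul_assoc F]

theorem XTrace.tr_nab_mul (hT : ∀ y, t.tr₁ y F = 0) (y : 𝔄) (a : A) :
    t.tr (nab F L a * y) = t.tr (L a * (y * F - F * y)) := by
  rw [nab_apply, mul_sub, sub_mul, map_sub, map_sub, ← mul_assoc, t.tr_comm hT, mul_assoc F,
    mul_assoc (L a)]

/-- The sum of `tr (Pₘ(w) ∇a Pₖ(z) b)` over the decompositions `z b w` of a word. -/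
def XTrace.pSum (t : XTrace 𝔄 M Z) (F : 𝔄) (L : A →ₗ[ℂ] 𝔄) (a : A) (m k : ℕ) (l : List A) : M :=
  lsum (fun z b w => t.tr (hit F L m (word w) * nab F L a * hit F L k (word z) * L b)) l

/-- The sum of `tr (b Pₘ(w) ∇a Pₖ(z))` over the decompositions `z b w` of a word. -/
def XTrace.qSum (t : XTrace 𝔄 M Z) (F : 𝔄) (L : A →ₗ[ℂ] 𝔄) (a : A) (m k : ℕ) (l : List A) : M :=
  lsum (fun z b w => t.tr (L b * (hit F L m (word w) * nab F L a * hit F L k (word z)))) l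

theorem lsum_telescope {V W : Type*} [AddCommGroup W] (f : List V → List V → W) (l : List V) :
    lsum (fun z b w => f (z ++ [b]) w) l - lsum (fun z b w => f z (b :: w)) l = f l [] - f [] l := by
  induction l generalizing f with
  | nil => simp
  | cons a l ih =>
    rw [lsum_cons, lsum_cons]
    have := ih (fun z w => f (a :: z) w)
    simp only [List.cons_append, List.nil_append] at this ⊢
    rw [add_sub_add_comm, this]
    abel

/-- Cyclicity turns the last commutator into a commutator of F with the product before it. Carrying
F through the odd factor Pₖ and through ∇a changes the sign twice, and only F Pₘ - Pₘ F = Pₘ₊₁ is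
left. -/
theorem XTrace.tr_hit_nab (hF : F * F = 1) (hT : ∀ y, t.tr₁ y F = 0) (a b : A) {m k : ℕ}
    (hm : Even m) (hk : Odd k) (x y : TensorAlgebra ℂ A) :
    t.tr (hit F L m x * nab F L a * hit F L k y * nab F L b) =
      -t.tr (hit F L (m + 1) x * nab F L a * hit F L k y * L b) := by
  have h1 := hit_succ_of_even (L := L) hF hm x
  have h2 := hit_comm_of_odd (L := L) hF hk y
  have h3 := F_nab (L := L) hF a
  rw [t.tr_mul_nab hT, ← map_neg, ← neg_mul]
  congr 2
  generalize hit F L m x = p at *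
  generalize hit F L k y = q at *
  generalize hit F L (m + 1) x = r at *
  generalize nab F L a = v at *
  have e : p * v * q * F = p * F * v * q := by
    rw [mul_assoc (p * v), ← neg_neg (q * F), ← h2, mul_assoc p F, h3]
    noncomm_ring
  rw [e, ← mul_assoc, ← mul_assoc, h1]
  noncomm_ring

theorem XTrace.pSum_succ (hF : F * F = 1) (hT : ∀ y, t.tr₁ y F = 0) (a : A) {m k : ℕ} (hm : Even m)
    (hk : Odd k) (l : List A) :
    lsum (fun z b w => t.tr (hit F L m (word w) * nab F L a * hit F L (k + 1) (word (z ++ [b])))) l =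
      t.pSum F L a m (k + 1) l - t.pSum F L a (m + 1) k l := by
  rw [XTrace.pSum, XTrace.pSum, ← lsum_sub]
  refine lsum_congr fun z b w _ => ?_
  rw [word_append, word_cons, word_nil, mul_one, hit_succ_mul_ι, mul_add, map_add, ← mul_assoc,
    ← mul_assoc, t.tr_hit_nab hF hT _ _ hm hk, ← sub_eq_add_neg]

theorem XTrace.pSum_zero (a : A) (m : ℕ) (l : List A) :
    lsum (fun z b w => t.tr (hit F L m (word w) * nab F L a * hit F L 0 (word (z ++ [b])))) l =
      t.pSum F L a m 0 l := by
  refine lsum_congr fun z b w _ => ?_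
  rw [word_append, word_cons, word_nil, mul_one, hit_zero_mul_ι, ← mul_assoc]

theorem XTrace.qSum_succ (hF : F * F = 1) (hT : ∀ y, t.tr₁ y F = 0) (a : A) {m k : ℕ} (hm : Odd m)
    (hk : Even k) (l : List A) :
    lsum (fun z b w => t.tr (hit F L (m + 1) (word (b :: w)) * nab F L a * hit F L k (word z))) l =
      t.qSum F L a (m + 1) k l - t.qSum F L a m (k + 1) l := by
  rw [XTrace.qSum, XTrace.qSum, ← lsum_sub]
  refine lsum_congr fun z b w _ => ?_
  have h1 := hit_succ_of_even (L := L) hF hk (word z)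
  have h2 := hit_comm_of_odd (L := L) hF hm (word w)
  have h3 := F_nab (L := L) hF a
  rw [word_cons, hit_succ_ι_mul, add_mul, add_mul, map_add, mul_assoc (nab F L b),
    mul_assoc (nab F L b), t.tr_nab_mul hT, sub_eq_add_neg _ (t.tr _), ← map_neg]
  congr 2
  · noncomm_ring
  rw [← mul_neg]
  congr 1
  generalize hit F L m (word w) = p at *
  generalize hit F L k (word z) = q at *
  generalize hit F L (k + 1) (word z) = r at *
  generalize nab F L a = v at *
  have e : F * (p * v * q) = p * v * (F * q) := by
    rw [← mul_assoc, ← mul_assoc, h2, neg_mul, mul_assoc p F, h3]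
    noncomm_ring
  rw [e, h1]
  noncomm_ring

theorem XTrace.qSum_zero (a : A) (k : ℕ) (l : List A) :
    lsum (fun z b w => t.tr (hit F L 0 (word (b :: w)) * nab F L a * hit F L k (word z))) l =
      t.qSum F L a 0 k l := by
  refine lsum_congr fun z b w _ => ?_
  rw [word_cons, hit_zero_ι_mul, mul_assoc, mul_assoc, mul_assoc]

/-- At even indices p - q is traded for P - Q, that is, for neighbouring odd-indexed terms. Then
p(2i+1) has the total weight -(c-2i-1) + (c-2i-2) = -1 and q(2i+1) has (c-2i-1) - (c-2i) = -1.
Linear weights are chosen for this reason. -/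
theorem alternating_sum (p q P Q : ℕ → M) (c : ℂ) (N : ℕ)
    (h : ∀ i ≤ N, p (2 * i) - q (2 * i) = P i - Q i) (hP : ∀ i < N, P (i + 1) = p (2 * i + 1))
    (hQ : ∀ i < N, Q i = q (2 * i + 1)) :
    ∑ i ∈ Finset.range (2 * N + 1), ((-1 : ℂ) ^ i * (c - i)) • (p i - q i) =
      c • P 0 - ∑ i ∈ Finset.range N, (p (2 * i + 1) + q (2 * i + 1)) - (c - 2 * N) • Q N := by
  induction N with
  | zero =>
    have := h 0 le_rfl
    simp only [mul_zero] at this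
    simp [← smul_sub, this]
  | succ N ih =>
    have h1 := h (N + 1) le_rfl
    rw [show 2 * (N + 1) + 1 = 2 * N + 1 + 1 + 1 by ring, Finset.sum_range_succ, Finset.sum_range_succ,
      ih (fun i hi => h i (hi.trans N.le_succ)) (fun i hi => hP i (hi.trans N.lt_succ_self))
        (fun i hi => hQ i (hi.trans N.lt_succ_self)), show 2 * N + 1 + 1 = 2 * (N + 1) by ring, h1,
      hP N N.lt_succ_self, hQ N N.lt_succ_self, Finset.sum_range_succ]
    simp only [pow_mul, pow_succ, pow_zero]
    push_cast
    simp only [neg_mul_neg, one_mul, mul_one, one_pow]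
    module

/-- For each even index, a telescoping sum over the cuts of the word relates the p- and q-sums to
those of the adjacent odd indices, and `alternating_sum` applies. The surviving odd-indexed sums are
those that the even component of the Chern character produces. -/
theorem XTrace.b_kOne (hF : F * F = 1) (hT : ∀ y, t.tr₁ y F = 0) (j : ℕ) (l : List A) (a : A) :
    t.b (t.kOne F L j (natD (ofW A (word l)) (T.ι A a : U (T A)))) =
      (j : ℂ) • t.tr (hit F L (2 * j + 1) (word l) * L a) +
        (j : ℂ) • t.tr (L a * hit F L (2 * j + 1) (word l)) -
      ∑ i ∈ Finset.range j, (t.pSum F L a (2 * j - (2 * i + 1)) (2 * i + 1) l +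
        t.qSum F L a (2 * j - (2 * i + 1)) (2 * i + 1) l) := by
  have hb : ∀ i, t.b (t.tau F L (2 * j) i (natD (ofW A (word l)) (T.ι A a : U (T A)))) =
      t.pSum F L a (2 * j - i) i l - t.qSum F L a (2 * j - i) i l := by
    intro i
    rw [XTrace.tau_natD, map_lsum, XTrace.pSum, XTrace.qSum, ← lsum_sub]
    simp only [t.b_tr₁]
  -- Up to sign these two traces are the end terms of the telescoping sums below; they occur only at
  -- i = 0 and at i = j.
  have hα : t.tr (hit F L (2 * j + 1) (word l) * L a) = -t.tr (hit F L (2 * j) (word l) * nab F L a) := by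
    rw [t.tr_mul_nab hT, hit_succ_of_even hF (even_two_mul j), ← map_neg, ← neg_mul]
    congr 2
    abel
  have hβ : t.tr (L a * hit F L (2 * j + 1) (word l)) = -t.tr (nab F L a * hit F L (2 * j) (word l)) := by
    rw [t.tr_nab_mul hT, hit_succ_of_even hF (even_two_mul j), ← map_neg, ← mul_neg]
    congr 2
    abel
  simp only [XTrace.kOne, LinearMap.sum_apply, LinearMap.smul_apply, map_sum, map_smul, hb]
  rw [alternating_sum (fun i => t.pSum F L a (2 * j - i) i l) (fun i => t.qSum F L a (2 * j - i) i l)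
    (fun i => if i = 0 then t.tr (hit F L (2 * j + 1) (word l) * L a) else
      t.pSum F L a (2 * j - (2 * i - 1)) (2 * i - 1) l)
    (fun i => if i = j then t.tr (L a * hit F L (2 * j + 1) (word l)) else
      t.qSum F L a (2 * j - (2 * i + 1)) (2 * i + 1) l)]
  · simp only [if_true]
    module
  · intro i hi
    have h := lsum_telescope (fun z w => t.tr (hit F L (2 * j - 2 * i) (word w) * nab F L a *
      hit F L (2 * i) (word z))) l
    have he : Even (2 * j - 2 * i) := by rw [← mul_tsub]; exact even_two_mul _
    have h1 : lsum (fun z b w => t.tr (hit F L (2 * j - 2 * i) (word w) * nab F L a *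
        hit F L (2 * i) (word (z ++ [b])))) l = t.pSum F L a (2 * j - 2 * i) (2 * i) l -
        if i = 0 then 0 else t.pSum F L a (2 * j - (2 * i - 1)) (2 * i - 1) l := by
      rcases i with _ | i
      · simpa using t.pSum_zero (F := F) (L := L) a (2 * j) l
      · have := t.pSum_succ (F := F) (L := L) hF hT a he (k := 2 * i + 1) (by simp) l
        rw [if_neg (by omega)]
        rw [show 2 * j - 2 * (i + 1) + 1 = 2 * j - (2 * (i + 1) - 1) by omega] at this
        exact this
    have h2 : lsum (fun z b w => t.tr (hit F L (2 * j - 2 * i) (word (b :: w)) * nab F L a *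
        hit F L (2 * i) (word z))) l = t.qSum F L a (2 * j - 2 * i) (2 * i) l -
        if i = j then 0 else t.qSum F L a (2 * j - (2 * i + 1)) (2 * i + 1) l := by
      by_cases hij : i = j
      · subst hij
        simpa using t.qSum_zero (F := F) (L := L) a (2 * i) l
      · have := t.qSum_succ (F := F) (L := L) hF hT a (m := 2 * j - 2 * i - 1) (k := 2 * i)
          (by obtain ⟨s, rfl⟩ := Nat.exists_eq_add_of_lt (lt_of_le_of_ne hi hij); exact ⟨s, by omega⟩)
          (by simp) l
        rw [if_neg hij]
        rw [show 2 * j - 2 * i - 1 + 1 = 2 * j - 2 * i by omega,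
          show 2 * j - 2 * i - 1 = 2 * j - (2 * i + 1) by omega] at this
        exact this
    rw [h1, h2] at h
    have h3 : t.tr (hit F L (2 * j - 2 * i) (word []) * nab F L a * hit F L (2 * i) (word l)) =
        if i = j then -t.tr (L a * hit F L (2 * j + 1) (word l)) else 0 := by
      by_cases hij : i = j
      · subst hij
        simp [hβ]
      · obtain ⟨s, hs⟩ : ∃ s, 2 * j - 2 * i = s + 1 := ⟨2 * j - 2 * i - 1, by omega⟩
        simp [hij, hs]
    have h4 : t.tr (hit F L (2 * j - 2 * i) (word l) * nab F L a * hit F L (2 * i) (word [])) =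
        if i = 0 then -t.tr (hit F L (2 * j + 1) (word l) * L a) else 0 := by
      rcases i with _ | i
      · simp [hα]
      · simp [show 2 * (i + 1) = 2 * i + 1 + 1 by ring]
    rw [h3, h4] at h
    split_ifs at h ⊢ <;> linear_combination (norm := module) h
  · intro i hi
    simp only [Nat.add_eq_zero_iff, one_ne_zero, and_false, if_false]
    rw [show 2 * (i + 1) - 1 = 2 * i + 1 by omega]
  · intro i hi
    simp only [if_neg hi.ne]

end Relations

/-! ### Functionals on the tensor algebra of `TA` -/

section SplitSum

variable {V W : Type*} [AddCommGroup V] [Module ℂ V] [AddCommGroup W] [Module ℂ W]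

theorem splitSum_add (E E' : TensorAlgebra ℂ V →ₗ[ℂ] V →ₗ[ℂ] TensorAlgebra ℂ V →ₗ[ℂ] W) :
    splitSum (E + E') = splitSum E + splitSum E' := by
  refine word_hom_ext fun l => ?_
  rw [LinearMap.add_apply, splitSum_word, splitSum_word, splitSum_word, ← lsum_add]
  rfl

theorem splitSum_smul (c : ℂ) (E : TensorAlgebra ℂ V →ₗ[ℂ] V →ₗ[ℂ] TensorAlgebra ℂ V →ₗ[ℂ] W) :
    splitSum (c • E) = c • splitSum E := by
  refine word_hom_ext fun l => ?_
  rw [LinearMap.smul_apply, splitSum_word, splitSum_word, ← lsum_smul]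
  rfl

theorem splitSum_mul (E E₁ E₂ : TensorAlgebra ℂ V →ₗ[ℂ] V →ₗ[ℂ] TensorAlgebra ℂ V →ₗ[ℂ] W)
    (x y : TensorAlgebra ℂ V) (h₁ : ∀ z b w, E₁ z b w = E z b (w * y))
    (h₂ : ∀ z b w, E₂ z b w = E (x * z) b w) :
    splitSum E (x * y) = splitSum E₁ x + splitSum E₂ y := by
  have e₁ : E₁ = E.compr₂ (LinearMap.lcomp ℂ W (LinearMap.mulRight ℂ y)) := by
    refine LinearMap.ext fun z => LinearMap.ext fun b => LinearMap.ext fun w => h₁ z b w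
  have e₂ : E₂ = E ∘ₗ LinearMap.mulLeft ℂ x := by
    refine LinearMap.ext fun z => LinearMap.ext fun b => LinearMap.ext fun w => h₂ z b w
  rw [e₁, e₂]
  clear h₁ h₂ e₁ e₂ E₁ E₂
  induction x using word_induction with
  | hw l =>
    induction y using word_induction with
    | hw l' =>
      rw [← word_append, splitSum_word, splitSum_word, splitSum_word, lsum_append]
      simp
    | hadd x y hx hy =>
      have : E.compr₂ (LinearMap.lcomp ℂ W (LinearMap.mulRight ℂ (x + y))) =
          E.compr₂ (LinearMap.lcomp ℂ W (LinearMap.mulRight ℂ x)) +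
            E.compr₂ (LinearMap.lcomp ℂ W (LinearMap.mulRight ℂ y)) := by
        refine LinearMap.ext fun z => LinearMap.ext fun b => LinearMap.ext fun w => ?_
        simp [mul_add]
      rw [mul_add, map_add, map_add, hx, hy, this, splitSum_add, LinearMap.add_apply]
      abel
    | hsmul c x hx =>
      have : E.compr₂ (LinearMap.lcomp ℂ W (LinearMap.mulRight ℂ (c • x))) =
          c • E.compr₂ (LinearMap.lcomp ℂ W (LinearMap.mulRight ℂ x)) := by
        refine LinearMap.ext fun z => LinearMap.ext fun b => LinearMap.ext fun w => ?_
        simp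
      rw [mul_smul_comm, map_smul, map_smul, hx, this, splitSum_smul, LinearMap.smul_apply, smul_add]
  | hadd x z hx hz =>
    have : E ∘ₗ LinearMap.mulLeft ℂ (x + z) = E ∘ₗ LinearMap.mulLeft ℂ x + E ∘ₗ LinearMap.mulLeft ℂ z := by
      refine LinearMap.ext fun z => LinearMap.ext fun b => LinearMap.ext fun w => ?_
      simp [add_mul]
    rw [add_mul, map_add, map_add, hx, hz, this, splitSum_add, LinearMap.add_apply]
    abel
  | hsmul c x hx =>
    have : E ∘ₗ LinearMap.mulLeft ℂ (c • x) = c • E ∘ₗ LinearMap.mulLeft ℂ x := by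
      refine LinearMap.ext fun z => LinearMap.ext fun b => LinearMap.ext fun w => ?_
      simp
    rw [smul_mul_assoc, map_smul, map_smul, hx, this, splitSum_smul, LinearMap.smul_apply, smul_add]

theorem splitSum_ι (E : TensorAlgebra ℂ V →ₗ[ℂ] V →ₗ[ℂ] TensorAlgebra ℂ V →ₗ[ℂ] W) (b : V) :
    splitSum E (TensorAlgebra.ι ℂ b) = E 1 b 1 := by
  have := splitSum_word E [b]
  simpa [lsum_cons] using this

variable (V) in
/-- The grading automorphism of the tensor algebra. -/
def gradeAut : TensorAlgebra ℂ V →ₐ[ℂ] TensorAlgebra ℂ V :=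
  TensorAlgebra.lift ℂ (-TensorAlgebra.ι ℂ)

@[simp] theorem gradeAut_ι (b : V) : gradeAut V (TensorAlgebra.ι ℂ b) = -TensorAlgebra.ι ℂ b := by
  rw [gradeAut, TensorAlgebra.lift_ι_apply, LinearMap.neg_apply]

theorem gradeAut_word (l : List V) : gradeAut V (word l) = (-1 : ℂ) ^ l.length • word l := by
  induction l with
  | nil => simp
  | cons a l ih => rw [word_cons, map_mul, ih, gradeAut_ι, List.length_cons, pow_succ]; simp

@[simp] theorem gradeAut_gradeAut (x : TensorAlgebra ℂ V) : gradeAut V (gradeAut V x) = x := by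
  induction x using word_induction with
  | hw l =>
    rw [gradeAut_word, map_smul, gradeAut_word, smul_smul, ← mul_pow]
    simp
  | hadd x y hx hy => simp only [map_add, hx, hy]
  | hsmul c x hx => simp only [map_smul, hx]

/-- The derivation of the tensor algebra extending a linear map on the generators. -/
def deriv (f : V →ₗ[ℂ] TensorAlgebra ℂ V) : TensorAlgebra ℂ V →ₗ[ℂ] TensorAlgebra ℂ V :=
  splitSum (trilin (fun z b w => z * f b * w) (by intros; simp [add_mul]) (by intros; simp)
    (by intros; simp [mul_add, add_mul]) (by intros; simp) (by intros; simp [mul_add])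
    (by intros; simp))

theorem deriv_word (f : V →ₗ[ℂ] TensorAlgebra ℂ V) (l : List V) :
    deriv f (word l) = lsum (fun z b w => word z * f b * word w) l := splitSum_word _ _

theorem deriv_ι (f : V →ₗ[ℂ] TensorAlgebra ℂ V) (b : V) : deriv f (TensorAlgebra.ι ℂ b) = f b := by
  rw [deriv, splitSum_ι]
  simp

theorem deriv_mul (f : V →ₗ[ℂ] TensorAlgebra ℂ V) (x y : TensorAlgebra ℂ V) :
    deriv f (x * y) = deriv f x * y + x * deriv f y := by
  have h1 : ∀ (g : TensorAlgebra ℂ V →ₗ[ℂ] TensorAlgebra ℂ V) x, g (deriv f x) =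
      splitSum (trilin (fun z b w => g (z * f b * w)) (by intros; simp [add_mul]) (by intros; simp)
    (by intros; simp [mul_add, add_mul]) (by intros; simp) (by intros; simp [mul_add])
    (by intros; simp)) x := by
    intro g x
    induction x using word_induction with
    | hw l => rw [deriv_word, splitSum_word, map_lsum]; rfl
    | hadd x y hx hy => simp only [map_add, hx, hy]
    | hsmul c x hx => simp only [map_smul, hx]
  have h2 := h1 (LinearMap.mulRight ℂ y) x
  have h3 := h1 (LinearMap.mulLeft ℂ x) y
  simp only [LinearMap.mulRight_apply, LinearMap.mulLeft_apply] at h2 h3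
  rw [h2, h3, deriv, splitSum_mul]
  · intro z b w
    simp [mul_assoc]
  · intro z b w
    simp [mul_assoc]

/-- The signed cyclic operator `∑ f(b) w α(z)`, the sum being over the decompositions `z b w`. -/
def rotOdd (f : V →ₗ[ℂ] TensorAlgebra ℂ V) : TensorAlgebra ℂ V →ₗ[ℂ] TensorAlgebra ℂ V :=
  splitSum (trilin (fun z b w => f b * w * gradeAut V z) (by intros; simp [mul_add]) (by intros; simp)
    (by intros; simp [add_mul]) (by intros; simp) (by intros; simp [mul_add, add_mul])
    (by intros; simp))

/-- The cyclic operator `∑ f(b) w z`, the sum being over the decompositions `z b w`. -/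
def rotEven (f : V →ₗ[ℂ] TensorAlgebra ℂ V) : TensorAlgebra ℂ V →ₗ[ℂ] TensorAlgebra ℂ V :=
  splitSum (trilin (fun z b w => f b * w * z) (by intros; simp [mul_add]) (by intros; simp)
    (by intros; simp [add_mul]) (by intros; simp) (by intros; simp [mul_add, add_mul])
    (by intros; simp))

theorem rotOdd_word (f : V →ₗ[ℂ] TensorAlgebra ℂ V) (l : List V) : rotOdd f (word l) =
    lsum (fun z b w => f b * word w * gradeAut V (word z)) l := splitSum_word _ _

theorem rotEven_word (f : V →ₗ[ℂ] TensorAlgebra ℂ V) (l : List V) : rotEven f (word l) =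
    lsum (fun z b w => f b * word w * word z) l := splitSum_word _ _

/-- A trace does not distinguish `rotEven f` from `deriv f`. The composite of a trace with a
derivation is again a trace, so the replacement can be repeated. -/
theorem rotEven_pow (f : V →ₗ[ℂ] TensorAlgebra ℂ V) (g : TensorAlgebra ℂ V →ₗ[ℂ] W)
    (hg : ∀ x y, g (x * y) = g (y * x)) (j : ℕ) (x : TensorAlgebra ℂ V) :
    g ((rotEven f ^ j) x) = g ((deriv f ^ j) x) := by
  induction j generalizing g with
  | zero => rfl
  | succ j ih =>
    have h1 : g ∘ₗ rotEven f = g ∘ₗ deriv f := by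
      refine word_hom_ext fun l => ?_
      rw [LinearMap.comp_apply, LinearMap.comp_apply, rotEven_word, deriv_word, map_lsum, map_lsum]
      refine lsum_congr fun z b w _ => ?_
      rw [hg, ← mul_assoc]
    rw [pow_succ', Module.End.mul_apply, ← LinearMap.comp_apply g, h1, ih (g ∘ₗ deriv f),
      LinearMap.comp_apply, pow_succ' (deriv f), Module.End.mul_apply]
    intro x y
    simp only [LinearMap.comp_apply, deriv_mul, map_add]
    rw [hg, hg x, add_comm]

theorem gradeAut_deriv (f : V →ₗ[ℂ] TensorAlgebra ℂ V) (hf : ∀ b, gradeAut V (f b) = -f b)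
    (x : TensorAlgebra ℂ V) : gradeAut V (deriv f x) = deriv f (gradeAut V x) := by
  induction x using word_induction with
  | hw l =>
    rw [gradeAut_word, map_smul, deriv_word, ← lsum_smul]
    refine (map_lsum (gradeAut V).toLinearMap _ _).trans (lsum_congr fun z b w hl => ?_)
    rw [AlgHom.toLinearMap_apply, map_mul, map_mul, hf, gradeAut_word, gradeAut_word, hl,
      List.length_append, List.length_cons, pow_add, pow_succ]
    simp [smul_smul, mul_comm]
  | hadd x y hx hy => simp only [map_add, hx, hy]
  | hsmul c x hx => simp only [map_smul, hx]

theorem gradeAut_rotOdd (f : V →ₗ[ℂ] TensorAlgebra ℂ V) (hf : ∀ b, gradeAut V (f b) = -f b)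
    (x : TensorAlgebra ℂ V) : gradeAut V (rotOdd f x) = rotOdd f (gradeAut V x) := by
  induction x using word_induction with
  | hw l =>
    rw [gradeAut_word, map_smul, rotOdd_word, ← lsum_smul]
    refine (map_lsum (gradeAut V).toLinearMap _ _).trans (lsum_congr fun z b w hl => ?_)
    rw [AlgHom.toLinearMap_apply, map_mul, map_mul, hf, gradeAut_word, gradeAut_word, map_smul,
      gradeAut_word, hl, List.length_append, List.length_cons, pow_add, pow_succ]
    simp [smul_smul]
    ring_nf
  | hadd x y hx hy => simp only [map_add, hx, hy]
  | hsmul c x hx => simp only [map_smul, hx]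

/-- The graded version. When an even word is cut at a marked letter, the part before it and the rest
have the same parity, so only the case of equal signs of graded cyclicity is needed. The evenness of
x is preserved because f is odd. -/
theorem rotOdd_pow (f : V →ₗ[ℂ] TensorAlgebra ℂ V) (hf : ∀ b, gradeAut V (f b) = -f b)
    (g : TensorAlgebra ℂ V →ₗ[ℂ] W)
    (hg : ∀ (s : ℂ) x y, gradeAut V x = s • x → gradeAut V y = s • y → g (x * y) = s • g (y * x))
    (j : ℕ) (x : TensorAlgebra ℂ V) (hx : gradeAut V x = x) :
    g ((rotOdd f ^ j) x) = g ((deriv f ^ j) x) := by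
  induction j generalizing g with
  | zero => rfl
  | succ j ih =>
    have h1 : g ∘ₗ rotOdd f ∘ₗ (LinearMap.id + (gradeAut V).toLinearMap) =
        g ∘ₗ deriv f ∘ₗ (LinearMap.id + (gradeAut V).toLinearMap) := by
      refine word_hom_ext fun l => ?_
      simp only [LinearMap.comp_apply, LinearMap.add_apply, LinearMap.id_apply,
        AlgHom.toLinearMap_apply, gradeAut_word]
      rcases Nat.even_or_odd l.length with h | h
      · rw [h.neg_one_pow, one_smul, map_add, map_add, map_add, map_add]
        have : g (rotOdd f (word l)) = g (deriv f (word l)) := by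
          rw [rotOdd_word, deriv_word, map_lsum, map_lsum]
          refine lsum_congr fun z b w hl => ?_
          rw [hl, List.length_append, List.length_cons, ← add_assoc, Nat.even_add_one,
            Nat.not_even_iff_odd] at h
          have h2 : (-1 : ℂ) ^ z.length * -(-1) ^ w.length = 1 := by
            have := h.neg_one_pow (α := ℂ)
            rw [pow_add] at this
            rw [mul_neg, this, neg_neg]
          have h3 : (-1 : ℂ) ^ z.length = -(-1) ^ w.length := by
            rcases neg_one_pow_eq_or ℂ z.length with h | h <;> rw [h] at h2 ⊢
            · linear_combination -h2
            · linear_combination h2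
          rw [gradeAut_word, mul_smul_comm, map_smul, mul_assoc (word z),
            hg ((-1) ^ z.length) (word z) (f b * word w) (gradeAut_word z)]
          rw [map_mul, hf, gradeAut_word, h3]
          simp
        rw [this]
      · simp [h.neg_one_pow]
    have h2 : ∀ y, gradeAut V y = y → g (rotOdd f y) = g (deriv f y) := by
      intro y hy
      have := LinearMap.congr_fun h1 y
      simp only [LinearMap.comp_apply, LinearMap.add_apply, LinearMap.id_apply,
        AlgHom.toLinearMap_apply, hy, ← two_smul ℂ y, map_smul] at this
      exact smul_right_injective W (two_ne_zero : (2 : ℂ) ≠ 0) this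
    have h3 : ∀ j, gradeAut V ((rotOdd f ^ j) x) = (rotOdd f ^ j) x := by
      intro j
      induction j with
      | zero => exact hx
      | succ j ih => rw [pow_succ', Module.End.mul_apply, gradeAut_rotOdd f hf, ih]
    rw [pow_succ', Module.End.mul_apply, h2 _ (h3 j), ← LinearMap.comp_apply g, ih (g ∘ₗ deriv f),
      LinearMap.comp_apply, pow_succ' (deriv f), Module.End.mul_apply]
    intro s x y hx hy
    simp only [LinearMap.comp_apply, deriv_mul, map_add, smul_add]
    rw [hg s _ _ (by rw [gradeAut_deriv f hf, hx, map_smul]) hy,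
      hg s _ _ hx (by rw [gradeAut_deriv f hf, hy, map_smul]), add_comm]

end SplitSum

/-! ### Towers of subwords and letters -/

section Towers

set_option linter.unusedSectionVars false

variable {𝔄 M Z A : Type*} [Ring 𝔄] [Algebra ℂ 𝔄] [AddCommGroup M] [Module ℂ M]
    [AddCommGroup Z] [Module ℂ Z] [NonUnitalRing A] [Module ℂ A]

/-- The linear extension to `TA` of a linear map `L` on `A`. -/
def uT (L : A →ₗ[ℂ] 𝔄) : T A →ₗ[ℂ] 𝔄 :=
  (TensorAlgebra.lift ℂ L).toLinearMap ∘ₗ (T.incl A : T A →ₗ[ℂ] TensorAlgebra ℂ A)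

/-- The homomorphism sending a generator `y` to `[F, y]`. -/
def pr (F : 𝔄) (L : A →ₗ[ℂ] 𝔄) : TensorAlgebra ℂ (T A) →ₐ[ℂ] 𝔄 :=
  TensorAlgebra.lift ℂ (nab F (uT L))

variable {F : 𝔄} {L : A →ₗ[ℂ] 𝔄} {t : XTrace 𝔄 M Z}

theorem uT_tword_cons (a : A) (l : List A) : uT L (tword (a :: l)) = hit F L 0 (word (a :: l)) := by
  rw [hit_zero, uT, LinearMap.comp_apply]
  exact congrArg _ (incl_tword_cons a l)

theorem uT_ι (a : A) : uT L (T.ι A a) = L a := by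
  rw [← tword_singleton, uT_tword_cons (F := 0), word_cons, hit_zero_ι_mul, word_nil, hit_one_zero,
    mul_one]

theorem XTrace.tr₁_uT (x : 𝔄) (l : List A) :
    t.tr₁ x (uT L (tword l)) = t.tr₁ x (hit F L 0 (word l)) := by
  cases l with
  | nil => simp [t.tr₁_one_right]
  | cons a l => rw [uT_tword_cons]

@[simp] theorem pr_ι (y : T A) : pr F L (TensorAlgebra.ι ℂ y) = nab F (uT L) y := by
  rw [pr, TensorAlgebra.lift_ι_apply]

theorem nab_tword (hF : F * F = 1) (l : List A) : nab F (uT L) (tword l) = hit F L 1 (word l) := by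
  cases l with
  | nil => simp
  | cons a l =>
    rw [nab_apply, uT_tword_cons (F := F), hit_succ_of_even hF (by simp)]
    abel

theorem nab_letter (a : A) : nab F (uT L) (T.ι A a) = nab F L a := by
  rw [nab_apply, uT_ι, nab_apply]

theorem F_pr (hF : F * F = 1) (Y : TensorAlgebra ℂ (T A)) :
    F * pr F L Y = pr F L (gradeAut (T A) Y) * F := by
  induction Y using word_induction with
  | hw l =>
    induction l with
    | nil => simp
    | cons a l ih =>
      rw [word_cons, map_mul (pr F L), ← mul_assoc, pr_ι, F_nab hF, neg_mul, mul_assoc, ih,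
        map_mul (gradeAut (T A)), map_mul (pr F L), gradeAut_ι, map_neg, pr_ι]
      noncomm_ring
  | hadd x y hx hy => simp only [map_add, mul_add, add_mul, hx, hy]
  | hsmul c x hx => simp only [map_smul, mul_smul_comm, smul_mul_assoc, hx]

/-- The sum over the decompositions of a word into factors, `2 j + 1` of which are alternately
arbitrary subwords and letters. -/
def tower (A : Type*) [NonUnitalRing A] [Module ℂ A] : ℕ → List A → TensorAlgebra ℂ (T A)
  | 0, l => TensorAlgebra.ι ℂ (tword l)
  | j + 1, l => lsum (fun z b w => TensorAlgebra.ι ℂ (tword z) * TensorAlgebra.ι ℂ (T.ι A b) *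
      tower A j w) l

theorem gradeAut_tower (j : ℕ) (l : List A) : gradeAut (T A) (tower A j l) = -tower A j l := by
  induction j generalizing l with
  | zero => simp [tower]
  | succ j ih =>
    rw [tower, ← lsum_neg]
    refine (map_lsum (gradeAut (T A)).toLinearMap _ _).trans (lsum_congr fun z b w _ => ?_)
    simp [ih]

/-- The commutator with a subword is P₁ of it, and the letters between the subwords carry one
commutator each, so `hit_split` reassembles P_{2j+1}. An empty subword contributes zero on both
sides. -/
theorem pr_tower (hF : F * F = 1) (j : ℕ) (l : List A) :
    pr F L (tower A j l) = hit F L (2 * j + 1) (word l) := by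
  induction j generalizing l with
  | zero => simp [tower, nab_tword hF]
  | succ j ih =>
    rw [tower, show 2 * (j + 1) + 1 = 1 + 1 + (2 * j + 1) by ring, hit_split]
    refine (map_lsum (pr F L).toLinearMap _ _).trans (lsum_congr fun z b w _ => ?_)
    simp [ih, nab_tword hF, nab_letter]

/-- The sum of `z ⊗ b ⊗ w` over the decompositions `z b w` of a word, where the empty words are
replaced by zero. -/
def tripleSplit (A : Type*) [NonUnitalRing A] [Module ℂ A] : T A →ₗ[ℂ] TensorAlgebra ℂ (T A) :=
  splitSum (trilin (fun z b w => TensorAlgebra.ι ℂ (ofW A z).snd * TensorAlgebra.ι ℂ (T.ι A b) *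
      TensorAlgebra.ι ℂ (ofW A w).snd) (by intros; simp [add_mul]) (by intros; simp)
    (by intros; simp [add_mul, mul_add]) (by intros; simp) (by intros; simp [mul_add])
    (by intros; simp)) ∘ₗ (T.incl A : T A →ₗ[ℂ] TensorAlgebra ℂ A)

theorem splitSum_incl_tword {W : Type*} [AddCommGroup W] [Module ℂ W]
    (E : TensorAlgebra ℂ A →ₗ[ℂ] A →ₗ[ℂ] TensorAlgebra ℂ A →ₗ[ℂ] W) (l : List A) :
    splitSum E (T.incl A (tword l)) = lsum (fun z b w => E (word z) b (word w)) l := by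
  cases l with
  | nil => simp
  | cons a l => rw [incl_tword_cons, splitSum_word]

theorem tripleSplit_tword (l : List A) : tripleSplit A (tword l) = tower A 1 l :=
  splitSum_incl_tword _ _

theorem tripleSplit_ι (a : A) : tripleSplit A (T.ι A a) = 0 := by
  rw [← tword_singleton, tripleSplit_tword]
  simp [tower, lsum_cons]

theorem gradeAut_tripleSplit (y : T A) : gradeAut (T A) (tripleSplit A y) = -tripleSplit A y := by
  have : (gradeAut (T A)).toLinearMap ∘ₗ tripleSplit A = -tripleSplit A := by
    refine T_hom_ext fun a l => ?_
    rw [LinearMap.neg_apply, LinearMap.comp_apply, tripleSplit_tword]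
    exact gradeAut_tower 1 _
  exact LinearMap.congr_fun this y

/-- The derivation kills the letters and cuts one of the j + 1 subwords into subword, letter,
subword. Each choice of the subword produces all of the next tower exactly once. -/
theorem deriv_tower (j : ℕ) (l : List A) :
    deriv (tripleSplit A) (tower A j l) = (j + 1 : ℂ) • tower A (j + 1) l := by
  induction j generalizing l with
  | zero => simp [tower, deriv_ι, tripleSplit_tword]
  | succ j ih =>
    have e : tower A (j + 1 + 1) l = lsum (fun z b w => tower A 1 z * TensorAlgebra.ι ℂ (T.ι A b) *
        tower A j w) l := by
      simp only [tower, lsum_mul, mul_lsum]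
      rw [lsum_assoc]
      simp only [mul_assoc]
    rw [tower, map_lsum]
    have : ∀ (z : List A) (b : A) (w : List A), deriv (tripleSplit A) (TensorAlgebra.ι ℂ (tword z) *
        TensorAlgebra.ι ℂ (T.ι A b) * tower A j w) =
        tower A 1 z * TensorAlgebra.ι ℂ (T.ι A b) * tower A j w + (j + 1 : ℂ) •
          (TensorAlgebra.ι ℂ (tword z) * TensorAlgebra.ι ℂ (T.ι A b) * tower A (j + 1) w) := by
      intro z b w
      rw [deriv_mul, deriv_mul, deriv_ι, deriv_ι, tripleSplit_tword, tripleSplit_ι, ih]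
      simp
    simp only [this]
    rw [lsum_add, lsum_smul, ← e]
    have e' : lsum (fun z b w => TensorAlgebra.ι ℂ (tword z) * TensorAlgebra.ι ℂ (T.ι A b) *
      tower A (j + 1) w) l = tower A (j + 1 + 1) l := rfl
    rw [e']
    push_cast
    module

theorem deriv_pow_ι (j : ℕ) (l : List A) :
    (deriv (tripleSplit A) ^ j) (TensorAlgebra.ι ℂ (tword l)) = (j.factorial : ℂ) • tower A j l := by
  induction j with
  | zero => simp [tower]
  | succ j ih =>
    rw [pow_succ', Module.End.mul_apply, ih, map_smul, deriv_tower, smul_smul, Nat.factorial_succ]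
    push_cast
    ring_nf

theorem deriv_pow_mul_ι (j : ℕ) (l : List A) (a : A) :
    (deriv (tripleSplit A) ^ j) (TensorAlgebra.ι ℂ (tword l) * TensorAlgebra.ι ℂ (T.ι A a)) =
      (j.factorial : ℂ) • (tower A j l * TensorAlgebra.ι ℂ (T.ι A a)) := by
  rw [← smul_mul_assoc, ← deriv_pow_ι]
  induction j with
  | zero => simp
  | succ j ih =>
    rw [pow_succ', Module.End.mul_apply, ih, deriv_mul, deriv_ι, tripleSplit_ι, mul_zero, add_zero,
      Module.End.mul_apply]

/-! ### The even component -/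

/-- The sum of `tr (u(y) pr(w) v pr(α z))` over the decompositions `z y w`. -/
def XTrace.qFun (t : XTrace 𝔄 M Z) (F : 𝔄) (L : A →ₗ[ℂ] 𝔄) (v : 𝔄) : TensorAlgebra ℂ (T A) →ₗ[ℂ] M :=
  splitSum (trilin (fun z y w => t.tr (uT L y * pr F L w * v * pr F L (gradeAut (T A) z)))
    (by intros; simp [mul_add]) (by intros; simp) (by intros; simp [add_mul]) (by intros; simp)
    (by intros; simp [add_mul, mul_add]) (by intros; simp))

theorem XTrace.qFun_mul (v : 𝔄) (x y : TensorAlgebra ℂ (T A)) : t.qFun F L v (x * y) =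
    t.qFun F L (pr F L y * v) x + t.qFun F L (v * pr F L (gradeAut (T A) x)) y := by
  rw [XTrace.qFun, splitSum_mul]
  · rfl
  · intro z b w
    simp [mul_assoc]
  · intro z b w
    simp [mul_assoc]

theorem XTrace.qFun_ι (v : 𝔄) (y : T A) :
    t.qFun F L v (TensorAlgebra.ι ℂ y) = t.tr (uT L y * v) := by
  rw [XTrace.qFun, splitSum_ι]
  simp

/-- The signs come from the grading automorphism in `qFun`; this is the cyclicity hypothesis of
`rotOdd_pow`. -/
theorem XTrace.qFun_cyclic (s : ℂ) (x y : TensorAlgebra ℂ (T A)) (hx : gradeAut (T A) x = s • x)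
    (hy : gradeAut (T A) y = s • y) : t.qFun F L 1 (x * y) = s • t.qFun F L 1 (y * x) := by
  have hv : ∀ (c : ℂ) (v : 𝔄), t.qFun F L (c • v) = c • t.qFun (A := A) F L v := by
    intro c v
    rw [XTrace.qFun, XTrace.qFun, ← splitSum_smul]
    congr 1
    refine LinearMap.ext fun z => LinearMap.ext fun b => LinearMap.ext fun w => ?_
    simp
  have h1 : (s * s) • x = x := by
    rw [mul_smul, ← hx, ← map_smul, ← hx, gradeAut_gradeAut]
  rw [XTrace.qFun_mul, XTrace.qFun_mul, hx, hy, map_smul, map_smul, one_mul, one_mul, mul_one, mul_one,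
    smul_add, hv, hv, LinearMap.smul_apply, LinearMap.smul_apply, smul_smul,
    ← (t.qFun F L (pr F L y)).map_smul (s * s), h1, add_comm]

/-- tr(y) = tr(F F y) = -tr(F y F) = -tr(y). -/
theorem XTrace.tr_odd (hF : F * F = 1) (hT : ∀ y, t.tr₁ y F = 0) {y : 𝔄} (hy : F * y = -(y * F)) :
    t.tr y = 0 := by
  have h1 : t.tr y = -t.tr y := by
    conv_lhs => rw [← one_mul y, ← hF, mul_assoc, hy, mul_neg, map_neg, ← mul_assoc, t.tr_comm hT,
      ← mul_assoc, hF, one_mul]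
  have h2 : (2 : ℂ) • t.tr y = 0 := by
    rw [two_smul]
    nth_rewrite 1 [h1]
    exact neg_add_cancel _
  exact (smul_eq_zero.1 h2).resolve_left two_ne_zero

/-- The terms are sorted by the factor that carries no commutator. The first subword gives the
leading trace, each later subword a positive term and each letter a negative one, according to the
parity of its position. The induction needs v arbitrary, since peeling off a subword and a letter
replaces v by v P₁(z) ∇b. -/
theorem XTrace.qFun_tower (hF : F * F = 1) (hT : ∀ y, t.tr₁ y F = 0) (j : ℕ) {v : 𝔄}
    (hv : F * v = -(v * F)) (l : List A) : t.qFun F L v (tower A j l) =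
      t.tr (hit F L (2 * j) (word l) * v) + ∑ i ∈ Finset.range j, lsum (fun z b w =>
        t.tr (hit F L (2 * j - (2 * i + 2)) (word w) * v * hit F L (2 * i + 1) (word z) * nab F L b) -
        t.tr (L b * (hit F L (2 * j - (2 * i + 1)) (word w) * v * hit F L (2 * i + 1) (word z)))) l := by
  induction j generalizing v l with
  | zero =>
    rw [tower, XTrace.qFun_ι]
    cases l with
    | nil => simp [t.tr_odd hF hT hv]
    | cons a l => simp [uT_tword_cons (F := F)]
  | succ j ih =>
    have step : ∀ z b w, t.qFun F L v (TensorAlgebra.ι ℂ (tword z) * TensorAlgebra.ι ℂ (T.ι A b) *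
        tower A j w) = t.tr (hit F L 0 (word z) * nab F L b * hit F L (2 * j + 1) (word w) * v) +
          (t.tr (hit F L (2 * j) (word w) * v * hit F L 1 (word z) * nab F L b) -
            t.tr (L b * (hit F L (2 * j + 1) (word w) * v * hit F L 1 (word z)))) +
          ∑ i ∈ Finset.range j, lsum (fun z' b' w' =>
        t.tr (hit F L (2 * j - (2 * i + 2)) (word w') * v * (hit F L 1 (word z) * nab F L b * hit F L (2 * i + 1) (word z')) * nab F L b') -
        t.tr (L b' * (hit F L (2 * j - (2 * i + 1)) (word w') * v * (hit F L 1 (word z) * nab F L b * hit F L (2 * i + 1) (word z'))))) w := by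
      intro z b w
      have hv' : F * (v * hit F L 1 (word z) * nab F L b) = -(v * hit F L 1 (word z) * nab F L b * F) := by
        rw [← mul_assoc, ← mul_assoc, hv, neg_mul, mul_assoc v, hit_comm_of_odd hF (by simp), neg_mul,
          mul_neg, neg_mul, ← mul_assoc v, mul_assoc _ F, F_nab hF]
        noncomm_ring
      -- The empty subword is sent to 0 by `uT` but to 1 by P₀; the discrepancy anticommutes with F,
      -- so its trace is zero.
      have h0 : t.tr (uT L (tword z) * (nab F L b * (hit F L (2 * j + 1) (word w) * v))) =
          t.tr (hit F L 0 (word z) * nab F L b * hit F L (2 * j + 1) (word w) * v) := by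
        cases z with
        | nil =>
          have := t.tr_odd hF hT (y := nab F L b * hit F L (2 * j + 1) (word w) * v) (by
            rw [← mul_assoc, ← mul_assoc, F_nab hF, neg_mul, mul_assoc _ F,
              hit_comm_of_odd hF (by simp), mul_neg, neg_neg, ← mul_assoc, mul_assoc _ F, hv]
            noncomm_ring)
          simp [this]
        | cons a z => simp only [uT_tword_cons (F := F), mul_assoc]
      rw [t.qFun_mul, t.qFun_mul, pr_tower hF, t.qFun_ι, t.qFun_ι, pr_ι, nab_letter, h0]
      have e : v * pr F L (gradeAut (T A) (TensorAlgebra.ι ℂ (tword z) * TensorAlgebra.ι ℂ (T.ι A b))) =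
          v * hit F L 1 (word z) * nab F L b := by
        simp [nab_letter, nab_tword hF, mul_assoc]
      rw [e, ih hv', gradeAut_ι, map_neg, pr_ι, nab_tword hF, uT_ι]
      simp only [mul_assoc, mul_neg, map_neg]
      abel
    rw [tower, map_lsum]
    simp only [step]
    rw [lsum_add, lsum_add, lsum_finset_sum, Finset.sum_range_succ', add_assoc, add_comm (lsum _ l)
      (Finset.sum _ _)]
    congr 1
    · rw [show 2 * (j + 1) = 0 + 1 + (2 * j + 1) by ring, hit_split, lsum_mul, map_lsum]
    congr 1
    refine Finset.sum_congr rfl fun i _ => ?_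
    rw [lsum_assoc]
    refine lsum_congr fun z b w _ => ?_
    rw [show 2 * (i + 1) + 1 = 1 + 1 + (2 * i + 1) by ring, hit_split, mul_lsum, mul_lsum, mul_lsum,
      lsum_mul, map_lsum, map_lsum, ← lsum_sub]
    rw [show 2 * (j + 1) - (2 * (i + 1) + 2) = 2 * j - (2 * i + 2) by omega,
      show 2 * (j + 1) - (1 + 1 + (2 * i + 1)) = 2 * j - (2 * i + 1) by omega]

/-- After `XTrace.tr_hit_nab` the sums left over by `XTrace.qFun_tower` are those in
`XTrace.b_kOne`. Replacing them by the boundary of `kOne` costs j copies of the two traces of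
P_{2j+1}, in addition to the one already present. -/
theorem XTrace.qFun_tower_mul_ι (hF : F * F = 1) (hT : ∀ y, t.tr₁ y F = 0) (j : ℕ) (l : List A)
    (a : A) : t.qFun F L 1 (tower A j l * TensorAlgebra.ι ℂ (T.ι A a)) =
      t.b (t.kOne F L j (natD (ofW A (word l)) (T.ι A a : U (T A)))) -
      (j + 1 : ℂ) • t.tr (hit F L (2 * j + 1) (word l) * L a + L a * hit F L (2 * j + 1) (word l)) := by
  rw [t.qFun_mul, pr_ι, nab_letter, t.qFun_ι, uT_ι, mul_one, one_mul, gradeAut_tower, map_neg,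
    pr_tower hF, t.qFun_tower hF hT j (F_nab hF a), t.b_kOne hF hT, t.tr_mul_nab hT]
  have h := hit_succ_of_even (L := L) hF (even_two_mul j) (word l)
  have e : hit F L (2 * j) (word l) * F - F * hit F L (2 * j) (word l) = -hit F L (2 * j + 1) (word l) := by
    rw [h]; abel
  have e2 : ∀ i ∈ Finset.range j, lsum (fun z b w =>
        t.tr (hit F L (2 * j - (2 * i + 2)) (word w) * nab F L a * hit F L (2 * i + 1) (word z) * nab F L b) -
        t.tr (L b * (hit F L (2 * j - (2 * i + 1)) (word w) * nab F L a * hit F L (2 * i + 1) (word z)))) l =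
      -(t.pSum F L a (2 * j - (2 * i + 1)) (2 * i + 1) l +
        t.qSum F L a (2 * j - (2 * i + 1)) (2 * i + 1) l) := by
    intro i hi
    rw [Finset.mem_range] at hi
    rw [neg_add, XTrace.pSum, XTrace.qSum, ← lsum_neg, ← lsum_neg, ← lsum_add]
    refine lsum_congr fun z b w _ => ?_
    rw [t.tr_hit_nab hF hT a b (by rw [show 2 * j - (2 * i + 2) = 2 * (j - (i + 1)) by omega]; simp)
      (by simp), show 2 * j - (2 * i + 2) + 1 = 2 * j - (2 * i + 1) by omega, sub_eq_add_neg]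
  rw [e, Finset.sum_congr rfl e2, Finset.sum_neg_distrib, neg_mul, map_neg, map_add, mul_neg, map_neg]
  module

end Towers

/-! ### Towers and the odd component -/

section OddTowers

set_option linter.unusedSectionVars false

variable {𝔄 M Z A : Type*} [Ring 𝔄] [Algebra ℂ 𝔄] [AddCommGroup M] [Module ℂ M]
    [AddCommGroup Z] [Module ℂ Z] [NonUnitalRing A] [Module ℂ A]
variable {F : 𝔄} {L : A →ₗ[ℂ] 𝔄} {t : XTrace 𝔄 M Z}

/-- The sum of `tr₁ (pr(α w) c pr(z)) (u(y))` over the decompositions `z y w`. -/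
def XTrace.jFun (t : XTrace 𝔄 M Z) (F : 𝔄) (L : A →ₗ[ℂ] 𝔄) (c : 𝔄) : TensorAlgebra ℂ (T A) →ₗ[ℂ] Z :=
  splitSum (trilin (fun z y w => t.tr₁ (pr F L (gradeAut (T A) w) * c * pr F L z) (uT L y))
    (by intros; simp [mul_add]) (by intros; simp) (by intros; simp) (by intros; simp)
    (by intros; simp [add_mul]) (by intros; simp))

theorem XTrace.jFun_mul (c : 𝔄) (x y : TensorAlgebra ℂ (T A)) : t.jFun F L c (x * y) =
    t.jFun F L (pr F L (gradeAut (T A) y) * c) x + t.jFun F L (c * pr F L x) y := by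
  rw [XTrace.jFun, splitSum_mul]
  · rfl
  · intro z b w
    simp [mul_assoc]
  · intro z b w
    simp [mul_assoc]

theorem XTrace.jFun_ι (c : 𝔄) (y : T A) :
    t.jFun F L c (TensorAlgebra.ι ℂ y) = t.tr₁ c (uT L y) := by
  rw [XTrace.jFun, splitSum_ι]
  simp

theorem XTrace.jFun_add (c c' : 𝔄) : t.jFun F L (c + c') = t.jFun F L c + t.jFun (A := A) F L c' := by
  rw [XTrace.jFun, XTrace.jFun, XTrace.jFun, ← splitSum_add]
  congr 1
  refine LinearMap.ext fun z => LinearMap.ext fun b => LinearMap.ext fun w => ?_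
  simp [mul_add, add_mul]

theorem XTrace.jFun_smul (s : ℂ) (c : 𝔄) : t.jFun F L (s • c) = s • t.jFun (A := A) F L c := by
  rw [XTrace.jFun, XTrace.jFun, ← splitSum_smul]
  congr 1
  refine LinearMap.ext fun z => LinearMap.ext fun b => LinearMap.ext fun w => ?_
  simp

/-- The bilinear map `(c, x) ↦ jFun c x`. -/
def XTrace.jBil (t : XTrace 𝔄 M Z) (F : 𝔄) (L : A →ₗ[ℂ] 𝔄) :
    𝔄 →ₗ[ℂ] TensorAlgebra ℂ (T A) →ₗ[ℂ] Z where
  toFun := t.jFun F L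
  map_add' := t.jFun_add
  map_smul' := t.jFun_smul

theorem XTrace.jBil_apply (c : 𝔄) (x : TensorAlgebra ℂ (T A)) : t.jBil F L c x = t.jFun F L c x := rfl

/-- Peeling a subword and a letter off the tower reproduces the recursion `XTrace.gSum_succ_succ`.
-/
theorem XTrace.jFun_tower (hF : F * F = 1) (j : ℕ) (c : 𝔄) (l : List A) :
    t.jFun F L c (tower A j l) = t.gSum F L (2 * j) c l := by
  induction j generalizing c l with
  | zero => rw [tower, t.jFun_ι, t.tr₁_uT (F := F), ← t.gSum_zero]
  | succ j ih =>
    rw [tower, map_lsum, show 2 * (j + 1) = 2 * j + 2 by ring, t.gSum_succ_succ]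
    refine lsum_congr fun z b w _ => ?_
    rw [t.jFun_mul, t.jFun_mul, ih, gradeAut_tower, map_neg, pr_tower hF, t.jFun_ι, t.jFun_ι, gradeAut_ι,
      t.tr₁_uT (F := F), map_mul (pr F L), pr_ι, pr_ι, map_neg, pr_ι, nab_tword hF, nab_letter, uT_ι]
    simp only [pow_mul, neg_one_sq, one_pow, one_smul, neg_mul, mul_neg, neg_neg, map_neg,
      LinearMap.neg_apply, ← sub_eq_add_neg, mul_assoc]

/-- The sum of `jFun (u(z)) (c ⊗ w ⊗ y)` over the decompositions `z c w` of a word. -/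
def XTrace.fFun (t : XTrace 𝔄 M Z) (F : 𝔄) (L : A →ₗ[ℂ] 𝔄) :
    T A →ₗ[ℂ] TensorAlgebra ℂ (T A) →ₗ[ℂ] Z :=
  splitSum (trilin (fun z c w => t.jBil F L (TensorAlgebra.lift ℂ L z) ∘ₗ
      LinearMap.mulLeft ℂ (TensorAlgebra.ι ℂ (T.ι A c) * TensorAlgebra.ι ℂ (ofW A w).snd))
    (by intros; ext; simp) (by intros; ext; simp) (by intros; ext; simp [add_mul, mul_assoc])
    (by intros; ext; simp [mul_assoc])
    (by intros; ext; simp [add_mul, mul_add, mul_assoc]) (by intros; ext; simp [mul_assoc])) ∘ₗ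
    (T.incl A : T A →ₗ[ℂ] TensorAlgebra ℂ A)

theorem XTrace.fFun_tword (l : List A) (y : TensorAlgebra ℂ (T A)) : t.fFun F L (tword l) y =
    lsum (fun z c w => t.jFun F L (hit F L 0 (word z)) (TensorAlgebra.ι ℂ (T.ι A c) *
      TensorAlgebra.ι ℂ (tword w) * y)) l := by
  rw [XTrace.fFun, LinearMap.comp_apply]
  refine (LinearMap.congr_fun (splitSum_incl_tword _ l) y).trans ?_
  refine (map_lsum₂ (LinearMap.id : _ →ₗ[ℂ] TensorAlgebra ℂ (T A) →ₗ[ℂ] Z) _ _ _).trans ?_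
  refine lsum_congr fun z c w _ => ?_
  rw [hit_zero]
  rfl

/-- The sum of `fFun y (w C z)` over the decompositions `z y w`. -/
def XTrace.rFun (t : XTrace 𝔄 M Z) (F : 𝔄) (L : A →ₗ[ℂ] 𝔄) (C : TensorAlgebra ℂ (T A)) :
    TensorAlgebra ℂ (T A) →ₗ[ℂ] Z :=
  splitSum (trilin (fun z y w => t.fFun F L y (w * C * z))
    (by intros; simp [mul_add]) (by intros; simp) (by intros; simp) (by intros; simp)
    (by intros; simp [add_mul]) (by intros; simp))

theorem XTrace.rFun_mul (C x y : TensorAlgebra ℂ (T A)) : t.rFun F L C (x * y) =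
    t.rFun F L (y * C) x + t.rFun F L (C * x) y := by
  rw [XTrace.rFun, splitSum_mul]
  · rfl
  · intro z b w
    simp [mul_assoc]
  · intro z b w
    simp [mul_assoc]

theorem XTrace.rFun_ι (C : TensorAlgebra ℂ (T A)) (y : T A) :
    t.rFun F L C (TensorAlgebra.ι ℂ y) = t.fFun F L y C := by
  rw [XTrace.rFun, splitSum_ι]
  simp

theorem XTrace.rFun_cyclic (x y : TensorAlgebra ℂ (T A)) :
    t.rFun F L 1 (x * y) = t.rFun F L 1 (y * x) := by
  rw [t.rFun_mul, t.rFun_mul, mul_one, mul_one, one_mul, one_mul, add_comm]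

/-- The factor under d is the letter c, a factor of the tower, or a factor of C. The first two cases
add up to the recursion `XTrace.gSum_succ`; in the third the coefficient in front of C is summed to
P_{2j+2} by `hit_split`. -/
theorem XTrace.lsum_jFun_tower (hF : F * F = 1) (j : ℕ) {C : TensorAlgebra ℂ (T A)}
    (hC : gradeAut (T A) C = C) (l : List A) :
    lsum (fun z c w => t.jFun F L (hit F L 0 (word z)) (TensorAlgebra.ι ℂ (T.ι A c) *
      (tower A j w * C))) l =
    t.gSum F L (2 * j + 1) (pr F L C) l + t.jFun F L (hit F L (2 * j + 2) (word l)) C := by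
  rw [t.gSum_succ, show 2 * j + 2 = 0 + 1 + (2 * j + 1) by ring, hit_split, ← t.jBil_apply,
    map_lsum₂, ← lsum_add]
  refine lsum_congr fun z b w _ => ?_
  rw [t.jFun_mul, t.jFun_mul, t.jFun_ι, t.jFun_tower hF, map_mul (gradeAut (T A)), gradeAut_tower, hC,
    map_mul (pr F L), map_neg, pr_tower hF, pr_ι, nab_letter, uT_ι, t.jBil_apply, pow_succ, pow_mul]
  simp [mul_assoc, add_assoc]

/-- Each of the j + 1 subwords of the tower may be the one on which `fFun` acts, and each
contributes the same expression. An even C is carried along to hold the factors already passed. -/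
theorem XTrace.rFun_tower (hF : F * F = 1) (j : ℕ) {C : TensorAlgebra ℂ (T A)}
    (hC : gradeAut (T A) C = C) (l : List A) : t.rFun F L C (tower A j l) = (j + 1 : ℂ) •
      (t.gSum F L (2 * j + 1) (pr F L C) l + t.jFun F L (hit F L (2 * j + 2) (word l)) C) := by
  induction j generalizing C l with
  | zero =>
    rw [tower, t.rFun_ι, t.fFun_tword, ← t.lsum_jFun_tower hF 0 hC]
    simp [tower, mul_assoc]
  | succ j ih =>
    -- A single letter c leaves w empty, and `tword` of the empty word is zero; this reflects φ(a) =
    -- 0.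
    have h0 : ∀ (a : A) y, t.fFun F L (T.ι A a) y = 0 := by
      intro a y
      rw [← tword_singleton, t.fFun_tword]
      simp [lsum_cons]
    have step : ∀ (z : List A) (b : A) (w : List A), t.rFun F L C (TensorAlgebra.ι ℂ (tword z) *
        TensorAlgebra.ι ℂ (T.ι A b) * tower A j w) =
        lsum (fun z₁ c z₂ => t.jFun F L (hit F L 0 (word z₁)) (TensorAlgebra.ι ℂ (T.ι A c) *
          (TensorAlgebra.ι ℂ (tword z₂) * TensorAlgebra.ι ℂ (T.ι A b) * tower A j w * C))) z +
        (j + 1 : ℂ) • (t.gSum F L (2 * j + 1) (pr F L C * hit F L 1 (word z) * nab F L b) w +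
          t.jFun F L (hit F L (2 * j + 2) (word w)) (C * (TensorAlgebra.ι ℂ (tword z) *
            TensorAlgebra.ι ℂ (T.ι A b)))) := by
      intro z b w
      rw [t.rFun_mul, t.rFun_mul, t.rFun_ι, t.rFun_ι, h0, add_zero, ih (by simp [hC]), t.fFun_tword,
        map_mul (pr F L), map_mul (pr F L), pr_ι, pr_ι, nab_tword hF, nab_letter]
      simp only [mul_assoc]
    have e : lsum (fun z b w => lsum (fun z₁ c z₂ => t.jFun F L (hit F L 0 (word z₁))
        (TensorAlgebra.ι ℂ (T.ι A c) * (TensorAlgebra.ι ℂ (tword z₂) * TensorAlgebra.ι ℂ (T.ι A b) *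
          tower A j w * C))) z) l = t.gSum F L (2 * (j + 1) + 1) (pr F L C) l +
        t.jFun F L (hit F L (2 * (j + 1) + 2) (word l)) C := by
      rw [← t.lsum_jFun_tower hF (j + 1) hC, ← lsum_assoc]
      refine lsum_congr fun z c w _ => ?_
      rw [tower, lsum_mul, mul_lsum, map_lsum]
    have e' : lsum (fun z b w => t.gSum F L (2 * j + 1) (pr F L C * hit F L 1 (word z) * nab F L b) w +
          t.jFun F L (hit F L (2 * j + 2) (word w)) (C * (TensorAlgebra.ι ℂ (tword z) *
            TensorAlgebra.ι ℂ (T.ι A b)))) l = t.gSum F L (2 * (j + 1) + 1) (pr F L C) l +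
        t.jFun F L (hit F L (2 * (j + 1) + 2) (word l)) C := by
      rw [show 2 * (j + 1) + 1 = 2 * j + 1 + 2 by ring, t.gSum_succ_succ,
        show 2 * (j + 1) + 2 = 1 + 1 + (2 * j + 2) by ring, hit_split, ← t.jBil_apply,
        map_lsum₂, ← lsum_add]
      refine lsum_congr fun z b w _ => ?_
      rw [t.jFun_mul, t.jFun_mul, t.jFun_ι, t.jFun_ι, t.tr₁_uT (F := F), t.jBil_apply, pow_succ, pow_mul,
        map_mul (gradeAut (T A)), gradeAut_ι, gradeAut_ι, map_mul (pr F L), map_neg, map_neg, pr_ι, pr_ι,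
        nab_tword hF, nab_letter, uT_ι]
      simp only [neg_one_sq, one_pow, one_mul, neg_mul, mul_neg, neg_neg, map_neg, neg_smul, one_smul,
        LinearMap.neg_apply, mul_assoc]
      abel
    rw [tower, map_lsum]
    simp only [step]
    rw [lsum_add, lsum_smul, e, e']
    push_cast
    module

theorem XTrace.rFun_one_tower (hF : F * F = 1) (j : ℕ) (l : List A) :
    t.rFun F L 1 (tower A j l) = (j + 1 : ℂ) • t.gSum F L (2 * j + 1) 1 l := by
  have h : t.jFun F L (hit F L (2 * j + 2) (word l)) 1 = 0 := by
    rw [← word_nil, XTrace.jFun, splitSum_word, lsum_nil]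
  rw [t.rFun_tower hF j (map_one _), h, add_zero, map_one]

end OddTowers

/-! ### Forms as words -/

section RotLists

theorem ofFn_rotate {α : Type*} {N : ℕ} (Q : Fin (N + 1) → α) (k : Fin (N + 1)) :
    List.ofFn (fun j : Fin N => Q (j.succ + k)) =
      (List.ofFn Q).drop (k + 1) ++ (List.ofFn Q).take k := by
  refine List.ext_getElem ?_ fun s h₁ h₂ => ?_
  · simp
    omega
  · rw [List.length_ofFn] at h₁
    rw [List.getElem_ofFn]
    have hk := k.2
    by_cases hs : s < N - k
    · rw [List.getElem_append_left (by simp; omega), List.getElem_drop, List.getElem_ofFn]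
      congr 1
      ext
      rw [Fin.val_add]
      simp only [Fin.val_succ]
      rw [Nat.mod_eq_of_lt (by omega)]
      omega
    · rw [List.getElem_append_right (by simp; omega), List.getElem_take, List.getElem_ofFn]
      congr 1
      ext
      rw [Fin.val_add]
      simp only [Fin.val_succ, List.length_drop, List.length_ofFn]
      rw [Nat.mod_eq_sub_mod (by omega), Nat.mod_eq_of_lt (by omega)]
      omega

theorem lsum_ofFn {V W : Type*} [AddCommGroup W] (f : List V → V → List V → W) {N : ℕ} (Y : Fin N → V) :
    lsum f (List.ofFn Y) =
      ∑ k : Fin N, f ((List.ofFn Y).take k) (Y k) ((List.ofFn Y).drop (k + 1)) := by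
  rw [lsum_eq_sum]
  refine Fintype.sum_equiv (finCongr (List.length_ofFn)) _ _ fun k => ?_
  simp
  rfl

/-- Translation by k is the k-th power of an (n+1)-cycle, whose sign is (-1)^n. -/
theorem sign_addRight {n : ℕ} (k : Fin (n + 1)) :
    Equiv.Perm.sign (Equiv.addRight k : Equiv.Perm (Fin (n + 1))) = (-1) ^ (n * k.val) := by
  have h : ∀ m : ℕ, ∀ i : Fin (n + 1), (finRotate (n + 1) ^ m) i = i + (Fin.ofNat (n + 1) m) := by
    intro m
    induction m with
    | zero => intro i; simp
    | succ m ih =>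
      intro i
      rw [pow_succ', Equiv.Perm.mul_apply, ih, finRotate_apply, add_assoc]
      congr 1
      ext
      simp [Fin.val_add]
  have e : (Equiv.addRight k : Equiv.Perm (Fin (n + 1))) = finRotate (n + 1) ^ k.val := by
    ext i
    rw [h]
    simp
  rw [e, map_pow, sign_finRotate, Nat.add_sub_cancel, pow_mul]

end RotLists

/-! ### Noncommutative forms over `TA`, and φ, in the tensor algebra of `TA` -/

section FormWords

set_option linter.unusedSectionVars false

variable {R : Type*} [NonUnitalRing R] [Module ℂ R] [IsScalarTower ℂ R R] [SMulCommClass ℂ R R]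
variable {V : Type*} [AddCommGroup V] [Module ℂ V]

theorem om_ext {n : ℕ} {f g : Om R n →ₗ[ℂ] V}
    (h : ∀ x v, f (x ⊗ₜ PiTensorProduct.tprod ℂ v) = g (x ⊗ₜ PiTensorProduct.tprod ℂ v)) : f = g := by
  refine TensorProduct.ext' fun x w => ?_
  induction w using PiTensorProduct.induction_on with
  | smul_tprod c v => rw [TensorProduct.tmul_smul, map_smul, map_smul, h]
  | add a b ha hb => rw [TensorProduct.tmul_add, map_add, map_add, ha, hb]

variable (R) in
/-- The map `x₀ dx₁ ⋯ dxₙ ↦ x₀ ⊗ (x₁ ⊗ ⋯ ⊗ xₙ)` with values in the tensor algebra. -/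
def formWord (n : ℕ) : Om R n →ₗ[ℂ] U R ⊗[ℂ] TensorAlgebra ℂ R :=
  LinearMap.lTensor (U R) (PiTensorProduct.lift (TensorAlgebra.tprod ℂ R n))

theorem formWord_tmul {n : ℕ} (x : U R) (v : Fin n → R) :
    formWord R n (x ⊗ₜ PiTensorProduct.tprod ℂ v) = x ⊗ₜ word (List.ofFn v) := by
  rw [formWord, LinearMap.lTensor_tmul, PiTensorProduct.lift.tprod, TensorAlgebra.tprod_apply, word,
    List.map_ofFn]
  rfl

theorem mulD_tmul {n : ℕ} (x : U R) (v : Fin n → R) (y : U R) :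
    mulD n (x ⊗ₜ PiTensorProduct.tprod ℂ v) y =
      x ⊗ₜ PiTensorProduct.tprod ℂ (Fin.snoc v y.snd : Fin (n + 1) → R) := by
  have h : x ⊗ₜ PiTensorProduct.tprod ℂ v = form n (Fin.cons x (fun i => (v i : U R))) := by
    rw [form_apply]
    simp
  rw [h, mulD_form, form_apply]
  have h0 : (Fin.snoc (Fin.cons x (fun i => (v i : U R)) : Fin (n + 1) → U R) y : Fin (n + 2) → U R) 0
      = x := by
    rw [← Fin.castSucc_zero, Fin.snoc_castSucc (α := fun _ => U R)]
    rfl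
  rw [h0]
  congr 2
  funext i
  rw [← Fin.cons_snoc_eq_snoc_cons (β := U R), Fin.cons_succ]
  refine Fin.lastCases ?_ (fun k => ?_) i
  · rw [Fin.snoc_last, Fin.snoc_last]
  · rw [Fin.snoc_castSucc (α := fun _ => U R), Fin.snoc_castSucc (α := fun _ => R), Unitization.snd_inr]

theorem formWord_mulD (n : ℕ) (ω : Om R n) (y : U R) : formWord R (n + 1) (mulD n ω y) =
    LinearMap.lTensor (U R) (LinearMap.mulRight ℂ (TensorAlgebra.ι ℂ y.snd)) (formWord R n ω) := by
  have : formWord R (n + 1) ∘ₗ (mulD n).flip y = LinearMap.lTensor (U R)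
      (LinearMap.mulRight ℂ (TensorAlgebra.ι ℂ y.snd)) ∘ₗ formWord R n := by
    refine om_ext fun x v => ?_
    rw [LinearMap.comp_apply, LinearMap.comp_apply, LinearMap.flip_apply, mulD_tmul, formWord_tmul,
      formWord_tmul, LinearMap.lTensor_tmul, List.ofFn_succ']
    simp [List.concat_eq_append]
  exact LinearMap.congr_fun this ω

theorem formWord_appendD (n : ℕ) (ω : Om R 2) (y : Fin n → U R) :
    formWord R (n + 2) (appendD n ω y) = LinearMap.lTensor (U R)
      (LinearMap.mulRight ℂ (word (List.ofFn fun i => (y i).snd))) (formWord R 2 ω) := by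
  induction n with
  | zero =>
    have : LinearMap.mulRight ℂ (word (List.ofFn fun i : Fin 0 => (y i).snd)) = LinearMap.id := by
      ext x
      simp
    rw [this, LinearMap.lTensor_id, LinearMap.id_apply]
    rfl
  | succ n ih =>
    have h : appendD (n + 1) ω y = mulD (n + 2) (appendD n ω (Fin.init y)) (y (Fin.last n)) := rfl
    rw [h, formWord_mulD, ih, ← LinearMap.comp_apply, ← LinearMap.lTensor_comp]
    congr 2
    ext x
    rw [LinearMap.comp_apply, LinearMap.mulRight_apply, LinearMap.mulRight_apply,
      LinearMap.mulRight_apply, List.ofFn_succ', List.concat_eq_append, word_append, word_cons, word_nil,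
      mul_one, mul_assoc]
    rfl

theorem formWord_dTwo (x y z : U R) : formWord R 2 (dTwo x y z) =
    x ⊗ₜ (TensorAlgebra.ι ℂ y.snd * TensorAlgebra.ι ℂ z.snd) := by
  rw [dTwo_apply, form_apply, formWord_tmul]
  simp

/-- The map `x₀ dx₁ ⋯ dxₙ ↦ x₀ ⊗ x₁ ⊗ ⋯ ⊗ xₙ`, for `x₀ ∈ R`, which vanishes on `dx₁ ⋯ dxₙ`. -/
def headIn : U R ⊗[ℂ] TensorAlgebra ℂ R →ₗ[ℂ] TensorAlgebra ℂ R :=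
  TensorProduct.lift ((LinearMap.mul ℂ (TensorAlgebra ℂ R)) ∘ₗ TensorAlgebra.ι ℂ ∘ₗ
    Unitization.sndHom (S := ℂ) (R := ℂ) (A := R))

theorem headIn_tmul (x : U R) (y : TensorAlgebra ℂ R) :
    headIn (x ⊗ₜ y) = TensorAlgebra.ι ℂ x.snd * y := rfl

theorem headIn_mulRight (w : TensorAlgebra ℂ R) (y : U R ⊗[ℂ] TensorAlgebra ℂ R) :
    headIn (LinearMap.lTensor (U R) (LinearMap.mulRight ℂ w) y) = headIn y * w := by
  induction y using TensorProduct.induction_on with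
  | zero => simp
  | tmul x y => simp [headIn_tmul, mul_assoc]
  | add x y hx hy => simp only [map_add, hx, hy, add_mul]

theorem headIn_formWord_tmul {n : ℕ} (x : U R) (v : Fin n → R) :
    headIn (formWord R n (x ⊗ₜ PiTensorProduct.tprod ℂ v)) =
      word (List.ofFn (Fin.cons x.snd v : Fin (n + 1) → R)) := by
  rw [formWord_tmul, headIn_tmul]
  simp

variable {A : Type*} [NonUnitalRing A] [Module ℂ A]

theorem phi_tword (l : List A) : phi (tword l) =
    lsum (fun z b w => dTwo (ofW A (word z)) (T.ι A b : U (T A)) (ofW A (word w))) l := by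
  have key : ∀ l : List A, phiHom A (word l) (1, 0) = (ofW A (word l),
      lsum (fun z b w => dTwo (ofW A (word z)) (T.ι A b : U (T A)) (ofW A (word w))) l) := by
    intro l
    induction l with
    | nil => simp
    | cons a l ih =>
      rw [word_cons, map_mul, Module.End.mul_apply, ih, phiHom_ι, lsum_cons]
      refine Prod.ext ?_ ?_
      · simp [phiStep]
      · change lmul 2 _ (lsum _ l) + _ = _
        rw [map_lsum, add_comm]
        simp [lmul_dTwo]
  cases l with
  | nil => simp
  | cons a l =>
    have : phi (tword (a :: l)) = (phiHom A (T.incl A (tword (a :: l))) (1, 0)).2 := rfl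
    rw [this, incl_tword_cons, key]

/-- The terms with z or w empty disappear on both sides: `headIn` discards the scalar part of x₀,
and d1 = 0. -/
theorem headIn_phi (y : T A) : headIn (formWord (T A) 2 (phi y)) = tripleSplit A y := by
  have : headIn ∘ₗ formWord (T A) 2 ∘ₗ phi = tripleSplit A := by
    refine T_hom_ext fun a l => ?_
    rw [LinearMap.comp_apply, LinearMap.comp_apply, phi_tword, map_lsum, map_lsum, tripleSplit_tword,
      tower]
    refine lsum_congr fun z b w _ => ?_
    rw [formWord_dTwo, headIn_tmul, ← mul_assoc]
    rfl
  exact LinearMap.congr_fun this y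

theorem phiForm_tmul (n : ℕ) (x : U (T A)) (v : Fin n → T A) :
    phiForm n (x ⊗ₜ PiTensorProduct.tprod ℂ v) = ∑ k : Fin (n + 1), (-1 : ℂ) ^ (n * k.val) •
      appendD n (phi ((Fin.cons x.snd v : Fin (n + 1) → T A) k))
        (fun j => (Fin.cons x (fun i => (v i : U (T A))) : Fin (n + 1) → U (T A)) (j.succ + k)) := by
  rw [phiForm, liftForm_tmul, sum_apply]
  refine Finset.sum_congr rfl fun k _ => ?_
  rw [smul_apply, MultilinearMap.domDomCongr_apply, LinearMap.uncurryLeft_apply]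
  simp only [LinearMap.comp_apply, Equiv.coe_addRight, zero_add]
  congr 3
  refine Fin.cases ?_ (fun i => ?_) k <;> simp

theorem snd_cons (n : ℕ) (x : U R) (v : Fin n → R) (k : Fin (n + 1)) :
    ((Fin.cons x (fun i => (v i : U R)) : Fin (n + 1) → U R) k).snd =
      (Fin.cons x.snd v : Fin (n + 1) → R) k := by
  refine Fin.cases ?_ (fun i => ?_) k <;> simp

/-- For n odd the sign (-1)^{nk} is the degree of the k factors moved behind the others, which is
the sign in `rotOdd`. For n even there is no sign and `rotEven` appears instead. -/
theorem headIn_phiForm_odd {n : ℕ} (hn : Odd n) (ω : Om (T A) n) :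
    headIn (formWord (T A) (n + 2) (phiForm n ω)) =
      rotOdd (tripleSplit A) (headIn (formWord (T A) n ω)) := by
  have : headIn ∘ₗ formWord (T A) (n + 2) ∘ₗ phiForm n =
      rotOdd (tripleSplit A) ∘ₗ headIn ∘ₗ formWord (T A) n := by
    refine om_ext fun x v => ?_
    simp only [LinearMap.comp_apply]
    rw [headIn_formWord_tmul, rotOdd_word, lsum_ofFn, phiForm_tmul, map_sum, map_sum]
    refine Finset.sum_congr rfl fun k _ => ?_
    rw [map_smul, map_smul, formWord_appendD, headIn_mulRight, headIn_phi, gradeAut_word]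
    simp only [snd_cons]
    rw [ofFn_rotate, word_append, pow_mul, hn.neg_one_pow, mul_smul_comm, mul_assoc, List.length_take,
      List.length_ofFn, min_eq_left k.2.le]
  exact LinearMap.congr_fun this ω

theorem headIn_phiForm_even {n : ℕ} (hn : Even n) (ω : Om (T A) n) :
    headIn (formWord (T A) (n + 2) (phiForm n ω)) =
      rotEven (tripleSplit A) (headIn (formWord (T A) n ω)) := by
  have : headIn ∘ₗ formWord (T A) (n + 2) ∘ₗ phiForm n =
      rotEven (tripleSplit A) ∘ₗ headIn ∘ₗ formWord (T A) n := by
    refine om_ext fun x v => ?_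
    simp only [LinearMap.comp_apply]
    rw [headIn_formWord_tmul, rotEven_word, lsum_ofFn, phiForm_tmul, map_sum, map_sum]
    refine Finset.sum_congr rfl fun k _ => ?_
    rw [map_smul, map_smul, formWord_appendD, headIn_mulRight, headIn_phi]
    simp only [snd_cons]
    rw [ofFn_rotate, word_append, pow_mul, hn.neg_one_pow, one_pow, one_smul, mul_assoc]
  exact LinearMap.congr_fun this ω

/-- The correction b(x φ(a)) vanishes because φ(a) = 0. On the generators ♮x da the map γ is
therefore (1 - φ)⁻¹ applied to x da itself. -/
theorem gammaOne_letter (x : U (T A)) (a : A) :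
    gammaOne A (natD x (T.ι A a : U (T A))) = dOne x (T.ι A a : U (T A)) := by
  have : gammaOne A (natD x (T.ι A a : U (T A))) = gammaForm (dOne x (T.ι A a : U (T A))) := rfl
  rw [this, gammaForm_dOne, phi_ι, map_zero, map_zero, add_zero]

theorem headIn_gamma_odd (j : ℕ) (x : X (T A)) :
    headIn (formWord (T A) (2 * j + 1) (gamma A (2 * j + 1) x)) =
      (rotOdd (tripleSplit A) ^ j) (headIn (formWord (T A) 1 (gammaOne A x.2))) := by
  induction j with
  | zero => rfl
  | succ j ih =>
    rw [pow_succ', Module.End.mul_apply, ← ih, ← headIn_phiForm_odd ⟨j, rfl⟩]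
    rfl

theorem headIn_gamma_even (j : ℕ) (x : X (T A)) :
    headIn (formWord (T A) (2 * j) (gamma A (2 * j) x)) =
      (rotEven (tripleSplit A) ^ j) (TensorAlgebra.ι ℂ x.1) := by
  induction j with
  | zero =>
    have : gamma A (2 * 0) x = (x.1 : U (T A)) ⊗ₜ PiTensorProduct.tprod ℂ Fin.elim0 := rfl
    rw [this, headIn_formWord_tmul]
    simp
  | succ j ih =>
    rw [pow_succ', Module.End.mul_apply, ← ih, ← headIn_phiForm_even (by simp)]
    rfl

end FormWords

/-! ### The Chern character on words -/

section MatTrace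

set_option linter.unusedSectionVars false

variable {M : Type*} [NonUnitalRing M] [Module ℂ M] [IsScalarTower ℂ M M] [SMulCommClass ℂ M M]

theorem trM_apply (Y : Mat M) : trM Y = (Y 0 0 + Y 1 1).snd := by
  simp [trM, Matrix.trace, Fin.sum_univ_two]

theorem trNat_apply (Y Z : Mat M) :
    trNat Y Z = natD (Y 0 0) (Z 0 0) + natD (Y 0 1) (Z 1 0) + (natD (Y 1 0) (Z 0 1) +
      natD (Y 1 1) (Z 1 1)) := by
  simp [trNat, Fin.sum_univ_two]

variable (M) in
/-- The trace of matrices. -/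
def matTrace : XTrace (Mat M) M (OmNat M) where
  b := bBar
  d := natD 1 ∘ₗ Unitization.inrHom (S := ℂ) (R := ℂ) (A := M)
  tr := trM
  tr₁ := trNat
  b_tr₁ x y := by
    have hs : ∀ x y : U M, (x - y).snd = x.snd - y.snd := fun _ _ => rfl
    rw [trNat_apply, trM_apply, trM_apply]
    simp only [map_add, bBar_natD, Matrix.mul_apply, Fin.sum_univ_two, Unitization.snd_add, hs]
    abel
  tr₁_mul x y z := by
    simp only [trNat_apply, Matrix.mul_apply, Fin.sum_univ_two, map_add, natD_mul, LinearMap.add_apply]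
    abel
  d_tr x := by
    have : natD 1 ((trM x : M) : U M) = natD 1 (x 0 0 + x 1 1) := by
      rw [trM_apply, ← natD_snd]
    refine this.trans ?_
    rw [trNat_apply]
    simp

theorem sgn_mul_sgn : sgn M * sgn M = 1 := by
  rw [sgn, Matrix.diagonal_mul_diagonal, ← Matrix.diagonal_one]
  congr 1
  funext i
  fin_cases i <;> simp

theorem matTrace_sgn (y : Mat M) : (matTrace M).tr₁ y (sgn M) = 0 := by
  change trNat y (sgn M) = 0
  rw [trNat_apply]
  simp [sgn, natD_one_right]

end MatTrace

/-! ### Closed formulas for the Chern character on words -/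

section ChernWords

set_option linter.unusedSectionVars false

variable {R M P : Type*} [NonUnitalRing R] [Module ℂ R]
  [NonUnitalRing M] [Module ℂ M] [IsScalarTower ℂ M M] [SMulCommClass ℂ M M]
  [NonUnitalRing P] [Module ℂ P] {r : R →ₙₐ[ℂ] M} {q : M →ₙₐ[ℂ] P} (h : IsExtension r q)
variable {A : Type*} [NonUnitalRing A] [Module ℂ A]

/-- The linear map `A → M₂(M⁺)` underlying a linear map with values in `offDiag`. -/
def matOf (l : A →ₗ[ℂ] offDiag h) : A →ₗ[ℂ] Mat M :=
  (jMat h).toLinearMap ∘ₗ Unitization.inrHom (S := ℂ) (R := ℂ) (A := offDiag h) ∘ₗ l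

theorem jMat_coe (x : offDiag h) : jMat h (x : U (offDiag h)) = matIncl M x := by
  simp [jMat]

theorem matOf_apply (l : A →ₗ[ℂ] offDiag h) (a : A) (i j : Fin 2) :
    matOf h l a i j = (((l a : Matrix (Fin 2) (Fin 2) M) i j : M) : U M) := by
  have : matOf h l a = jMat h (l a : U (offDiag h)) := rfl
  rw [this, jMat_coe]
  rfl

variable {h}

theorem jMat_uMap (l : A →ₗ[ℂ] offDiag h) (x : TensorAlgebra ℂ A) :
    jMat h (uMap (T.lift l) (ofW A x)) = TensorAlgebra.lift ℂ (matOf h l) x := by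
  have e : (jMat h).comp ((uMap (T.lift l)).comp (ofW A)) = TensorAlgebra.lift ℂ (matOf h l) := by
    refine TensorAlgebra.hom_ext (LinearMap.ext fun a => ?_)
    have : T.lift l (T.ι A a) = l a := lift_ι l a
    change jMat h (uMap (T.lift l) (ofW A (TensorAlgebra.ι ℂ a))) =
      TensorAlgebra.lift ℂ (matOf h l) (TensorAlgebra.ι ℂ a)
    rw [ofW_ι, uMap_coe, this, TensorAlgebra.lift_ι_apply]
    rfl
  exact DFunLike.congr_fun e x

theorem jMat_lift (l : A →ₗ[ℂ] offDiag h) (y : T A) :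
    jMat h (T.lift l y : U (offDiag h)) = uT (matOf h l) y := by
  have := jMat_uMap l (T.incl A y)
  rwa [ofW_incl, uMap_coe] at this

theorem commF_jMat (l : A →ₗ[ℂ] offDiag h) (y : T A) :
    commF (jMat h (T.lift l y : U (offDiag h))) = nab (sgn M) (uT (matOf h l)) y := by
  rw [jMat_lift]
  rfl

theorem commF_one : commF (1 : Mat M) = 0 := by simp [commF]

theorem mapForm_tmul {R S : Type*} [NonUnitalRing R] [Module ℂ R] [IsScalarTower ℂ R R]
    [SMulCommClass ℂ R R] [NonUnitalRing S] [Module ℂ S] [IsScalarTower ℂ S S] [SMulCommClass ℂ S S]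
    (f : R →ₙₐ[ℂ] S) {n : ℕ} (x : U R) (v : Fin n → R) :
    mapForm f n (x ⊗ₜ PiTensorProduct.tprod ℂ v) =
      uMap f x ⊗ₜ PiTensorProduct.tprod ℂ (fun i => f (v i)) := by
  rw [mapForm, TensorProduct.map_tmul, PiTensorProduct.map_tprod]
  rfl

theorem pr_word_ofFn {𝔄 : Type*} [Ring 𝔄] [Algebra ℂ 𝔄] (F : 𝔄) (L : A →ₗ[ℂ] 𝔄) (l : List (T A)) :
    pr F L (word l) = (l.map (nab F (uT L))).prod := by
  rw [word, map_list_prod, List.map_map]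
  congr 1
  exact List.map_congr_left fun y _ => pr_ι y

/-- For n odd the sign of the rotation by k is (-1)^k, the sign of the grading automorphism in
`qFun`. -/
theorem chiZero_mapForm {n : ℕ} (hn : Odd n) (l : A →ₗ[ℂ] offDiag h) (ω : Om (T A) n) :
    chiZero h n (mapForm (T.lift l) n ω) = (chiConst n * superFactor) •
      (matTrace M).qFun (sgn M) (matOf h l) 1 (headIn (formWord (T A) n ω)) := by
  have : chiZero h n ∘ₗ mapForm (T.lift l) n = (chiConst n * superFactor) •
      (matTrace M).qFun (sgn M) (matOf h l) 1 ∘ₗ headIn ∘ₗ formWord (T A) n := by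
    refine om_ext fun x v => ?_
    simp only [LinearMap.comp_apply, LinearMap.smul_apply, chiZero]
    congr 1
    rw [headIn_formWord_tmul, XTrace.qFun, splitSum_word, lsum_ofFn, mapForm_tmul, liftForm_tmul,
      sum_apply, map_sum]
    refine Finset.sum_congr rfl fun k _ => ?_
    rw [smul_apply, MultilinearMap.domDomCongr_apply, MultilinearMap.compLinearMap_apply,
      MultilinearMap.mkPiAlgebraFin_apply, List.ofFn_succ, List.prod_cons, trilin_apply]
    simp only [Equiv.coe_addRight, zero_add, if_true, Fin.succ_ne_zero, if_false,
      LinearMap.comp_apply, AlgHom.toLinearMap_apply]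
    set Y : Fin (n + 1) → T A := Fin.cons x.snd v with hY
    set X' : Fin (n + 1) → U (offDiag h) :=
      Fin.cons (uMap (T.lift l) x) (fun j => ((T.lift l (v j) : offDiag h) : U (offDiag h))) with hX
    have hX' : ∀ k, X' k = (X' k).fst • (1 : U (offDiag h)) + (T.lift l (Y k) : U (offDiag h)) := by
      intro k
      conv_lhs => rw [U_cases (X' k)]
      congr 2
      refine Fin.cases ?_ (fun i => ?_) k
      · exact uMap_snd _ _
      · rfl
    have h1 : ∀ k, commF (jMat h (X' k)) = nab (sgn M) (uT (matOf h l)) (Y k) := by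
      intro k
      rw [hX' k, map_add, map_add, map_smul, map_smul, map_one, commF_one, smul_zero, zero_add,
        commF_jMat]
    simp only [h1]
    have h2 : List.ofFn (fun i : Fin n => nab (sgn M) (uT (matOf h l)) (Y (i.succ + k))) =
        (List.ofFn (fun i : Fin n => Y (i.succ + k))).map (nab (sgn M) (uT (matOf h l))) := by
      rw [List.map_ofFn]
      rfl
    have hodd : sgn M * pr (sgn M) (matOf h l) (word (List.ofFn fun i : Fin n => Y (i.succ + k))) =
        -(pr (sgn M) (matOf h l) (word (List.ofFn fun i : Fin n => Y (i.succ + k))) * sgn M) := by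
      rw [F_pr sgn_mul_sgn, gradeAut_word, List.length_ofFn, hn.neg_one_pow]
      simp
    -- This is why `headIn` may drop the scalar part of x₀: it multiplies a product of an odd number
    -- of commutators, which anticommutes with F and has no trace.
    have h3 : trM (pr (sgn M) (matOf h l) (word (List.ofFn fun i : Fin n => Y (i.succ + k)))) = 0 :=
      (matTrace M).tr_odd sgn_mul_sgn matTrace_sgn hodd
    rw [h2, ← pr_word_ofFn, hX' k, map_add (jMat h), map_smul (jMat h), map_one, jMat_lift, add_mul,
      smul_mul_assoc, one_mul, map_zsmul, map_add trM, map_smul trM, h3, smul_zero, zero_add, ofFn_rotate, word_append,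
      map_mul (pr _ _), sign_addRight, gradeAut_word, map_smul, mul_smul_comm, map_smul,
      List.length_take, List.length_ofFn, min_eq_left k.2.le, mul_one, mul_assoc, pow_mul,
      hn.neg_one_pow]
    change _ = _ • trM _
    rcases neg_one_pow_eq_or ℂ k.val with h | h <;>
      rcases Nat.even_or_odd k.val with h' | h' <;> simp [h'.neg_one_pow]
  exact LinearMap.congr_fun this ω

/-- The sign (-1)^{n-i} counts the factors on the right of dxᵢ, and those are the ones to which
`jFun` applies the grading automorphism. -/
theorem chiOne_mapForm (n : ℕ) (l : A →ₗ[ℂ] offDiag h) (x : TensorAlgebra ℂ A)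
    (v : Fin (n + 1) → T A) :
    chiOne h n (mapForm (T.lift l) (n + 1) (ofW A x ⊗ₜ PiTensorProduct.tprod ℂ v)) =
      (chiConst n * superFactor) •
      (matTrace M).jFun (sgn M) (matOf h l) (TensorAlgebra.lift ℂ (matOf h l) x) (word (List.ofFn v)) := by
  simp only [LinearMap.smul_apply, chiOne]
  congr 1
  rw [XTrace.jFun, splitSum_word, lsum_ofFn, mapForm_tmul, liftForm_tmul, sum_apply]
  refine Finset.sum_congr rfl fun k _ => ?_
  have hx := jMat_uMap l x
  set Q : Fin (n + 2) → Mat M := Fin.cons (TensorAlgebra.lift ℂ (matOf h l) x)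
    (fun j => if j = k then uT (matOf h l) (v j) else nab (sgn M) (uT (matOf h l)) (v j)) with hQ
  have h1 : ∀ s : Fin (n + 2), (if s = 0 ∨ s = k.succ then (jMat h).toLinearMap
          else commF ∘ₗ (jMat h).toLinearMap) ((Fin.cons (uMap (T.lift l) (ofW A x))
            (fun j => ((T.lift l (v j) : offDiag h) : U (offDiag h))) :
            Fin (n + 2) → U (offDiag h)) s) = Q s := by
    intro s
    refine Fin.cases ?_ (fun j => ?_) s
    · simpa [hQ] using hx
    · simp only [Fin.succ_ne_zero, false_or, Fin.cons_succ, hQ, Fin.succ_inj]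
      split_ifs
      · exact jMat_lift l _
      · exact commF_jMat l _
  rw [smul_apply, MultilinearMap.compLinearMap_apply, MultilinearMap.domDomCongr_apply]
  simp only [h1]
  rw [MultilinearMap.uncurryRight_apply, LinearMap.compMultilinearMap_apply,
    MultilinearMap.mkPiAlgebraFin_apply, trilin_apply]
  -- The translation by k.succ + 1 puts dxᵢ into the last slot, as `trNat` requires, and lists the
  -- other factors cyclically from the one following it.
  have h2 : ∀ j : Fin (n + 1), j.castSucc + (k.succ + 1) = j.succ + k.succ := by
    intro j
    rw [add_comm k.succ, ← add_assoc, Fin.coeSucc_eq_succ]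
  have h3 : (Fin.last (n + 1)) + (k.succ + 1) = k.succ := by
    rw [add_comm k.succ, ← add_assoc, Fin.last_add_one, zero_add]
  have h6 : (Fin.init fun i => Q ((Equiv.addRight (k.succ + 1)) i)) = fun j => Q (j.succ + k.succ) := by
    funext j
    exact congrArg Q (h2 j)
  have h7 : Equiv.addRight (k.succ + 1) (Fin.last (n + 1)) = k.succ := h3
  rw [h6, h7, ofFn_rotate, List.ofFn_succ (f := Q)]
  have hQ0 : Q 0 = TensorAlgebra.lift ℂ (matOf h l) x := rfl
  have hQs : ∀ j : Fin (n + 1), Q j.succ =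
      if j = k then uT (matOf h l) (v j) else nab (sgn M) (uT (matOf h l)) (v j) := fun j => rfl
  have hk : ((k.succ : Fin (n + 2)) : ℕ) = k + 1 := Fin.val_succ k
  have h4 : (List.ofFn fun j => Q j.succ).drop (k + 1) =
      ((List.ofFn v).drop (k + 1)).map (nab (sgn M) (uT (matOf h l))) := by
    refine List.ext_getElem (by simp) fun s h₁ h₂ => ?_
    rw [List.getElem_drop, List.getElem_map, List.getElem_drop, List.getElem_ofFn, List.getElem_ofFn,
      hQs, if_neg]
    intro h
    have := congrArg Fin.val h
    simp only at this
    omega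
  have h5 : (List.ofFn fun j => Q j.succ).take k =
      ((List.ofFn v).take k).map (nab (sgn M) (uT (matOf h l))) := by
    refine List.ext_getElem (by simp) fun s h₁ h₂ => ?_
    rw [List.getElem_take, List.getElem_map, List.getElem_take, List.getElem_ofFn, List.getElem_ofFn,
      hQs, if_neg]
    intro h
    have := congrArg Fin.val h
    simp only at this
    have := h₁
    rw [List.length_take] at this
    omega
  rw [hk, List.drop_succ_cons, List.take_succ_cons, h4, h5, hQ0, hQs, if_pos rfl, List.prod_append,
    List.prod_cons, ← pr_word_ofFn, ← pr_word_ofFn, gradeAut_word, map_smul, smul_mul_assoc,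
    smul_mul_assoc, map_smul, LinearMap.smul_apply, ← mul_assoc, List.length_drop, List.length_ofFn,
    Nat.add_sub_add_right]
  rfl

theorem chiOne_mapForm_appendD (n : ℕ) (l : A →ₗ[ℂ] offDiag h) (y : T A)
    (v : Fin n → U (T A)) :
    chiOne h (n + 1) (mapForm (T.lift l) (n + 2) (appendD n (phi y) v)) =
      (chiConst (n + 1) * superFactor) •
      (matTrace M).fFun (sgn M) (matOf h l) y (word (List.ofFn fun i => (v i).snd)) := by
  set g : U (T A) ⊗[ℂ] TensorAlgebra ℂ (T A) →ₗ[ℂ] OmNat M := TensorProduct.lift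
    ((chiConst (n + 1) * superFactor) • ((matTrace M).jBil (sgn M) (matOf h l)) ∘ₗ
      (TensorAlgebra.lift ℂ (matOf h l)).toLinearMap ∘ₗ (toW A).toLinearMap) with hg
  have h1 : ∀ ω : Om (T A) (n + 2), chiOne h (n + 1) (mapForm (T.lift l) (n + 2) ω) =
      g (formWord (T A) (n + 2) ω) := by
    intro ω
    have : chiOne h (n + 1) ∘ₗ mapForm (T.lift l) (n + 2) = g ∘ₗ formWord (T A) (n + 2) := by
      refine om_ext fun x v => ?_
      obtain ⟨x, rfl⟩ : ∃ x', ofW A x' = x := ⟨_, ofW_toW x⟩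
      rw [LinearMap.comp_apply, LinearMap.comp_apply, chiOne_mapForm, formWord_tmul]
      simp [hg]
      rfl
    exact LinearMap.congr_fun this ω
  rw [h1, formWord_appendD]
  set w := word (List.ofFn fun i => (v i).snd)
  have h2 : g ∘ₗ LinearMap.lTensor (U (T A)) (LinearMap.mulRight ℂ w) ∘ₗ formWord (T A) 2 ∘ₗ phi =
      (chiConst (n + 1) * superFactor) • ((matTrace M).fFun (sgn M) (matOf h l)).flip w := by
    refine T_hom_ext fun a l' => ?_
    simp only [LinearMap.comp_apply, LinearMap.smul_apply, LinearMap.flip_apply]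
    rw [phi_tword, XTrace.fFun_tword, map_lsum, map_lsum, map_lsum, ← lsum_smul]
    refine lsum_congr fun z b u _ => ?_
    rw [formWord_dTwo, LinearMap.lTensor_tmul, LinearMap.mulRight_apply, hit_zero]
    simp [hg]
    rfl
  exact LinearMap.congr_fun h2 y

theorem chiOne_mapForm_phiForm {n : ℕ} (hn : Even n) (l : A →ₗ[ℂ] offDiag h) (ω : Om (T A) n) :
    chiOne h (n + 1) (mapForm (T.lift l) (n + 2) (phiForm n ω)) = (chiConst (n + 1) * superFactor) •
      (matTrace M).rFun (sgn M) (matOf h l) 1 (headIn (formWord (T A) n ω)) := by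
  have : chiOne h (n + 1) ∘ₗ mapForm (T.lift l) (n + 2) ∘ₗ phiForm n =
      (chiConst (n + 1) * superFactor) •
      (matTrace M).rFun (sgn M) (matOf h l) 1 ∘ₗ headIn ∘ₗ formWord (T A) n := by
    refine om_ext fun x v => ?_
    simp only [LinearMap.comp_apply, LinearMap.smul_apply]
    rw [headIn_formWord_tmul, XTrace.rFun, splitSum_word, lsum_ofFn, phiForm_tmul, map_sum, map_sum,
      Finset.smul_sum]
    refine Finset.sum_congr rfl fun k _ => ?_
    rw [pow_mul, hn.neg_one_pow, one_pow, one_smul, chiOne_mapForm_appendD, trilin_apply, mul_one]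
    simp only [snd_cons]
    rw [ofFn_rotate, word_append]
  exact LinearMap.congr_fun this ω

/-- The component of γ in degree 2j+1 is φ^j. Under the graded cyclic functional `qFun` it becomes
the j-th power of a derivation, hence j! times a tower, evaluated by `XTrace.qFun_tower_mul_ι`. -/
theorem chern_fst (j : ℕ) (l : A →ₗ[ℂ] offDiag h) (x : T A) (y : List A) (a : A) :
    (chern h (2 * j + 1) l (x, natD (ofW A (word y)) (T.ι A a : U (T A)))).1 =
      (chiConst (2 * j + 1 : ℕ) * superFactor * j.factorial) •
        (bBar ((matTrace M).kOne (sgn M) (matOf h l) j (natD (ofW A (word y)) (T.ι A a : U (T A)))) -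
        (j + 1 : ℂ) • trM (hit (sgn M) (matOf h l) (2 * j + 1) (word y) * matOf h l a +
          matOf h l a * hit (sgn M) (matOf h l) (2 * j + 1) (word y))) := by
  have h1 : (chern h (2 * j + 1) l (x, natD (ofW A (word y)) (T.ι A a : U (T A)))).1 =
    chiZero h (2 * j + 1) (mapForm (T.lift l) (2 * j + 1) (gamma A (2 * j + 1)
      (x, natD (ofW A (word y)) (T.ι A a : U (T A))))) := rfl
  have h2 : headIn (formWord (T A) 1 (dOne (ofW A (word y)) (T.ι A a : U (T A)))) =
      TensorAlgebra.ι ℂ (tword y) * TensorAlgebra.ι ℂ (T.ι A a) := by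
    rw [dOne_apply, form_apply, formWord_tmul, headIn_tmul]
    simp [tword]
  have h3 : gradeAut (T A) (TensorAlgebra.ι ℂ (tword y) * TensorAlgebra.ι ℂ (T.ι A a)) =
      TensorAlgebra.ι ℂ (tword y) * TensorAlgebra.ι ℂ (T.ι A a) := by simp
  rw [h1, chiZero_mapForm ⟨j, rfl⟩, headIn_gamma_odd, gammaOne_letter, h2,
    rotOdd_pow _ gradeAut_tripleSplit _ (fun s x y => (matTrace M).qFun_cyclic s x y) j _ h3,
    deriv_pow_mul_ι, map_smul, (matTrace M).qFun_tower_mul_ι sgn_mul_sgn matTrace_sgn, smul_smul]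
  rfl

/-- Of the j + 1 applications of φ the last is built into `rFun`. The other j give j! times a tower,
and `XTrace.rFun_one_tower` supplies the factor j + 1. -/
theorem chern_snd (j : ℕ) (l : A →ₗ[ℂ] offDiag h) (y : List A) (w : OmNat (T A)) :
    (chern h (2 * j + 1) l (tword y, w)).2 =
      (chiConst (2 * j + 1 : ℕ) * superFactor * (j + 1).factorial) •
        (matTrace M).gSum (sgn M) (matOf h l) (2 * j + 1) 1 y := by
  have h1 : (chern h (2 * j + 1) l (tword y, w)).2 =
    chiOne h (2 * j + 1) (mapForm (T.lift l) (2 * j + 2) (phiForm (2 * j) (gamma A (2 * j)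
      (tword y, w)))) := rfl
  rw [h1, chiOne_mapForm_phiForm (by simp), headIn_gamma_even,
    rotEven_pow _ _ (fun x y => (matTrace M).rFun_cyclic x y), deriv_pow_ι, map_smul,
    (matTrace M).rFun_one_tower sgn_mul_sgn, smul_smul, smul_smul, Nat.factorial_succ]
  push_cast
  ring_nf

end ChernWords

/-! ### The homotopy between the Chern character and its renormalization -/

section Homotopy

set_option linter.unusedSectionVars false

variable {M : Type*} [NonUnitalRing M] [Module ℂ M] [IsScalarTower ℂ M M] [SMulCommClass ℂ M M]
variable {M' : Type*} [NonUnitalRing M'] [Module ℂ M'] [IsScalarTower ℂ M' M']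
  [SMulCommClass ℂ M' M']
variable {A : Type*} [NonUnitalRing A] [Module ℂ A]

/-- The constant `-Γ(1 + n/2)/(n+1)! · (-√(2i))`, for `n = 2 j + 1`. -/
def chernConst (j : ℕ) : ℂ := chiConst (2 * j + 1 : ℕ) * superFactor

/-- The linear map `A → M₂(M⁺)` defined by a linear map `A → M₂(M)`. -/
def matL (L : A →ₗ[ℂ] Matrix (Fin 2) (Fin 2) M) : A →ₗ[ℂ] Mat M :=
  (matIncl M : Matrix (Fin 2) (Fin 2) M →ₗ[ℂ] Mat M) ∘ₗ L

theorem matL_apply (L : A →ₗ[ℂ] Matrix (Fin 2) (Fin 2) M) (a : A) (i j : Fin 2) :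
    matL L a i j = (L a i j : U M) := rfl

/-- The homotopy of even degree on `X(TA)` attached to a linear map `A → M₂(M)`. -/
def homot (j : ℕ) (L : A →ₗ[ℂ] Matrix (Fin 2) (Fin 2) M) : X (T A) →ₗ[ℂ] X M :=
  LinearMap.prodMap
    ((chernConst j * (j + 1).factorial * (2 * 4 ^ j)) •
      ((matTrace M).hitZeroSum (sgn M) (matL L) j +
        (matTrace M).tr ∘ₗ (TensorAlgebra.lift ℂ (matL L)).toLinearMap) ∘ₗ
        (T.incl A : T A →ₗ[ℂ] TensorAlgebra ℂ A))
    ((chernConst j * (j + 1).factorial * (2 * 4 ^ j)) •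
      ((matTrace M).hitOneSum (sgn M) (matL L) j +
        (matTrace M).chainOne (TensorAlgebra.lift ℂ (matL L))) +
      (chernConst j * j.factorial) • (matTrace M).kOne (sgn M) (matL L) j)

theorem homot_word (j : ℕ) (L : A →ₗ[ℂ] Matrix (Fin 2) (Fin 2) M) {l : List A} (hl : l ≠ [])
    (w : OmNat (T A)) :
    homot j L (tword l, w) = ((chernConst j * (j + 1).factorial * (2 * 4 ^ j)) •
      ((matTrace M).hitZeroSum (sgn M) (matL L) j (word l) +
        (matTrace M).tr (TensorAlgebra.lift ℂ (matL L) (word l))), (homot j L (0, w)).2) := by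
  refine Prod.ext ?_ rfl
  simp only [homot, LinearMap.prodMap_apply, LinearMap.smul_apply, LinearMap.comp_apply]
  rw [← incl_tword hl]
  rfl

theorem homot_zero_snd (j : ℕ) (L : A →ₗ[ℂ] Matrix (Fin 2) (Fin 2) M) (w : OmNat (T A)) :
    homot j L (0, w) = (0, (chernConst j * (j + 1).factorial * (2 * 4 ^ j)) •
      ((matTrace M).hitOneSum (sgn M) (matL L) j w +
        (matTrace M).chainOne (TensorAlgebra.lift ℂ (matL L)) w) +
      (chernConst j * j.factorial) • (matTrace M).kOne (sgn M) (matL L) j w) := by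
  simp [homot]

theorem homot_fst_zero (j : ℕ) (L : A →ₗ[ℂ] Matrix (Fin 2) (Fin 2) M) (x : T A) :
    (homot j L (x, 0)).2 = 0 := by
  simp [homot]

section Chern

variable {R P : Type*} [NonUnitalRing R] [Module ℂ R] [NonUnitalRing P] [Module ℂ P]
  {r : R →ₙₐ[ℂ] M} {q : M →ₙₐ[ℂ] P} {h : IsExtension r q}

theorem matOf_eq_matL (l : A →ₗ[ℂ] offDiag h) :
    matOf h l = matL ((offDiag h).toSubmodule.subtype ∘ₗ l) := by
  refine LinearMap.ext fun a => Matrix.ext fun i j => ?_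
  rw [matOf_apply, matL_apply]
  rfl

/-- On words, `XTrace.hitSum_even` leaves ½·4^{-j} G_{2j+1}; the factor 2·4^j in `homot` normalizes
it, and `kOne` does not contribute. On ♮x da the trace terms agree for the same reason, because
(j+1)! = (j+1) j!, and the boundary of `kOne` accounts for the remainder in `chern_fst`. The chain
map tr P₀ cancels in both components. -/
theorem chern_eq (j : ℕ) (l : A →ₗ[ℂ] offDiag h) (x : X (T A)) :
    chern h (2 * j + 1) l x = bdry (homot j ((offDiag h).toSubmodule.subtype ∘ₗ l) x) -
      homot j ((offDiag h).toSubmodule.subtype ∘ₗ l) (bdry x) := by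
  set L := (offDiag h).toSubmodule.subtype ∘ₗ l with hL
  have hlL : matOf h l = matL L := matOf_eq_matL l
  suffices H : chern h (2 * j + 1) l = bdry ∘ₗ homot j L - homot j L ∘ₗ bdry from
    LinearMap.congr_fun H x
  have h4 : (4 : ℂ) ^ j * (4⁻¹) ^ j = 1 := by rw [← mul_pow]; norm_num
  refine X_T_ext (fun a y => ?_) (fun y a => ?_)
  · have h1 : (chern h (2 * j + 1) l (tword (a :: y), 0)).1 = 0 := by
      have := chern_fst j l (tword (a :: y)) [] 0
      simpa using this
    have h2 := chern_snd j l (a :: y) 0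
    refine Prod.ext ?_ ?_
    · rw [h1]
      simp only [LinearMap.sub_apply, LinearMap.comp_apply, bdry_apply, map_zero]
      rw [homot_word j L (by simp), homot_zero_snd, homot_zero_snd, bdry_apply]
      simp
    · rw [h2, hlL]
      have h3 := (matTrace M).hitSum_even (L := matL L) sgn_mul_sgn matTrace_sgn j (a :: y)
      have h5 := (matTrace M).chain_even (TensorAlgebra.lift ℂ (matL L)) (a :: y)
      have h6 := (matTrace M).kOne_d_word (F := sgn M) (L := matL L) j (a :: y)
      have hd : ∀ x : M, natD 1 (x : U M) = (matTrace M).d x := fun x => rfl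
      simp only [LinearMap.sub_apply, LinearMap.comp_apply, bdry_apply, map_zero]
      rw [homot_word j L (by simp), bdry_apply, coe_tword_cons,
        homot_zero_snd j L (natD 1 (ofW A (word (a :: y)))), hd, h6, h5, map_smul, map_add]
      change _ = _ - _
      rw [smul_zero, add_zero, ← smul_sub, add_sub_add_right_eq_sub, h3, smul_smul]
      congr 1
      change chernConst j * _ = _
      linear_combination (-chernConst j * (j + 1).factorial) * h4
  · have h1 := chern_fst j l 0 y a
    have h2 : (chern h (2 * j + 1) l (0, natD (ofW A (word y)) (T.ι A a : U (T A)))).2 = 0 := by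
      have := chern_snd j l [] (natD (ofW A (word y)) (T.ι A a : U (T A)))
      rw [tword_nil] at this
      rw [this, XTrace.gSum, lsum_nil, smul_zero]
    refine Prod.ext ?_ ?_
    · rw [h1, hlL]
      have h3 := (matTrace M).hitSum_odd (L := matL L) sgn_mul_sgn matTrace_sgn j y a
      have h5 := (matTrace M).chain_odd (TensorAlgebra.lift ℂ (matL L)) y a
      have hb : ∀ x : OmNat M, bBar x = (matTrace M).b x := fun x => rfl
      have ht : ∀ x : Mat M, trM x = (matTrace M).tr x := fun x => rfl
      have e : ((0 : T A), (0 : OmNat (T A))) = 0 := rfl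
      -- Both words in b̄(♮l da) = l a - a l are nonempty, so `homot_word` applies to each of them
      -- separately.
      have hs : ∀ x x' : T A, ((x - x' : T A), (0 : OmNat (T A))) = (x, 0) - (x', 0) := by
        intro x x'; simp
      simp only [LinearMap.sub_apply, LinearMap.comp_apply, bdry_apply, map_zero, Unitization.inr_zero]
      rw [bBar_letter, hs, map_sub, homot_word j L (by simp), homot_word j L (by simp), homot_zero_snd,
        bdry_apply, hb, hb, map_add (matTrace M).b, map_smul (matTrace M).b,
        map_smul (matTrace M).b, map_add (matTrace M).b, h5, ht]
      change _ = _ - (_ - _)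
      rw [map_sub] at h3
      rw [map_sub (TensorAlgebra.lift ℂ (matL L)), map_sub (matTrace M).tr]
      have h7 := congrArg (fun z => (chernConst j * (j + 1).factorial * (2 * 4 ^ j)) • z) h3
      simp only [smul_sub, smul_add, smul_smul, neg_smul, smul_neg, Nat.factorial_succ] at h7 ⊢
      have h8 : chernConst j * (((j + 1) * j.factorial : ℕ) : ℂ) * (2 * 4 ^ j) * (2⁻¹ * 4⁻¹ ^ j) =
          chernConst j * j.factorial * (j + 1) := by
        push_cast
        linear_combination (chernConst j * (j + 1) * j.factorial) * h4
      rw [h8] at h7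
      change (chernConst j * _) • _ - (chernConst j * _ * _) • _ = _
      linear_combination (norm := module) -h7
    · rw [h2]
      have hs : ∀ x : T A, (homot j L (x, 0)).2 = 0 := homot_fst_zero j L
      simp only [LinearMap.sub_apply, LinearMap.comp_apply, bdry_apply]
      have h0 : natD 1 ((0 : T A) : U (T A)) = 0 := by rw [Unitization.inr_zero, map_zero]
      rw [homot_zero_snd, bdry_apply, h0, Prod.snd_sub, hs, Unitization.inr_zero, map_zero, sub_zero]

end Chern

end Homotopy

/-! ### Naturality of the homotopy in the coefficient algebra -/

section Natural

set_option linter.unusedSectionVars false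

variable {𝔄 M Z A : Type*} [Ring 𝔄] [Algebra ℂ 𝔄] [AddCommGroup M] [Module ℂ M]
    [AddCommGroup Z] [Module ℂ Z] [NonUnitalRing A] [Module ℂ A]
variable {𝔅 M' Z' : Type*} [Ring 𝔅] [Algebra ℂ 𝔅] [AddCommGroup M'] [Module ℂ M']
    [AddCommGroup Z'] [Module ℂ Z']
variable {F : 𝔄} {L : A →ₗ[ℂ] 𝔄} {t : XTrace 𝔄 M Z} {t' : XTrace 𝔅 M' Z'} (Φ : 𝔄 →ₐ[ℂ] 𝔅)

theorem map_nab (a : A) : Φ (nab F L a) = nab (Φ F) (Φ.toLinearMap ∘ₗ L) a := by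
  simp [nab_apply]

theorem map_hit (m : ℕ) (x : TensorAlgebra ℂ A) :
    Φ (hit F L m x) = hit (Φ F) (Φ.toLinearMap ∘ₗ L) m x := by
  induction x using word_induction with
  | hw l =>
    induction l generalizing m with
    | nil => cases m <;> simp
    | cons a l ih =>
      rw [word_cons]
      cases m with
      | zero => rw [hit_zero_ι_mul, hit_zero_ι_mul, map_mul, ih]; rfl
      | succ m =>
        rw [hit_succ_ι_mul, hit_succ_ι_mul, map_add, map_mul, map_mul, ih, ih, map_nab]
        rfl
  | hadd x y hx hy => rw [map_add, map_add, map_add, hx, hy]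
  | hsmul c x hx => rw [map_smul, map_smul, map_smul, hx]

theorem map_lift (x : TensorAlgebra ℂ A) :
    Φ (TensorAlgebra.lift ℂ L x) = TensorAlgebra.lift ℂ (Φ.toLinearMap ∘ₗ L) x := by
  have h := map_hit (F := 0) (L := L) Φ 0 x
  rwa [hit_zero, hit_zero] at h

variable {Φ} {f : M →ₗ[ℂ] M'} {g : Z →ₗ[ℂ] Z'}

theorem XTrace.map_hitZeroSum (hf : ∀ x, f (t.tr x) = t'.tr (Φ x)) (j : ℕ) (x : TensorAlgebra ℂ A) :
    f (t.hitZeroSum F L j x) = t'.hitZeroSum (Φ F) (Φ.toLinearMap ∘ₗ L) j x := by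
  simp only [XTrace.hitZeroSum, LinearMap.sum_apply, LinearMap.smul_apply, map_sum, map_smul,
    XTrace.hitZero_apply, hf, map_mul, map_hit]

theorem XTrace.map_hitOneSum (hg : ∀ x y, g (t.tr₁ x y) = t'.tr₁ (Φ x) (Φ y)) (j : ℕ)
    (w : OmNat (T A)) :
    g (t.hitOneSum F L j w) = t'.hitOneSum (Φ F) (Φ.toLinearMap ∘ₗ L) j w := by
  suffices h : g ∘ₗ t.hitOneSum F L j = t'.hitOneSum (Φ F) (Φ.toLinearMap ∘ₗ L) j from
    LinearMap.congr_fun h w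
  refine omNat_T_ext fun l a => ?_
  simp only [XTrace.hitOneSum, LinearMap.comp_apply, LinearMap.sum_apply, LinearMap.smul_apply,
    map_sum, map_smul g, XTrace.hitOne_natD, hg]
  simp only [map_smul Φ, map_add Φ, map_mul, map_hit]
  rfl

theorem XTrace.map_chainOne (hg : ∀ x y, g (t.tr₁ x y) = t'.tr₁ (Φ x) (Φ y)) (w : OmNat (T A)) :
    g (t.chainOne (TensorAlgebra.lift ℂ L) w) =
      t'.chainOne (TensorAlgebra.lift ℂ (Φ.toLinearMap ∘ₗ L)) w := by
  suffices h : g ∘ₗ t.chainOne (TensorAlgebra.lift ℂ L) =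
      t'.chainOne (TensorAlgebra.lift ℂ (Φ.toLinearMap ∘ₗ L)) from LinearMap.congr_fun h w
  refine omNat_T_ext fun l a => ?_
  simp [XTrace.chainOne, hg, map_lift]

theorem XTrace.map_kOne (hg : ∀ x y, g (t.tr₁ x y) = t'.tr₁ (Φ x) (Φ y)) (j : ℕ)
    (w : OmNat (T A)) :
    g (t.kOne F L j w) = t'.kOne (Φ F) (Φ.toLinearMap ∘ₗ L) j w := by
  suffices h : g ∘ₗ t.kOne F L j = t'.kOne (Φ F) (Φ.toLinearMap ∘ₗ L) j from
    LinearMap.congr_fun h w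
  refine omNat_T_ext fun l a => ?_
  simp only [XTrace.kOne, LinearMap.comp_apply, LinearMap.sum_apply, LinearMap.smul_apply,
    map_sum, map_smul, XTrace.tau_natD, map_lsum, hg, map_mul, map_hit, map_nab]
  rfl

end Natural

/-! ### The homotopy of a diagonal lifting, and the numerical constant -/

section HomotNatural

set_option linter.unusedSectionVars false

variable {M : Type*} [NonUnitalRing M] [Module ℂ M] [IsScalarTower ℂ M M] [SMulCommClass ℂ M M]
variable {M' : Type*} [NonUnitalRing M'] [Module ℂ M'] [IsScalarTower ℂ M' M']
  [SMulCommClass ℂ M' M']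
variable {A : Type*} [NonUnitalRing A] [Module ℂ A]

/-- The map of matrices induced by a homomorphism. -/
def matMap (g : M →ₙₐ[ℂ] M') : Mat M →ₐ[ℂ] Mat M' := (uMap g).mapMatrix

theorem matMap_apply (g : M →ₙₐ[ℂ] M') (x : Mat M) (i j : Fin 2) :
    matMap g x i j = uMap g (x i j) := rfl

theorem matMap_sgn (g : M →ₙₐ[ℂ] M') : matMap g (sgn M) = sgn M' := by
  refine Matrix.ext fun i j => ?_
  rw [matMap_apply]
  fin_cases i <;> fin_cases j <;> simp [sgn]

theorem matMap_matL (g : M →ₙₐ[ℂ] M') (L : A →ₗ[ℂ] Matrix (Fin 2) (Fin 2) M) :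
    (matMap g).toLinearMap ∘ₗ matL L = matL ((g : M →ₗ[ℂ] M').mapMatrix ∘ₗ L) := by
  refine LinearMap.ext fun a => Matrix.ext fun i j => ?_
  exact uMap_coe g _

theorem map_trM (g : M →ₙₐ[ℂ] M') (x : Mat M) : g (trM x) = trM (matMap g x) := by
  rw [trM_apply, trM_apply, matMap_apply, matMap_apply, ← map_add, uMap_snd]

theorem map_trNat (g : M →ₙₐ[ℂ] M') (x y : Mat M) :
    omMap g (trNat x y) = trNat (matMap g x) (matMap g y) := by
  rw [trNat_apply, trNat_apply]
  simp [matMap_apply]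

theorem homot_apply (j : ℕ) (L : A →ₗ[ℂ] Matrix (Fin 2) (Fin 2) M) (x : T A) (w : OmNat (T A)) :
    homot j L (x, w) = ((chernConst j * (j + 1).factorial * (2 * 4 ^ j)) •
      ((matTrace M).hitZeroSum (sgn M) (matL L) j (T.incl A x) +
        (matTrace M).tr (TensorAlgebra.lift ℂ (matL L) (T.incl A x))),
      (chernConst j * (j + 1).factorial * (2 * 4 ^ j)) •
      ((matTrace M).hitOneSum (sgn M) (matL L) j w +
        (matTrace M).chainOne (TensorAlgebra.lift ℂ (matL L)) w) +
      (chernConst j * j.factorial) • (matTrace M).kOne (sgn M) (matL L) j w) := rfl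

theorem map_homot (g : M →ₙₐ[ℂ] M') (j : ℕ) (L : A →ₗ[ℂ] Matrix (Fin 2) (Fin 2) M) (x : X (T A)) :
    X.map g (homot j L x) = homot j ((g : M →ₗ[ℂ] M').mapMatrix ∘ₗ L) x := by
  obtain ⟨x, w⟩ := x
  have hf : ∀ x, (g : M →ₗ[ℂ] M') ((matTrace M).tr x) = (matTrace M').tr (matMap g x) := map_trM g
  have hg : ∀ x y, omMap g ((matTrace M).tr₁ x y) = (matTrace M').tr₁ (matMap g x) (matMap g y) :=
    map_trNat g
  have h1 := XTrace.map_hitZeroSum (F := sgn M) (L := matL L) hf j (T.incl A x)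
  have h2 := map_lift (L := matL L) (matMap g) (T.incl A x)
  have h3 := XTrace.map_hitOneSum (F := sgn M) (L := matL L) hg j w
  have h4 := XTrace.map_chainOne (L := matL L) hg w
  have h5 := XTrace.map_kOne (F := sgn M) (L := matL L) hg j w
  have h6 := hf (TensorAlgebra.lift ℂ (matL L) (T.incl A x))
  rw [matMap_sgn, matMap_matL] at h1 h3 h5
  rw [matMap_matL] at h2 h4
  rw [h2] at h6
  rw [homot_apply, homot_apply, X_map_apply]
  refine Prod.ext ?_ ?_
  · change (g : M →ₗ[ℂ] M') _ = _
    rw [map_smul, map_add, h1, h6]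
  · change omMap g _ = _
    rw [map_add (omMap g), map_smul (omMap g), map_smul (omMap g), map_add (omMap g), h3, h4, h5]

theorem hit_diagonal {𝔄 : Type*} [Ring 𝔄] [Algebra ℂ 𝔄] {F : 𝔄} {L : A →ₗ[ℂ] 𝔄}
    (h : nab F L = 0) (m : ℕ) (x : TensorAlgebra ℂ A) : hit F L (m + 1) x = 0 := by
  induction x using word_induction with
  | hw l =>
    induction l with
    | nil => simp
    | cons a l ih => rw [word_cons, hit_succ_ι_mul, ih, h]; simp
  | hadd x y hx hy => rw [map_add, hx, hy, add_zero]
  | hsmul c x hx => rw [map_smul, hx, smul_zero]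

theorem lift_diagonal {L : A →ₗ[ℂ] Matrix (Fin 2) (Fin 2) M} (h₁ : ∀ a, L a 0 1 = 0)
    (h₂ : ∀ a, L a 1 0 = 0) (x : TensorAlgebra ℂ A) :
    TensorAlgebra.lift ℂ (matL L) x 0 0 =
        T.liftU ((Matrix.entryLinearMap ℂ M 0 0) ∘ₗ L : A →ₗ[ℂ] M) x ∧
      TensorAlgebra.lift ℂ (matL L) x 0 1 = 0 ∧ TensorAlgebra.lift ℂ (matL L) x 1 0 = 0 := by
  induction x using word_induction with
  | hw l =>
    induction l with
    | nil => simp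
    | cons a l ih =>
      obtain ⟨h3, h4, h5⟩ := ih
      rw [word_cons, map_mul, map_mul, TensorAlgebra.lift_ι_apply]
      simp only [Matrix.mul_apply, Fin.sum_univ_two, h3, h4, h5, matL_apply, h₁, h₂]
      simp [T.liftU]
  | hadd x y hx hy =>
    obtain ⟨h3, h4, h5⟩ := hx
    obtain ⟨h3', h4', h5'⟩ := hy
    simp only [map_add, Matrix.add_apply, h3, h4, h5, h3', h4', h5', add_zero, and_self]
  | hsmul c x hx =>
    obtain ⟨h3, h4, h5⟩ := hx
    simp only [map_smul, Matrix.smul_apply, h3, h4, h5, smul_zero, and_self]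

theorem nab_diagonal {L : A →ₗ[ℂ] Matrix (Fin 2) (Fin 2) M} (h₁ : ∀ a, L a 0 1 = 0)
    (h₂ : ∀ a, L a 1 0 = 0) : nab (sgn M) (matL L) = 0 := by
  refine LinearMap.ext fun a => Matrix.ext fun i j => ?_
  rw [nab_apply]
  fin_cases i <;> fin_cases j <;> simp [sgn, matL_apply, h₁, h₂]

/-- A diagonal L commutes with F, so every term with a commutator vanishes. What is left is tr(Fx) +
tr(x) = 2x₀₀ and, in odd degree, the matrix ½(Fy + yF) + y, whose diagonal entries are 2y₀₀ and 0.
The lower right corner plays no role. -/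
theorem homot_diagonal (j : ℕ) {L : A →ₗ[ℂ] Matrix (Fin 2) (Fin 2) M} (h₁ : ∀ a, L a 0 1 = 0)
    (h₂ : ∀ a, L a 1 0 = 0) (x : X (T A)) :
    homot j L x = (chernConst j * (j + 1).factorial * (2 * 4 ^ j) * 2) •
      X.map (T.lift ((Matrix.entryLinearMap ℂ M 0 0) ∘ₗ L : A →ₗ[ℂ] M)) x := by
  have hn := nab_diagonal h₁ h₂
  set L' := ((Matrix.entryLinearMap ℂ M 0 0) ∘ₗ L : A →ₗ[ℂ] M)
  have hz : (matTrace M).hitZeroSum (sgn M) (matL L) j = (matTrace M).hitZero (sgn M) (matL L) 0 := by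
    rw [XTrace.hitZeroSum, Finset.sum_range_succ', Finset.sum_eq_zero]
    · simp
    · intro i _
      refine LinearMap.ext fun x => ?_
      rw [LinearMap.smul_apply, XTrace.hitZero_apply, show 2 * (i + 1) = 2 * i + 1 + 1 by ring,
        hit_diagonal hn]
      simp
  have ho : (matTrace M).hitOneSum (sgn M) (matL L) j = (matTrace M).hitOne (sgn M) (matL L) 0 := by
    rw [XTrace.hitOneSum, Finset.sum_range_succ', Finset.sum_eq_zero]
    · simp
    · intro i _
      refine omNat_T_ext fun l a => ?_
      rw [LinearMap.smul_apply, XTrace.hitOne_natD, show 2 * (i + 1) = 2 * i + 1 + 1 by ring,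
        hit_diagonal hn]
      simp
  have hk : (matTrace M).kOne (sgn M) (matL L) j = 0 := by
    refine omNat_T_ext fun l a => ?_
    simp only [XTrace.kOne, LinearMap.sum_apply, LinearMap.smul_apply, XTrace.tau_natD, hn,
      LinearMap.zero_apply, mul_zero, zero_mul, map_zero, lsum_zero, smul_zero, Finset.sum_const_zero]
  suffices H : homot j L = (chernConst j * (j + 1).factorial * (2 * 4 ^ j) * 2) •
      X.map (T.lift L') from LinearMap.congr_fun H x
  refine X_T_ext (fun a l => ?_) (fun l a => ?_)
  · rw [LinearMap.smul_apply, X_map_word, homot_apply]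
    generalize chernConst j * (j + 1).factorial * (2 * 4 ^ j) = C
    rw [mul_smul C 2, hz, XTrace.hitZero_apply, hit_zero, incl_tword (by simp)]
    have h3 := lift_diagonal h₁ h₂ (word (a :: l))
    refine Prod.ext ?_ ?_
    · have e : ∀ x : Mat M, (matTrace M).tr x = trM x := fun _ => rfl
      change C • _ = C • ((2 : ℂ) • (T.liftU L' (word (a :: l))).snd)
      congr 1
      rw [e, e, trM_apply, trM_apply, ← h3.1]
      generalize TensorAlgebra.lift ℂ (matL L) (word (a :: l)) = y
      simp only [two_smul]
      simp [Matrix.mul_apply, sgn]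
      abel
    · simp
  · rw [LinearMap.smul_apply, X_map_letter, homot_zero_snd]
    generalize chernConst j * (j + 1).factorial * (2 * 4 ^ j) = C
    rw [mul_smul C 2, ho, hk, XTrace.hitOne_natD, XTrace.chainOne, omLift_letter, toW_ofW, hit_zero]
    have h3 := lift_diagonal h₁ h₂ (word l)
    have e : ∀ x y : Mat M, (matTrace M).tr₁ x y = trNat x y := fun _ _ => rfl
    rw [LinearMap.zero_apply, smul_zero, add_zero, Prod.smul_mk, Prod.smul_mk, smul_zero,
      smul_zero]
    refine congrArg (fun z => ((0 : M), _ • z)) ?_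
    simp only [LinearMap.compl₁₂_apply, LinearMap.comp_apply, AlgHom.toLinearMap_apply,
      TensorAlgebra.lift_ι_apply]
    rw [e, e, ← LinearMap.add_apply, ← map_add, trNat_apply, ← h3.1]
    obtain ⟨_, h4, h5⟩ := h3
    generalize TensorAlgebra.lift ℂ (matL L) (word l) = y at *
    have h6 : ((2⁻¹ : ℂ) • (sgn M * y + y * sgn M) + y) 0 0 = (2 : ℂ) • y 0 0 := by
      simp [Matrix.mul_apply, sgn]
      module
    have h7 : ((2⁻¹ : ℂ) • (sgn M * y + y * sgn M) + y) 1 1 = 0 := by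
      simp [Matrix.mul_apply, sgn]
      module
    rw [h6, h7]
    simp [matL_apply, h₁, h₂, L']

/-- Legendre's duplication formula at 1 + n/2 gives Γ(1+n/2) (j+1)! 2^{2j+2} = (2j+2)! √π. The signs
in `chiConst` and `superFactor` cancel, so the result does not depend on j. -/
theorem chernConst_eq (j : ℕ) : chernConst j * (j + 1).factorial * (2 * 4 ^ j) * 2 =
    (2 * Real.pi * Complex.I) ^ (1 / 2 : ℂ) := by
  have h2 : Complex.Gamma (1 + (2 * j + 1 : ℕ) / 2) * (j + 1).factorial * (2 * 4 ^ j) * 2 =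
      (2 * j + 2).factorial * (Real.sqrt Real.pi : ℂ) := by
    have := Complex.Gamma_mul_Gamma_add_half (1 + (2 * j + 1 : ℕ) / 2)
    have e1 : (1 + ((2 * j + 1 : ℕ) : ℂ) / 2 + 1 / 2) = ((j + 1 : ℕ) : ℂ) + 1 := by push_cast; ring
    have e2 : (2 * (1 + ((2 * j + 1 : ℕ) : ℂ) / 2)) = ((2 * j + 2 : ℕ) : ℂ) + 1 := by push_cast; ring
    rw [e1, e2, Complex.Gamma_nat_eq_factorial, Complex.Gamma_nat_eq_factorial] at this
    rw [this]
    have e3 : (2 : ℂ) ^ (1 - (((2 * j + 2 : ℕ) : ℂ) + 1)) * (2 * 4 ^ j * 2) = 1 := by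
      rw [show (1 - (((2 * j + 2 : ℕ) : ℂ) + 1)) = -((2 * j + 2 : ℕ) : ℂ) by ring, Complex.cpow_neg,
        Complex.cpow_natCast, show (4 : ℂ) = 2 ^ 2 by norm_num, ← pow_mul,
        show (2 : ℂ) * 2 ^ (2 * j) * 2 = 2 ^ (2 * j + 2) by ring]
      exact inv_mul_cancel₀ (pow_ne_zero _ two_ne_zero)
    linear_combination ((2 * j + 2).factorial * (Real.sqrt Real.pi : ℂ)) * e3
  have h3 : ((2 * j + 1 + 1).factorial : ℂ) ≠ 0 := by exact_mod_cast Nat.factorial_ne_zero _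
  have hπ : (Real.pi : ℂ) ≠ 0 := by exact_mod_cast Real.pi_ne_zero
  have hI : 2 * Complex.I ≠ 0 := mul_ne_zero two_ne_zero Complex.I_ne_zero
  -- The principal root is multiplicative here because the factor π is positive.
  have h4 : (2 * Real.pi * Complex.I) ^ (1 / 2 : ℂ) =
      (Real.sqrt Real.pi : ℂ) * (2 * Complex.I) ^ (1 / 2 : ℂ) := by
    rw [show (2 * Real.pi * Complex.I : ℂ) = (Real.pi : ℂ) * (2 * Complex.I) by ring,
      Complex.cpow_def_of_ne_zero (mul_ne_zero hπ hI), Complex.log_ofReal_mul Real.pi_pos hI, add_mul,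
      Complex.exp_add, ← Complex.cpow_def_of_ne_zero hI, Real.sqrt_eq_rpow,
      Complex.ofReal_cpow Real.pi_pos.le, Complex.cpow_def_of_ne_zero hπ, Complex.ofReal_log Real.pi_pos.le]
    norm_num
  rw [h4, chernConst, chiConst, superFactor]
  generalize Complex.Gamma (1 + (2 * j + 1 : ℕ) / 2) = G at *
  field_simp
  linear_combination h2

end HomotNatural

/-! ### Continuity of the homotopy -/

section Estimates

set_option linter.unusedSectionVars false

open Polynomial

variable {𝔄 M Z A : Type*} [Ring 𝔄] [Algebra ℂ 𝔄] [AddCommGroup M] [Module ℂ M]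
    [AddCommGroup Z] [Module ℂ Z] [NonUnitalRing A] [Module ℂ A]
variable {F : 𝔄} {L : A →ₗ[ℂ] 𝔄} {t : XTrace 𝔄 M Z}

theorem Filtered.mem_zero (𝔍 : Filtered 𝔄) (x : 𝔄) : x ∈ 𝔍.seq 0 := 𝔍.zero ▸ trivial

theorem Filtered.mul_left (𝔍 : Filtered 𝔄) {k : ℕ} {x : 𝔄} (y : 𝔄) (hx : x ∈ 𝔍.seq k) :
    y * x ∈ 𝔍.seq k := zero_add k ▸ 𝔍.mul 0 k (𝔍.mem_zero y) hx

theorem Filtered.mul_right (𝔍 : Filtered 𝔄) {k : ℕ} {x : 𝔄} (y : 𝔄) (hx : x ∈ 𝔍.seq k) :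
    x * y ∈ 𝔍.seq k := 𝔍.mul k 0 hx (𝔍.mem_zero y)

/-- The filtration of polynomials by conditions on the coefficients, which become weaker as the
degree grows. -/
def shiftedFiltered (𝔍 : Filtered 𝔄) : Filtered 𝔄[X] where
  seq k := ⨅ m, (𝔍.seq (k - m)).comap ((lcoeff 𝔄 m).restrictScalars ℂ)
  zero := by simp [𝔍.zero]
  anti _ _ h := iInf_mono fun m => Submodule.comap_mono (𝔍.anti (Nat.sub_le_sub_right h m))
  mul m n x y hx hy := by
    rw [Submodule.mem_iInf] at hx hy ⊢
    intro k
    change (x * y).coeff k ∈ 𝔍.seq (m + n - k)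
    rw [coeff_mul]
    refine sum_mem fun p hp => ?_
    rw [Finset.HasAntidiagonal.mem_antidiagonal] at hp
    exact 𝔍.anti (by omega) (𝔍.mul _ _ (hx p.1) (hy p.2))

/-- The elements of `TA⁺`, as words, which lie in a power of an ideal. -/
def wordPow (K : Submodule ℂ (T A)) (k : ℕ) : Submodule ℂ (TensorAlgebra ℂ A) :=
  (powPlus K k).comap (ofW A).toLinearMap

theorem mem_wordPow {K : Submodule ℂ (T A)} {k : ℕ} {x : TensorAlgebra ℂ A} :
    x ∈ wordPow K k ↔ ofW A x ∈ powPlus K k := Iff.rfl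

variable {K : Submodule ℂ (T A)}

/-- The filtration of `TA⁺`, as an algebra of words, by the powers of an ideal. -/
def wordFiltered (hK : IsTwoSided K) : Filtered (TensorAlgebra ℂ A) where
  seq := wordPow K
  zero := rfl
  anti _ _ h := Submodule.comap_mono ((powFiltered hK).anti h)
  mul m n x y hx hy := by
    rw [mem_wordPow] at *
    rw [map_mul]
    exact (powFiltered hK).mul m n hx hy

/-- A commutator can spoil at most one factor in K. In terms of `shiftedFiltered`, only the constant
coefficient of the image of K is constrained, and multiplicativity does the rest. -/
theorem hit_mem (𝔍 : Filtered 𝔄) (hL : ∀ x ∈ K, TensorAlgebra.lift ℂ L (T.incl A x) ∈ 𝔍.seq 1)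
    {k m : ℕ} {x : TensorAlgebra ℂ A} (hx : x ∈ wordPow K k) : hit F L m x ∈ 𝔍.seq (k - m) := by
  have h := (shiftedFiltered 𝔍).hom_powPlus ((uX F L).comp (toW A)) (I := K) (fun y hy => ?_) k hx
  · rw [AlgHom.comp_apply, AlgHom.toLinearMap_apply, toW_ofW] at h
    exact (Submodule.mem_iInf _).1 h m
  · refine (Submodule.mem_iInf _).2 fun m => ?_
    rw [AlgHom.comp_apply, toW_coe]
    cases m with
    | zero =>
      change hit F L 0 (T.incl A y) ∈ 𝔍.seq 1
      rw [hit_zero]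
      exact hL y hy
    | succ m =>
      rw [show 1 - (m + 1) = 0 by omega, 𝔍.zero]
      trivial

theorem omLift_mem (hK : IsTwoSided K) {V : Type*} [AddCommGroup V] [Module ℂ V]
    {E : TensorAlgebra ℂ A →ₗ[ℂ] A →ₗ[ℂ] V} {k : ℕ} {Y : Submodule ℂ V}
    (h : ∀ x ∈ wordPow K k, ∀ a, E x a ∈ Y) {w : OmNat (T A)} (hw : w ∈ natSpan (powPlus K k) ⊤) :
    omLift E w ∈ Y := by
  have : natSpan (powPlus K k) ⊤ ≤ Y.comap (omLift E) := by
    refine natSpan_le fun x hx y _ => ?_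
    rw [Submodule.mem_comap, omLift_natD, toW_coe]
    have hx' : toW A x ∈ wordPow K k := by rwa [mem_wordPow, ofW_toW]
    induction T.incl A y using word_induction with
    | hw l =>
      rw [rotSum_word]
      exact lsum_mem _ fun z b w =>
        h _ ((wordFiltered hK).mul_right _ ((wordFiltered hK).mul_left _ hx')) _
    | hadd x y hx hy => rw [map_add]; exact add_mem hx hy
    | hsmul c x hx => rw [map_smul]; exact Submodule.smul_mem _ c hx
  exact this hw

/-- The marked letter meets at most one of the k factors in K; the other k - 1 are distributed
between z and w. -/
theorem splitSum_mem (hK : IsTwoSided K) {V : Type*} [AddCommGroup V] [Module ℂ V]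
    {E : TensorAlgebra ℂ A →ₗ[ℂ] A →ₗ[ℂ] TensorAlgebra ℂ A →ₗ[ℂ] V} {k : ℕ} {Y : Submodule ℂ V}
    (h : ∀ r s, k ≤ r + s + 1 → ∀ z ∈ wordPow K r, ∀ w ∈ wordPow K s, ∀ b, E z b w ∈ Y)
    {x : TensorAlgebra ℂ A} (hx : x ∈ wordPow K k) : splitSum E x ∈ Y := by
  have base : ∀ (E : TensorAlgebra ℂ A →ₗ[ℂ] A →ₗ[ℂ] TensorAlgebra ℂ A →ₗ[ℂ] V),
      (∀ z b w, E z b w ∈ Y) → ∀ x, splitSum E x ∈ Y := by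
    intro E h x
    induction x using word_induction with
    | hw l => rw [splitSum_word]; exact lsum_mem _ fun z b w => h _ _ _
    | hadd x y hx hy => rw [map_add]; exact add_mem hx hy
    | hsmul c x hx => rw [map_smul]; exact Submodule.smul_mem _ c hx
  match k, hx with
  | 0, _ => exact base E (fun z b w => h 0 0 (by omega) z trivial w trivial b) x
  | 1, _ => exact base E (fun z b w => h 0 0 (by omega) z trivial w trivial b) x
  | k + 2, hx =>
    have key : ∀ k (E : TensorAlgebra ℂ A →ₗ[ℂ] A →ₗ[ℂ] TensorAlgebra ℂ A →ₗ[ℂ] V),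
        (∀ r s, k + 1 ≤ r + s + 1 → ∀ z ∈ wordPow K r, ∀ w ∈ wordPow K s, ∀ b, E z b w ∈ Y) →
        ∀ x ∈ powI K (k + 1), splitSum E (T.incl A x) ∈ Y := by
      intro k
      induction k with
      | zero => exact fun E h x _ => base E (fun z b w => h 0 0 (by omega) z trivial w trivial b) _
      | succ k ih =>
        intro E h x hx
        have : powI K (k + 2) ≤ Y.comap
            (splitSum E ∘ₗ (T.incl A : T A →ₗ[ℂ] TensorAlgebra ℂ A)) := by
          refine powI_le fun x hx y hy => ?_
          change splitSum E (T.incl A (x * y)) ∈ Y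
          have hx' : T.incl A x ∈ wordPow K (k + 1) := by
            rw [mem_wordPow, ofW_incl]; exact mem_powPlus.2 hx
          have hy' : T.incl A y ∈ wordPow K 1 := by
            rw [mem_wordPow, ofW_incl]; exact mem_powPlus.2 hy
          rw [map_mul, splitSum_mul E
            (E.compr₂ (LinearMap.lcomp ℂ V (LinearMap.mulRight ℂ (T.incl A y))))
            (E ∘ₗ LinearMap.mulLeft ℂ (T.incl A x)) _ _ (fun _ _ _ => rfl) (fun _ _ _ => rfl)]
          refine add_mem (ih _ (fun r s hrs z hz w hw b => ?_) x hx) (base _ (fun z b w => ?_) _)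
          · exact h r (s + 1) (by omega) z hz _ ((wordFiltered hK).mul s 1 hw hy') b
          · exact h (k + 1) 0 (by omega) _ ((wordFiltered hK).mul_right _ hx') w trivial b
        exact this hx
    rw [mem_wordPow, powPlus, if_neg (by omega)] at hx
    obtain ⟨y, hy, hyx⟩ := hx
    have : x = T.incl A y := by
      rw [← toW_ofW x, ← toW_coe y]
      exact congrArg _ hyx.symm
    rw [this]
    exact key (k + 1) E h y hy

variable {Y : ℕ → Submodule ℂ M} {Y' : ℕ → Submodule ℂ Z}

theorem XTrace.kOne_mem (hK : IsTwoSided K) (𝔍 : Filtered 𝔄)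
    (hL : ∀ x ∈ K, TensorAlgebra.lift ℂ L (T.incl A x) ∈ 𝔍.seq 1)
    (hY : ∀ k, ∀ x ∈ 𝔍.seq k, ∀ y, t.tr₁ x y ∈ Y' k) (j k : ℕ) {w : OmNat (T A)}
    (hw : w ∈ natSpan (powPlus K k) ⊤) : t.kOne F L j w ∈ Y' (k - (2 * j + 1)) := by
  rw [XTrace.kOne, LinearMap.sum_apply]
  refine sum_mem fun i hi => ?_
  rw [LinearMap.smul_apply]
  refine Submodule.smul_mem _ _ (omLift_mem hK (fun x hx a => ?_) hw)
  rw [LinearMap.mk₂_apply]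
  refine splitSum_mem hK (fun r s hrs z hz w hw b => ?_) hx
  rw [trilin_apply]
  refine hY _ _ ?_ _
  have hi := Finset.mem_range.1 hi
  exact 𝔍.anti (by omega) (𝔍.mul _ _ (𝔍.mul_right (nab F L a) (hit_mem (m := 2 * j - i) 𝔍 hL hw))
    (hit_mem (m := i) 𝔍 hL hz))

theorem XTrace.hitOneSum_mem (hK : IsTwoSided K) (𝔍 : Filtered 𝔄)
    (hL : ∀ x ∈ K, TensorAlgebra.lift ℂ L (T.incl A x) ∈ 𝔍.seq 1)
    (hY : ∀ k, ∀ x ∈ 𝔍.seq k, ∀ y, t.tr₁ x y ∈ Y' k) (j k : ℕ) {w : OmNat (T A)}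
    (hw : w ∈ natSpan (powPlus K k) ⊤) : t.hitOneSum F L j w ∈ Y' (k - (2 * j)) := by
  rw [XTrace.hitOneSum, LinearMap.sum_apply]
  refine sum_mem fun i hi => ?_
  rw [LinearMap.smul_apply]
  refine Submodule.smul_mem _ _ (omLift_mem hK (fun x hx a => hY _ _ ?_ _) hw)
  have hi := Finset.mem_range.1 hi
  have := 𝔍.anti (by omega : k - 2 * j ≤ k - 2 * i) (hit_mem (F := F) (m := 2 * i) 𝔍 hL hx)
  exact Submodule.smul_mem _ _ (add_mem (𝔍.mul_left F this) (𝔍.mul_right F this))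

theorem XTrace.chainOne_mem (hK : IsTwoSided K) (𝔍 : Filtered 𝔄)
    (hL : ∀ x ∈ K, TensorAlgebra.lift ℂ L (T.incl A x) ∈ 𝔍.seq 1)
    (hY : ∀ k, ∀ x ∈ 𝔍.seq k, ∀ y, t.tr₁ x y ∈ Y' k) (k : ℕ) {w : OmNat (T A)}
    (hw : w ∈ natSpan (powPlus K k) ⊤) : t.chainOne (TensorAlgebra.lift ℂ L) w ∈ Y' k := by
  refine omLift_mem hK (fun x hx a => hY _ _ ?_ _) hw
  have := hit_mem (F := (0 : 𝔄)) (m := 0) 𝔍 hL hx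
  rwa [hit_zero] at this

theorem XTrace.hitZeroSum_mem (𝔍 : Filtered 𝔄)
    (hL : ∀ x ∈ K, TensorAlgebra.lift ℂ L (T.incl A x) ∈ 𝔍.seq 1)
    (hY : ∀ k, ∀ x ∈ 𝔍.seq k, t.tr x ∈ Y k) (j k : ℕ) {x : TensorAlgebra ℂ A}
    (hx : x ∈ wordPow K k) : t.hitZeroSum F L j x ∈ Y (k - (2 * j)) := by
  rw [XTrace.hitZeroSum, LinearMap.sum_apply]
  refine sum_mem fun i hi => ?_
  rw [LinearMap.smul_apply]
  refine Submodule.smul_mem _ _ (hY _ _ ?_)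
  have hi := Finset.mem_range.1 hi
  exact 𝔍.mul_left F (𝔍.anti (by omega : k - 2 * j ≤ k - 2 * i) (hit_mem (F := F) (m := 2 * i) 𝔍 hL hx))

/-- Each of the m commutators contributes one factor in the first step of the filtration. -/
theorem hit_mem_of_nab (𝔍 : Filtered 𝔄) (h : ∀ a, nab F L a ∈ 𝔍.seq 1) (m : ℕ)
    (x : TensorAlgebra ℂ A) : hit F L m x ∈ 𝔍.seq m := by
  induction x using word_induction with
  | hw l =>
    induction l generalizing m with
    | nil =>
      cases m with
      | zero => exact 𝔍.mem_zero _
      | succ m => rw [word_nil, hit_one_succ]; exact zero_mem _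
    | cons a l ih =>
      rw [word_cons]
      cases m with
      | zero => exact 𝔍.mem_zero _
      | succ m =>
        rw [hit_succ_ι_mul]
        exact add_mem (𝔍.mul_left _ (ih _)) (add_comm 1 m ▸ 𝔍.mul 1 m (h a) (ih m))
  | hadd x y hx hy => rw [map_add]; exact add_mem hx hy
  | hsmul c x hx => rw [map_smul]; exact Submodule.smul_mem _ c hx

end Estimates

/-! ### Filtration estimates for the homotopy and for the Chern character -/

section HomotEstimates

set_option linter.unusedSectionVars false

variable {M : Type*} [NonUnitalRing M] [Module ℂ M] [IsScalarTower ℂ M M] [SMulCommClass ℂ M M]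
variable {A : Type*} [NonUnitalRing A] [Module ℂ A]

/-- The filtration of `M₂(M⁺)` by the powers of an ideal. -/
def matFiltered {I : Submodule ℂ M} (hI : IsTwoSided I) : Filtered (Mat M) where
  seq k := ⨅ i, ⨅ j, (powPlus I k).comap (Matrix.entryLinearMap ℂ (U M) i j)
  zero := by simp [powPlus_zero]
  anti _ _ h := iInf_mono fun i => iInf_mono fun j => Submodule.comap_mono ((powFiltered hI).anti h)
  mul m n x y hx hy := by
    simp only [Submodule.mem_iInf, Submodule.mem_comap, Matrix.entryLinearMap_apply] at *
    intro i j
    rw [Matrix.mul_apply]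
    exact sum_mem fun l _ => (powFiltered hI).mul m n (hx i l) (hy l j)

theorem mem_matFiltered {I : Submodule ℂ M} {hI : IsTwoSided I} {k : ℕ} {x : Mat M} :
    x ∈ (matFiltered hI).seq k ↔ ∀ i j, x i j ∈ powPlus I k := by
  simp [matFiltered, Submodule.mem_iInf]

theorem trM_mem {I : Submodule ℂ M} (hI : IsTwoSided I) (k : ℕ) (x : Mat M)
    (hx : x ∈ (matFiltered hI).seq k) : (matTrace M).tr x ∈ powI I k := by
  change trM x ∈ _
  rw [trM_apply]
  rw [mem_matFiltered] at hx
  exact powPlus_snd (add_mem (hx 0 0) (hx 1 1))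

theorem trNat_mem {I : Submodule ℂ M} (hI : IsTwoSided I) (k : ℕ) (x : Mat M)
    (hx : x ∈ (matFiltered hI).seq k) (y : Mat M) :
    (matTrace M).tr₁ x y ∈ natSpan (powPlus I k) ⊤ := by
  change trNat x y ∈ _
  rw [trNat_apply]
  rw [mem_matFiltered] at hx
  exact add_mem (add_mem (mem_natSpan_top (hx _ _) _) (mem_natSpan_top (hx _ _) _))
    (add_mem (mem_natSpan_top (hx _ _) _) (mem_natSpan_top (hx _ _) _))

/-- At most 2j commutators are inserted, and `kOne` cuts the word at one further letter, so at most
2j + 1 factors are lost. When k is smaller, the truncated index 0 imposes no condition. -/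
theorem homot_coarse {K : Submodule ℂ (T A)} {I : Submodule ℂ M} (hK : IsTwoSided K)
    (hI : IsTwoSided I) {L : A →ₗ[ℂ] Matrix (Fin 2) (Fin 2) M}
    (hL : ∀ x ∈ K, ∀ i j, TensorAlgebra.lift ℂ (matL L) (T.incl A x) i j ∈ powPlus I 1) (j k : ℕ)
    {x : X (T A)} (hx : x ∈ coarse K k) : homot j L x ∈ coarse I (k - (2 * j + 1)) := by
  obtain ⟨x, w⟩ := x
  obtain ⟨h1, h2⟩ := hx
  have hL' : ∀ x ∈ K, TensorAlgebra.lift ℂ (matL L) (T.incl A x) ∈ (matFiltered hI).seq 1 :=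
    fun x hx => mem_matFiltered.2 (hL x hx)
  have h3 : T.incl A x ∈ wordPow K k := by rw [mem_wordPow, ofW_incl]; exact mem_powPlus.2 h1
  have e1 : powI I (k - 2 * j) ≤ powI I (k - (2 * j + 1)) := powI_anti hI (by omega)
  have e2 : powI I k ≤ powI I (k - (2 * j + 1)) := powI_anti hI (by omega)
  have e3 : ∀ m, k - (2 * j + 1) ≤ m →
      natSpan (powPlus I m) ⊤ ≤ natSpan (powPlus I (k - (2 * j + 1))) ⊤ :=
    fun m hm => natSpan_mono ((powFiltered hI).anti hm) le_rfl
  rw [homot_apply]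
  refine ⟨Submodule.smul_mem _ _ (add_mem (e1 ?_) (e2 ?_)), add_mem (Submodule.smul_mem _ _
    (add_mem (e3 (k - 2 * j) (by omega) ?_) (e3 k (by omega) ?_))) (Submodule.smul_mem _ _ ?_)⟩
  · exact XTrace.hitZeroSum_mem (Y := powI I) _ hL' (trM_mem hI) j k h3
  · refine trM_mem hI _ _ ?_
    have := hit_mem (F := sgn M) (m := 0) _ hL' h3
    rwa [hit_zero] at this
  · exact XTrace.hitOneSum_mem (Y' := fun k => natSpan (powPlus I k) ⊤) hK _ hL' (trNat_mem hI) j k h2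
  · exact XTrace.chainOne_mem (Y' := fun k => natSpan (powPlus I k) ⊤) hK _ hL' (trNat_mem hI) k h2
  · exact XTrace.kOne_mem (Y' := fun k => natSpan (powPlus I k) ⊤) hK _ hL' (trNat_mem hI) j k h2

variable {R P : Type*} [NonUnitalRing R] [Module ℂ R] [NonUnitalRing P] [Module ℂ P]
  [IsScalarTower ℂ P P] [SMulCommClass ℂ P P]
  {r : R →ₙₐ[ℂ] M} {q : M →ₙₐ[ℂ] P} {h : IsExtension r q}

theorem image_eq_ker (h : IsExtension r q) : image r = LinearMap.ker (q : M →ₗ[ℂ] P) := by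
  ext x
  exact (h.exact x).symm

theorem isTwoSided_image (h : IsExtension r q) : IsTwoSided (image r) :=
  image_eq_ker h ▸ isTwoSided_ker q

theorem nab_matOf_mem (l : A →ₗ[ℂ] offDiag h) (a : A) :
    nab (sgn M) (matOf h l) a ∈ (matFiltered (isTwoSided_image h)).seq 1 := by
  rw [mem_matFiltered]
  have h1 : ((l a : Matrix (Fin 2) (Fin 2) M) 0 1 : U M) ∈ powPlus (image r) 1 :=
    mem_powPlus.2 (l a).2.1
  have h2 : ((l a : Matrix (Fin 2) (Fin 2) M) 1 0 : U M) ∈ powPlus (image r) 1 :=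
    mem_powPlus.2 (l a).2.2
  intro i j
  rw [nab_apply]
  fin_cases i <;> fin_cases j
  · simp [sgn]
  · simpa [sgn, matOf_apply] using add_mem h1 h1
  · simpa [sgn, matOf_apply] using sub_mem (neg_mem h2) h2
  · simp [sgn]

/-- Every term of the closed formulas contains 2j + 1 commutators with F, and a commutator with F
only retains the off-diagonal entries, which lie in R. -/
theorem chern_mem (j : ℕ) (l : A →ₗ[ℂ] offDiag h) (x : X (T A)) :
    chern h (2 * j + 1) l x ∈ coarse (image r) (2 * j + 1) := by
  have hI := isTwoSided_image h
  have hn := nab_matOf_mem l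
  have hh := hit_mem_of_nab (matFiltered hI) hn
  set F := sgn M
  set L := matOf h l
  set 𝔍 := matFiltered hI
  have hT := trM_mem hI
  -- Membership is restated as the vanishing of a linear map into the quotient, so that it can be
  -- tested on words and on ♮x da.
  suffices H : ⊤ ≤ (coarse (image r) (2 * j + 1)).comap (chern h (2 * j + 1) l) from H trivial
  suffices H : ∀ z : X (T A), (coarse (image r) (2 * j + 1)).mkQ (chern h (2 * j + 1) l z) = 0 from
    fun z _ => (Submodule.Quotient.mk_eq_zero (coarse (image r) (2 * j + 1))).1 (H z)
  suffices H : (coarse (image r) (2 * j + 1)).mkQ ∘ₗ chern h (2 * j + 1) l = 0 from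
    LinearMap.congr_fun H
  refine X_T_ext (fun a y => ?_) (fun y a => ?_)
  · refine (Submodule.Quotient.mk_eq_zero _).2 ⟨?_, ?_⟩
    · have h1 := chern_fst j l (tword (a :: y)) [] 0
      have h2 : (chern h (2 * j + 1) l (tword (a :: y), 0)).1 = 0 := by simpa using h1
      rw [h2]
      exact zero_mem _
    · rw [chern_snd, XTrace.gSum_eq]
      refine Submodule.smul_mem _ _ (sum_mem fun p hp => Submodule.smul_mem _ _ ?_)
      rw [Finset.HasAntidiagonal.mem_antidiagonal] at hp
      refine lsum_mem _ fun z b w => trNat_mem hI _ _ ?_ _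
      rw [← hp]
      exact 𝔍.mul _ _ (𝔍.mul_right _ (hh _ _)) (hh _ _)
  · refine (Submodule.Quotient.mk_eq_zero _).2 ⟨?_, ?_⟩
    · have hb : ∀ x : OmNat M, bBar x = (matTrace M).b x := fun x => rfl
      have ht : ∀ x : Mat M, trM x = (matTrace M).tr x := fun x => rfl
      rw [chern_fst, hb, XTrace.b_kOne sgn_mul_sgn matTrace_sgn, ht]
      have h1 := hT _ _ (𝔍.mul_right (L a) (hh (2 * j + 1) (word y)))
      have h2 := hT _ _ (𝔍.mul_left (L a) (hh (2 * j + 1) (word y)))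
      refine Submodule.smul_mem _ _ (sub_mem (sub_mem (add_mem (Submodule.smul_mem _ _ h1)
        (Submodule.smul_mem _ _ h2)) (sum_mem fun i hi => ?_)) (Submodule.smul_mem _ _ ?_))
      · have hi := Finset.mem_range.1 hi
        have h3 : ∀ z w : TensorAlgebra ℂ A, hit F L (2 * j - (2 * i + 1)) w * nab F L a *
            hit F L (2 * i + 1) z ∈ 𝔍.seq (2 * j + 1) := by
          intro z w
          have := 𝔍.mul _ _ (𝔍.mul _ _ (hh (2 * j - (2 * i + 1)) w) (hn a)) (hh (2 * i + 1) z)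
          rwa [show 2 * j - (2 * i + 1) + 1 + (2 * i + 1) = 2 * j + 1 by omega] at this
        exact add_mem (lsum_mem _ fun z b w => hT _ _ (𝔍.mul_right _ (h3 _ _)))
          (lsum_mem _ fun z b w => hT _ _ (𝔍.mul_left _ (h3 _ _)))
      · rw [map_add]
        exact add_mem h1 h2
    · have h1 := chern_snd j l [] (natD (ofW A (word y)) (T.ι A a : U (T A)))
      rw [tword_nil] at h1
      rw [h1, XTrace.gSum, lsum_nil, smul_zero]
      exact zero_mem _

end HomotEstimates

/-! ### Cochains and homomorphisms -/

section Cochains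

set_option linter.unusedSectionVars false

variable {R : Type*} [NonUnitalRing R] [Module ℂ R] [IsScalarTower ℂ R R] [SMulCommClass ℂ R R]
variable {S : Type*} [NonUnitalRing S] [Module ℂ S] [IsScalarTower ℂ S S] [SMulCommClass ℂ S S]
variable {A : Type*} [NonUnitalRing A] [Module ℂ A] [IsScalarTower ℂ A A] [SMulCommClass ℂ A A]

theorem homogeneous_comp_even {g : X R →ₗ[ℂ] X S} (h₁ : ∀ x, (g (x, 0)).2 = 0)
    (h₂ : ∀ w, (g (0, w)).1 = 0) {d : ZMod 2} {f : X S →ₗ[ℂ] ℂ} (hf : f ∈ homogeneous S d) :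
    f ∘ₗ g ∈ homogeneous R d := by
  refine ⟨fun hd w => ?_, fun hd x => ?_⟩
  · have : g (0, w) = (0, (g (0, w)).2) := Prod.ext (h₂ w) rfl
    rw [LinearMap.comp_apply, this]
    exact hf.1 hd _
  · have : g (x, 0) = ((g (x, 0)).1, 0) := Prod.ext rfl (h₁ x)
    rw [LinearMap.comp_apply, this]
    exact hf.2 hd _

theorem homogeneous_comp_odd {g : X R →ₗ[ℂ] X S} (h₁ : ∀ x, (g (x, 0)).1 = 0)
    (h₂ : ∀ w, (g (0, w)).2 = 0) {d : ZMod 2} {f : X S →ₗ[ℂ] ℂ} (hf : f ∈ homogeneous S d) :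
    f ∘ₗ g ∈ homogeneous R (d + 1) := by
  have e : ∀ d : ZMod 2, (d + 1 = 0 → d = 1) ∧ (d + 1 = 1 → d = 0) := by decide
  refine ⟨fun hd w => ?_, fun hd x => ?_⟩
  · have : g (0, w) = ((g (0, w)).1, 0) := Prod.ext rfl (h₂ w)
    rw [LinearMap.comp_apply, this]
    exact hf.2 ((e d).1 hd) _
  · have : g (x, 0) = (0, (g (x, 0)).2) := Prod.ext (h₁ x) rfl
    rw [LinearMap.comp_apply, this]
    exact hf.1 ((e d).2 hd) _

theorem add_one_add_one (d : ZMod 2) : d + 1 + 1 = d := by revert d; decide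

theorem homogeneous_comp_bdry {d : ZMod 2} {f : X R →ₗ[ℂ] ℂ} (hf : f ∈ homogeneous R d) :
    f ∘ₗ bdry ∈ homogeneous R (d + 1) :=
  homogeneous_comp_odd (fun x => by simp [bdry_apply]) (fun w => by simp [bdry_apply]) hf

theorem homogeneous_comp_map {d : ZMod 2} (g : R →ₙₐ[ℂ] S) {f : X S →ₗ[ℂ] ℂ}
    (hf : f ∈ homogeneous S d) : f ∘ₗ X.map g ∈ homogeneous R d :=
  homogeneous_comp_even (fun x => by simp [X_map_apply]) (fun w => by simp [X_map_apply]) hf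

theorem homogeneous_comp_cartan {d : ZMod 2} (f₀ f₁ : A →ₗ[ℂ] S) {f : X S →ₗ[ℂ] ℂ}
    (hf : f ∈ homogeneous S d) : f ∘ₗ cartan f₀ f₁ ∈ homogeneous (T A) (d + 1) :=
  homogeneous_comp_odd (fun x => by simp [cartan_apply]) (fun w => by simp [cartan_apply]) hf

theorem homogeneous_comp_homot {d : ZMod 2} (j : ℕ) (L : A →ₗ[ℂ] Matrix (Fin 2) (Fin 2) S)
    {f : X S →ₗ[ℂ] ℂ} (hf : f ∈ homogeneous S d) : f ∘ₗ homot j L ∈ homogeneous (T A) d :=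
  homogeneous_comp_even (fun x => by simp [homot_apply]) (fun w => by simp [homot_apply]) hf

theorem cochains_comp_bdry {I : Submodule ℂ R} (hI : IsTwoSided I) {d : ZMod 2} {f : X R →ₗ[ℂ] ℂ}
    (hf : f ∈ cochains I d) : f ∘ₗ bdry ∈ cochains I (d + 1) := by
  obtain ⟨h, m, hm⟩ := (mem_cochains hI).1 hf
  exact (mem_cochains hI).2 ⟨homogeneous_comp_bdry h, m + 1, fun x hx => hm _ (bdry_coarse hI m hx)⟩

theorem cochains_comp_map {I : Submodule ℂ R} {J : Submodule ℂ S} (hI : IsTwoSided I)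
    (hJ : IsTwoSided J) {g : R →ₙₐ[ℂ] S} (hg : ∀ x ∈ I, g x ∈ J) {d : ZMod 2} {f : X S →ₗ[ℂ] ℂ}
    (hf : f ∈ cochains J d) : f ∘ₗ X.map g ∈ cochains I d := by
  obtain ⟨h, m, hm⟩ := (mem_cochains hJ).1 hf
  exact (mem_cochains hI).2 ⟨homogeneous_comp_map g h, m, fun x hx => hm _ (map_coarse g hg m hx)⟩

theorem mem_cocycles {I : Submodule ℂ R} {d : ZMod 2} {f : X R →ₗ[ℂ] ℂ} :
    f ∈ cocycles I d ↔ f ∈ cochains I d ∧ ∀ x, f (bdry x) = 0 :=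
  and_congr_right fun _ => ⟨fun h x => LinearMap.congr_fun h x, fun h => LinearMap.ext h⟩

theorem cocycles_comp_map {I : Submodule ℂ R} {J : Submodule ℂ S} (hI : IsTwoSided I)
    (hJ : IsTwoSided J) {g : R →ₙₐ[ℂ] S} (hg : ∀ x ∈ I, g x ∈ J) {d : ZMod 2} {f : X S →ₗ[ℂ] ℂ}
    (hf : f ∈ cocycles J d) : f ∘ₗ X.map g ∈ cocycles I d := by
  rw [mem_cocycles] at hf ⊢
  refine ⟨cochains_comp_map hI hJ hg hf.1, fun x => ?_⟩
  rw [LinearMap.comp_apply, ← map_bdry]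
  exact hf.2 _

theorem cochains_comp_cartan {K : Submodule ℂ (T A)} {J : Submodule ℂ S} (hK : IsTwoSided K)
    (hJ : IsTwoSided J) {f₀ f₁ : A →ₗ[ℂ] S} (hf₀₁ : ∀ a, f₁ a - f₀ a ∈ J)
    (hf₀ : ∀ x ∈ K, T.lift f₀ x ∈ J) {d : ZMod 2} {f : X S →ₗ[ℂ] ℂ} (hf : f ∈ cochains J d) :
    f ∘ₗ cartan f₀ f₁ ∈ cochains K (d + 1) := by
  obtain ⟨h, m, hm⟩ := (mem_cochains hJ).1 hf
  refine (mem_cochains hK).2 ⟨homogeneous_comp_cartan f₀ f₁ h, m + 1, fun x hx => hm _ ?_⟩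
  exact filt_odd_le_coarse hJ m (cartan_filt f₀ f₁ hK hJ hf₀₁ hf₀ m (coarse_le_filt_odd K m hx))

theorem cochains_comp_homot {K : Submodule ℂ (T A)} {J : Submodule ℂ S} (hK : IsTwoSided K)
    (hJ : IsTwoSided J) (j : ℕ) {L : A →ₗ[ℂ] Matrix (Fin 2) (Fin 2) S}
    (hL : ∀ x ∈ K, ∀ s t, TensorAlgebra.lift ℂ (matL L) (T.incl A x) s t ∈ powPlus J 1)
    {d : ZMod 2} {f : X S →ₗ[ℂ] ℂ} (hf : f ∈ cochains J d) :
    f ∘ₗ homot j L ∈ cochains K d := by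
  obtain ⟨h, m, hm⟩ := (mem_cochains hJ).1 hf
  refine (mem_cochains hK).2 ⟨homogeneous_comp_homot j L h, m + (2 * j + 1), fun x hx => hm _ ?_⟩
  have := homot_coarse hK hJ hL j _ hx
  rwa [Nat.add_sub_cancel] at this

/-- Expanding a product of a + b factors from N + R', each term contains at least a factors from N
or at least b from R'. The induction peels off the last factor. -/
theorem powI_le_sup {I N R' : Submodule ℂ R} (hN : IsTwoSided N) (hR : IsTwoSided R')
    (hI : I ≤ N ⊔ R') (a b : ℕ) : powI I (a + b) ≤ powI N a ⊔ powI R' b := by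
  suffices h : ∀ k a b, a + b = k + 1 → powI I (k + 1) ≤ powI N a ⊔ powI R' b by
    match a, b with
    | 0, b => exact le_sup_of_le_left le_top
    | a + 1, b => exact (show a + 1 + b = a + b + 1 by omega) ▸ h (a + b) (a + 1) b (by omega)
  intro k
  induction k with
  | zero =>
    intro a b hab
    match a, b, hab with
    | 0, b, _ => exact le_sup_of_le_left le_top
    | a, 0, _ => exact le_sup_of_le_right le_top
    | a + 1, b + 1, hab => omega
  | succ k ih =>
    intro a b hab
    match a, b, hab with
    | 0, b, _ => exact le_sup_of_le_left le_top
    | a, 0, _ => exact le_sup_of_le_right le_top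
    | a + 1, b + 1, hab =>
      refine powI_le fun x hx y hy => ?_
      obtain ⟨u, hu, v, hv, rfl⟩ := Submodule.mem_sup.1 (hI hy)
      rw [mul_add]
      refine add_mem ?_ ?_
      · obtain ⟨z, hz, w, hw, rfl⟩ := Submodule.mem_sup.1 (ih a (b + 1) (by omega) hx)
        rw [add_mul]
        exact add_mem (Submodule.mem_sup_left (powI_mul hN a 1 hz hu))
          (Submodule.mem_sup_right (powI_right hR _ _ _ hw))
      · obtain ⟨z, hz, w, hw, rfl⟩ := Submodule.mem_sup.1 (ih (a + 1) b (by omega) hx)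
        rw [add_mul]
        exact add_mem (Submodule.mem_sup_left (powI_right hN _ _ _ hz))
          (Submodule.mem_sup_right (powI_mul hR b 1 hw hv))

theorem powPlus_le_sup {I N R' : Submodule ℂ R} (hN : IsTwoSided N) (hR : IsTwoSided R')
    (hI : I ≤ N ⊔ R') (a b : ℕ) : powPlus I (a + b) ≤ powPlus N a ⊔ powPlus R' b := by
  match a, b with
  | 0, b => exact le_sup_of_le_left le_top
  | a, 0 => exact le_sup_of_le_right le_top
  | a + 1, b + 1 =>
    rw [powPlus, powPlus, powPlus, if_neg (by omega), if_neg (by omega), if_neg (by omega),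
      ← Submodule.map_sup]
    exact Submodule.map_mono (powI_le_sup hN hR hI _ _)

/-- The device by which a functional that is continuous for two ideals separately becomes continuous
for their sum. -/
theorem eq_zero_of_mem_coarse {I N R' : Submodule ℂ R} (hN : IsTwoSided N) (hR : IsTwoSided R')
    (hI : I ≤ N ⊔ R') {f : X R →ₗ[ℂ] ℂ} {a b : ℕ} (h₁ : ∀ x ∈ coarse N a, f x = 0)
    (h₂ : ∀ x ∈ coarse R' b, f x = 0) (x : X R) (hx : x ∈ coarse I (a + b)) : f x = 0 := by
  have h : coarse I (a + b) ≤ coarse N a ⊔ coarse R' b := by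
    rintro ⟨x, w⟩ ⟨h3, h4⟩
    obtain ⟨u, hu, v, hv, rfl⟩ := Submodule.mem_sup.1 (powI_le_sup hN hR hI a b h3)
    have h5 : natSpan (powPlus I (a + b)) ⊤ ≤
        natSpan (powPlus N a) ⊤ ⊔ natSpan (powPlus R' b) ⊤ := by
      refine natSpan_le fun x hx y hy => ?_
      obtain ⟨z, hz, z', hz', rfl⟩ := Submodule.mem_sup.1 (powPlus_le_sup hN hR hI a b hx)
      rw [map_add, LinearMap.add_apply]
      exact add_mem (Submodule.mem_sup_left (mem_natSpan hz hy))
        (Submodule.mem_sup_right (mem_natSpan hz' hy))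
    obtain ⟨y, hy, y', hy', rfl⟩ := Submodule.mem_sup.1 (h5 h4)
    exact Submodule.mem_sup.2 ⟨(u, y), ⟨hu, hy⟩, (v, y'), ⟨hv, hy'⟩, rfl⟩
  obtain ⟨y, hy, z, hz, rfl⟩ := Submodule.mem_sup.1 (h hx)
  rw [map_add, h₁ y hy, h₂ z hz, add_zero]

theorem map_lift_T (g : R →ₙₐ[ℂ] S) (f : A →ₗ[ℂ] R) (x : T A) :
    g (T.lift f x) = T.lift ((g : R →ₗ[ℂ] S) ∘ₗ f) x := by
  have h : (uMap g).comp (T.liftU f) = T.liftU ((g : R →ₗ[ℂ] S) ∘ₗ f) := by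
    refine TensorAlgebra.hom_ext (LinearMap.ext fun a => ?_)
    change uMap g (TensorAlgebra.lift ℂ _ _) = TensorAlgebra.lift ℂ _ _
    rw [TensorAlgebra.lift_ι_apply, TensorAlgebra.lift_ι_apply]
    exact uMap_coe g (f a)
  have h1 := congrArg (fun z : U S => z.snd) (DFunLike.congr_fun h (T.incl A x))
  rw [AlgHom.comp_apply, uMap_snd] at h1
  exact h1

theorem comp_lift_T (g : R →ₙₐ[ℂ] S) (f : A →ₗ[ℂ] R) :
    g.comp (T.lift f) = T.lift ((g : R →ₗ[ℂ] S) ∘ₗ f) := NonUnitalAlgHom.ext (map_lift_T g f)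

theorem lift_T_comp (f : R →ₗ[ℂ] S) (g : A →ₗ[ℂ] R) :
    (T.lift f).comp (T.lift (T.ι R ∘ₗ g)) = T.lift (f ∘ₗ g) := by
  rw [comp_lift_T]
  congr 1
  ext a
  exact lift_ι f (g a)

theorem lift_T_ι (x : T A) : T.lift (T.ι A) x = x := by
  change (ofW A (T.incl A x)).snd = x
  rw [ofW_incl, Unitization.snd_inr]

theorem isTwoSided_JT : IsTwoSided (JT A) := isTwoSided_ker _

/-- A section of a surjective homomorphism carries `JA` into the kernel. -/
theorem lift_section_mem {q : R →ₙₐ[ℂ] A} {σ : A →ₗ[ℂ] R} (hσ : ∀ a, q (σ a) = a) (x : T A)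
    (hx : x ∈ JT A) : T.lift σ x ∈ LinearMap.ker (q : R →ₗ[ℂ] A) := by
  change q (T.lift σ x) = 0
  rw [map_lift_T]
  have : (q : R →ₗ[ℂ] A) ∘ₗ σ = LinearMap.id := LinearMap.ext hσ
  rw [this]
  exact hx

/-- The class of a cocycle pulled back along a linear splitting does not depend on the splitting. -/
theorem section_sub_mem_coboundaries {q : R →ₙₐ[ℂ] A} {σ₀ σ₁ : A →ₗ[ℂ] R} (h₀ : ∀ a, q (σ₀ a) = a)
    (h₁ : ∀ a, q (σ₁ a) = a) {d : ZMod 2} {f : X R →ₗ[ℂ] ℂ}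
    (hf : f ∈ cocycles (LinearMap.ker (q : R →ₗ[ℂ] A)) d) :
    f ∘ₗ X.map (T.lift σ₁) - f ∘ₗ X.map (T.lift σ₀) ∈ coboundaries (JT A) d := by
  rw [mem_cocycles] at hf
  refine ⟨f ∘ₗ cartan σ₀ σ₁, cochains_comp_cartan isTwoSided_JT (isTwoSided_ker q) (fun a => ?_)
    (lift_section_mem h₀) hf.1, LinearMap.ext fun x => ?_⟩
  · change q (σ₁ a - σ₀ a) = 0
    rw [map_sub, h₀, h₁, sub_self]
  · change f (cartan σ₀ σ₁ (bdry x)) = f (X.map (T.lift σ₁) x) - f (X.map (T.lift σ₀) x)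
    rw [← map_sub, cartan_homotopy, map_add, hf.2, zero_add]

theorem comp_bdry_mem_cocycles {I : Submodule ℂ R} (hI : IsTwoSided I) {d : ZMod 2}
    {f : X R →ₗ[ℂ] ℂ} (hf : f ∈ cochains I d) : f ∘ₗ bdry ∈ cocycles I (d + 1) :=
  mem_cocycles.2 ⟨cochains_comp_bdry hI hf, fun x => by simp [bdry_bdry]⟩

theorem comp_bdry_mem_coboundaries {I : Submodule ℂ R} {d : ZMod 2}
    {f : X R →ₗ[ℂ] ℂ} (hf : f ∈ cochains I d) : f ∘ₗ bdry ∈ coboundaries I (d + 1) :=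
  ⟨f, by rwa [add_one_add_one], rfl⟩

theorem coboundaries_le {I : Submodule ℂ R} (hI : IsTwoSided I) (d : ZMod 2) :
    coboundaries I d ≤ cocycles I d := by
  rintro _ ⟨f, hf, rfl⟩
  have := comp_bdry_mem_cocycles hI hf
  rwa [add_one_add_one] at this

theorem HP.mk_eq {d : ZMod 2} {f g : X (T A) →ₗ[ℂ] ℂ} (hf : f ∈ cocycles (JT A) d)
    (hg : g ∈ cocycles (JT A) d) (h : f - g ∈ coboundaries (JT A) d) : HP.mk f hf = HP.mk g hg :=
  (Submodule.Quotient.eq _).2 h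

/-- In ♮f(x)df(y) - ♮g(x)dg(y) one variable is changed at a time. It is applied to a splitting of TE
→ TA, to show that a functional vanishing on the first step of the filtration descends. -/
theorem map_sub_map_mem {J : Submodule ℂ S} (hJ : IsTwoSided J) (f g : R →ₙₐ[ℂ] S)
    (h : ∀ x, f x - g x ∈ J) (x : X R) : X.map f x - X.map g x ∈ filt J 1 := by
  obtain ⟨x, w⟩ := x
  have e := filt_odd J 0
  rw [mul_zero, zero_add] at e
  rw [e, X_map_apply, X_map_apply]
  refine ⟨h x, ?_⟩
  change omMap f w - omMap g w ∈ oddPart J 0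
  suffices H : (oddPart J 0).mkQ ∘ₗ omMap f = (oddPart J 0).mkQ ∘ₗ omMap g from
    (Submodule.Quotient.eq _).1 (LinearMap.congr_fun H w)
  refine omNat_ext fun x y => (Submodule.Quotient.eq _).2 ?_
  rw [omMap_natD, omMap_natD, uMap_coe, uMap_coe]
  have e1 : natD (uMap f x) (f y : U S) - natD (uMap g x) (g y : U S) =
      natD (uMap f x - uMap g x) (f y : U S) + natD (uMap g x) ((f y - g y : S) : U S) := by
    rw [Unitization.inr_sub, map_sub, map_sub, LinearMap.sub_apply]
    abel
  have e2 : uMap f x - uMap g x = ((f x.snd - g x.snd : S) : U S) := by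
    rw [U_cases x, map_add, map_add, map_smul, map_smul, map_one, map_one, uMap_coe, uMap_coe,
      add_sub_add_left_eq_sub, ← Unitization.inr_sub]
    simp
  rw [e1, e2]
  exact add_mem (natD_mem_oddPart hJ (by omega : 1 + 0 = 0 + 1) (mem_powPlus.2 (h _)) trivial)
    (natD_mem_oddPart hJ (by omega : 0 + 1 = 0 + 1) trivial (h y))

end Cochains

/-! ### The Chern character and the connecting morphism -/

section Main

set_option linter.unusedSectionVars false

variable {R : Type*} [NonUnitalRing R] [Module ℂ R] [IsScalarTower ℂ R R] [SMulCommClass ℂ R R]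
variable {S : Type*} [NonUnitalRing S] [Module ℂ S] [IsScalarTower ℂ S S] [SMulCommClass ℂ S S]
variable {A : Type*} [NonUnitalRing A] [Module ℂ A] [IsScalarTower ℂ A A] [SMulCommClass ℂ A A]
variable {E : Type*} [NonUnitalRing E] [Module ℂ E] [IsScalarTower ℂ E E] [SMulCommClass ℂ E E]
variable {M : Type*} [NonUnitalRing M] [Module ℂ M] [IsScalarTower ℂ M M] [SMulCommClass ℂ M M]
variable {P : Type*} [NonUnitalRing P] [Module ℂ P] [IsScalarTower ℂ P P] [SMulCommClass ℂ P P]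

/-- The homomorphism of matrix algebras induced by a homomorphism. -/
def matHom (g : R →ₙₐ[ℂ] S) : Matrix (Fin 2) (Fin 2) R →ₙₐ[ℂ] Matrix (Fin 2) (Fin 2) S where
  toFun m := m.map g
  map_smul' c m := by ext; simp
  map_zero' := by ext; simp
  map_add' a b := by ext; simp
  map_mul' a b := by ext; simp [Matrix.mul_apply]

theorem lift_matL (L : A →ₗ[ℂ] Matrix (Fin 2) (Fin 2) M) (x : T A) :
    TensorAlgebra.lift ℂ (matL L) (T.incl A x) = matIncl M (T.lift L x) := by
  have h : (Unitization.lift (matIncl M)).comp (T.liftU L) = TensorAlgebra.lift ℂ (matL L) := by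
    refine TensorAlgebra.hom_ext (LinearMap.ext fun a => ?_)
    change Unitization.lift (matIncl M) (TensorAlgebra.lift ℂ _ _) = TensorAlgebra.lift ℂ _ _
    rw [TensorAlgebra.lift_ι_apply, TensorAlgebra.lift_ι_apply]
    change Unitization.lift (matIncl M) ((L a : Matrix (Fin 2) (Fin 2) M) : U _) = _
    simp [matL]
    try rfl
  have h2 : T.liftU L (T.incl A x) = ((T.lift L x : Matrix (Fin 2) (Fin 2) M) : U _) := by
    conv_lhs => rw [U_cases (T.liftU L (T.incl A x)), T.liftU_fst, zero_smul, zero_add]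
    rfl
  rw [← h, AlgHom.comp_apply, h2]
  simp

/-- If a linear map to matrices lifts a homomorphism, then its extension to `TA` maps `JA` to the
matrices over the kernel of the lifting. -/
theorem lift_matL_mem {g : M →ₙₐ[ℂ] S} {ρ : A →ₙₐ[ℂ] Matrix (Fin 2) (Fin 2) S}
    {L : A →ₗ[ℂ] Matrix (Fin 2) (Fin 2) M} (hL : ∀ a s t, g (L a s t) = ρ a s t) (x : T A)
    (hx : x ∈ JT A) (s t : Fin 2) :
    TensorAlgebra.lift ℂ (matL L) (T.incl A x) s t ∈ powPlus (LinearMap.ker (g : M →ₗ[ℂ] S)) 1 := by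
  rw [lift_matL]
  change ((T.lift L x s t : M) : U M) ∈ _
  rw [mem_powPlus, powI_one]
  change matHom g (T.lift L x) s t = 0
  have h : (matHom g : Matrix (Fin 2) (Fin 2) M →ₗ[ℂ] Matrix (Fin 2) (Fin 2) S) ∘ₗ L =
      (ρ : A →ₗ[ℂ] Matrix (Fin 2) (Fin 2) S) ∘ₗ LinearMap.id :=
    LinearMap.ext fun a => Matrix.ext fun s t => hL a s t
  have hx' : T.lift (LinearMap.id : A →ₗ[ℂ] A) x = 0 := hx
  rw [map_lift_T, h, ← map_lift_T, hx', map_zero]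
  rfl

theorem exists_linear_section {g : R →ₙₐ[ℂ] S} (hg : Function.Surjective g) :
    ∃ s : S →ₗ[ℂ] R, ∀ y, g (s y) = y := by
  obtain ⟨s, hs⟩ := LinearMap.exists_rightInverse_of_surjective (g : R →ₗ[ℂ] S)
    (LinearMap.range_eq_top.2 hg)
  exact ⟨s, fun y => LinearMap.congr_fun hs y⟩

/-- The kernel of a homomorphism as a subalgebra. -/
def kerSub (g : R →ₙₐ[ℂ] S) : NonUnitalSubalgebra ℂ R where
  toNonUnitalSubsemiring :=
    { carrier := {x | g x = 0}
      zero_mem' := map_zero g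
      add_mem' := fun {x y} hx hy => by
        change g (x + y) = 0
        rw [map_add, show g x = 0 from hx, show g y = 0 from hy, add_zero]
      mul_mem' := fun {x y} hx _ => by
        change g (x * y) = 0
        rw [map_mul, show g x = 0 from hx, zero_mul] }
  smul_mem' := fun c x hx => by
    change g (c • x) = 0
    rw [map_smul, show g x = 0 from hx, smul_zero]

theorem isExtension_kerSub {g : R →ₙₐ[ℂ] S} (hg : Function.Surjective g) :
    IsExtension (NonUnitalSubalgebraClass.subtype (kerSub g)) g where
  inj := Subtype.val_injective
  surj := hg
  exact x := ⟨fun h => ⟨⟨x, h⟩, rfl⟩, by rintro ⟨b, rfl⟩; exact b.2⟩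

theorem T_map_surjective {g : R →ₙₐ[ℂ] S} (hg : Function.Surjective g) :
    Function.Surjective (T.map g) := by
  obtain ⟨s, hs⟩ := exists_linear_section hg
  intro y
  refine ⟨T.lift (T.ι R ∘ₗ s) y, ?_⟩
  rw [map_lift_T]
  have : ((T.map g : T R →ₙₐ[ℂ] T S) : T R →ₗ[ℂ] T S) ∘ₗ T.ι R ∘ₗ s = T.ι S := by
    refine LinearMap.ext fun z => ?_
    change T.lift _ (T.ι R (s z)) = _
    rw [lift_ι]
    exact congrArg (T.ι S) (hs z)
  rw [this, lift_T_ι]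

theorem map_map_T (g : R →ₙₐ[ℂ] S) (x : T R) :
    T.lift (LinearMap.id : S →ₗ[ℂ] S) (T.map g x) = g (T.lift LinearMap.id x) := by
  rw [map_lift_T, T.map, map_lift_T]
  congr 2
  refine LinearMap.ext fun z => ?_
  exact lift_ι _ _

variable {R₀ : Type*} [NonUnitalRing R₀] [Module ℂ R₀]
  {r : R₀ →ₙₐ[ℂ] M} {mp : M →ₙₐ[ℂ] P} {h : IsExtension r mp}
  {me : M →ₙₐ[ℂ] E} {p : E →ₙₐ[ℂ] A} {pa : P →ₙₐ[ℂ] A}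

/-- Here f is the renormalization. Its coboundary vanishes on high powers of ker(M → E) because f is
a cochain, and on high powers of R by closedness of the cocycle that f extends. These two ideals
generate ker(M → A), so the coboundary is a cocycle for the larger ideal, although f need not be a
cochain for it. -/
theorem renormalization_bdry_mem_cocycles (hI : LinearMap.ker (p.comp me : M →ₗ[ℂ] A) ≤
      LinearMap.ker (me : M →ₗ[ℂ] E) ⊔ image r) (h : IsExtension r mp) {d : ZMod 2}
    {f : X M →ₗ[ℂ] ℂ} (hf : f ∈ cochains (LinearMap.ker (me : M →ₗ[ℂ] E)) d) {j : ℕ}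
    (hf' : ∀ x ∈ filt (image r) (2 * (2 * j) + 1), f (bdry x) = 0) :
    f ∘ₗ bdry ∈ cocycles (LinearMap.ker (p.comp me : M →ₗ[ℂ] A)) (d + 1) := by
  obtain ⟨hd, m, hm⟩ := (mem_cochains (isTwoSided_ker me)).1 hf
  refine mem_cocycles.2 ⟨(mem_cochains (isTwoSided_ker _)).2 ⟨homogeneous_comp_bdry hd,
    m + 1 + (2 * j + 1), eq_zero_of_mem_coarse (isTwoSided_ker me) (isTwoSided_image h) hI
    (fun x hx => hm _ (bdry_coarse (isTwoSided_ker me) m hx))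
    (fun x hx => hf' x (coarse_le_filt_odd _ _ hx))⟩, fun x => by simp [bdry_bdry]⟩

/-- By `chern_eq`, f ∘ ch = f∂H - (fH)∂. The first term is compared, through a Cartan homotopy over
TM, with its value on a diagonal deformation of the lifting. The cochain φ consists of fH and of the
homotopy term. -/
theorem exists_chern_eq (hpa : ∀ x, pa (mp x) = p (me x))
    (hI : LinearMap.ker (p.comp me : M →ₗ[ℂ] A) ≤ LinearMap.ker (me : M →ₗ[ℂ] E) ⊔ image r)
    {ρ : A →ₙₐ[ℂ] Matrix (Fin 2) (Fin 2) E} (hρ : ∀ a, p (ρ a 0 0) = a)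
    {l : A →ₗ[ℂ] offDiag h}
    (hl : ∀ (a : A) (s t : Fin 2), me ((l a : Matrix (Fin 2) (Fin 2) M) s t) = ρ a s t)
    {d : ZMod 2} {f : X M →ₗ[ℂ] ℂ} (hf : f ∈ cochains (LinearMap.ker (me : M →ₗ[ℂ] E)) d) {j : ℕ}
    (hf' : ∀ x ∈ filt (image r) (2 * (2 * j) + 1), f (bdry x) = 0) :
    ∃ φ ∈ cochains (JT A) d, ∃ σ₀ : A →ₗ[ℂ] M, (∀ a, p (me (σ₀ a)) = a) ∧
      f ∘ₗ chern h (2 * j + 1) l =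
        ((2 * Real.pi * Complex.I) ^ (1 / 2 : ℂ)) • (f ∘ₗ bdry ∘ₗ X.map (T.lift σ₀)) - φ ∘ₗ bdry := by
  obtain ⟨s, hs⟩ := exists_linear_section h.surj
  set L : A →ₗ[ℂ] Matrix (Fin 2) (Fin 2) M := (offDiag h).toSubmodule.subtype ∘ₗ l with hLdef
  set L' : A →ₗ[ℂ] Matrix (Fin 2) (Fin 2) (T M) := (T.ι M).mapMatrix ∘ₗ L with hL'def
  set c : T M →ₙₐ[ℂ] M := T.lift LinearMap.id with hc
  -- The map s ∘ mp is linear but not multiplicative. Over TM it extends to a homomorphism,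
  -- homotopic to the identity and killing the letters that come from R.
  set f₁ : M →ₗ[ℂ] T M := T.ι M ∘ₗ s ∘ₗ (mp : M →ₗ[ℂ] P) with hf₁
  have hcι : ∀ m, c (T.ι M m) = m := fun m => lift_ι _ _
  have hL : ∀ a s t, me (L a s t) = ρ a s t := hl
  have h01 : ∀ a, mp (L a 0 1) = 0 := fun a => (h.exact _).2 (l a).2.1
  have h10 : ∀ a, mp (L a 1 0) = 0 := fun a => (h.exact _).2 (l a).2.2
  set J := LinearMap.ker (((p.comp me).comp c : T M →ₙₐ[ℂ] A) : T M →ₗ[ℂ] A) with hJdef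
  have hJ : IsTwoSided J := isTwoSided_ker _
  have hcoc := renormalization_bdry_mem_cocycles hI h hf hf'
  set κ : X (T M) →ₗ[ℂ] ℂ := (f ∘ₗ bdry) ∘ₗ X.map c with hκdef
  have hκ : κ ∈ cocycles J (d + 1) :=
    cocycles_comp_map hJ (isTwoSided_ker _) (fun x hx => hx) hcoc
  have hκ0 : ∀ x, κ (bdry x) = 0 := (mem_cocycles.1 hκ).2
  have hmap : ∀ m, T.map mp (T.ι M m) = T.ι P (mp m) := fun m => lift_ι _ _
  -- The extension of TP by the kernel of TM → TP plays over TM the role of the extension of P by R,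
  -- so that a Chern character over TM is defined.
  set h' := isExtension_kerSub (T_map_surjective h.surj) with hh'
  have him : image (NonUnitalSubalgebraClass.subtype (kerSub (T.map mp))) =
      LinearMap.ker (T.map mp : T M →ₗ[ℂ] T P) := image_eq_ker h'
  set J' := LinearMap.ker (T.map mp : T M →ₗ[ℂ] T P) with hJ'
  have hJ't : IsTwoSided J' := isTwoSided_ker _
  have hκJ : ∀ x ∈ filt J' (2 * (2 * j) + 1), κ x = 0 := by
    intro x hx
    refine hf' _ (map_filt_odd c (fun y hy => ?_) _ hx)
    rw [image_eq_ker h]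
    change mp (c y) = 0
    rw [hc, ← map_map_T, show T.map mp y = 0 from hy, map_zero]
  have hoff : ∀ a, L' a ∈ offDiag h' := by
    intro a
    constructor
    · rw [him]
      change T.map mp (T.ι M (L a 0 1)) = 0
      rw [hmap, h01, map_zero]
    · rw [him]
      change T.map mp (T.ι M (L a 1 0)) = 0
      rw [hmap, h10, map_zero]
  set l' : A →ₗ[ℂ] offDiag h' := L'.codRestrict (offDiag h').toSubmodule hoff with hl'
  have hl'L : (offDiag h').toSubmodule.subtype ∘ₗ l' = L' := rfl
  refine ⟨κ ∘ₗ cartan (T.ι M) f₁ ∘ₗ homot j L' + f ∘ₗ homot j L, add_mem ?_ ?_,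
    s ∘ₗ (mp : M →ₗ[ℂ] P) ∘ₗ Matrix.entryLinearMap ℂ M 0 0 ∘ₗ L, fun a => ?_,
    LinearMap.ext fun x => ?_⟩
  · have h1 : κ ∘ₗ cartan (T.ι M) f₁ ∈ cochains J (d + 1 + 1) := by
      refine cochains_comp_cartan hJ hJ (fun a => ?_) (fun x hx => ?_) (mem_cocycles.1 hκ).1
      · change p (me (c (T.ι M (s (mp a)) - T.ι M a))) = 0
        rw [map_sub, hcι, hcι, ← hpa, map_sub, hs, sub_self, map_zero]
      · rwa [lift_T_ι]
    -- Over TM the lifting is considered modulo ker(TM → A), where it lifts the homomorphism A →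
    -- M₂(A) induced by ρ.
    rw [add_one_add_one] at h1
    refine cochains_comp_homot isTwoSided_JT hJ j (lift_matL_mem (ρ := (matHom p).comp ρ)
      fun a s t => ?_) h1
    change p (me (c (T.ι M (L a s t)))) = p (ρ a s t)
    rw [hcι, hL]
  · exact cochains_comp_homot isTwoSided_JT (isTwoSided_ker me) j (lift_matL_mem hL) hf
  · change p (me (s (mp (L a 0 0)))) = a
    rw [← hpa, hs, hpa, hL, hρ]
  · have h1 : homot j L x = X.map c (homot j L' x) := by
      rw [map_homot]
      have e : (c : T M →ₗ[ℂ] M).mapMatrix ∘ₗ L' = L :=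
        LinearMap.ext fun a => Matrix.ext fun s t => hcι _
      rw [e]
    have h2 := cartan_homotopy (T.ι M) f₁ (homot j L' x)
    have h3 : X.map (T.lift (T.ι M)) (homot j L' x) = homot j L' x := by
      have : T.lift (T.ι M) = NonUnitalAlgHom.id ℂ (T M) := NonUnitalAlgHom.ext lift_T_ι
      rw [this, map_id]
    have h4 := chern_eq j l' x
    rw [hl'L] at h4
    -- The crucial vanishing. The Chern character over TM lies in the step 2n - 1 of the filtration
    -- by ker(TM → TP), the Cartan homotopy preserves this step because it deforms letters modulo
    -- that kernel, and κ is zero on it.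
    have h5 : κ (cartan (T.ι M) f₁ (chern h' (2 * j + 1) l' x)) = 0 := by
      refine hκJ _ (cartan_filt _ _ hJ't hJ't (fun a => ?_) (fun x hx => ?_) _ ?_)
      · change T.map mp (T.ι M (s (mp a)) - T.ι M a) = 0
        rw [map_sub, hmap, hmap, hs, sub_self]
      · rwa [lift_T_ι]
      · rw [← him]
        exact coarse_le_filt_odd _ _ (chern_mem j l' x)
    -- After the deformation the off-diagonal entries are gone, and `homot_diagonal` evaluates the
    -- homotopy.
    have h6 : κ (X.map (T.lift f₁) (homot j L' x)) = ((2 * Real.pi * Complex.I) ^ (1 / 2 : ℂ)) *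
        f (bdry (X.map (T.lift (s ∘ₗ (mp : M →ₗ[ℂ] P) ∘ₗ Matrix.entryLinearMap ℂ M 0 0 ∘ₗ L)) x)) := by
      have e : ∀ m, T.lift f₁ (T.ι M m) = T.ι M (s (mp m)) := fun m => lift_ι _ _
      rw [map_homot, homot_diagonal, chernConst_eq, map_smul, smul_eq_mul]
      · have e2 : Matrix.entryLinearMap ℂ (T M) 0 0 ∘ₗ
            ((T.lift f₁ : T M →ₗ[ℂ] T M).mapMatrix ∘ₗ L') =
            T.ι M ∘ₗ s ∘ₗ (mp : M →ₗ[ℂ] P) ∘ₗ Matrix.entryLinearMap ℂ M 0 0 ∘ₗ L :=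
          LinearMap.ext fun a => e _
        have e3 : c.comp (T.lift (T.ι M ∘ₗ s ∘ₗ (mp : M →ₗ[ℂ] P) ∘ₗ
            Matrix.entryLinearMap ℂ M 0 0 ∘ₗ L)) =
            T.lift (s ∘ₗ (mp : M →ₗ[ℂ] P) ∘ₗ Matrix.entryLinearMap ℂ M 0 0 ∘ₗ L) := by
          rw [hc, lift_T_comp, LinearMap.id_comp]
        rw [e2, ← e3, map_comp]
        rfl
      · intro a
        change T.lift f₁ (T.ι M (L a 0 1)) = 0
        rw [e, h01, map_zero, map_zero]
      · intro a
        change T.lift f₁ (T.ι M (L a 1 0)) = 0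
        rw [e, h10, map_zero, map_zero]
    have h7 : f (bdry (homot j L x)) = κ (homot j L' x) := by rw [h1]; rfl
    have h8 := congrArg κ h2
    rw [h3, map_sub, map_add, hκ0, zero_add, h6] at h8
    have h9 : bdry (homot j L' x) = chern h' (2 * j + 1) l' x + homot j L' (bdry x) := by
      rw [h4, sub_add_cancel]
    rw [h9, map_add, map_add, h5, zero_add] at h8
    simp only [LinearMap.comp_apply, LinearMap.sub_apply, LinearMap.smul_apply, LinearMap.add_apply,
      smul_eq_mul]
    rw [chern_eq, map_sub, h7]
    linear_combination -h8

/-- The coboundary θ∂ is a cocycle for ker(TE → A), by the argument used for the renormalization.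
The cochain φ is its pullback along the homomorphism TA → TE given by a splitting of E → A. -/
theorem exists_connecting {d : ZMod 2} {f : X M →ₗ[ℂ] ℂ}
    (hf : f ∈ cochains (LinearMap.ker (me : M →ₗ[ℂ] E)) d) {j : ℕ}
    {s : E →ₗ[ℂ] M} (hs : ∀ e, me (s e) = e) {θ : X (T E) →ₗ[ℂ] ℂ} (hθ : IsUniversalCocycle p d θ)
    {ψ : X (T E) →ₗ[ℂ] ℂ} (hψ : ψ ∈ cochains (JT E) (d + 1))
    (hrel : ∀ x ∈ filt (TRel p) (2 * (2 * j) + 1), f (X.map (T.lift s) x) = θ x + ψ (bdry x))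
    {s' : A →ₗ[ℂ] E} (hs' : ∀ a, p (s' a) = a) :
    ∃ φ ∈ cocycles (JT A) (d + 1), φ ∘ₗ X.map (T.map p) = θ ∘ₗ bdry ∧
      φ - f ∘ₗ bdry ∘ₗ X.map (T.lift (s ∘ₗ s')) ∈ coboundaries (JT A) (d + 1) := by
  set c : T E →ₙₐ[ℂ] E := T.lift LinearMap.id with hc
  have hcι : ∀ m, c (T.ι E m) = m := fun m => lift_ι _ _
  set I := LinearMap.ker ((p.comp c : T E →ₙₐ[ℂ] A) : T E →ₗ[ℂ] A)
  have hI : IsTwoSided I := isTwoSided_ker _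
  have hT : IsTwoSided (TRel p) := isTwoSided_ker _
  -- Subtracting from x the letter given by its image in E leaves an element of JE, and that letter
  -- dies in TA when x dies in A.
  have hle : I ≤ JT E ⊔ TRel p := by
    intro x hx
    have hx' : p (c x) = 0 := hx
    rw [← sub_add_cancel x (T.ι E (c x))]
    refine add_mem (Submodule.mem_sup_left ?_) (Submodule.mem_sup_right ?_)
    · change c (x - T.ι E (c x)) = 0
      rw [map_sub, hcι, sub_self]
    · change T.lift _ (T.ι E (c x)) = 0
      rw [lift_ι]
      change T.ι A (p (c x)) = 0
      rw [hx', map_zero]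
  obtain ⟨hθd, m, hm⟩ := (mem_cochains isTwoSided_JT).1 hθ.1
  have hθI : θ ∘ₗ bdry ∈ cocycles I (d + 1) := by
    refine mem_cocycles.2 ⟨(mem_cochains hI).2 ⟨homogeneous_comp_bdry hθd, m + 1 + 1,
      eq_zero_of_mem_coarse isTwoSided_JT hT hle
        (fun x hx => hm _ (bdry_coarse isTwoSided_JT m hx))
        (fun x hx => hθ.2 x (coarse_le_filt_odd (TRel p) 0 hx))⟩, fun x => by simp [bdry_bdry]⟩
  set S := T.lift (T.ι E ∘ₗ s') with hS
  have hSI : ∀ x ∈ JT A, S x ∈ I := lift_section_mem (q := p.comp c) fun a => by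
    change p (c (T.ι E (s' a))) = a
    rw [hcι, hs']
  refine ⟨(θ ∘ₗ bdry) ∘ₗ X.map S, cocycles_comp_map isTwoSided_JT hI hSI hθI,
    LinearMap.ext fun x => ?_, ?_⟩
  -- The composite TE → TA → TE is the identity modulo T(B:E), and θ∂ vanishes on the first step of
  -- that filtration.
  · have h1 : X.map (S.comp (T.map p)) x - X.map (NonUnitalAlgHom.id ℂ (T E)) x ∈
        filt (TRel p) 1 := by
      refine map_sub_map_mem hT _ _ (fun y => ?_) x
      change T.map p (S (T.map p y) - y) = 0
      have h2 : ∀ z, T.map p (S z) = z := by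
        intro z
        rw [hS, map_lift_T]
        have : ((T.map p : T E →ₙₐ[ℂ] T A) : T E →ₗ[ℂ] T A) ∘ₗ T.ι E ∘ₗ s' = T.ι A := by
          refine LinearMap.ext fun z => ?_
          change T.lift _ (T.ι E (s' z)) = _
          rw [lift_ι]
          exact congrArg (T.ι A) (hs' z)
        rw [this, lift_T_ι]
      rw [map_sub, h2, sub_self]
    have h3 := hθ.2 _ h1
    rw [map_id, map_sub, map_sub, map_comp, sub_eq_zero] at h3
    exact h3
  -- This difference vanishes on a step of the T(B:E)-filtration by `hrel`, hence is a cochain for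
  -- ker(TE → A), and κ∂ pulls back to a coboundary on X(TA). The term ψ∂ drops out because ∂² = 0.
  · set κ := f ∘ₗ X.map (T.lift s) - θ - ψ ∘ₗ bdry with hκ
    have hκE : κ ∈ cochains (JT E) d := by
      have h1 := cochains_comp_bdry isTwoSided_JT hψ
      rw [add_one_add_one] at h1
      exact sub_mem (sub_mem (cochains_comp_map isTwoSided_JT (isTwoSided_ker me)
        (lift_section_mem hs) hf) hθ.1) h1
    obtain ⟨hκd, m', hm'⟩ := (mem_cochains isTwoSided_JT).1 hκE
    have hκI : κ ∈ cochains I d := by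
      refine (mem_cochains hI).2 ⟨hκd, m' + (2 * j + 1),
        eq_zero_of_mem_coarse isTwoSided_JT hT hle hm' (fun x hx => ?_)⟩
      have := hrel x (coarse_le_filt_odd _ _ hx)
      simp only [hκ, LinearMap.sub_apply, LinearMap.comp_apply, this]
      ring
    have h2 := comp_bdry_mem_coboundaries (cochains_comp_map isTwoSided_JT hI hSI hκI)
    rw [← neg_mem_iff] at h2
    convert h2 using 1
    refine LinearMap.ext fun x => ?_
    simp only [hκ, LinearMap.sub_apply, LinearMap.comp_apply, LinearMap.neg_apply]
    rw [← lift_T_comp, ← hS, map_comp, ← map_bdry, bdry_bdry, ← map_bdry]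
    simp

end Main

end PeriodicCyclic
end

theorem proposition3 {B E A J N Q R M P : Type*}
    [NonUnitalRing B] [Module ℂ B] [IsScalarTower ℂ B B] [SMulCommClass ℂ B B]
    [NonUnitalRing E] [Module ℂ E] [IsScalarTower ℂ E E] [SMulCommClass ℂ E E]
    [NonUnitalRing A] [Module ℂ A] [IsScalarTower ℂ A A] [SMulCommClass ℂ A A]
    [NonUnitalRing J] [Module ℂ J] [IsScalarTower ℂ J J] [SMulCommClass ℂ J J]
    [NonUnitalRing N] [Module ℂ N] [IsScalarTower ℂ N N] [SMulCommClass ℂ N N]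
    [NonUnitalRing Q] [Module ℂ Q] [IsScalarTower ℂ Q Q] [SMulCommClass ℂ Q Q]
    [NonUnitalRing R] [Module ℂ R] [IsScalarTower ℂ R R] [SMulCommClass ℂ R R]
    [NonUnitalRing M] [Module ℂ M] [IsScalarTower ℂ M M] [SMulCommClass ℂ M M]
    [NonUnitalRing P] [Module ℂ P] [IsScalarTower ℂ P P] [SMulCommClass ℂ P P]
    -- an invertible extension, with a lifting
    (i : B →ₙₐ[ℂ] E) (p : E →ₙₐ[ℂ] A) (D : Lifting i p J N Q R M P)
    (ρ : A →ₙₐ[ℂ] Matrix (Fin 2) (Fin 2) E) (hρ : IsInvertibleVia i p ρ)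
    -- a cocycle of degree `d` over `F_R^{2n-1} X(M̂)`, with `n` odd
    (n : ℕ) (hn : Odd n) (d : ZMod 2)
    (τ : filt (image D.rm) (2 * n - 1) →ₗ[ℂ] ℂ)
    (hτ : IsCocycleOver (image D.rm) (image D.nm) (2 * n - 1) d τ)
    -- a linear lifting of `ρ` to `M^s_+`
    (l : A →ₗ[ℂ] offDiag D.row_mid)
    (hl : ∀ (a : A) (s t : Fin 2), D.me ((l a : Matrix (Fin 2) (Fin 2) M) s t) = ρ a s t)
    -- a renormalization of `τ`, and a linear splitting of `M → A`
    (τR : X M →ₗ[ℂ] ℂ)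
    (hτR : IsRenormalization (image D.rm) (image D.nm) (2 * n - 1) d τ τR)
    (σ : A →ₗ[ℂ] M) (hσ : ∀ a, p (D.me (σ a)) = a) :
    ∃ (hch : ∀ x, chern D.row_mid n l x ∈ filt (image D.rm) (2 * n - 1))
      (h₁ : τ ∘ₗ (chern D.row_mid n l).codRestrict _ hch ∈ cocycles (JT A) (d + 1))
      (h₂ : τR ∘ₗ bdry ∘ₗ X.map (T.lift σ) ∈ cocycles (JT A) (d + 1)),
      HP.mk _ h₁ = ((2 * Real.pi * Complex.I) ^ (1 / 2 : ℂ)) • HP.mk _ h₂ ∧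
      ∀ β : HP B d, Represents D (2 * n - 1) d τ β → IsConnecting i p d β (HP.mk _ h₂) := by

  obtain ⟨j, rfl⟩ := hn
  -- The filtration degree 2n - 1 is odd with half-index n - 1 = 2j, so that F_R^{2n-1} starts with
  -- Rⁿ, the power that n commutators reach.
  have hk : 2 * (2 * j + 1) - 1 = 2 * (2 * j) + 1 := by omega
  have hnm : image D.nm = LinearMap.ker (D.me : M →ₗ[ℂ] E) := image_eq_ker D.col_mid
  have hf : τR ∈ cochains (LinearMap.ker (D.me : M →ₗ[ℂ] E)) d := hnm ▸ hτR.cochain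
  have hext : ∀ x (hx : x ∈ filt (image D.rm) (2 * (2 * j + 1) - 1)), τR x = τ ⟨x, hx⟩ :=
    fun x hx => hτR.extends_cocycle ⟨x, hx⟩
  have hf' : ∀ x ∈ filt (image D.rm) (2 * (2 * j) + 1), τR (bdry x) = 0 := by
    intro x hx
    have hb := bdry_filt_odd (isTwoSided_image D.row_mid) (2 * j) hx
    rw [← hk] at hx hb
    rw [hext _ hb]
    exact hτ.closed ⟨x, hx⟩ ⟨_, hb⟩ rfl
  -- An element of M that dies in A maps into B. Subtracting a lift to R of its image moves it into
  -- N.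
  have hI : LinearMap.ker (p.comp D.me : M →ₗ[ℂ] A) ≤
      LinearMap.ker (D.me : M →ₗ[ℂ] E) ⊔ image D.rm := by
    intro x hx
    obtain ⟨b, hb⟩ := (D.row_bot.exact _).1 (show p (D.me x) = 0 from hx)
    obtain ⟨r, rfl⟩ := D.col_left.surj b
    rw [← sub_add_cancel x (D.rm r)]
    refine add_mem (Submodule.mem_sup_left ?_) (Submodule.mem_sup_right ⟨r, rfl⟩)
    change D.me (x - D.rm r) = 0
    rw [map_sub, D.sq_rmbe, hb, sub_self]
  have hch : ∀ x, chern D.row_mid (2 * j + 1) l x ∈ filt (image D.rm) (2 * (2 * j + 1) - 1) := by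
    intro x
    rw [hk]
    exact coarse_le_filt_odd _ _ (chern_mem j l x)
  have hcoc := renormalization_bdry_mem_cocycles hI D.row_mid hf hf'
  have hker : IsTwoSided (LinearMap.ker (p.comp D.me : M →ₗ[ℂ] A)) := isTwoSided_ker _
  have hsec : ∀ σ : A →ₗ[ℂ] M, (∀ a, p (D.me (σ a)) = a) →
      τR ∘ₗ bdry ∘ₗ X.map (T.lift σ) ∈ cocycles (JT A) (d + 1) := fun σ hσ =>
    cocycles_comp_map isTwoSided_JT hker (lift_section_mem (q := p.comp D.me) hσ) hcoc
  have hsub : ∀ σ₀ σ₁ : A →ₗ[ℂ] M, (∀ a, p (D.me (σ₀ a)) = a) → (∀ a, p (D.me (σ₁ a)) = a) →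
      τR ∘ₗ bdry ∘ₗ X.map (T.lift σ₁) - τR ∘ₗ bdry ∘ₗ X.map (T.lift σ₀) ∈
        coboundaries (JT A) (d + 1) := fun σ₀ σ₁ h₀ h₁ =>
    section_sub_mem_coboundaries (q := p.comp D.me) h₀ h₁ hcoc
  obtain ⟨φ, hφ, σ₀, hσ₀, heq⟩ := exists_chern_eq D.sq_mpea hI hρ.upper_left hl hf hf'
  have hτch : τ ∘ₗ (chern D.row_mid (2 * j + 1) l).codRestrict _ hch =
      τR ∘ₗ chern D.row_mid (2 * j + 1) l := LinearMap.ext fun x => (hext _ (hch x)).symm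
  have hφ' := comp_bdry_mem_coboundaries hφ
  have h₁ : τ ∘ₗ (chern D.row_mid (2 * j + 1) l).codRestrict _ hch ∈ cocycles (JT A) (d + 1) := by
    rw [hτch, heq]
    exact sub_mem (Submodule.smul_mem _ _ (hsec σ₀ hσ₀)) (coboundaries_le isTwoSided_JT _ hφ')
  refine ⟨hch, h₁, hsec σ hσ, ?_, ?_⟩
  -- The difference of the cocycles is the coboundary φ∂ together with the change from the splitting
  -- σ₀ produced by ρ to the given σ.
  · refine HP.mk_eq h₁ (Submodule.smul_mem _ _ (hsec σ hσ)) ?_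
    rw [hτch, heq, sub_right_comm, ← smul_sub]
    exact sub_mem (Submodule.smul_mem _ _ (hsub σ σ₀ hσ hσ₀)) hφ'
  · rintro β ⟨s, hs, -, θ, hθ, huniv, hβ, ψ, hψ, hrel⟩
    obtain ⟨s', hs'⟩ := exists_linear_section D.row_bot.surj
    obtain ⟨φ, hφ, hφθ, hφσ⟩ := exists_connecting hf hs huniv hψ (j := j) (fun x hx => by
      rw [← hk] at hx
      obtain ⟨h, e⟩ := hrel x hx
      rw [hext _ h, e]) hs'
    refine ⟨θ, hθ, φ, hφ, huniv, hβ, hφθ, HP.mk_eq hφ (hsec σ hσ) ?_⟩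
    -- The composite s ∘ s' is one more splitting of M → A, and it is exchanged for σ in the same
    -- way.
    rw [← sub_add_sub_cancel]
    refine add_mem hφσ (hsub σ (s ∘ₗ s') hσ fun a => ?_)
    change p (D.me (s (s' a))) = a
    rw [hs, hs']
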